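/- **Auxiliary functions.** For positive integers $s,t$ define $K(s,t)$, $K'(s,t)$, $R(s,t)$ by - $K(1,t)=2$, $K'(1,t)=5$, $R(1,t)=0$ for all $t$; $K(s,1)=2^s$, $K'(s,1)=2^s+3$, $R(s,1)=0$ for all $s$; - for $s,t>1$, writing $n=K'(s,t-1)$ and $m=K(s-1,n)$: $K(s,t)=m\,K(s,t-1)$, $K'(s,t)=m\,n+K'(s-1,n)$, $R(s,t)=2m+R(s-1,n)$. Define $F(s,t)=(F_0,F_1,F_2,F_3)(s,t)$ by - $F(1,t)=(2t+7,\ 10t+15,\ 16t+12,\ 8t+4)$ for $t>1$; - $F(s,1)=(2^{s+1}+5,\ 3\cdot 2^{s+1}+9,\ 2^{s+3}+8,\ 2^{s+2}+4)$ for all $s$; - for $s,t>1$, with $n,m$ as above and $r=R(s,t-1)$, $$\begin{aligned}F_0(s,t)&=m\,[F_0(s,t-1)+r-2]+F_0(s-1,n),\\ F_1(s,t)&=m\,[F_1(s,t-1)+3n+3r-4]+F_1(s-1,n),\\ F_2(s,t)&=m\,[F_2(s,t-1)+3n+4r+1]+F_2(s-1,n),\\ F_3(s,t)&=m\,[F_3(s,t-1)+2r+3]+F_3(s-1,n).\end{aligned}$$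 **The complexes $X(s,t)$.** All complexes are strongly regular CW complexes (the intersection of two faces is a face), so that a face is determined by its vertices. Each $X(s,t)$ has all its vertices on a cyclically ordered *profile* and carries a marking: *roots* $a_1,\dots,a_{K'(s,t)}$, counterclockwise along the profile, where $a_{K'(s,t)},a_1,a_2$ are consecutive and $a_1$ is the *hub*; *root triangles* $a_1a_ia_{i+1}$ for $1<i<K'(s,t)$; for some $i$ with $1<i<K'(s,t)$ a *tooth* $a_ib_ia_{i+1}$, whose *tip* $b_i$ comes immediately after $a_i$ on the profile; and, for $K(s,t)$ of the roots $a_i$ with $2<i<K'(s,t)$, a *fillet*, which is a list of $t$ consecutive vertices $c_1,\dots,c_t=a_i$ of the profile lying directly between the tips $b_{i-1}$ and $b_i$ of two teeth. - $X(s,1)$ is the triangulated disc formed by root triangles $a_1a_ia_{i+1}$ and teeth $a_ib_ia_{i+1}$ for $i=2,\dots,2^s+2$; each root contained in two teeth is a fillet. It has no facets ($3$-faces). - For $t>1$, $X(1,t)$ has profile $a_1,a_2,b_2,c_1,\dots,c_{t-1},a_3,b_3,c'_1,\dots,c'_{t-1},a_4,b_4,a_5$, teeth $a_2b_2a_3$,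 $a_3b_3a_4$, $a_4b_4a_5$ and fillets $(c_1,\dots,c_{t-1},a_3)$, $(c'_1,\dots,c'_{t-1},a_4)$. It consists of the following facets and their faces: the connected sum of the simplices $a_1a_2a_3a_5$, $a_1a_3a_4a_5$; the connected sum of $a_2b_2a_3a_5$, $b_2c_{t-1}a_3a_5$; the connected sum of $c_{t-1}a_3b_3a_5$, $a_3b_3a_4a_5$, $b_3c'_{t-1}a_4a_5$; the simplex $c'_{t-1}a_4b_4a_5$; and for $i=1,\dots,t-2$ the simplices $b_2c_ic_{i+1}a_5$, $c_ic_{i+1}b_3a_5$, $b_3c'_ic'_{i+1}a_5$, $c'_ic'_{i+1}b_4a_5$. (A connected sum of simplices is one facet; the triangles along which the simplices are glued are not faces of it.) - For $s,t>1$, put $n=K'(s,t-1)$. Take $X(s-1,n)$ with hub $o$ and reverse the orientation of its profile. For each of its $K(s-1,n)$ fillets $(c_1,\dots,c_n)$, now running clockwise, let $b$ and $b'$ be the tips clockwise and counterclockwise of the fillet, and $a$ the root counterclockwise of $b'$ (so $c_nb'a$ is a tooth). For $1\le i\le n-1$ let $Y_i$ be the facet containing the triangle $bc_{i+1}c_i$,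 and $Z_i$ the ridge ($2$-face) other than that triangle with $bc_i\subset Z_i\subset Y_i$. 1. Attach a simplex on $o,a,b',c_n$. 2. Attach a facet on $o,b',c_1,\dots,c_n$ that is the connected sum of the simplices $oc_{i+1}c_ib'$, $1\le i\le n-1$. 3. Add new vertices $\alpha_1,\dots,\alpha_{n-1}$ and $\beta_1,\dots,\beta_{n-2}$, so that $c_1,\alpha_1,\beta_1,c_2,\alpha_2,\beta_2,\dots,c_{n-1},\alpha_{n-1},c_n$ is the clockwise order. For each $i\le n-1$ add $\alpha_i$ to $Z_i$, replacing the edge $bc_i$ by $b\alpha_i$ and $\alpha_ic_i$. For $i<n-1$ add $\alpha_i,\beta_i,\alpha_{i+1}$ to $Y_i$ and replace the triangle $bc_{i+1}c_i$ by the triangles $b\alpha_{i+1}\alpha_i$, $\alpha_{i+1}\beta_i\alpha_i$, $\alpha_{i+1}c_{i+1}\beta_i$, $c_{i+1}\beta_ic_i$, $\beta_i\alpha_ic_i$. For $i=n-1$ add $\alpha_i$ to $Y_i$ and replace $bc_{i+1}c_i$ by $bc_{i+1}\alpha_i$ and $c_{i+1}\alpha_ic_i$. 4. Attach a copy of $X(s,t-1)$: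 its hub is identified with $b$, its roots $a_2,\dots,a_n$ with $\alpha_{n-1},\dots,\alpha_1$ in this order, and the tip of each tooth on the roots identified with $\alpha_{i+1},\alpha_i$ with $\beta_i$. Appending $c_i$ to a fillet of the copy that ends with $\alpha_i$ gives a fillet of $X(s,t)$. The new roots from each round are $b',c_1,\dots,c_{n-1}$; the teeth $c_{i+1}\beta_ic_i$ ($i\le n-2$) and $c_n\alpha_{n-1}c_{n-1}$ replace the tooth $c_nb'a$. Finally, let $aba'$ be any tooth of $X(s-1,n)$ not replaced in this way, where $a,b,a'$ lie counterclockwise on the reversed profile. If $a,b,a'$ are consecutive, it is a tooth of $X(s,t)$. Otherwise let $d$ be the vertex that follows $a$ counterclockwise; there is a triangle $adb$ in the same facet. Delete the edge $ab$ and the triangles $aba'$, $adb$, insert the edge $a'd$ and the triangles $ada'$, $dba'$, and let $ada'$ be a tooth of $X(s,t)$. For $t>1$, $X(s,t)$ is a $3$-ball, and $S(s,t)$ is the $3$-sphere obtained from $X(s,t)$ by coning over its boundary: add a new vertex $v$ and, for each nonempty $k$-face $Z$ of $\partial X(s,t)$, a $(k+1)$-face that is a pyramid with base $Z$ and apex $v$.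 **Proposition.** For all positive integers $s$ and $t$ with $t>1$, the $f$-vector $(f_0,f_1,f_2,f_3)$ of $S(s,t)$, where $f_k$ is the number of $k$-faces, equals $F(s,t)$. -/

import Mathlib

/-! Strongly regular CW complexes are handled through their faces. In such a complex the
intersection of two faces is a face, so a face is determined by its set of vertices, containment of
faces is containment of vertex sets, and the complex is determined up to isomorphism by its faces.
Hence a complex is recorded by listing, in each dimension, the vertex sets of its faces. -/

namespace FatSpheres

/-! ### The functions `K`, `K'`, `R` and `F` (defined for positive arguments) -/

mutual

/-- The function `K(s,t)`; the value is `0` if an argument is not positive. -/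
def K : ℕ → ℕ → ℕ
  | 0, _ => 0
  | _ + 1, 0 => 0
  | 1, _ + 1 => 2
  | s + 2, 1 => 2 ^ (s + 2)
  | s + 2, t + 2 => K (s + 2) (t + 1) * K (s + 1) (KPrime (s + 2) (t + 1))
termination_by s t => (s, t)

/-- The function `K'(s,t)`; the value is `0` if an argument is not positive. -/
def KPrime : ℕ → ℕ → ℕ
  | 0, _ => 0
  | _ + 1, 0 => 0
  | 1, _ + 1 => 5
  | s + 2, 1 => 2 ^ (s + 2) + 3
  | s + 2, t + 2 =>
      KPrime (s + 2) (t + 1) * K (s + 1) (KPrime (s + 2) (t + 1))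
        + KPrime (s + 1) (KPrime (s + 2) (t + 1))
termination_by s t => (s, t)

end

/-- The function `R(s,t)`; the value is `0` if an argument is not positive. -/
def R : ℕ → ℕ → ℕ
  | 0, _ => 0
  | 1, _ => 0
  | _ + 2, 0 => 0
  | _ + 2, 1 => 0
  | s + 2, t + 2 =>
      2 * K (s + 1) (KPrime (s + 2) (t + 1)) + R (s + 1) (KPrime (s + 2) (t + 1))
termination_by s => s

/-- The vector `F(s,t) = (F₀, F₁, F₂, F₃)`; the value is `0` if an argument is not positive. -/
def F : ℕ → ℕ → Fin 4 → ℤ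
  | 0, _ => 0
  | _ + 1, 0 => 0
  | s + 1, 1 =>
      ![2 ^ (s + 2) + 5, 3 * 2 ^ (s + 2) + 9, 2 ^ (s + 4) + 8, 2 ^ (s + 3) + 4]
  | 1, t + 2 =>
      ![2 * (t + 2 : ℕ) + 7, 10 * (t + 2 : ℕ) + 15, 16 * (t + 2 : ℕ) + 12, 8 * (t + 2 : ℕ) + 4]
  | s + 2, t + 2 =>
      let k' : ℕ := KPrime (s + 2) (t + 1)
      let r : ℤ := R (s + 2) (t + 1)
      let m : ℤ := K (s + 1) k'
      ![m * (F (s + 2) (t + 1) 0 + r - 2) + F (s + 1) k' 0,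
        m * (F (s + 2) (t + 1) 1 + 3 * k' + 3 * r - 4) + F (s + 1) k' 1,
        m * (F (s + 2) (t + 1) 2 + 3 * k' + 4 * r + 1) + F (s + 1) k' 2,
        m * (F (s + 2) (t + 1) 3 + 2 * r + 3) + F (s + 1) k' 3]
termination_by s t => (s, t)

/-! ### Complexes and operations on them -/

/-- A complex with vertices in `V`, given by its faces: `face k` is the set of (vertex sets of)
`k`-faces. The empty face is not recorded. -/
structure Cx (V : Type) where
  face : ℕ → Finset (Finset V)

namespace Cx

variable {V W ι : Type} [DecidableEq V] [DecidableEq W]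

/-- The faces of `C` together with the faces of `D`. If some faces of `D` carry the same vertices
as faces of `C`, then they are identified. -/
def union (C D : Cx V) : Cx V where
  face k := C.face k ∪ D.face k

/-- Union of a finite family of complexes. -/
def iUnion (I : Finset ι) (C : ι → Cx V) : Cx V where
  face k := I.biUnion fun i => (C i).face k

/-- Renaming of vertices. -/
def map (f : V → W) (C : Cx V) : Cx W where
  face k := (C.face k).image (Finset.image f)

/-- The simplicial complex generated by a set of simplices. -/
def simplicial (T : Finset (Finset V)) : Cx V where
  face k := T.biUnion (Finset.powersetCard (k + 1))

/-- A single `3`-dimensional facet, with all its faces, that is a connected sum of the tetrahedra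
in `T`: its boundary is obtained from the boundaries of the tetrahedra by deleting the triangles
along which two of them are glued. -/
def connectedSum (T : Finset (Finset V)) : Cx V where
  face
    | 0 => T.biUnion (Finset.powersetCard 1)
    | 1 => T.biUnion (Finset.powersetCard 2)
    | 2 => (T.biUnion (Finset.powersetCard 3)).filter fun τ => (T.filter fun σ => τ ⊆ σ).card = 1
    | 3 => {T.biUnion id}
    | _ => ∅

/-- The boundary of a `3`-ball: the subcomplex generated by the ridges that belong to exactly one
facet. -/
def boundary (C : Cx V) : Cx V where
  face k := (C.face k).filter fun Z =>
    k ≤ 2 ∧ ∃ T ∈ C.face 2, Z ⊆ T ∧ ((C.face 3).filter fun Y => T ⊆ Y).card = 1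

/-- Coning over a subcomplex `D` of `C` at a new vertex `none`: the vertex `none` is added and, for
each `k`-face `Z` of `D`, the `(k+1)`-face that is the pyramid with base `Z` and apex `none`. -/
def cone (C D : Cx V) : Cx (Option V) where
  face
    | 0 => (C.face 0).image (Finset.image some) ∪ {{none}}
    | k + 1 => (C.face (k + 1)).image (Finset.image some)
        ∪ (D.face k).image fun Z => insert none (Z.image some)

/-- The `f`-vector of a `3`-complex. -/
def fVector (C : Cx V) : Fin 4 → ℕ := fun k => (C.face k).card

end Cx

/-! ### The balls `X(s,t)` -/

/-- Names of vertices. `a i`, `b i`, `c i`, `c' i` are used in the initial complexes. In the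
recursion, `old v` is the vertex `v` of the complex that is being enlarged, `copy j v` is the vertex
`v` of the `j`-th attached copy, and `extra j i` are further new vertices. -/
inductive Vertex : Type
  | a (i : ℕ)
  | b (i : ℕ)
  | c (i : ℕ)
  | c' (i : ℕ)
  | old (v : Vertex)
  | copy (j : ℕ) (v : Vertex)
  | extra (j i : ℕ)
  deriving DecidableEq

/-- The part of the profile that comes after one root `aᵢ` and ends with the next root `aᵢ₊₁`, read
counterclockwise. `root` is `aᵢ₊₁`, and `inner` lists the vertices strictly between `aᵢ` and `aᵢ₊₁`.
There is a tooth on `aᵢ`, `aᵢ₊₁` exactly if `inner` is nonempty; its tip is then the first vertex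
of `inner`. `fillet` tells whether there is a fillet ending with the root `aᵢ₊₁`; this fillet then
consists of the vertices of `inner` other than the tip, followed by `aᵢ₊₁`. -/
structure Arc where
  inner : List Vertex
  root : Vertex
  fillet : Bool

/-- A complex with its marking: the profile, read counterclockwise, is formed by the hub `a₁`, the
root `a₂`, and the arcs. -/
structure Ball where
  cx : Cx Vertex
  hub : Vertex
  secondRoot : Vertex
  arcs : List Arc

open Vertex

/-- `X(s,1)`: a triangulated disc with `2^s + 1` root triangles and `2^s + 1` teeth. -/
def X1 (s : ℕ) : Ball where
  cx := Cx.simplicial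
    ((Finset.Icc 2 (2 ^ s + 2)).image (fun i => {a 1, a i, a (i + 1)})
      ∪ (Finset.Icc 2 (2 ^ s + 2)).image (fun i => {a i, b i, a (i + 1)}))
  hub := a 1
  secondRoot := a 2
  arcs := (List.range (2 ^ s + 1)).map fun i =>
    { inner := [b (i + 2)], root := a (i + 3), fillet := decide (i + 3 ≤ 2 ^ s + 2) }

/-- `X(1,t)` for `t > 1`. -/
def X1' (t : ℕ) : Ball where
  cx :=
    (Cx.connectedSum {{a 1, a 2, a 3, a 5}, {a 1, a 3, a 4, a 5}}).union <|
    (Cx.connectedSum {{a 2, b 2, a 3, a 5}, {b 2, c (t - 1), a 3, a 5}}).union <|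
    (Cx.connectedSum {{c (t - 1), a 3, b 3, a 5}, {a 3, b 3, a 4, a 5},
      {b 3, c' (t - 1), a 4, a 5}}).union <|
    (Cx.connectedSum {{c' (t - 1), a 4, b 4, a 5}}).union <|
    Cx.iUnion (Finset.Icc 1 (t - 2)) fun i =>
      (Cx.connectedSum {{b 2, c i, c (i + 1), a 5}}).union <|
      (Cx.connectedSum {{c i, c (i + 1), b 3, a 5}}).union <|
      (Cx.connectedSum {{b 3, c' i, c' (i + 1), a 5}}).union <|
      Cx.connectedSum {{c' i, c' (i + 1), b 4, a 5}}
  hub := a 1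
  secondRoot := a 2
  arcs :=
    [{ inner := b 2 :: (List.range (t - 1)).map (fun i => c (i + 1)), root := a 3, fillet := true },
     { inner := b 3 :: (List.range (t - 1)).map (fun i => c' (i + 1)), root := a 4, fillet := true },
     { inner := [b 4], root := a 5, fillet := false }]

/-- Renaming of the vertices of a marked complex. -/
def Ball.map (f : Vertex → Vertex) (B : Ball) : Ball where
  cx := B.cx.map f
  hub := f B.hub
  secondRoot := f B.secondRoot
  arcs := B.arcs.map fun A => { inner := A.inner.map f, root := f A.root, fillet := A.fillet }

/-- An arc, together with the root where it starts, and the tip of the tooth that comes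
counterclockwise after the arc (if any). -/
structure Site where
  start : Vertex
  arc : Arc
  nextTip : Vertex

/-- The sites of a list of arcs, the first of which starts at the root `v`. If there is no
tooth after an arc, then `nextTip` is irrelevant. -/
def sites (v : Vertex) : List Arc → List Site
  | [] => []
  | A :: L => { start := v, arc := A,
                nextTip := ((L.head?.bind fun A' => A'.inner.head?).getD v) } :: sites A.root L

/-- The vertices that appear in one round of the recursive construction, with the names that they
have there; `c i` and `α i` are meant for `1 ≤ i ≤ n` and `1 ≤ i ≤ n - 1`, and `β i` for
`1 ≤ i ≤ n - 2`. -/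
structure Round where
  n : ℕ
  o : Vertex
  a : Vertex
  b : Vertex
  b' : Vertex
  c : ℕ → Vertex
  α : ℕ → Vertex
  β : ℕ → Vertex

namespace Round

variable (r : Round)

/-- Attach a simplex on `o, a, b', cₙ`. -/
def step2 (C : Cx Vertex) : Cx Vertex :=
  C.union (Cx.connectedSum {{r.o, r.a, r.b', r.c r.n}})

/-- Attach a facet on `o, b', c₁, …, cₙ` that is a connected sum of the simplices
`o cᵢ₊₁ cᵢ b'`. -/
def step3 (C : Cx Vertex) : Cx Vertex :=
  C.union (Cx.connectedSum
    ((Finset.Icc 1 (r.n - 1)).image fun i => {r.o, r.c (i + 1), r.c i, r.b'}))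

/-- The triangle `b cᵢ₊₁ cᵢ`. -/
def topTriangle (i : ℕ) : Finset Vertex := {r.b, r.c (i + 1), r.c i}

/-- `Y` is the facet `Yᵢ`, the one containing the triangle `b cᵢ₊₁ cᵢ`. -/
def IsY (C : Cx Vertex) (i : ℕ) (Y : Finset Vertex) : Prop :=
  Y ∈ C.face 3 ∧ r.topTriangle i ⊆ Y

/-- `Z` is the ridge `Zᵢ`, the one with `b cᵢ ⊂ Zᵢ ⊂ Yᵢ` that is not the triangle `b cᵢ₊₁ cᵢ`. -/
def IsZ (C : Cx Vertex) (i : ℕ) (Z : Finset Vertex) : Prop :=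
  Z ∈ C.face 2 ∧ {r.b, r.c i} ⊆ Z ∧ (∃ Y ∈ C.face 3, r.IsY C i Y ∧ Z ⊆ Y) ∧ Z ≠ r.topTriangle i

instance (C : Cx Vertex) (i : ℕ) (Y : Finset Vertex) : Decidable (r.IsY C i Y) := by
  unfold IsY; infer_instance

instance (C : Cx Vertex) (i : ℕ) (Z : Finset Vertex) : Decidable (r.IsZ C i Z) := by
  unfold IsZ; infer_instance

/-- The vertices that are added to the facet `Yᵢ`. -/
def newVertices (i : ℕ) : Finset Vertex :=
  if i < r.n - 1 then {r.α i, r.β i, r.α (i + 1)} else {r.α i}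

/-- The triangles on the boundary of `Yᵢ` by which `b cᵢ₊₁ cᵢ` is replaced. -/
def newTriangles (i : ℕ) : Finset (Finset Vertex) :=
  if i < r.n - 1 then
    {{r.b, r.α (i + 1), r.α i}, {r.α (i + 1), r.β i, r.α i}, {r.α (i + 1), r.c (i + 1), r.β i},
      {r.c (i + 1), r.β i, r.c i}, {r.β i, r.α i, r.c i}}
  else
    {{r.b, r.c (i + 1), r.α i}, {r.c (i + 1), r.α i, r.c i}}

/-- For `i = 1, …, n - 1`, extend the ridge `Zᵢ` to include `αᵢ` and the facet `Yᵢ` to include the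
vertices `newVertices i`, delete the edge `b cᵢ` and the triangle `b cᵢ₊₁ cᵢ`, and add the
triangles `newTriangles i` with their edges and vertices. -/
def step4 (C : Cx Vertex) : Cx Vertex :=
  let I := Finset.Icc 1 (r.n - 1)
  let D : Cx Vertex :=
    { face := fun
        | 0 => C.face 0
        | 1 => C.face 1 \ I.image (fun i => {r.b, r.c i})
        | 2 => (C.face 2 \ I.image r.topTriangle).image
            fun Z => Z ∪ (I.filter fun i => r.IsZ C i Z).image r.α
        | 3 => (C.face 3).image
            fun Y => Y ∪ (I.filter fun i => r.IsY C i Y).biUnion r.newVertices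
        | _ => ∅ }
  D.union (Cx.simplicial (I.biUnion r.newTriangles))

end Round

/-- The non-hub roots of the `j`-th copy of `M`, clockwise. They are named `α₁, α₂, …`. -/
def alphas (M : Ball) (j : ℕ) : List Vertex :=
  ((M.secondRoot :: M.arcs.map Arc.root).map (copy j)).reverse

/-- New vertices `β₁, β₂, …`, one for every two consecutive non-hub roots of the `j`-th copy of `M`,
clockwise: the tip of the tooth of the copy on these roots if there is such a tooth, a further new
vertex otherwise. -/
def betas (M : Ball) (j : ℕ) : List Vertex :=
  (M.arcs.zipIdx.map fun p => (p.1.inner.head?.map (copy j)).getD (extra j p.2)).reverse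

/-- The vertices used in the round for the fillet at the site `p.1`, the `p.2`-th site. -/
def roundAt (M : Ball) (o : Vertex) (p : Site × ℕ) : Round :=
  let cs := p.1.arc.inner.tail ++ [p.1.arc.root]
  { n := cs.length
    o := o
    a := p.1.start
    b := p.1.nextTip
    b' := p.1.arc.inner.headD o
    c := fun i => cs.getD (i - 1) o
    α := fun i => (alphas M p.2).getD (i - 1) o
    β := fun i => (betas M p.2).getD (i - 1) o }

/-- The names of the vertices of the `j`-th copy of `M`, whose hub is identified with `b`. The
non-hub roots and the tips are the vertices `αᵢ` and (some of) the `βᵢ` by choice of names. -/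
def copyName (M : Ball) (j : ℕ) (b v : Vertex) : Vertex :=
  if v = M.hub then b else copy j v

/-- One full round, for the site `p`: nothing happens unless there is a fillet. -/
def attachAt (M : Ball) (o : Vertex) (C : Cx Vertex) (p : Site × ℕ) : Cx Vertex :=
  if p.1.arc.fillet then
    let r := roundAt M o p
    (r.step4 (r.step3 (r.step2 C))).union (M.cx.map (copyName M p.2 r.b))
  else C

/-- The change of diagonal at a tooth of the original complex that is still present. With the
orientation after reflection, the tooth is `a b a'` and the additional triangle is `a d b`, where
`a'` is the start of the arc, `b` and `d` are its first and last inner vertices, and `a` is the root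
where the arc ends. If `a, b, a'` are consecutive (`b = d`), or there is no tooth, nothing
happens. -/
def flipAt (C : Cx Vertex) (p : Site × ℕ) : Cx Vertex :=
  match p.1.arc.fillet, p.1.arc.inner with
  | false, v :: w :: L =>
      let a := p.1.arc.root
      let a' := p.1.start
      let b := v
      let d := (w :: L).getLastD w
      { face := fun
          | 1 => (C.face 1 \ {{a, b}}) ∪ {{a', d}}
          | 2 => (C.face 2 \ {{a, b, a'}, {a, d, b}}) ∪ {{a, d, a'}, {d, b, a'}}
          | k => C.face k }
  | _, _ => C

/-- The part of the profile of the resulting complex, counterclockwise, that replaces the (reflected)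
arc at the site `p`. If there was a fillet, the roots are now `cₙ, cₙ₋₁, …, c₁, b', a`; there is a
tooth on `cₙ, cₙ₋₁` with tip `αₙ₋₁`, and one on `cᵢ₊₁, cᵢ` with tip `βᵢ` for `i ≤ n - 2`. Between
`βᵢ` and `αᵢ` are the vertices of the attached copy, and a fillet of the copy that ends with `αᵢ`
is continued by `cᵢ`. -/
def newArcs (M : Ball) (o : Vertex) (p : Site × ℕ) : List Arc :=
  if p.1.arc.fillet then
    let r := roundAt M o p
    { inner := [r.α (r.n - 1)], root := r.c (r.n - 1), fillet := false } ::
      (M.arcs.zipIdx.map fun q =>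
        let i := r.n - 2 - q.2
        { inner := r.β i :: q.1.inner.tail.map (copy p.2) ++ [r.α i]
          root := r.c i
          fillet := q.1.fillet }) ++
      [{ inner := [], root := r.b', fillet := false },
       { inner := [], root := r.a, fillet := false }]
  else [{ inner := p.1.arc.inner.reverse, root := p.1.start, fillet := false }]

/-- The complex built from `B` and one copy of `M` for each fillet of `B`. -/
def recursionStep (B M : Ball) : Ball :=
  let B' := B.map old
  let ps := (sites B'.secondRoot B'.arcs).zipIdx
  { cx := ps.foldl flipAt (ps.foldl (attachAt M B'.hub) B'.cx)
    hub := B'.hub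
    secondRoot := (B'.arcs.map Arc.root).getLastD B'.secondRoot
    arcs := ps.reverse.flatMap (newArcs M B'.hub) }

/-- The marked complex `X(s,t)` for positive `s` and `t` (other values are irrelevant). -/
def X : ℕ → ℕ → Ball
  | 0, _ => X1 0
  | s + 1, 0 => X1 (s + 1)
  | s + 1, 1 => X1 (s + 1)
  | 1, t + 2 => X1' (t + 2)
  | s + 2, t + 2 => recursionStep (X (s + 1) (KPrime (s + 2) (t + 1))) (X (s + 2) (t + 1))
termination_by s t => (s, t)

/-- The `3`-sphere `S(s,t)`, obtained by coning over the boundary of `X(s,t)`. -/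
def S (s t : ℕ) : Cx (Option Vertex) :=
  (X s t).cx.cone (X s t).cx.boundary

end FatSpheres

namespace FatSpheres

open Vertex Finset

variable {Z W S e Y T : Finset Vertex} {i j k : ℕ} {x y : Vertex}

/-- The number of facets containing a set of vertices. -/
def Cx.nfac {V : Type} [DecidableEq V] (C : Cx V) (S : Finset V) : ℕ :=
  ((C.face 3).filter fun Y => S ⊆ Y).card

/-- A root triangle of a marked complex, contained in `ε` facets. -/
structure RootOK (C : Cx Vertex) (ε : ℕ) (o x y : Vertex) : Prop where
  vo : {o} ∈ C.face 0
  vx : {x} ∈ C.face 0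
  vy : {y} ∈ C.face 0
  ox : {o, x} ∈ C.face 1
  oy : {o, y} ∈ C.face 1
  xy : {x, y} ∈ C.face 1
  tri : {o, x, y} ∈ C.face 2
  fac : C.nfac {o, x, y} = ε

/-- A tooth on the roots `x, y`, contained in `ε` facets. -/
structure ToothOK (C : Cx Vertex) (ε : ℕ) (o x b y : Vertex) : Prop where
  xb : {x, b} ∈ C.face 1
  yb : {b, y} ∈ C.face 1
  tri : {x, b, y} ∈ C.face 2
  fac : C.nfac {x, b, y} = ε
  free : ∀ Z ∈ C.face 2, {x, y} ⊆ Z → C.nfac Z = 1 → Z = {o, x, y} ∨ Z = {x, b, y}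

/-- A pair of adjacent triangles `a b a'`, `a d b` in a common facet in which the diagonal
can be changed. -/
structure FlipOK (C : Cx Vertex) (a a' b d : Vertex) : Prop where
  ad : {a, d} ∈ C.face 1
  bd : {b, d} ∈ C.face 1
  diag : {a', d} ∉ C.face 1
  tri : {a, d, b} ∈ C.face 2
  diag' : ∀ Z ∈ C.face 2, ¬ {a', d} ⊆ Z
  both : ∀ Z ∈ C.face 2, {a, b} ⊆ Z → Z = {a, b, a'} ∨ Z = {a, d, b}
  fac : ∃ Y ∈ C.face 3, {a, b} ⊆ Y ∧ {a', d} ⊆ Y ∧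
    ∀ Y' ∈ C.face 3, {a, b} ⊆ Y' ∨ {a', d} ⊆ Y' → Y' = Y

/-- The faces around a fillet `c₁, …, cₙ` between the tips `b'` and `b`. -/
structure FilletOK (C : Cx Vertex) (a b b' : Vertex) (c : ℕ → Vertex) (n : ℕ) : Prop where
  edge' : ∀ i, 1 ≤ i → i ≤ n → {b', c i} ∈ C.face 1
  edge : ∀ i, 1 ≤ i → i ≤ n → {b, c i} ∈ C.face 1
  side : ∀ i, 1 ≤ i → i < n → {c i, c (i + 1)} ∈ C.face 1
  tri' : ∀ i, 1 ≤ i → i < n → {b', c i, c (i + 1)} ∈ C.face 2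
  fac' : ∀ i, 1 ≤ i → i < n → C.nfac {b', c i, c (i + 1)} = 1
  free' : ∀ i, 2 ≤ i → i ≤ n → ∀ Z ∈ C.face 2, {b', c i} ⊆ Z → C.nfac Z = 1 →
    Z = {b', c (i - 1), c i} ∨ Z = {b', c i, if i < n then c (i + 1) else a}
  tri : ∀ i, 1 ≤ i → i < n → {b, c i, c (i + 1)} ∈ C.face 2
  fac : ∀ i, 1 ≤ i → i < n → C.nfac {b, c i, c (i + 1)} = 1
  near : ∀ i, 1 ≤ i → i < n → ∀ Y ∈ C.face 3, {b, c i} ⊆ Y → (2 ≤ i ∧ c (i - 1) ∈ Y) ∨ c (i + 1) ∈ Y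
  far : ∀ i j, 1 ≤ i → i + 2 ≤ j → j ≤ n → ∀ Y ∈ C.face 3, ¬ {b, c i, c j} ⊆ Y
  free : ∀ i, 2 ≤ i → i < n → ∀ Z ∈ C.face 2, {b, c i} ⊆ Z → C.nfac Z = 1 →
    Z = {b, c (i - 1), c i} ∨ Z = {b, c i, c (i + 1)}
  sideFree : ∀ i, 1 ≤ i → i < n → ∀ Z ∈ C.face 2, {c i, c (i + 1)} ⊆ Z → C.nfac Z = 1 →
    Z = {b', c i, c (i + 1)} ∨ Z = {b, c i, c (i + 1)}
  only : ∀ Z ∈ C.face 2, Z ⊆ insert b' ((Icc 1 n).image c) →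
    ∃ i, 1 ≤ i ∧ i < n ∧ Z = {b', c i, c (i + 1)}
  start : 2 ≤ n → ∃ Z ∈ C.face 2, {b, c 1} ⊆ Z ∧ Z ≠ {b, c 1, c 2} ∧ C.nfac Z = 1

/-- The faces at the end of a fillet, where `x` is the root that follows. -/
structure FilletEnd (C : Cx Vertex) (b : Vertex) (c : ℕ → Vertex) (n : ℕ) (x : Vertex) : Prop where
  near : ∀ Y ∈ C.face 3, {b, c n} ⊆ Y → 2 ≤ n ∧ c (n - 1) ∈ Y
  free : 2 ≤ n → ∀ Z ∈ C.face 2, {b, c n} ⊆ Z → C.nfac Z = 1 →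
    Z = {b, c (n - 1), c n} ∨ Z = {b, c n, x}

/-- No face of positive dimension contains `x` and `y`. -/
structure Apart (C : Cx Vertex) (x y : Vertex) : Prop where
  e1 : ∀ Z ∈ C.face 1, ¬ {x, y} ⊆ Z
  e2 : ∀ Z ∈ C.face 2, ¬ {x, y} ⊆ Z
  e3 : ∀ Z ∈ C.face 3, ¬ {x, y} ⊆ Z

/-- `C` embeds into `C'` by `f`, such that for vertex sets `S` with the property `P` the faces
containing `S` correspond to each other; corresponding faces have the same vertices, except for
vertices of `C'` that do not come from `U`. -/
structure Sim (C C' : Cx Vertex) (f : Vertex → Vertex) (U T : Set Vertex)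
    (P : Finset Vertex → Prop) (e₂ e₃ : Finset Vertex → Finset Vertex) : Prop where
  inj : Set.InjOn f U
  mono : ∀ S S', S ⊆ S' → P S → P S'
  sub₂ : ∀ Z ∈ C.face 2, ↑Z ⊆ U
  sub₃ : ∀ Z ∈ C.face 3, ↑Z ⊆ U
  up₁ : ∀ S : Finset Vertex, P S → ↑S ⊆ U → ∀ Z', S.image f ⊆ Z' → Z' ∈ C'.face 1 →
    ∃ Z ∈ C.face 1, ↑Z ⊆ U ∧ Z.image f = Z'
  up₂ : ∀ S : Finset Vertex, P S → ↑S ⊆ U → ∀ Z', S.image f ⊆ Z' → Z' ∈ C'.face 2 →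
    ∃ Z ∈ C.face 2, e₂ Z = Z'
  down₂ : ∀ Z ∈ C.face 2, P Z → e₂ Z ∈ C'.face 2
  up₃ : ∀ S : Finset Vertex, P S → ↑S ⊆ U → ∀ Z', S.image f ⊆ Z' → Z' ∈ C'.face 3 →
    ∃ Z ∈ C.face 3, e₃ Z = Z'
  down₃ : ∀ Z ∈ C.face 3, P Z → e₃ Z ∈ C'.face 3
  trace₂ : ∀ Z ∈ C.face 2, ∀ x ∈ U, f x ∈ e₂ Z ↔ x ∈ Z
  trace₃ : ∀ Z ∈ C.face 3, ∀ x ∈ U, f x ∈ e₃ Z ↔ x ∈ Z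
  incl : ∀ Z ∈ C.face 2, ∀ Y ∈ C.face 3, P Z → Z ⊆ Y → e₂ Z ⊆ e₃ Y
  keep₀ : ∀ x ∈ U, {x} ∈ C.face 0 → {f x} ∈ C'.face 0
  keep₁ : ∀ Z ∈ C.face 1, ↑Z ⊆ U → (∀ x ∈ Z, x ∉ T) → Z.image f ∈ C'.face 1
  keep₂ : ∀ Z ∈ C.face 2, (∀ x ∈ Z, x ∉ T) → e₂ Z = Z.image f ∧ Z.image f ∈ C'.face 2

namespace Sim

variable {C C' : Cx Vertex} {f : Vertex → Vertex} {U T : Set Vertex} {P : Finset Vertex → Prop}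
  {e₂ e₃ : Finset Vertex → Finset Vertex}

lemma image_sub₂ (h : Sim C C' f U T P e₂ e₃) (hZ : Z ∈ C.face 2)
    (hS : ↑S ⊆ U) : S.image f ⊆ e₂ Z ↔ S ⊆ Z := by
  rw [image_subset_iff]
  exact forall₂_congr fun x hx => h.trace₂ Z hZ x (hS hx)

lemma image_sub₃ (h : Sim C C' f U T P e₂ e₃) (hZ : Z ∈ C.face 3)
    (hS : ↑S ⊆ U) : S.image f ⊆ e₃ Z ↔ S ⊆ Z := by
  rw [image_subset_iff]
  exact forall₂_congr fun x hx => h.trace₃ Z hZ x (hS hx)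

lemma inj₃ (h : Sim C C' f U T P e₂ e₃) {Y' : Finset Vertex} (hY : Y ∈ C.face 3)
    (hY' : Y' ∈ C.face 3) (he : e₃ Y = e₃ Y') : Y = Y' := by
  have h1 := h.sub₃ Y hY
  have h2 := h.sub₃ Y' hY'
  apply Finset.Subset.antisymm
  · rw [← h.image_sub₃ hY' h1, ← he, h.image_sub₃ hY h1]
  · rw [← h.image_sub₃ hY h2, he, h.image_sub₃ hY' h2]

lemma nfac_set (h : Sim C C' f U T P e₂ e₃) (hP : P S) (hS : ↑S ⊆ U) :
    C'.nfac (S.image f) = C.nfac S := by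
  unfold Cx.nfac
  rw [← card_image_of_injOn (f := e₃) (s := (C.face 3).filter fun Y => S ⊆ Y)]
  · congr 1; ext Y; simp only [mem_filter, mem_image]; constructor
    · grind [h.up₃, h.image_sub₃]
    · rintro ⟨Z, ⟨hZ, hSZ⟩, rfl⟩
      exact ⟨h.down₃ Z hZ (h.mono _ _ hSZ hP), (h.image_sub₃ hZ hS).2 hSZ⟩
  · intro Y hY Y' hY' he; grind [coe_filter, h.inj₃]

lemma nfac_face (h : Sim C C' f U T P e₂ e₃) (hZ : Z ∈ C.face 2)
    (hP : P Z) : C'.nfac (e₂ Z) = C.nfac Z := by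
  rw [← h.nfac_set hP (h.sub₂ Z hZ)]
  unfold Cx.nfac
  congr 1
  ext Y
  simp only [mem_filter, and_congr_right_iff]
  intro hY
  have h0 := (h.image_sub₂ hZ (h.sub₂ Z hZ)).2 subset_rfl
  grind [h.up₃, h.sub₂, h.incl, h.image_sub₃]

lemma facet (h : Sim C C' f U T P e₂ e₃) {Y' : Finset Vertex} (hP : P S) (hS : ↑S ⊆ U)
    (hY : Y' ∈ C'.face 3) (hSY : S.image f ⊆ Y') :
    ∃ Y ∈ C.face 3, S ⊆ Y ∧ e₃ Y = Y' := by grind [h.up₃, h.image_sub₃]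

lemma ridge (h : Sim C C' f U T P e₂ e₃) {Z' : Finset Vertex} (hP : P S) (hS : ↑S ⊆ U)
    (hZ : Z' ∈ C'.face 2) (hSZ : S.image f ⊆ Z') :
    ∃ Z ∈ C.face 2, S ⊆ Z ∧ e₂ Z = Z' ∧ C'.nfac Z' = C.nfac Z := by
  obtain ⟨Z, hZ₀, rfl⟩ := h.up₂ S hP hS Z' hSZ hZ
  have := (h.image_sub₂ hZ₀ hS).1 hSZ
  exact ⟨Z, hZ₀, this, rfl, h.nfac_face hZ₀ (h.mono _ _ this hP)⟩

lemma notMem₁ (h : Sim C C' f U T P e₂ e₃) (hP : P S) (hS : ↑S ⊆ U)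
    (hn : S ∉ C.face 1) : S.image f ∉ C'.face 1 := by
  intro hS'
  obtain ⟨Z, hZ, hZU, he⟩ := h.up₁ S hP hS _ subset_rfl hS'
  grind [coe_inj, coe_image, h.inj.image_eq_image_iff]

lemma rootOK (h : Sim C C' f U T P e₂ e₃) {ε : ℕ} {o : Vertex} (hr : RootOK C ε o x y)
    (hP : P {o, x, y}) (hU : ∀ v ∈ ({o, x, y} : Finset Vertex), v ∈ U ∧ v ∉ T) :
    RootOK C' ε (f o) (f x) (f y) := by
  simp only [mem_insert, mem_singleton, forall_eq_or_imp, forall_eq] at hU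
  obtain ⟨⟨ho, ho'⟩, ⟨hx, hx'⟩, hy, hy'⟩ := hU
  refine ⟨h.keep₀ _ ho hr.vo, h.keep₀ _ hx hr.vx, h.keep₀ _ hy hr.vy, ?_, ?_, ?_, ?_, ?_⟩
  · simpa [image_insert] using h.keep₁ _ hr.ox (by grind) (by simp [*])
  · simpa [image_insert] using h.keep₁ _ hr.oy (by grind) (by simp [*])
  · simpa [image_insert] using h.keep₁ _ hr.xy (by grind) (by simp [*])
  · simpa [image_insert] using (h.keep₂ _ hr.tri (by simp [*])).2
  · rw [← hr.fac, ← h.nfac_set hP (by grind)]; simp [image_insert]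

lemma toothOK (h : Sim C C' f U T P e₂ e₃) {ε : ℕ} {o b : Vertex} (ht : ToothOK C ε o x b y)
    (hP : P {x, b, y}) (hP' : P {x, y}) (hU : ∀ v ∈ ({o, x, b, y} : Finset Vertex), v ∈ U ∧ v ∉ T) :
    ToothOK C' ε (f o) (f x) (f b) (f y) := by
  simp only [mem_insert, mem_singleton, forall_eq_or_imp, forall_eq] at hU
  obtain ⟨⟨ho, ho'⟩, ⟨hx, hx'⟩, ⟨hb, hb'⟩, hy, hy'⟩ := hU
  constructor
  · simpa [image_insert] using h.keep₁ _ ht.xb (by grind) (by simp [*])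
  · simpa [image_insert] using h.keep₁ _ ht.yb (by grind) (by simp [*])
  · simpa [image_insert] using (h.keep₂ _ ht.tri (by simp [*])).2
  · rw [← ht.fac, ← h.nfac_set hP (by grind)]; simp [image_insert]
  · intro Z hZ hxy hn; obtain ⟨W, hW, hSW, rfl, hn'⟩ := h.ridge hP' (by grind) hZ (by grind)
    rw [hn'] at hn; rcases ht.free W hW hSW hn with rfl | rfl
    · left; rw [(h.keep₂ _ hW (by simp [*])).1]; simp [image_insert]
    · right; rw [(h.keep₂ _ hW (by simp [*])).1]; grind

lemma flipOK (h : Sim C C' f U T P e₂ e₃) {a a' b d : Vertex} (ht : FlipOK C a a' b d)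
    (hP : P {a, b}) (hP' : P {a', d}) (hU : ∀ v ∈ ({a, a', b, d} : Finset Vertex), v ∈ U ∧ v ∉ T) :
    FlipOK C' (f a) (f a') (f b) (f d) := by
  simp only [mem_insert, mem_singleton, forall_eq_or_imp, forall_eq] at hU
  obtain ⟨⟨ha, haT⟩, ⟨ha', haT'⟩, ⟨hb, hb'⟩, hd, hd'⟩ := hU
  have hs1 : (({a, b} : Finset Vertex) : Set Vertex) ⊆ U := by grind
  have hs2 : (({a', d} : Finset Vertex) : Set Vertex) ⊆ U := by grind
  have hi1 : ({a, b} : Finset Vertex).image f = {f a, f b} := by grind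
  have hi2 : ({a', d} : Finset Vertex).image f = {f a', f d} := by simp [image_insert]
  constructor
  · simpa [image_insert] using h.keep₁ _ ht.ad (by grind) (by simp [*])
  · simpa [image_insert] using h.keep₁ _ ht.bd (by grind) (by simp [*])
  · grind [h.notMem₁, ht.diag]
  · simpa [image_insert] using (h.keep₂ _ ht.tri (by simp [*])).2
  · grind [h.ridge, ht.diag']
  · intro Z hZ hs; obtain ⟨W, hW, hSW, rfl, -⟩ := h.ridge hP hs1 hZ (hi1 ▸ hs)
    rcases ht.both W hW hSW with rfl | rfl
    · left; rw [(h.keep₂ _ hW (by simp [*])).1]; simp [image_insert]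
    · right; rw [(h.keep₂ _ hW (by simp [*])).1]; simp [image_insert]
  · obtain ⟨Y, hY, h1, h2, h3⟩ := ht.fac; refine ⟨e₃ Y, h.down₃ Y hY (h.mono _ _ h1 hP), ?_, ?_, ?_⟩
    all_goals grind [h.image_sub₃, h.facet]

lemma apart (h : Sim C C' f U T P e₂ e₃) (ha : Apart C x y)
    (hP : P {x, y}) (hx : x ∈ U) (hy : y ∈ U) : Apart C' (f x) (f y) := by
  have hs1 : (({x, y} : Finset Vertex) : Set Vertex) ⊆ U := by grind
  have hi1 : ({x, y} : Finset Vertex).image f = {f x, f y} := by grind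
  rw [Finset.ext_iff] at hi1
  constructor
  · intro Z hZ hxy; obtain ⟨W, hW, hWU, rfl⟩ := h.up₁ _ hP hs1 Z (fun v hv => hxy ((hi1 v).1 hv)) hZ
    apply ha.e1 W hW; intro v hv; have hvU := hs1 hv
    have : f v ∈ W.image f := hxy ((hi1 _).1 (mem_image_of_mem f hv))
    obtain ⟨w, hw, hwv⟩ := mem_image.1 this
    rwa [← h.inj (hWU hw) hvU hwv]
  all_goals grind [h.ridge, ha.e2, h.facet, ha.e3]

lemma edge (h : Sim C C' f U T P e₂ e₃) (he : {x, y} ∈ C.face 1)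
    (hx : x ∈ U ∧ x ∉ T) (hy : y ∈ U ∧ y ∉ T) : {f x, f y} ∈ C'.face 1 := by
  simpa [image_insert] using
    h.keep₁ _ he (by grind) (by simp [*])

lemma tri (h : Sim C C' f U T P e₂ e₃) {z : Vertex} (he : {x, y, z} ∈ C.face 2)
    (hx : x ∉ T) (hy : y ∉ T) (hz : z ∉ T) : {f x, f y, f z} ∈ C'.face 2 := by
  simpa [image_insert] using (h.keep₂ _ he (by simp [*])).2

lemma fac (h : Sim C C' f U T P e₂ e₃) {z : Vertex} (hP : P {x, y, z})
    (hx : x ∈ U) (hy : y ∈ U) (hz : z ∈ U) : C'.nfac {f x, f y, f z} = C.nfac {x, y, z} := by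
  rw [← h.nfac_set hP (by grind)]
  simp [image_insert]

lemma freeRidges (h : Sim C C' f U T P e₂ e₃) {u v : Vertex} (hP : P {x, y})
    (hx : x ∈ U ∧ x ∉ T) (hy : y ∈ U ∧ y ∉ T) (hu : u ∉ T) (hv : v ∉ T)
    (hf : ∀ Z ∈ C.face 2, {x, y} ⊆ Z → C.nfac Z = 1 → Z = {x, u, y} ∨ Z = {x, y, v}) :
    ∀ Z ∈ C'.face 2, {f x, f y} ⊆ Z → C'.nfac Z = 1 → Z = {f x, f u, f y} ∨ Z = {f x, f y, f v} := by
  intro Z hZ hxy hn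
  obtain ⟨W, hW, hSW, rfl, hn'⟩ := h.ridge hP (by grind) hZ (by grind)
  rw [hn'] at hn
  rcases hf W hW hSW hn with rfl | rfl
  · left; rw [(h.keep₂ _ hW (by simp [*])).1]; grind
  · right; rw [(h.keep₂ _ hW (by simp [*])).1]; grind

lemma facetPair (h : Sim C C' f U T P e₂ e₃) (hP : P {x, y})
    (hx : x ∈ U) (hy : y ∈ U) {Y' : Finset Vertex} (hY : Y' ∈ C'.face 3) (hxy : {f x, f y} ⊆ Y') :
    ∃ Y ∈ C.face 3, {x, y} ⊆ Y ∧ e₃ Y = Y' ∧ ∀ v ∈ U, f v ∈ Y' ↔ v ∈ Y := by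
  grind [Set.insert_subset_iff, image_insert, h.facet, h.trace₃]

lemma freeStart (h : Sim C C' f U T P e₂ e₃) {z : Vertex} (hP : P {x, y})
    (hx : x ∈ U) (hy : y ∈ U) (hz : z ∈ U)
    (hs : ∃ Z ∈ C.face 2, {x, y} ⊆ Z ∧ Z ≠ {x, y, z} ∧ C.nfac Z = 1) :
    ∃ Z ∈ C'.face 2, {f x, f y} ⊆ Z ∧ Z ≠ {f x, f y, f z} ∧ C'.nfac Z = 1 := by
  obtain ⟨Z, hZ, hxy, hne, hn⟩ := hs
  have hPZ := h.mono _ _ hxy hP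
  refine ⟨e₂ Z, h.down₂ Z hZ hPZ, ?_, ?_, (h.nfac_face hZ hPZ).trans hn⟩
  · have := (h.image_sub₂ (S := {x, y}) hZ (by grind)).2 hxy; simpa [image_insert] using this
  · intro he; apply hne; ext v; constructor
    · intro hv; have hvU := h.sub₂ Z hZ hv; have := (h.trace₂ Z hZ v hvU).2 hv; rw [he] at this
      simp only [mem_insert, mem_singleton] at this ⊢; rcases this with h1 | h1 | h1
      · exact .inl (h.inj hvU hx h1)
      · exact .inr (.inl (h.inj hvU hy h1))
      · exact .inr (.inr (h.inj hvU hz h1))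
    · intro hv; simp only [mem_insert, mem_singleton] at hv; have hvU : v ∈ U := by grind
      rw [← h.trace₂ Z hZ v hvU, he]; rcases hv with rfl | rfl | rfl <;> simp

lemma filletOK (h : Sim C C' f U T P e₂ e₃) {a b b' : Vertex} {c : ℕ → Vertex} {n : ℕ}
    (hf : FilletOK C a b b' c n) (hP : ∀ i, 1 ≤ i → i < n → P {b, c i})
    (hP' : ∀ i, 2 ≤ i → i ≤ n → P {b', c i}) (hP₁ : ∀ i, 1 ≤ i → i < n → P {c i})
    (hcard : ∀ Z ∈ C'.face 2, 3 ≤ Z.card)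
    (ha : a ∈ U ∧ a ∉ T) (hb : b ∈ U ∧ b ∉ T) (hb' : b' ∈ U ∧ b' ∉ T)
    (hc : ∀ i, 1 ≤ i → i ≤ n → c i ∈ U ∧ c i ∉ T) :
    FilletOK C' (f a) (f b) (f b') (fun i => f (c i)) n := by
  constructor
  · grind [h.edge, hf.edge']
  · grind [h.edge, hf.edge]
  · grind [h.edge, hf.side]
  · grind [h.tri, hf.tri']
  · intro i h1 h2; rw [h.fac _ hb'.1 (hc i h1 h2.le).1 (hc _ (by omega) h2).1, hf.fac' i h1 h2]
    exact h.mono _ _ (by grind) (hP' (i + 1) (by omega) h2)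
  · grind [h.freeRidges, hf.free']
  · grind [h.tri, hf.tri]
  · intro i h1 h2; rw [h.fac _ hb.1 (hc i h1 h2.le).1 (hc _ (by omega) h2).1, hf.fac i h1 h2]
    exact h.mono _ _ (by grind) (hP i h1 h2)
  · intro i h1 h2 Y hY hbc
    obtain ⟨W, hW, hSW, -, ht⟩ := h.facetPair (hP i h1 h2) hb.1 (hc i h1 h2.le).1 hY hbc
    grind [hf.near]
  · intro i j h1 h2 h3 Y hY hbc
    obtain ⟨W, hW, hSW, -, ht⟩ := h.facetPair (hP i h1 (by omega)) hb.1 (hc i h1 (by omega)).1 hY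
      (subset_trans (by grind) hbc)
    apply hf.far i j h1 h2 h3 W hW; grind
  · grind [h.freeRidges, hf.free]
  · intro i h1 h2 Z hZ hs hn; have hi := hc i h1 h2.le; have hi' := hc (i + 1) (by omega) h2
    obtain ⟨W, hW, hSW, rfl, hn'⟩ := h.ridge (S := {c i, c (i + 1)})
      (h.mono _ _ (by simp) (hP₁ i h1 h2)) (by grind) hZ
      (by grind)
    rw [hn'] at hn; rcases hf.sideFree i h1 h2 W hW hSW hn with rfl | rfl
    · left; rw [(h.keep₂ _ hW (by grind)).1]; simp [image_insert]
    · right; rw [(h.keep₂ _ hW (by grind)).1]; simp [image_insert]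
  · intro W' hW' hsub; have hex : ∃ i, 1 ≤ i ∧ i < n ∧ f (c i) ∈ W' := by
      by_contra! hno; have : W' ⊆ {f b', f (c n)} := by grind
      have := (hcard W' hW').trans (card_le_card this); grind
    obtain ⟨i, h1, h2, h3⟩ := hex
    obtain ⟨W, hW, hSW, rfl, -⟩ := h.ridge (hP₁ i h1 h2) (by grind) hW' (by grind)
    obtain ⟨j, h4, h5, rfl⟩ := hf.only W hW (by
      intro x hx; have hxU := h.sub₂ W hW hx; have := hsub ((h.trace₂ W hW x hxU).2 hx)
      simp only [mem_insert, mem_image, mem_Icc] at this ⊢; rcases this with h6 | ⟨k, ⟨h4, h5⟩, h6⟩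
      · exact .inl (h.inj hxU hb'.1 h6)
      · exact .inr ⟨k, ⟨h4, h5⟩, h.inj (hc k h4 h5).1 hxU h6⟩)
    refine ⟨j, h4, h5, ?_⟩; rw [(h.keep₂ _ hW (by grind)).1]; simp [image_insert]
  grind [le_rfl, h.freeStart, hf.start]

lemma filletEnd (h : Sim C C' f U T P e₂ e₃) {b : Vertex} {c : ℕ → Vertex} {n : ℕ}
    (he : FilletEnd C b c n x) (hP : P {b, c n}) (hb : b ∈ U ∧ b ∉ T)
    (hc : ∀ i, 1 ≤ i → i ≤ n → c i ∈ U ∧ c i ∉ T) (hx : x ∉ T)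
    (hn : 1 ≤ n) : FilletEnd C' (f b) (fun i => f (c i)) n (f x) := by
  constructor
  · intro Y hY hbc; obtain ⟨W, hW, hSW, -, ht⟩ := h.facetPair hP hb.1 (hc n hn le_rfl).1 hY hbc
    obtain ⟨h1, h2⟩ := he.near W hW hSW; grind
  grind [le_rfl, h.freeRidges, he.free]

end Sim


lemma mem_powersetCard_one {V : Type} {Z S : Finset V} :
    Z ∈ powersetCard 1 S ↔ ∃ x ∈ S, Z = {x} := by
  grind [card_eq_one]

section SmallSets

variable {V : Type} [DecidableEq V]

lemma pair_eq_iff (x y z w : V) : ({x, y} : Finset V) = {z, w} ↔ x = z ∧ y = w ∨ x = w ∧ y = z := by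
  rw [← coe_inj]
  simpa using Set.pair_eq_pair_iff

lemma triple_eq_iff (x y z u v w : V) : ({x, y, z} : Finset V) = {u, v, w} ↔
    ((x = u ∨ x = v ∨ x = w) ∧ (y = u ∨ y = v ∨ y = w) ∧ (z = u ∨ z = v ∨ z = w)) ∧
    ((u = x ∨ u = y ∨ u = z) ∧ (v = x ∨ v = y ∨ v = z) ∧ (w = x ∨ w = y ∨ w = z)) := by
  constructor
  · intro h; constructor
    · simpa [subset_iff] using h.subset
    · simpa [subset_iff] using h.superset
  grind

lemma mem_powersetCard_two_triple {x y z : V} (hxy : x ≠ y) (hxz : x ≠ z) (hyz : y ≠ z)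
    {Z : Finset V} :
    Z ∈ powersetCard 2 {x, y, z} ↔ Z = {x, y} ∨ Z = {x, z} ∨ Z = {y, z} := by
  have hx : x ∉ ({y, z} : Finset V) := by simp [*]
  have hy : y ∉ ({z} : Finset V) := by simp [*]
  rw [powersetCard_succ_insert hx, powersetCard_succ_insert hy]
  simp [powersetCard_one, mem_powersetCard]
  aesop

lemma mem_powersetCard_three_triple {x y z : V} (hxy : x ≠ y) (hxz : x ≠ z) (hyz : y ≠ z)
    {Z : Finset V} :
    Z ∈ powersetCard 3 {x, y, z} ↔ Z = {x, y, z} := by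
  have h : ({x, y, z} : Finset V).card = 3 := card_eq_three.2 ⟨x, y, z, hxy, hxz, hyz, rfl⟩
  rw [← h, powersetCard_self, mem_singleton]

lemma powersetCard_four_triple {x y z : V} : powersetCard 4 ({x, y, z} : Finset V) = ∅ := by
  grind [powersetCard_eq_empty, lt_of_le_of_lt, card_le_three]

lemma mem_powersetCard_two_quad {x y z w : V} (hxy : x ≠ y) (hxz : x ≠ z) (hyz : y ≠ z)
    (hxw : x ≠ w) (hyw : y ≠ w) (hzw : z ≠ w) {Z : Finset V} :
    Z ∈ powersetCard 2 {x, y, z, w} ↔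
      Z = {x, y} ∨ Z = {x, z} ∨ Z = {x, w} ∨ Z = {y, z} ∨ Z = {y, w} ∨ Z = {z, w} := by
  have hx : x ∉ ({y, z, w} : Finset V) := by simp [*]
  rw [powersetCard_succ_insert hx, mem_union, mem_powersetCard_two_triple hyz hyw hzw]
  simp [powersetCard_one]
  aesop

lemma mem_powersetCard_three_quad {x y z w : V} (hxy : x ≠ y) (hxz : x ≠ z) (hyz : y ≠ z)
    (hxw : x ≠ w) (hyw : y ≠ w) (hzw : z ≠ w) {Z : Finset V} :
    Z ∈ powersetCard 3 {x, y, z, w} ↔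
      Z = {x, y, z} ∨ Z = {x, y, w} ∨ Z = {x, z, w} ∨ Z = {y, z, w} := by
  have hx : x ∉ ({y, z, w} : Finset V) := by simp [*]
  rw [powersetCard_succ_insert hx, mem_union, mem_powersetCard_three_triple hyz hyw hzw, mem_image]
  grind [mem_powersetCard_two_triple]

lemma card_triple {x y z : V} (hxy : x ≠ y) (hxz : x ≠ z) (hyz : y ≠ z) :
    ({x, y, z} : Finset V).card = 3 :=
  card_eq_three.2 ⟨x, y, z, hxy, hxz, hyz, rfl⟩

lemma connectedSum_singleton_face_two {S : Finset V} :
    (Cx.connectedSum {S}).face 2 = powersetCard 3 S := by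
  ext Z
  simp only [Cx.connectedSum, singleton_biUnion, mem_filter, and_iff_left_iff_imp]
  intro h
  rw [filter_singleton, if_pos (mem_powersetCard.1 h).1, card_singleton]

lemma connectedSum_singleton_face_one {S : Finset V} :
    (Cx.connectedSum {S}).face 1 = powersetCard 2 S := by
  simp [Cx.connectedSum]

end SmallSets

/-- Symbols for the vertices used in a round. -/
inductive Sym : Type
  | o | a | b | b'
  | c (i : ℕ)
  | α (i : ℕ)
  | β (i : ℕ)

/-- The round with vertices named by `g`. -/
def roundOf (n : ℕ) (g : Sym → Vertex) : Round where
  n := n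
  o := g .o
  a := g .a
  b := g .b
  b' := g .b'
  c i := g (.c i)
  α i := g (.α i)
  β i := g (.β i)

section Fan

variable {n : ℕ} {g : Sym → Vertex}

/-- The tetrahedra glued in the second step of a round. -/
def fan (n : ℕ) (g : Sym → Vertex) : Finset (Finset Vertex) :=
  (Icc 1 (n - 1)).image fun i => {g .o, g (.c (i + 1)), g (.c i), g .b'}

lemma mem_fan : S ∈ fan n g ↔ ∃ i, 1 ≤ i ∧ i < n ∧ S = {g .o, g (.c (i + 1)), g (.c i), g .b'} := by
  grind [fan]

lemma fan_zero (hn : 2 ≤ n) : Z ∈ (Cx.connectedSum (fan n g)).face 0 ↔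
      Z = {g .o} ∨ Z = {g .b'} ∨ ∃ i, 1 ≤ i ∧ i ≤ n ∧ Z = {g (.c i)} := by
  simp only [Cx.connectedSum, mem_biUnion, mem_fan, mem_powersetCard_one]
  constructor
  · grind
  · rintro (rfl | rfl | ⟨i, h1, h2, rfl⟩)
    · exact ⟨_, ⟨1, le_rfl, hn, rfl⟩, g .o, by simp, rfl⟩
    · exact ⟨_, ⟨1, le_rfl, hn, rfl⟩, g .b', by simp, rfl⟩
    · by_cases h : i = n
      · exact ⟨_, ⟨i - 1, by omega, by omega, rfl⟩, g (.c i), by grind, rfl⟩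
      · exact ⟨_, ⟨i, h1, by omega, rfl⟩, g (.c i), by simp, rfl⟩

lemma fan_one (hg : g.Injective) (hn : 2 ≤ n) : Z ∈ (Cx.connectedSum (fan n g)).face 1 ↔
      Z = {g .o, g .b'} ∨ (∃ i, 1 ≤ i ∧ i ≤ n ∧ (Z = {g .o, g (.c i)} ∨ Z = {g .b', g (.c i)})) ∨
        ∃ i, 1 ≤ i ∧ i < n ∧ Z = {g (.c i), g (.c (i + 1))} := by
  have key : ∀ i, Z ∈ powersetCard 2 {g .o, g (.c (i + 1)), g (.c i), g .b'} ↔ _ :=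
    fun i => mem_powersetCard_two_quad (by grind) (by grind)
      (by grind) (by grind) (by grind) (by grind)
  simp only [Cx.connectedSum, mem_biUnion, mem_fan]
  constructor
  · grind [S, pair_comm]
  · rintro (rfl | ⟨i, h1, h2, h3⟩ | ⟨i, h1, h2, rfl⟩)
    · exact ⟨_, ⟨1, le_rfl, hn, rfl⟩, by grind⟩
    · by_cases h : i = n
      · refine ⟨_, ⟨i - 1, by omega, by omega, rfl⟩, ?_⟩; grind
      · refine ⟨_, ⟨i, by omega, by omega, rfl⟩, ?_⟩; grind
    · refine ⟨_, ⟨i, h1, h2, rfl⟩, ?_⟩; grind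

lemma fan_two (hg : g.Injective) (hn : 2 ≤ n) : Z ∈ (Cx.connectedSum (fan n g)).face 2 ↔
      Z = {g .o, g .b', g (.c 1)} ∨ Z = {g .o, g .b', g (.c n)} ∨
        ∃ i, 1 ≤ i ∧ i < n ∧ (Z = {g .o, g (.c i), g (.c (i + 1))} ∨
          Z = {g .b', g (.c i), g (.c (i + 1))}) := by
  have key : ∀ i, Z ∈ powersetCard 3 {g .o, g (.c (i + 1)), g (.c i), g .b'} ↔ _ :=
    fun i => mem_powersetCard_three_quad (by grind) (by grind)
      (by grind) (by grind) (by grind) (by grind)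
  have perm1 : ∀ x y z : Vertex, ({x, y, z} : Finset Vertex) = {x, z, y} := by grind
  have perm2 : ∀ x y z : Vertex, ({x, y, z} : Finset Vertex) = {z, y, x} := by grind
  simp only [Cx.connectedSum, mem_filter, mem_biUnion, card_eq_one]
  constructor
  · rintro ⟨⟨S, hS, hx⟩, T, hT⟩
    have huniq : ∀ S S', S ∈ fan n g → S' ∈ fan n g → Z ⊆ S → Z ⊆ S' → S = S' := by
      intro S S' h1 h2 h3 h4; have h5 : S ∈ ({T} : Finset _) := by grind
      have h6 : S' ∈ ({T} : Finset _) := by grind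
      grind
    obtain ⟨i, h1, h2, rfl⟩ := mem_fan.1 hS; have hZS := (mem_powersetCard.1 hx).1
    rw [key i] at hx; rcases hx with rfl | rfl | rfl | rfl
    · grind
    · by_cases h : i + 1 = n
      · grind
      · exfalso; have := huniq _ _ hS (mem_fan.2 ⟨i + 1, by omega, by omega, rfl⟩) hZS (by grind)
        have : g (.c i) ∈ ({g .o, g (.c (i + 1 + 1)), g (.c (i + 1)), g .b'} : Finset _) := by grind
        simp [hg.eq_iff] at this; omega
    · by_cases h : i = 1
      · grind
      · exfalso; have := huniq _ _ hS (mem_fan.2 ⟨i - 1, by omega, by omega, rfl⟩) hZS (by grind)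
        have : g (.c (i + 1)) ∈ ({g .o, g (.c (i - 1 + 1)), g (.c (i - 1)), g .b'} : Finset _) := by
          grind
        simp [hg.eq_iff] at this; omega
    grind
  · intro h
    have : ∃ i, 1 ≤ i ∧ i < n ∧ Z ∈ powersetCard 3 {g .o, g (.c (i + 1)), g (.c i), g .b'} ∧
        ∀ j, 1 ≤ j → j < n → Z ⊆ {g .o, g (.c (j + 1)), g (.c j), g .b'} → j = i := by
      rcases h with rfl | rfl | ⟨i, h1, h2, rfl | rfl⟩
      · refine ⟨1, le_rfl, hn, ?_, ?_⟩
        · grind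
        · simp [insert_subset_iff, hg.eq_iff]; omega
      · refine ⟨n - 1, by omega, by omega, ?_, ?_⟩
        · grind
        · simp [insert_subset_iff, hg.eq_iff]; omega
      · refine ⟨i, h1, h2, ?_, ?_⟩
        · grind
        · simp [insert_subset_iff, hg.eq_iff]; omega
      · refine ⟨i, h1, h2, ?_, ?_⟩
        · grind
        · simp [insert_subset_iff, hg.eq_iff]; omega
    obtain ⟨i, h1, h2, h3, h4⟩ := this
    refine ⟨⟨_, mem_fan.2 ⟨i, h1, h2, rfl⟩, h3⟩, {g .o, g (.c (i + 1)), g (.c i), g .b'}, ?_⟩; ext S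
    simp only [mem_filter, mem_singleton, mem_fan]; constructor
    · grind
    grind

/-- The vertices of the facet glued in the second step of a round. -/
def fanFacet (n : ℕ) (g : Sym → Vertex) : Finset Vertex :=
  insert (g .o) (insert (g .b') ((Icc 1 n).image fun i => g (.c i)))

lemma mem_fanFacet :
    x ∈ fanFacet n g ↔ x = g .o ∨ x = g .b' ∨ ∃ i, 1 ≤ i ∧ i ≤ n ∧ x = g (.c i) := by
  simp only [fanFacet, mem_insert, mem_image, mem_Icc, and_assoc, eq_comm]

lemma fan_three (hn : 2 ≤ n) : Z ∈ (Cx.connectedSum (fan n g)).face 3 ↔ Z = fanFacet n g := by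
  simp only [Cx.connectedSum, mem_singleton]
  suffices (fan n g).biUnion id = fanFacet n g by rw [this]
  ext x
  simp only [mem_biUnion, mem_fan, id, mem_fanFacet]
  constructor
  · grind
  · rintro (rfl | rfl | ⟨i, h1, h2, rfl⟩)
    · exact ⟨_, ⟨1, le_rfl, hn, rfl⟩, by simp⟩
    · exact ⟨_, ⟨1, le_rfl, hn, rfl⟩, by simp⟩
    · by_cases h : i = n
      · exact ⟨_, ⟨i - 1, by omega, by omega, rfl⟩, by grind⟩
      · exact ⟨_, ⟨i, h1, by omega, rfl⟩, by simp⟩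

end Fan


/-- The conditions on a complex under which a round can be performed at a fillet. The vertices
in `Fr` are not used yet. -/
structure Host (C : Cx Vertex) (n : ℕ) (g : Sym → Vertex) (Fr : Set Vertex) : Prop where
  inj : g.Injective
  two : 2 ≤ n
  frα : ∀ i, g (.α i) ∈ Fr
  frβ : ∀ i, g (.β i) ∈ Fr
  fro : g .o ∉ Fr
  fra : g .a ∉ Fr
  frb : g .b ∉ Fr
  frb' : g .b' ∉ Fr
  frc : ∀ i, g (.c i) ∉ Fr
  sub₀ : ∀ Z ∈ C.face 0, ∀ x ∈ Z, x ∉ Fr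
  sub₁ : ∀ Z ∈ C.face 1, ∀ x ∈ Z, x ∉ Fr
  sub₂ : ∀ Z ∈ C.face 2, ∀ x ∈ Z, x ∉ Fr
  sub₃ : ∀ Z ∈ C.face 3, ∀ x ∈ Z, x ∉ Fr
  card₁ : ∀ Z ∈ C.face 1, Z.card = 2
  card₂ : ∀ Z ∈ C.face 2, 3 ≤ Z.card
  card₃ : ∀ Z ∈ C.face 3, 2 ≤ Z.card
  anti : ∀ Z ∈ C.face 2, ∀ W ∈ C.face 2, Z ⊆ W → Z = W
  root : RootOK C 1 (g .o) (g .a) (g (.c n))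
  tooth : ToothOK C 1 (g .o) (g .a) (g .b') (g (.c n))
  apb : Apart C (g .o) (g .b')
  apc : ∀ i, 1 ≤ i → i < n → Apart C (g .o) (g (.c i))
  fil : FilletOK C (g .a) (g .b) (g .b') (fun i => g (.c i)) n
  vb : {g .b} ∈ C.face 0
  vb' : {g .b'} ∈ C.face 0
  vc : ∀ i, 1 ≤ i → i ≤ n → {g (.c i)} ∈ C.face 0

/-- The complex after the first two steps of a round. -/
def glued (C : Cx Vertex) (n : ℕ) (g : Sym → Vertex) : Cx Vertex :=
  (roundOf n g).step3 ((roundOf n g).step2 C)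

namespace Host

variable {C : Cx Vertex} {n : ℕ} {g : Sym → Vertex} {Fr : Set Vertex}

lemma glued_zero (h : Host C n g Fr) : Z ∈ (glued C n g).face 0 ↔ Z ∈ C.face 0 := by
  have hf := fan_zero (n := n) (g := g) h.two (Z := Z)
  unfold fan at hf
  simp only [glued, Round.step3, Round.step2, Cx.union, roundOf, mem_union, hf]
  simp only [Cx.connectedSum, singleton_biUnion, mem_powersetCard_one, mem_insert, mem_singleton]
  grind [h.root.vo, h.root.vx, h.vb', h.root.vy, h.vc]

lemma glued_one (h : Host C n g Fr) : Z ∈ (glued C n g).face 1 ↔ Z ∈ C.face 1 ∨ Z = {g .o, g .b'} ∨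
      ∃ i, 1 ≤ i ∧ i < n ∧ Z = {g .o, g (.c i)} := by
  have hf := fan_one (n := n) h.inj h.two (Z := Z)
  unfold fan at hf
  simp only [glued, Round.step3, Round.step2, Cx.union, roundOf, mem_union, hf]
  rw [connectedSum_singleton_face_one]
  have h4 : Z ∈ powersetCard 2 {g .o, g .a, g .b', g (.c n)} ↔ _ :=
    mem_powersetCard_two_quad (by grind [h.inj]) (by grind [h.inj])
      (by grind [h.inj]) (by grind [h.inj]) (by grind [h.inj])
      (by grind [h.inj])
  rw [h4]
  have := h.two
  constructor
  · rintro ((h1 | rfl | rfl | rfl | rfl | rfl | rfl) | rfl | ⟨i, h1, h2, rfl | rfl⟩ | ⟨i, h1, h2, rfl⟩)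
    all_goals grind [h.root.ox, h.root.oy, h.tooth.xb, h.root.xy, h.tooth.yb, h.fil.edge',
      h.fil.side]
  grind

lemma glued_two (h : Host C n g Fr) :
    Z ∈ (glued C n g).face 2 ↔ Z ∈ C.face 2 ∨ Z = {g .o, g .a, g .b'} ∨
      Z = {g .o, g .b', g (.c n)} ∨ Z = {g .o, g .b', g (.c 1)} ∨
      ∃ i, 1 ≤ i ∧ i < n ∧ Z = {g .o, g (.c i), g (.c (i + 1))} := by
  have hf := fan_two (n := n) h.inj h.two (Z := Z)
  unfold fan at hf
  simp only [glued, Round.step3, Round.step2, Cx.union, roundOf, mem_union, hf]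
  rw [connectedSum_singleton_face_two]
  have h4 : Z ∈ powersetCard 3 {g .o, g .a, g .b', g (.c n)} ↔ _ :=
    mem_powersetCard_three_quad (by grind [h.inj]) (by grind [h.inj])
      (by grind [h.inj]) (by grind [h.inj]) (by grind [h.inj])
      (by grind [h.inj])
  grind [h.root.tri, h.tooth.tri, h.fil.tri']

lemma glued_three (h : Host C n g Fr) : Z ∈ (glued C n g).face 3 ↔
      Z ∈ C.face 3 ∨ Z = {g .o, g .a, g .b', g (.c n)} ∨ Z = fanFacet n g := by
  have hf := fan_three (n := n) (g := g) h.two (Z := Z)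
  unfold fan at hf
  simp only [glued, Round.step3, Round.step2, Cx.union, roundOf, mem_union, hf]
  simp [Cx.connectedSum, or_assoc]

end Host

/-- The triangles that are replaced in the third step of a round. -/
def topTri (g : Sym → Vertex) (i : ℕ) : Finset Vertex := {g .b, g (.c i), g (.c (i + 1))}

lemma mem_newVertices {n : ℕ} {g : Sym → Vertex} : x ∈ (roundOf n g).newVertices i ↔
      x = g (.α i) ∨ i + 1 < n ∧ (x = g (.β i) ∨ x = g (.α (i + 1))) := by
  change (x ∈ if i < n - 1 then {g (.α i), g (.β i), g (.α (i + 1))} else {g (.α i)}) ↔ _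
  grind

lemma topTriangle_eq (n : ℕ) (g : Sym → Vertex) (i : ℕ) :
    (roundOf n g).topTriangle i = topTri g i := by grind [Round.topTriangle, topTri, roundOf]

/-- The ridge that results from `Z` by adding new vertices in the third step of a round. -/
def ext₂ (C : Cx Vertex) (n : ℕ) (g : Sym → Vertex) (Z : Finset Vertex) : Finset Vertex :=
  Z ∪ ((Icc 1 (n - 1)).filter fun i => (roundOf n g).IsZ C i Z).image fun i => g (.α i)

/-- The facet that results from `Y` by adding new vertices in the third step of a round. -/
def ext₃ (n : ℕ) (g : Sym → Vertex) (Y : Finset Vertex) : Finset Vertex :=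
  Y ∪ ((Icc 1 (n - 1)).filter fun i => topTri g i ⊆ Y).biUnion (roundOf n g).newVertices

namespace Host

variable {C : Cx Vertex} {n : ℕ} {g : Sym → Vertex} {Fr : Set Vertex}

lemma isZ_iff (h : Host C n g Fr) :
    (roundOf n g).IsZ (glued C n g) i Z ↔ (roundOf n g).IsZ C i Z := by
  simp only [Round.IsZ, Round.IsY, h.glued_two, h.glued_three, topTriangle_eq]
  have hb2 : ∀ x y z, g .b ∉ ({g x, g y, g z} : Finset Vertex) ∨ x = .b ∨ y = .b ∨ z = .b := by
    intro x y z; simp [h.inj.eq_iff, eq_comm]; tauto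
  constructor
  · rintro ⟨hZ, hbc, ⟨Y, -, ⟨⟨hY, htop⟩, hZY⟩⟩, hne⟩; have hbZ : g .b ∈ Z := hbc (by simp [roundOf])
    grind [mem_fanFacet, h.inj]
  grind

lemma isZ_simple : (roundOf n g).IsZ C i Z ↔ Z ∈ C.face 2 ∧ g .b ∈ Z ∧ g (.c i) ∈ Z ∧
      (∃ Y ∈ C.face 3, topTri g i ⊆ Y ∧ Z ⊆ Y) ∧ Z ≠ topTri g i := by
  grind [Round.IsZ, Round.IsY, topTriangle_eq, insert_subset_iff, roundOf]

lemma mem_ext₂ (h : Host C n g Fr) :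
    x ∈ ext₂ C n g Z ↔ x ∈ Z ∨ ∃ i, 1 ≤ i ∧ i < n ∧ (roundOf n g).IsZ C i Z ∧ x = g (.α i) := by
  grind [ext₂]

lemma mem_ext₃ (h : Host C n g Fr) : x ∈ ext₃ n g Z ↔ x ∈ Z ∨ ∃ i, 1 ≤ i ∧ i < n ∧ topTri g i ⊆ Z ∧
      (x = g (.α i) ∨ i + 1 < n ∧ (x = g (.β i) ∨ x = g (.α (i + 1)))) := by
  have := h.two
  simp only [ext₃, mem_union, mem_biUnion, mem_filter, mem_Icc, mem_newVertices]
  grind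

lemma trace₂ (h : Host C n g Fr) (hx : x ∉ Fr) : x ∈ ext₂ C n g Z ↔ x ∈ Z := by
  rw [h.mem_ext₂, or_iff_left]
  grind [h.frα]

lemma trace₃ (h : Host C n g Fr) (hx : x ∉ Fr) : x ∈ ext₃ n g Z ↔ x ∈ Z := by
  rw [h.mem_ext₃, or_iff_left]
  grind [h.frα, h.frβ]

lemma subset_ext₂ (Z : Finset Vertex) : Z ⊆ ext₂ C n g Z := subset_union_left

lemma subset_ext₃ (Z : Finset Vertex) : Z ⊆ ext₃ n g Z := subset_union_left

lemma ext₂_inj (h : Host C n g Fr) (hZ : ∀ x ∈ Z, x ∉ Fr)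
    (hW : ∀ x ∈ W, x ∉ Fr) (he : ext₂ C n g Z = ext₂ C n g W) : Z = W := by
  grind [Finset.Subset.antisymm, subset_ext₂, h.trace₂]

lemma ext₃_inj (h : Host C n g Fr) (hZ : ∀ x ∈ Z, x ∉ Fr)
    (hW : ∀ x ∈ W, x ∉ Fr) (he : ext₃ n g Z = ext₃ n g W) : Z = W := by
  grind [Finset.Subset.antisymm, subset_ext₃, h.trace₃]

lemma ext₂_eq_self (h : Host C n g Fr)
    (hZ : ∀ i, 1 ≤ i → i < n → g .b ∈ Z → g (.c i) ∉ Z) : ext₂ C n g Z = Z := by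
  ext x
  rw [h.mem_ext₂, or_iff_left]
  grind [isZ_simple]

lemma top_facet (h : Host C n g Fr) (h1 : 1 ≤ i) (h2 : i < n) :
    ∃ Y ∈ C.face 3, topTri g i ⊆ Y ∧ ∀ Y' ∈ C.face 3, topTri g i ⊆ Y' → Y' = Y := by
  have := h.fil.fac i h1 h2
  rw [Cx.nfac, card_eq_one] at this
  obtain ⟨Y, hY⟩ := this
  rw [Finset.ext_iff] at hY
  simp only [mem_filter, mem_singleton] at hY
  exact ⟨Y, ((hY Y).2 rfl).1, ((hY Y).2 rfl).2, fun Y' h3 h4 => (hY Y').1 ⟨h3, h4⟩⟩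

lemma c_mem_top (h : Host C n g Fr) (h1 : 1 ≤ i) (h2 : i < n) (h3 : 1 ≤ j) (h4 : j ≤ n) (hY : Y ∈ C.face 3) (ht : topTri g i ⊆ Y) (hj : g (.c j) ∈ Y) :
    j = i ∨ j = i + 1 := by
  by_contra hne
  simp only [topTri, insert_subset_iff, singleton_subset_iff] at ht
  rcases lt_or_ge j i with h5 | h5
  · exact h.fil.far j (i + 1) h3 (by omega) (by omega) Y hY (by grind)
  · exact h.fil.far i j h1 (by omega) (by omega) Y hY (by grind)

lemma top_unique (h : Host C n g Fr) (h1 : 1 ≤ i) (h2 : i < n) (h3 : 1 ≤ j)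
    (h4 : j < n) (hY : Y ∈ C.face 3) (hi : topTri g i ⊆ Y)
    (hj : topTri g j ⊆ Y) : i = j := by grind [topTri, h.c_mem_top]

lemma incl (h : Host C n g Fr) (hY : Y ∈ C.face 3) (hZY : Z ⊆ Y) : ext₂ C n g Z ⊆ ext₃ n g Y := by
  intro x hx
  rw [h.mem_ext₂] at hx
  rw [h.mem_ext₃]
  rcases hx with hx | ⟨i, h1, h2, h3, rfl⟩
  · grind
  · right; obtain ⟨-, h4, h5, -⟩ := isZ_simple.1 h3; rcases h.fil.near i h1 h2 Y hY (by grind) with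
      ⟨h6, h7⟩ | h7
    · refine ⟨i - 1, by omega, by omega, ?_, .inr ⟨by omega, .inr ?_⟩⟩
      all_goals grind [topTri, insert_subset_iff]
    · exact ⟨i, h1, h2, by grind [topTri, insert_subset_iff], .inl rfl⟩

end Host


/-- The conditions on the complex `N` that is attached in a round. Here `th i` tells whether `N`
has a tooth on `αᵢ₊₁, αᵢ`, and `ε` is the number of facets of `N` containing a root triangle
or a tooth. -/
structure Cap (N : Cx Vertex) (n : ℕ) (g : Sym → Vertex) (Fr : Set Vertex) (ε : ℕ)
    (th : ℕ → Prop) : Prop where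
  sub₀ : ∀ Z ∈ N.face 0, ∀ x ∈ Z, x = g .b ∨ x ∈ Fr
  sub₁ : ∀ Z ∈ N.face 1, ∀ x ∈ Z, x = g .b ∨ x ∈ Fr
  sub₂ : ∀ Z ∈ N.face 2, ∀ x ∈ Z, x = g .b ∨ x ∈ Fr
  sub₃ : ∀ Z ∈ N.face 3, ∀ x ∈ Z, x = g .b ∨ x ∈ Fr
  zero : ∀ Z ∈ N.face 0, ∃ x, Z = {x}
  card₁ : ∀ Z ∈ N.face 1, Z.card = 2
  card₂ : ∀ Z ∈ N.face 2, 3 ≤ Z.card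
  anti : ∀ Z ∈ N.face 2, ∀ W ∈ N.face 2, Z ⊆ W → Z = W
  vb : {g .b} ∈ N.face 0
  vα : ∀ i, 1 ≤ i → i < n → {g (.α i)} ∈ N.face 0
  vβ : ∀ i, 1 ≤ i → i + 1 < n → th i → {g (.β i)} ∈ N.face 0
  no₀ : ∀ i, 1 ≤ i → i + 1 < n → ¬ th i → ∀ Z ∈ N.face 0, g (.β i) ∉ Z
  no₁ : ∀ i, 1 ≤ i → i + 1 < n → ¬ th i → ∀ Z ∈ N.face 1, g (.β i) ∉ Z
  no₂ : ∀ i, 1 ≤ i → i + 1 < n → ¬ th i → ∀ Z ∈ N.face 2, g (.β i) ∉ Z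
  no₃ : ∀ i, 1 ≤ i → i + 1 < n → ¬ th i → ∀ Z ∈ N.face 3, g (.β i) ∉ Z
  hubα : ∀ i, 1 ≤ i → i < n → {g .b, g (.α i)} ∈ N.face 1
  αα : ∀ i, 1 ≤ i → i + 1 < n → {g (.α (i + 1)), g (.α i)} ∈ N.face 1
  αβ : ∀ i, 1 ≤ i → i + 1 < n → th i → {g (.α (i + 1)), g (.β i)} ∈ N.face 1
  βα : ∀ i, 1 ≤ i → i + 1 < n → th i → {g (.β i), g (.α i)} ∈ N.face 1
  tri : ∀ i, 1 ≤ i → i + 1 < n → {g .b, g (.α (i + 1)), g (.α i)} ∈ N.face 2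
  tooth : ∀ i, 1 ≤ i → i + 1 < n → th i → {g (.α (i + 1)), g (.β i), g (.α i)} ∈ N.face 2
  facTri : ∀ i, 1 ≤ i → i + 1 < n → N.nfac {g .b, g (.α (i + 1)), g (.α i)} = ε
  facTooth : ∀ i, 1 ≤ i → i + 1 < n → th i → N.nfac {g (.α (i + 1)), g (.β i), g (.α i)} = ε
  small : ∀ i, 1 ≤ i → i + 1 < n → ∀ Z ∈ N.face 2, Z ⊆ {g .b, g (.α (i + 1)), g (.β i), g (.α i)} →
    Z = {g .b, g (.α (i + 1)), g (.α i)} ∨ th i ∧ Z = {g (.α (i + 1)), g (.β i), g (.α i)}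
  freeHub : ∀ i, 2 ≤ i → i + 1 < n → ∀ Z ∈ N.face 2, {g .b, g (.α i)} ⊆ Z → N.nfac Z = 1 →
    Z = {g .b, g (.α (i + 1)), g (.α i)} ∨ Z = {g .b, g (.α i), g (.α (i - 1))}
  freeSide : ∀ i, 1 ≤ i → i + 1 < n → th i → ∀ Z ∈ N.face 2, {g (.α (i + 1)), g (.α i)} ⊆ Z →
    N.nfac Z = 1 →
    Z = {g .b, g (.α (i + 1)), g (.α i)} ∨ Z = {g (.α (i + 1)), g (.β i), g (.α i)}

/-- The complex after a round, in which `N` is attached. -/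
def rounded (C : Cx Vertex) (n : ℕ) (g : Sym → Vertex) (N : Cx Vertex) : Cx Vertex :=
  ((roundOf n g).step4 (glued C n g)).union N

section Sets

variable (n : ℕ) (g : Sym → Vertex)

/-- The edges deleted in a round. -/
def delEdges : Finset (Finset Vertex) := (Ico 1 n).image fun i => {g .b, g (.c i)}

/-- The new edges at the hub. -/
def hubEdges : Finset (Finset Vertex) :=
  insert {g .o, g .b'} ((Ico 1 n).image fun i => {g .o, g (.c i)})

open Classical in
/-- The indices at which there is no tooth of the attached complex. -/
noncomputable def gaps (th : ℕ → Prop) : Finset ℕ := (Ico 1 (n - 1)).filter fun i => ¬ th i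

/-- The other new edges that do not belong to the attached complex. -/
noncomputable def mixEdges (th : ℕ → Prop) : Finset (Finset Vertex) :=
  (Ico 1 n).image (fun i => {g (.α i), g (.c i)}) ∪
  ((Ico 1 (n - 1)).image (fun i => {g (.c (i + 1)), g (.β i)}) ∪
  ((Ico 1 (n - 1)).image (fun i => {g (.β i), g (.c i)}) ∪
  ({{g (.c n), g (.α (n - 1))}} ∪
  ((gaps n th).image (fun i => {g (.α (i + 1)), g (.β i)}) ∪
  (gaps n th).image (fun i => {g (.β i), g (.α i)})))))

/-- The triangles deleted in a round. -/
def delTris : Finset (Finset Vertex) := (Ico 1 n).image (topTri g)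

/-- The new triangles at the hub. -/
def hubTris : Finset (Finset Vertex) := insert {g .o, g .a, g .b'} (insert {g .o, g .b', g (.c 1)}
    ((Ico 1 n).image fun i => {g .o, g (.c i), g (.c (i + 1))}))

/-- The other new triangles that do not belong to the attached complex. -/
noncomputable def mixTris (th : ℕ → Prop) : Finset (Finset Vertex) :=
  (Ico 1 (n - 1)).image (fun i => {g (.α (i + 1)), g (.c (i + 1)), g (.β i)}) ∪
  ((Ico 1 (n - 1)).image (fun i => {g (.c (i + 1)), g (.β i), g (.c i)}) ∪
  ((Ico 1 (n - 1)).image (fun i => {g (.β i), g (.α i), g (.c i)}) ∪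
  ({{g .b, g (.c n), g (.α (n - 1))}} ∪ ({{g (.c n), g (.α (n - 1)), g (.c (n - 1))}} ∪
  (gaps n th).image (fun i => {g (.α (i + 1)), g (.β i), g (.α i)})))))

variable {n g}

lemma mem_delEdges : Z ∈ delEdges n g ↔ ∃ i, 1 ≤ i ∧ i < n ∧ Z = {g .b, g (.c i)} := by
  simp only [delEdges, mem_image, mem_Ico, and_assoc, eq_comm]

lemma mem_hubEdges :
    Z ∈ hubEdges n g ↔ Z = {g .o, g .b'} ∨ ∃ i, 1 ≤ i ∧ i < n ∧ Z = {g .o, g (.c i)} := by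
  simp only [hubEdges, mem_insert, mem_image, mem_Ico, and_assoc, eq_comm]

lemma mem_gaps {th : ℕ → Prop} : i ∈ gaps n th ↔ 1 ≤ i ∧ i + 1 < n ∧ ¬ th i := by grind [gaps]

lemma mem_Ico_pred : i ∈ Ico 1 (n - 1) ↔ 1 ≤ i ∧ i + 1 < n := by grind

lemma mem_mixEdges {th : ℕ → Prop} : Z ∈ mixEdges n g th ↔
    (∃ i, 1 ≤ i ∧ i < n ∧ Z = {g (.α i), g (.c i)}) ∨
    (∃ i, 1 ≤ i ∧ i + 1 < n ∧ Z = {g (.c (i + 1)), g (.β i)}) ∨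
    (∃ i, 1 ≤ i ∧ i + 1 < n ∧ Z = {g (.β i), g (.c i)}) ∨
    Z = {g (.c n), g (.α (n - 1))} ∨
    (∃ i, 1 ≤ i ∧ i + 1 < n ∧ ¬ th i ∧ Z = {g (.α (i + 1)), g (.β i)}) ∨
    (∃ i, 1 ≤ i ∧ i + 1 < n ∧ ¬ th i ∧ Z = {g (.β i), g (.α i)}) := by
  simp only [mixEdges, mem_union, mem_image, mem_gaps, mem_Ico_pred, mem_singleton, and_assoc]
  grind

lemma mem_delTris : Z ∈ delTris n g ↔ ∃ i, 1 ≤ i ∧ i < n ∧ Z = topTri g i := by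
  simp only [delTris, mem_image, mem_Ico, and_assoc, eq_comm]

lemma mem_hubTris : Z ∈ hubTris n g ↔ Z = {g .o, g .a, g .b'} ∨ Z = {g .o, g .b', g (.c 1)} ∨
      ∃ i, 1 ≤ i ∧ i < n ∧ Z = {g .o, g (.c i), g (.c (i + 1))} := by
  simp only [hubTris, mem_insert, mem_image, mem_Ico, and_assoc, eq_comm]

lemma mem_mixTris {th : ℕ → Prop} : Z ∈ mixTris n g th ↔
    (∃ i, 1 ≤ i ∧ i + 1 < n ∧ Z = {g (.α (i + 1)), g (.c (i + 1)), g (.β i)}) ∨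
    (∃ i, 1 ≤ i ∧ i + 1 < n ∧ Z = {g (.c (i + 1)), g (.β i), g (.c i)}) ∨
    (∃ i, 1 ≤ i ∧ i + 1 < n ∧ Z = {g (.β i), g (.α i), g (.c i)}) ∨
    Z = {g .b, g (.c n), g (.α (n - 1))} ∨ Z = {g (.c n), g (.α (n - 1)), g (.c (n - 1))} ∨
    (∃ i, 1 ≤ i ∧ i + 1 < n ∧ ¬ th i ∧ Z = {g (.α (i + 1)), g (.β i), g (.α i)}) := by
  simp only [mixTris, mem_union, mem_image, mem_gaps, mem_Ico_pred, mem_singleton, and_assoc]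
  simp only [eq_comm]

lemma mem_newTriangles :
    Z ∈ (roundOf n g).newTriangles i ↔ i + 1 < n ∧ (Z = {g .b, g (.α (i + 1)), g (.α i)} ∨
        Z = {g (.α (i + 1)), g (.β i), g (.α i)} ∨
        Z = {g (.α (i + 1)), g (.c (i + 1)), g (.β i)} ∨
        Z = {g (.c (i + 1)), g (.β i), g (.c i)} ∨
        Z = {g (.β i), g (.α i), g (.c i)}) ∨
      ¬ i + 1 < n ∧ (Z = {g .b, g (.c (i + 1)), g (.α i)} ∨
        Z = {g (.c (i + 1)), g (.α i), g (.c i)}) := by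
  change (Z ∈ if i < n - 1 then
    {{g .b, g (.α (i + 1)), g (.α i)}, {g (.α (i + 1)), g (.β i), g (.α i)},
      {g (.α (i + 1)), g (.c (i + 1)), g (.β i)}, {g (.c (i + 1)), g (.β i), g (.c i)},
      {g (.β i), g (.α i), g (.c i)}} else
    {{g .b, g (.c (i + 1)), g (.α i)}, {g (.c (i + 1)), g (.α i), g (.c i)}}) ↔ _
  grind

end Sets

namespace Host

variable {C N : Cx Vertex} {n : ℕ} {g : Sym → Vertex} {Fr : Set Vertex} {ε : ℕ} {th : ℕ → Prop}

lemma rounded_zero (h : Host C n g Fr) (hN : Cap N n g Fr ε th) : Z ∈ (rounded C n g N).face 0 ↔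
      Z ∈ C.face 0 ∨ Z ∈ N.face 0 ∨ ∃ i, 1 ≤ i ∧ i + 1 < n ∧ Z = {g (.β i)} := by
  have := h.two
  simp only [rounded, Cx.union, Round.step4, mem_union, Cx.simplicial, mem_biUnion,
    mem_newTriangles, h.glued_zero, zero_add, mem_powersetCard_one, mem_Icc]
  constructor
  · rintro ((h1 | ⟨T, ⟨i, ⟨h1, h2⟩, h3⟩, x, hx, rfl⟩) | h1)
    any_goals grind
    · change 1 ≤ i at h1; change i ≤ n - 1 at h2; rcases h3 with ⟨h3, h4⟩ | ⟨h3, h4⟩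
      · have hbi : ∃ j, 1 ≤ j ∧ j + 1 < n ∧ ({g (.β i)} : Finset Vertex) = {g (.β j)} :=
          ⟨i, h1, h3, rfl⟩
        rcases h4 with rfl | rfl | rfl | rfl | rfl <;>
        grind [hN.vb, hN.vα, h.vc]
      grind [hN.vb, hN.vα, h.vc]
  · rintro (h1 | h1 | ⟨i, h1, h2, rfl⟩)
    any_goals grind
    · exact .inl (.inr ⟨_, ⟨i, ⟨h1, by change i ≤ n - 1; omega⟩,
        .inl ⟨h2, .inr (.inl rfl)⟩⟩, g (.β i), by simp, rfl⟩)

lemma not_del_of_notMem (_ : Host C n g Fr)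
    (hZ : ∀ i, 1 ≤ i → i < n → g (.c i) ∈ Z → g .b ∉ Z) : Z ∉ delEdges n g := by
  grind [mem_delEdges]

lemma rounded_one (h : Host C n g Fr) (hN : Cap N n g Fr ε th) : Z ∈ (rounded C n g N).face 1 ↔
      Z ∈ C.face 1 ∧ Z ∉ delEdges n g ∨ Z ∈ hubEdges n g ∨ Z ∈ N.face 1 ∨ Z ∈ mixEdges n g th := by
  have := h.two
  have hI : ∀ i, 1 ≤ i ∧ i ≤ (roundOf n g).n - 1 ↔ 1 ≤ i ∧ i < n := by
    intro i; change 1 ≤ i ∧ i ≤ n - 1 ↔ _; omega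
  have hdel : Z ∈ image (fun i => {(roundOf n g).b, (roundOf n g).c i})
      (Icc 1 ((roundOf n g).n - 1)) ↔ Z ∈ delEdges n g := by
    rw [mem_delEdges]; simp only [mem_image, mem_Icc, hI, and_assoc, eq_comm]; rfl
  simp only [rounded, Cx.union, Round.step4, mem_union, Cx.simplicial, mem_biUnion,
    mem_newTriangles, h.glued_one, Nat.reduceAdd, mem_Icc, hI, mem_sdiff, hdel,
    ← mem_hubEdges]
  constructor
  · rintro ((⟨h1 | h1, h2⟩ | ⟨T, ⟨i, ⟨h1, h2⟩, h3⟩, hx⟩) | h1)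
    any_goals grind
    · have nodel : ∀ i, {g (.c (i + 1)), g (.c i)} ∉ delEdges n g := fun i =>
        h.not_del_of_notMem (by grind [h.inj])
      have hm := fun Z => mem_mixEdges (n := n) (g := g) (th := th) (Z := Z)
      rcases h3 with ⟨h3, h4⟩ | ⟨h3, h4⟩
      · have m1 : ({g (.α (i + 1)), g (.β i)} : Finset Vertex) ∈ N.face 1 ∨
            ({g (.α (i + 1)), g (.β i)} : Finset Vertex) ∈ mixEdges n g th := by grind [hN.αβ]
        have m2 : ({g (.β i), g (.α i)} : Finset Vertex) ∈ N.face 1 ∨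
            ({g (.β i), g (.α i)} : Finset Vertex) ∈ mixEdges n g th := by grind [hN.βα]
        have m3 : ∀ j, 1 ≤ j → j < n → {g (.α j), g (.c j)} ∈ mixEdges n g th := by grind
        have m4 : {g (.c (i + 1)), g (.β i)} ∈ mixEdges n g th := by grind
        have m5 : {g (.β i), g (.c i)} ∈ mixEdges n g th := by grind
        rcases h4 with rfl | rfl | rfl | rfl | rfl <;>
        rw [mem_powersetCard_two_triple (h.inj.ne (by simp)) (h.inj.ne (by simp))
            (h.inj.ne (by simp))] at hx <;>
        rcases hx with rfl | rfl | rfl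
        all_goals grind [pair_comm, hN.hubα, hN.αα, h.fil.side]
      · obtain rfl : n = i + 1 := by omega
        have m1 : {g (.c (i + 1)), g (.α i)} ∈ mixEdges (i + 1) g th := by rw [hm]; simp
        have m3 : {g (.α i), g (.c i)} ∈ mixEdges (i + 1) g th := by grind
        rcases h4 with rfl | rfl <;>
        rw [mem_powersetCard_two_triple (h.inj.ne (by simp)) (h.inj.ne (by simp))
            (h.inj.ne (by simp))] at hx <;>
        rcases hx with rfl | rfl | rfl
        · refine .inl ⟨h.fil.edge _ (by omega) le_rfl, ?_⟩; grind [h.not_del_of_notMem, h.inj]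
        all_goals grind [pair_comm, hN.hubα, h.fil.side]
  · rintro (⟨h1, h2⟩ | h1 | h1 | h1)
    any_goals grind
    · grind [mem_hubEdges, h.not_del_of_notMem, h.inj]
    · refine .inl (.inr ?_); rw [mem_mixEdges] at h1
      have mk : ∀ x y z : Sym, x ≠ y → x ≠ z → y ≠ z →
          (({g x, g y} : Finset Vertex) ∈ powersetCard 2 {g x, g y, g z}) ∧
          (({g x, g y} : Finset Vertex) ∈ powersetCard 2 {g z, g x, g y}) := by
        intro x y z hxy hxz hyz
        constructor <;> rw [mem_powersetCard_two_triple] <;> simp [h.inj.eq_iff, *, Ne.symm]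
      rcases h1 with ⟨i, h1, h2, rfl⟩ | ⟨i, h1, h2, rfl⟩ | ⟨i, h1, h2, rfl⟩ | rfl |
        ⟨i, h1, h2, -, rfl⟩ | ⟨i, h1, h2, -, rfl⟩
      · by_cases h3 : i + 1 < n
        · exact ⟨_, ⟨i, ⟨h1, h2⟩, .inl ⟨h3, .inr (.inr (.inr (.inr rfl)))⟩⟩,
            (mk _ _ _ (by simp) (by simp) (by simp)).2⟩
        · exact ⟨_, ⟨i, ⟨h1, h2⟩, .inr ⟨h3, .inr rfl⟩⟩, (mk _ _ _ (by simp) (by simp) (by simp)).2⟩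
      · exact ⟨_, ⟨i, ⟨h1, by omega⟩, .inl ⟨h2, .inr (.inr (.inr (.inl rfl)))⟩⟩,
          (mk _ _ _ (by simp) (by simp) (by simp)).1⟩
      · exact ⟨_, ⟨i, ⟨h1, by omega⟩, .inl ⟨h2, .inr (.inr (.inr (.inl rfl)))⟩⟩,
          (mk _ _ _ (by simp) (by simp) (by simp)).2⟩
      · obtain ⟨m, rfl⟩ : ∃ m, n = m + 1 := ⟨n - 1, by omega⟩
        exact ⟨_, ⟨m, ⟨by omega, by omega⟩, .inr ⟨by omega, .inr rfl⟩⟩,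
          (mk _ _ _ (by simp) (by simp) (by simp)).1⟩
      · exact ⟨_, ⟨i, ⟨h1, by omega⟩, .inl ⟨h2, .inr (.inl rfl)⟩⟩,
          (mk _ _ _ (by simp) (by simp) (by simp)).1⟩
      · exact ⟨_, ⟨i, ⟨h1, by omega⟩, .inl ⟨h2, .inr (.inr (.inr (.inr rfl)))⟩⟩,
          (mk _ _ _ (by simp) (by simp) (by simp)).1⟩

lemma rounded_two (h : Host C n g Fr) (hN : Cap N n g Fr ε th) : Z ∈ (rounded C n g N).face 2 ↔
      (∃ W ∈ C.face 2, W ∉ delTris n g ∧ ext₂ C n g W = Z) ∨ Z = {g .o, g .b', g (.c n)} ∨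
      Z ∈ hubTris n g ∨ Z ∈ N.face 2 ∨ Z ∈ mixTris n g th := by
  have := h.two
  have hI : ∀ i, 1 ≤ i ∧ i ≤ (roundOf n g).n - 1 ↔ 1 ≤ i ∧ i < n := by
    intro i; change 1 ≤ i ∧ i ≤ n - 1 ↔ _; omega
  have hdel : ∀ Z, (∃ i, (1 ≤ i ∧ i < n) ∧ (roundOf n g).topTriangle i = Z) ↔ Z ∈ delTris n g := by
    intro Z; rw [mem_delTris]; simp only [and_assoc, topTriangle_eq, eq_comm]
  have hext : ∀ Z, Z ∪ image (roundOf n g).α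
      {i ∈ Icc 1 ((roundOf n g).n - 1) | (roundOf n g).IsZ (glued C n g) i Z} =
      ext₂ C n g Z := by
    intro Z; simp only [h.isZ_iff]; rfl
  simp only [rounded, Cx.union, Round.step4, mem_union, Cx.simplicial, mem_biUnion,
    mem_newTriangles, Nat.reduceAdd, mem_Icc, hI, mem_sdiff, hext, mem_image,
    h.glued_two]
  have hhub : ∀ W, W = {g .o, g .b', g (.c n)} ∨ W ∈ hubTris n g →
      W ∉ delTris n g ∧ ext₂ C n g W = W := by
    intro W hW; have hb : g .b ∉ W := by
      rw [mem_hubTris] at hW; rcases hW with rfl | rfl | rfl | ⟨i, -, -, rfl⟩ <;> grind [h.inj]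
    grind [mem_delTris, topTri, h.ext₂_eq_self]
  have hself : ∀ x y z : Sym, x ≠ y → x ≠ z → y ≠ z →
      ({g x, g y, g z} : Finset Vertex) ∈ powersetCard 3 {g x, g y, g z} := by
    grind [mem_powersetCard_three_triple, h.inj]
  constructor
  · rintro ((⟨W, ⟨h1, h2⟩, rfl⟩ | ⟨T, ⟨i, ⟨h1, h2⟩, h3⟩, hx⟩) | h1)
    · have h3 : W ∈ C.face 2 ∨ W = {g .o, g .b', g (.c n)} ∨ W ∈ hubTris n g := by
        rw [mem_hubTris]; tauto
      grind
    · rw [mem_mixTris]; rcases h3 with ⟨h3, h4⟩ | ⟨h3, h4⟩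
      · rcases h4 with rfl | rfl | rfl | rfl | rfl <;>
        rw [mem_powersetCard_three_triple (h.inj.ne (by simp)) (h.inj.ne (by simp))
            (h.inj.ne (by simp))] at hx <;> subst hx
        · grind [hN.tri]
        · by_cases ht : th i
          · grind [hN.tooth]
          grind
        · grind
        · grind
        grind
      · obtain rfl : n = i + 1 := by omega
        rcases h4 with rfl | rfl <;>
        rw [mem_powersetCard_three_triple (h.inj.ne (by simp)) (h.inj.ne (by simp))
            (h.inj.ne (by simp))] at hx <;> subst hx
        · grind
        grind
    grind
  · rintro (⟨W, h1, h2, rfl⟩ | h1 | h1 | h1 | h1)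
    · grind
    · refine .inl (.inl ⟨Z, ⟨by tauto, ?_⟩, (hhub Z (.inl h1)).2⟩)
      rw [hdel]; exact (hhub Z (.inl h1)).1
    · refine .inl (.inl ⟨Z, ⟨by grind [mem_hubTris], ?_⟩, (hhub Z (.inr h1)).2⟩); grind
    · exact .inr h1
    · refine .inl (.inr ?_); rw [mem_mixTris] at h1
      obtain ⟨m, rfl⟩ : ∃ m, n = m + 1 := ⟨n - 1, by omega⟩
      rcases h1 with ⟨i, h1, h2, rfl⟩ | ⟨i, h1, h2, rfl⟩ | ⟨i, h1, h2, rfl⟩ | rfl | rfl |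
        ⟨i, h1, h2, -, rfl⟩
      · exact ⟨_, ⟨i, ⟨h1, by omega⟩, .inl ⟨h2, .inr (.inr (.inl rfl))⟩⟩,
          hself _ _ _ (by simp) (by simp) (by simp)⟩
      · exact ⟨_, ⟨i, ⟨h1, by omega⟩, .inl ⟨h2, .inr (.inr (.inr (.inl rfl)))⟩⟩,
          hself _ _ _ (by simp) (by simp) (by simp)⟩
      · exact ⟨_, ⟨i, ⟨h1, by omega⟩, .inl ⟨h2, .inr (.inr (.inr (.inr rfl)))⟩⟩,
          hself _ _ _ (by simp) (by simp) (by simp)⟩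
      · exact ⟨_, ⟨m, ⟨by omega, by omega⟩, .inr ⟨by omega, .inl rfl⟩⟩,
          hself _ _ _ (by simp) (by simp) (by simp)⟩
      · exact ⟨_, ⟨m, ⟨by omega, by omega⟩, .inr ⟨by omega, .inr rfl⟩⟩,
          hself _ _ _ (by simp) (by simp) (by simp)⟩
      · exact ⟨_, ⟨i, ⟨h1, by omega⟩, .inl ⟨h2, .inr (.inl rfl)⟩⟩,
          hself _ _ _ (by simp) (by simp) (by simp)⟩

lemma rounded_three (h : Host C n g Fr) : Z ∈ (rounded C n g N).face 3 ↔
      (∃ W ∈ C.face 3, ext₃ n g W = Z) ∨ Z = {g .o, g .a, g .b', g (.c n)} ∨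
      Z = fanFacet n g ∨ Z ∈ N.face 3 := by
  have hext : ∀ Z, Z ∪ Finset.biUnion {i ∈ Icc 1 ((roundOf n g).n - 1) |
      (roundOf n g).IsY (glued C n g) i Z} (roundOf n g).newVertices = if Z ∈ (glued C n g).face 3
        then ext₃ n g Z else Z := by
    intro Z; simp only [Round.IsY, topTriangle_eq]
    split_ifs with hZ
    · simp only [hZ, true_and]; rfl
    · simp [hZ]
  have hself : ∀ Z, g .b ∉ Z → ext₃ n g Z = Z := by
    intro Z hb; ext x; rw [h.mem_ext₃, or_iff_left]; grind [topTri]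
  have hb1 : g .b ∉ ({g .o, g .a, g .b', g (.c n)} : Finset Vertex) := by grind [h.inj]
  have hb2 : g .b ∉ fanFacet n g := by grind [mem_fanFacet, h.inj]
  simp only [rounded, Cx.union, Round.step4, mem_union, Cx.simplicial, mem_biUnion,
    mem_newTriangles, Nat.reduceAdd, hext, mem_image]
  constructor
  · rintro ((⟨W, h1, rfl⟩ | ⟨T, ⟨i, -, h3⟩, hx⟩) | h1)
    · rw [if_pos h1]; rcases h.glued_three.1 h1 with h1 | rfl | rfl
      all_goals grind
    · rcases h3 with ⟨-, rfl | rfl | rfl | rfl | rfl⟩ | ⟨-, rfl | rfl⟩ <;>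
        simp [powersetCard_four_triple] at hx
    · simp [h1]
  · have hg := fun Z => h.glued_three (Z := Z); rintro (⟨W, h1, rfl⟩ | rfl | rfl | h1)
    · grind
    · grind
    · grind
    · exact .inr h1

end Host


/-- The triangles along which the first two facets of a round are glued. -/
def IsGlue (n : ℕ) (g : Sym → Vertex) (Z : Finset Vertex) : Prop :=
  Z = {g .o, g .a, g (.c n)} ∨ Z = {g .a, g .b', g (.c n)} ∨
    ∃ i, 1 ≤ i ∧ i < n ∧ Z = {g .b', g (.c i), g (.c (i + 1))}

/-- The triangles along which `N` is attached. -/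
def IsSeam (n : ℕ) (g : Sym → Vertex) (th : ℕ → Prop) (Z : Finset Vertex) : Prop :=
  ∃ i, 1 ≤ i ∧ i + 1 < n ∧ (Z = {g .b, g (.α (i + 1)), g (.α i)} ∨
    th i ∧ Z = {g (.α (i + 1)), g (.β i), g (.α i)})

/-- The edges on the boundary of the disc along which `N` is attached. -/
def IsRim (n : ℕ) (g : Sym → Vertex) (th : ℕ → Prop) (Z : Finset Vertex) : Prop :=
  Z = {g .b, g (.α 1)} ∨ Z = {g .b, g (.α (n - 1))} ∨ ∃ i, 1 ≤ i ∧ i + 1 < n ∧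
      (th i ∧ (Z = {g (.α (i + 1)), g (.β i)} ∨ Z = {g (.β i), g (.α i)}) ∨
      ¬ th i ∧ Z = {g (.α (i + 1)), g (.α i)})

open Classical in
/-- The ridges of `N` that are free after attaching `N` along the ridges with property `D`. -/
noncomputable def outerRidges (N : Cx Vertex) (D : Finset Vertex → Prop) : Finset (Finset Vertex) :=
  (N.face 2).filter fun Z => N.nfac Z + (if D Z then 1 else 0) = 1

open Classical in
/-- The edges of `N` that are on the boundary after attaching `N` along the ridges with
property `D`; the property `E` describes the boundary of the union of these ridges. -/
noncomputable def outerEdges (N : Cx Vertex) (D E : Finset Vertex → Prop) :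
    Finset (Finset Vertex) :=
  (N.face 1).filter fun Z => (∃ T ∈ outerRidges N D, Z ⊆ T) ∨ E Z

namespace Host

variable {C N : Cx Vertex} {n : ℕ} {g : Sym → Vertex} {Fr : Set Vertex} {ε : ℕ} {th : ℕ → Prop}

lemma not_subset_seam (_ : Host C n g Fr)
    (hS : ∃ x ∈ S, x ≠ g .b ∧ x ∉ Fr) (hY : ∀ x ∈ Y, x = g .b ∨ x ∈ Fr) : ¬ S ⊆ Y := by grind

lemma exists_ne_hub (_ : Host C n g Fr) (hS : 2 ≤ S.card)
    (hold : ∀ x ∈ S, x ∉ Fr) : ∃ x ∈ S, x ≠ g .b ∧ x ∉ Fr := by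
  obtain ⟨x, hx, hne⟩ := exists_mem_ne (by omega) (g .b) (s := S)
  exact ⟨x, hx, hne, hold x hx⟩

lemma nfac_rounded (h : Host C n g Fr) (hN : Cap N n g Fr ε th) (S : Finset Vertex) :
    (rounded C n g N).nfac S = ((C.face 3).filter fun Y => S ⊆ ext₃ n g Y).card +
      (if S ⊆ {g .o, g .a, g .b', g (.c n)} then 1 else 0) +
      (if S ⊆ fanFacet n g then 1 else 0) + N.nfac S := by
  have hF : (rounded C n g N).face 3 = (((C.face 3).image (ext₃ n g) ∪
      {{g .o, g .a, g .b', g (.c n)}}) ∪ {fanFacet n g}) ∪ N.face 3 := by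
    ext Z; simp only [h.rounded_three, mem_union, mem_image, mem_singleton, or_assoc]
  have hap : ∀ W ∈ C.face 3, ¬ (g .o ∈ ext₃ n g W ∧ g .b' ∈ ext₃ n g W) := by
    rintro W hW ⟨h1, h2⟩; rw [h.trace₃ h.fro] at h1; rw [h.trace₃ h.frb'] at h2
    exact h.apb.e3 W hW (by grind)
  have d1 : Disjoint ((C.face 3).image (ext₃ n g)) {{g .o, g .a, g .b', g (.c n)}} := by
    grind [disjoint_singleton_right]
  have d2 : Disjoint ((C.face 3).image (ext₃ n g) ∪ {{g .o, g .a, g .b', g (.c n)}})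
      {fanFacet n g} := by
    rw [disjoint_singleton_right, mem_union, mem_image, mem_singleton]; rintro (⟨W, hW, he⟩ | he)
    · grind [mem_fanFacet]
    · have : g .a ∈ fanFacet n g := by rw [he]; simp
      grind [mem_fanFacet, h.inj]
  have d3 : Disjoint (((C.face 3).image (ext₃ n g) ∪ {{g .o, g .a, g .b', g (.c n)}}) ∪
      {fanFacet n g}) (N.face 3) := by
    rw [disjoint_right]; intro Z hZ hZ'; have hs := hN.sub₃ Z hZ
    simp only [mem_union, mem_image, mem_singleton] at hZ'
    rcases hZ' with (⟨W, hW, rfl⟩ | rfl) | rfl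
    · exact h.not_subset_seam (h.exists_ne_hub (h.card₃ W hW) (h.sub₃ W hW)) hs (subset_ext₃ W)
    all_goals grind [mem_fanFacet, h.inj, h.fro]
  have hs : ∀ T : Finset Vertex, (({T} : Finset (Finset Vertex)).filter fun Y => S ⊆ Y).card =
      if S ⊆ T then 1 else 0 := by grind [filter_singleton]
  rw [Cx.nfac, hF, filter_union, card_union_of_disjoint
    (disjoint_filter_filter d3), filter_union, card_union_of_disjoint
    (disjoint_filter_filter d2), filter_union, card_union_of_disjoint
    (disjoint_filter_filter d1), hs, hs, filter_image, card_image_of_injOn,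
    Cx.nfac]
  intro Y hY Y' hY' he
  grind [coe_filter, h.ext₃_inj, h.sub₃]

lemma nfac_seam_zero (_ : Host C n g Fr) (hN : Cap N n g Fr ε th)
    (hS : ∃ x ∈ S, x ≠ g .b ∧ x ∉ Fr) : N.nfac S = 0 := by
  grind [Cx.nfac, card_eq_zero, filter_eq_empty_iff, hN.sub₃]

lemma nfac_ext₂ (h : Host C n g Fr) (hN : Cap N n g Fr ε th)
    (hW : W ∈ C.face 2) : ((rounded C n g N).nfac (ext₂ C n g W) = C.nfac W ∧ ¬ IsGlue n g W) ∨
      ((rounded C n g N).nfac (ext₂ C n g W) = 2 ∧ IsGlue n g W) := by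
  have hold := h.sub₂ W hW
  have hcard := h.card₂ W hW
  have := h.two
  have e1 : ((C.face 3).filter fun Y => ext₂ C n g W ⊆ ext₃ n g Y) =
      (C.face 3).filter fun Y => W ⊆ Y := by
    grind [filter_congr, subset_ext₂, h.trace₃, h.incl]
  obtain ⟨x, hx, hxb⟩ := h.exists_ne_hub (by omega : 2 ≤ W.card) hold
  have e2 := h.nfac_seam_zero hN ⟨x, subset_ext₂ (C := C) (n := n) (g := g) W hx, hxb⟩
  rw [h.nfac_rounded hN, e1, e2, ← Cx.nfac]
  have hob : ¬ (g .o ∈ W ∧ g .b' ∈ W) := fun h1 =>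
    h.apb.e2 W hW (by grind)
  have hoc : ∀ i, 1 ≤ i → i < n → ¬ (g .o ∈ W ∧ g (.c i) ∈ W) := fun i h1 h2 h3 =>
    (h.apc i h1 h2).e2 W hW (by grind)
  have key : ∀ x y z : Vertex, W ⊆ {x, y, z} → W = {x, y, z} := fun x y z hs =>
    eq_of_subset_of_card_le hs (card_le_three.trans hcard)
  have k1 : ext₂ C n g W ⊆ {g .o, g .a, g .b', g (.c n)} ↔
      W = {g .o, g .a, g (.c n)} ∨ W = {g .a, g .b', g (.c n)} := by
    constructor
    all_goals grind [subset_ext₂, h.ext₂_eq_self, h.inj]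
  have k2 : ext₂ C n g W ⊆ fanFacet n g ↔
      ∃ i, 1 ≤ i ∧ i < n ∧ W = {g .b', g (.c i), g (.c (i + 1))} := by
    constructor
    · intro h1; have h2 := (subset_ext₂ W).trans h1; have ho : g .o ∉ W := by
        intro ho; have : W ⊆ {g .o, g (.c n)} := by intro x hx; have := h2 hx; grind [mem_fanFacet]
        have := (card_le_card this).trans card_le_two; omega
      apply h.fil.only W hW; intro x hx; have := h2 hx; grind [mem_fanFacet]
    · rintro ⟨i, h1, h2, rfl⟩; rw [h.ext₂_eq_self (by simp [h.inj.eq_iff])]; grind [mem_fanFacet]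
  have hexcl : (W = {g .o, g .a, g (.c n)} ∨ W = {g .a, g .b', g (.c n)}) →
      ¬ ∃ i, 1 ≤ i ∧ i < n ∧ W = {g .b', g (.c i), g (.c (i + 1))} := by
    intro h1 h2; grind [h.inj]
  by_cases h1 : W = {g .o, g .a, g (.c n)} ∨ W = {g .a, g .b', g (.c n)}
  · right; have h2 := hexcl h1; rw [if_pos (k1.2 h1), if_neg (h2 ∘ k2.1)]
    refine ⟨?_, h1.elim .inl (.inr ∘ .inl)⟩; grind [h.root.fac, h.tooth.fac]
  · by_cases h2 : ∃ i, 1 ≤ i ∧ i < n ∧ W = {g .b', g (.c i), g (.c (i + 1))}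
    · right; rw [if_neg (h1 ∘ k1.1), if_pos (k2.2 h2)]; refine ⟨?_, .inr (.inr h2)⟩
      grind [h.fil.fac']
    · left; rw [if_neg (h1 ∘ k1.1), if_neg (h2 ∘ k2.1)]; refine ⟨rfl, ?_⟩; rintro (h3 | h3 | h3)
      all_goals grind

lemma α_mem (h : Host C n g Fr) (hY : Y ∈ C.face 3) :
    g (.α i) ∈ ext₃ n g Y ↔ (1 ≤ i ∧ i < n ∧ topTri g i ⊆ Y) ∨
      (2 ≤ i ∧ i < n ∧ topTri g (i - 1) ⊆ Y) := by
  rw [h.mem_ext₃, or_iff_right (fun h1 => h.sub₃ Y hY _ h1 (h.frα i))]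
  constructor
  · rintro ⟨j, h1, h2, h3, h4⟩; simp only [h.inj.eq_iff, Sym.α.injEq, reduceCtorEq, false_or] at h4
    grind
  grind

lemma β_mem (h : Host C n g Fr) (hY : Y ∈ C.face 3) :
    g (.β i) ∈ ext₃ n g Y ↔ 1 ≤ i ∧ i + 1 < n ∧ topTri g i ⊆ Y := by
  rw [h.mem_ext₃, or_iff_right (fun h1 => h.sub₃ Y hY _ h1 (h.frβ i))]
  constructor
  · rintro ⟨j, h1, h2, h3, h4⟩
    simp only [h.inj.eq_iff, Sym.β.injEq, reduceCtorEq, false_or, or_false] at h4; grind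
  grind

lemma filter_top (h : Host C n g Fr) (h1 : 1 ≤ i) (h2 : i < n)
    (hS : ∀ Y ∈ C.face 3, S ⊆ ext₃ n g Y ↔ topTri g i ⊆ Y) :
    ((C.face 3).filter fun Y => S ⊆ ext₃ n g Y).card = 1 := by
  rw [filter_congr hS]
  exact h.fil.fac i h1 h2

lemma not_subset_old (h : Host C n g Fr) (hS : ∃ x ∈ S, x ∈ Fr) :
    ¬ S ⊆ {g .o, g .a, g .b', g (.c n)} ∧ ¬ S ⊆ fanFacet n g := by
  grind [mem_fanFacet, h.fro, h.fra, h.frb', h.frc]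

lemma nfac_of_top (h : Host C n g Fr) (hN : Cap N n g Fr ε th)
    (h1 : 1 ≤ i) (h2 : i < n) (hF : ∃ x ∈ S, x ∈ Fr)
    (hS : ∀ Y ∈ C.face 3, S ⊆ ext₃ n g Y ↔ topTri g i ⊆ Y) :
    (rounded C n g N).nfac S = 1 + N.nfac S := by
  obtain ⟨h3, h4⟩ := h.not_subset_old hF
  rw [h.nfac_rounded hN, h.filter_top h1 h2 hS, if_neg h3, if_neg h4]

lemma seam_top (h : Host C n g Fr) (h1 : 1 ≤ i) (h2 : i + 1 < n)
    (hS : S = {g .b, g (.α (i + 1)), g (.α i)} ∨ S = {g (.α (i + 1)), g (.β i), g (.α i)}) :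
    ∀ Y ∈ C.face 3, S ⊆ ext₃ n g Y ↔ topTri g i ⊆ Y := by
  intro Y hY
  constructor
  · intro h3; have h4 : g (.α i) ∈ ext₃ n g Y := h3 (by grind)
    have h5 : g (.α (i + 1)) ∈ ext₃ n g Y := h3 (by grind)
    rw [h.α_mem hY] at h4 h5; rcases h4 with ⟨-, -, h4⟩ | ⟨h6, -, h4⟩
    · exact h4
    · rcases h5 with ⟨-, -, h5⟩ | ⟨-, -, h5⟩
      · have := h.top_unique (by omega) (by omega) (by omega) (by omega) hY h4 h5; omega
      · grind
  · intro h3; have hb := (h.trace₃ (Z := Y) h.frb).2 (h3 (by simp [topTri]))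
    grind [h.α_mem, h.β_mem]

lemma nfac_cap (h : Host C n g Fr) (hN : Cap N n g Fr ε th)
    (hZ : Z ∈ N.face 2) [Decidable (IsSeam n g th Z)] : (rounded C n g N).nfac Z =
      N.nfac Z + if IsSeam n g th Z then 1 else 0 := by
  have hcard := hN.card₂ Z hZ
  have hfr : ∃ x ∈ Z, x ∈ Fr := by
    obtain ⟨x, hx, hne⟩ := exists_mem_ne (by omega) (g .b) (s := Z); grind [hN.sub₂]
  split_ifs with hs
  · obtain ⟨i, h1, h2, h3⟩ := hs; grind [add_comm, h.nfac_of_top, h.seam_top]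
  · obtain ⟨h3, h4⟩ := h.not_subset_old hfr; rw [h.nfac_rounded hN, if_neg h3, if_neg h4]
    suffices ((C.face 3).filter fun Y => Z ⊆ ext₃ n g Y).card = 0 by omega
    rw [card_eq_zero, filter_eq_empty_iff]; intro Y hY hZY; obtain ⟨x, hx, hxF⟩ := hfr
    have hx' := hZY hx; rw [h.mem_ext₃, or_iff_right (fun h1 => h.sub₃ Y hY _ h1 hxF)] at hx'
    obtain ⟨i, h1, h2, ht, -⟩ := hx'; have hall : ∀ y ∈ Z, y = g .b ∨ y = g (.α i) ∨
        i + 1 < n ∧ (y = g (.β i) ∨ y = g (.α (i + 1))) := by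
      intro y hy; rcases hN.sub₂ Z hZ y hy with h5 | h5
      · exact .inl h5
      · have := hZY hy; rw [h.mem_ext₃, or_iff_right (fun h1 => h.sub₃ Y hY _ h1 h5)] at this
        grind [h.top_unique]
    by_cases h5 : i + 1 < n
    · apply hs; refine ⟨i, h1, h5, hN.small i h1 h5 Z hZ ?_⟩; grind
    · have : Z ⊆ {g .b, g (.α i)} := by grind
      have := (card_le_card this).trans card_le_two; omega

lemma nfac_hubTris (h : Host C n g Fr) (hN : Cap N n g Fr ε th)
    (hZ : Z ∈ hubTris n g) : (rounded C n g N).nfac Z = 1 := by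
  have := h.two
  have hnb : ∃ x ∈ Z, x ≠ g .b ∧ x ∉ Fr := by grind [mem_hubTris, h.inj, h.fro]
  rw [h.nfac_rounded hN, h.nfac_seam_zero hN hnb]
  have hz : ((C.face 3).filter fun Y => Z ⊆ ext₃ n g Y).card = 0 := by
    rw [card_eq_zero, filter_eq_empty_iff]; intro Y hY hZY; rw [mem_hubTris] at hZ
    rcases hZ with rfl | rfl | ⟨i, h1, h2, rfl⟩ <;>
      simp only [insert_subset_iff, singleton_subset_iff, h.trace₃ h.fro,
        h.trace₃ h.frb', h.trace₃ (h.frc _)] at hZY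
    · exact h.apb.e3 Y hY (by grind)
    · exact h.apb.e3 Y hY (by grind)
    · exact (h.apc i h1 h2).e3 Y hY (by grind)
  rw [hz]
  rw [mem_hubTris] at hZ
  rcases hZ with rfl | rfl | ⟨i, h1, h2, rfl⟩
  · rw [if_pos (by grind), if_neg]; intro h1; have := h1 (show g .a ∈ _ by simp)
    grind [mem_fanFacet, h.inj]
  · rw [if_neg, if_pos]
    · grind [mem_fanFacet, le_rfl]
    · intro h1; have := h1 (show g (.c 1) ∈ _ by simp); simp [h.inj.eq_iff] at this; omega
  · rw [if_neg, if_pos]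
    · grind [mem_fanFacet]
    · intro h3; have := h3 (show g (.c i) ∈ _ by simp); simp [h.inj.eq_iff] at this; omega

lemma nfac_mixTris (h : Host C n g Fr) (hN : Cap N n g Fr ε th)
    (hZ : Z ∈ mixTris n g th) : (rounded C n g N).nfac Z = 1 := by
  have hn := h.two
  have mc : ∀ {Y : Finset Vertex} (j : ℕ), g (.c j) ∈ ext₃ n g Y ↔ g (.c j) ∈ Y :=
    fun j => h.trace₃ (h.frc j)
  have mb : ∀ {Y : Finset Vertex}, g .b ∈ ext₃ n g Y ↔ g .b ∈ Y := h.trace₃ h.frb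
  have hcc : ∀ j, g (.c j) ≠ g .b := fun j => h.inj.ne (by simp)
  have key : ∃ i, 1 ≤ i ∧ i < n ∧ (∃ x ∈ Z, x ∈ Fr) ∧ N.nfac Z = 0 ∧
      ∀ Y ∈ C.face 3, Z ⊆ ext₃ n g Y ↔ topTri g i ⊆ Y := by
    rw [mem_mixTris] at hZ
    rcases hZ with ⟨i, h1, h2, rfl⟩ | ⟨i, h1, h2, rfl⟩ | ⟨i, h1, h2, rfl⟩ | rfl | rfl |
      ⟨i, h1, h2, ht, rfl⟩
    · refine ⟨i, h1, by omega, ⟨g (.β i), by simp, h.frβ _⟩,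
        h.nfac_seam_zero hN ⟨g (.c (i + 1)), by simp, hcc _, h.frc _⟩, fun Y hY => ?_⟩
      grind [insert_subset_iff, topTri, h.β_mem, h.α_mem]
    · refine ⟨i, h1, by omega, ⟨g (.β i), by simp, h.frβ _⟩,
        h.nfac_seam_zero hN ⟨g (.c (i + 1)), by simp, hcc _, h.frc _⟩, fun Y hY => ?_⟩
      grind [insert_subset_iff, topTri, h.β_mem]
    · refine ⟨i, h1, by omega, ⟨g (.β i), by simp, h.frβ _⟩,
        h.nfac_seam_zero hN ⟨g (.c i), by simp, hcc _, h.frc _⟩, fun Y hY => ?_⟩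
      grind [insert_subset_iff, topTri, h.β_mem, h.α_mem]
    · refine ⟨n - 1, by omega, by omega, ⟨g (.α (n - 1)), by simp, h.frα _⟩,
        h.nfac_seam_zero hN ⟨g (.c n), by simp, hcc _, h.frc _⟩, fun Y hY => ?_⟩
      grind [insert_subset_iff, le_rfl, topTri, h.α_mem]
    · refine ⟨n - 1, by omega, by omega, ⟨g (.α (n - 1)), by simp, h.frα _⟩,
        h.nfac_seam_zero hN ⟨g (.c n), by simp, hcc _, h.frc _⟩, fun Y hY => ?_⟩
      grind [insert_subset_iff, le_rfl, topTri, h.α_mem]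
    · refine ⟨i, h1, by omega, ⟨g (.β i), by simp, h.frβ _⟩, ?_, h.seam_top h1 h2 (.inr rfl)⟩
      rw [Cx.nfac, card_eq_zero, filter_eq_empty_iff]; intro Y hY hs
      exact hN.no₃ i h1 h2 ht Y hY (hs (by simp))
  obtain ⟨i, h1, h2, h3, h4, h5⟩ := key
  rw [h.nfac_of_top hN h1 h2 h3 h5, h4]

lemma nfac_inner (h : Host C n g Fr) (hN : Cap N n g Fr ε th) :
    (rounded C n g N).nfac {g .o, g .b', g (.c n)} = 2 := by
  have := h.two
  rw [h.nfac_rounded hN, h.nfac_seam_zero hN ⟨g .o, by simp, by grind [h.inj], h.fro⟩]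
  have hz : ((C.face 3).filter fun Y => {g .o, g .b', g (.c n)} ⊆ ext₃ n g Y).card = 0 := by
    rw [card_eq_zero, filter_eq_empty_iff]; intro Y hY hZY
    simp only [insert_subset_iff, h.trace₃ h.fro, h.trace₃ h.frb'] at hZY
    exact h.apb.e3 Y hY (by grind)
  rw [hz, if_pos (by grind), if_pos]
  grind [mem_fanFacet, le_rfl]

/-- The free ridges after a round. -/
lemma free_iff (h : Host C n g Fr) (hN : Cap N n g Fr ε th) :
    Z ∈ (rounded C n g N).face 2 ∧ (rounded C n g N).nfac Z = 1 ↔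
      (∃ W ∈ C.face 2, (C.nfac W = 1 ∧ W ∉ delTris n g ∧ ¬ IsGlue n g W) ∧ ext₂ C n g W = Z) ∨
      Z ∈ hubTris n g ∨ Z ∈ outerRidges N (IsSeam n g th) ∨ Z ∈ mixTris n g th := by
  classical
  grind [outerRidges, h.rounded_two, h.nfac_ext₂, h.nfac_inner, h.nfac_cap, h.nfac_hubTris,
    h.nfac_mixTris]

end Host


/-- The boundary edges that become interior edges in the first two steps of a round. -/
def lostEdges (n : ℕ) (g : Sym → Vertex) : Finset (Finset Vertex) :=
  insert {g .a, g (.c n)} ((Ico 2 (n + 1)).image fun i => {g .b', g (.c i)})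

lemma mem_lostEdges {n : ℕ} {g : Sym → Vertex} : Z ∈ lostEdges n g ↔
    Z = {g .a, g (.c n)} ∨ ∃ i, 2 ≤ i ∧ i ≤ n ∧ Z = {g .b', g (.c i)} := by
  simp only [lostEdges, mem_insert, mem_image, mem_Ico, and_assoc, eq_comm, Nat.lt_succ_iff]

/-- A set contained in a free ridge. -/
def Cx.OnBd {V : Type} [DecidableEq V] (C : Cx V) (S : Finset V) : Prop :=
  ∃ T ∈ C.face 2, C.nfac T = 1 ∧ S ⊆ T

namespace Host

variable {C N : Cx Vertex} {n : ℕ} {g : Sym → Vertex} {Fr : Set Vertex} {ε : ℕ} {th : ℕ → Prop}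

lemma pair_sub {V : Type} [DecidableEq V] {e : Finset V} {x y z : V} (he : e.card = 2)
    (hs : e ⊆ {x, y, z}) : e = {x, y} ∨ e = {x, z} ∨ e = {y, z} := by
  obtain ⟨u, v, huv, rfl⟩ := card_eq_two.1 he
  simp only [insert_subset_iff, singleton_subset_iff, mem_insert, mem_singleton] at hs
  grind

/-- A ridge is extended by at most one vertex. -/
lemma isZ_unique (h : Host C n g Fr) (h1 : 1 ≤ i) (h2 : i < n)
    (h3 : 1 ≤ j) (h4 : j < n) (hi : (roundOf n g).IsZ C i W) (hj : (roundOf n g).IsZ C j W) :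
    i = j := by grind [isZ_simple, h.c_mem_top]

lemma isZ_c (h : Host C n g Fr) (h1 : 1 ≤ i) (h2 : i < n)
    (h3 : 1 ≤ j) (h4 : j ≤ n) (hi : (roundOf n g).IsZ C i W) (hj : g (.c j) ∈ W) : j = i := by
  obtain ⟨hW, hb, hci, ⟨Y, hY, ht, hWY⟩, hne⟩ := isZ_simple.1 hi
  have h5 := h.c_mem_top h1 h2 h3 h4 hY ht (hWY hj)
  rcases h5 with rfl | rfl
  · rfl
  · exfalso; apply hne; refine (h.anti _ (h.fil.tri i h1 h2) W hW ?_).symm; grind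

lemma fresh_ext₂ (h : Host C n g Fr) (hW : W ∈ C.face 2) (hx : x ∈ ext₂ C n g W) (hF : x ∈ Fr) :
    ∃ i, 1 ≤ i ∧ i < n ∧ (roundOf n g).IsZ C i W ∧ x = g (.α i) := by grind [h.mem_ext₂, h.sub₂]

lemma α_ext₂ (h : Host C n g Fr) (hW : W ∈ C.face 2)
    (hx : g (.α i) ∈ ext₂ C n g W) : 1 ≤ i ∧ i < n ∧ (roundOf n g).IsZ C i W := by
  grind [h.fresh_ext₂, h.frα, h.inj]

lemma β_ext₂ (h : Host C n g Fr) (hW : W ∈ C.face 2) :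
    g (.β i) ∉ ext₂ C n g W := by grind [h.fresh_ext₂, h.frβ, h.inj]

lemma fresh_ext₂_unique (h : Host C n g Fr) (hW : W ∈ C.face 2) (hx : x ∈ ext₂ C n g W) (hF : x ∈ Fr) (hy : y ∈ ext₂ C n g W) (hF' : y ∈ Fr) :
    x = y := by grind [h.fresh_ext₂, h.isZ_unique]

lemma not_glue_of_b (h : Host C n g Fr) (hb : g .b ∈ Z) : ¬ IsGlue n g Z := by
  rintro (rfl | rfl | ⟨i, -, -, rfl⟩) <;> grind [h.inj]

lemma rounded_free (h : Host C n g Fr) (hN : Cap N n g Fr ε th)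
    (hZ : (∃ W ∈ C.face 2, (C.nfac W = 1 ∧ W ∉ delTris n g ∧ ¬ IsGlue n g W) ∧ ext₂ C n g W = Z) ∨
      Z ∈ hubTris n g ∨ Z ∈ outerRidges N (IsSeam n g th) ∨ Z ∈ mixTris n g th) (hS : S ⊆ Z) :
    (rounded C n g N).OnBd S :=
  ⟨Z, ((h.free_iff hN).2 hZ).1, ((h.free_iff hN).2 hZ).2, hS⟩

section Mix

lemma mix₁ (h1 : 1 ≤ i) (h2 : i + 1 < n) :
    {g (.α (i + 1)), g (.c (i + 1)), g (.β i)} ∈ mixTris n g th :=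
  mem_mixTris.2 (.inl ⟨i, h1, h2, rfl⟩)

lemma mix₂ (h1 : 1 ≤ i) (h2 : i + 1 < n) : {g (.c (i + 1)), g (.β i), g (.c i)} ∈ mixTris n g th :=
  mem_mixTris.2 (.inr (.inl ⟨i, h1, h2, rfl⟩))

lemma mix₃ (h1 : 1 ≤ i) (h2 : i + 1 < n) : {g (.β i), g (.α i), g (.c i)} ∈ mixTris n g th :=
  mem_mixTris.2 (.inr (.inr (.inl ⟨i, h1, h2, rfl⟩)))

lemma mix₄ : {g .b, g (.c n), g (.α (n - 1))} ∈ mixTris n g th :=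
  mem_mixTris.2 (.inr (.inr (.inr (.inl rfl))))

lemma mix₅ : {g (.c n), g (.α (n - 1)), g (.c (n - 1))} ∈ mixTris n g th :=
  mem_mixTris.2 (.inr (.inr (.inr (.inr (.inl rfl)))))

lemma mix₆ (h1 : 1 ≤ i) (h2 : i + 1 < n) (h3 : ¬ th i) :
    {g (.α (i + 1)), g (.β i), g (.α i)} ∈ mixTris n g th :=
  mem_mixTris.2 (.inr (.inr (.inr (.inr (.inr ⟨i, h1, h2, h3, rfl⟩)))))

end Mix

lemma mixEdge_onBd (h : Host C n g Fr) (hN : Cap N n g Fr ε th)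
    (he : e ∈ mixEdges n g th) : (rounded C n g N).OnBd e := by
  have := h.two
  have key : ∀ Z ∈ mixTris n g th, e ⊆ Z → (rounded C n g N).OnBd e := fun Z hZ =>
    h.rounded_free hN (.inr (.inr (.inr hZ)))
  rw [mem_mixEdges] at he
  rcases he with ⟨i, h1, h2, rfl⟩ | ⟨i, h1, h2, rfl⟩ | ⟨i, h1, h2, rfl⟩ | rfl |
    ⟨i, h1, h2, h3, rfl⟩ | ⟨i, h1, h2, h3, rfl⟩
  · by_cases h3 : i + 1 < n
    · exact key _ (mix₃ h1 h3) (by simp)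
    grind [mix₅]
  · grind [mix₂]
  · exact key _ (mix₂ h1 h2) (by simp)
  · grind [mix₅]
  · grind [mix₆]
  · exact key _ (mix₆ h1 h2 h3) (by simp)

/-- The boundary triangle at the start of a fillet contains the first vertex `α₁`. -/
lemma hubα_one_onBd (h : Host C n g Fr) (hN : Cap N n g Fr ε th) :
    (rounded C n g N).OnBd {g .b, g (.α 1)} := by
  have := h.two
  obtain ⟨Z, hZ, hbc, hne, hn⟩ := h.fil.start h.two
  simp only [insert_subset_iff, singleton_subset_iff] at hbc
  obtain ⟨Y, hY⟩ := card_eq_one.1 hn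
  have hY' : Y ∈ (C.face 3).filter fun Y => Z ⊆ Y := by rw [hY]; simp
  rw [mem_filter] at hY'
  have hc2 := (h.fil.near 1 le_rfl (by omega) Y hY'.1 (by grind)).resolve_left (by omega)
  have ht : topTri g 1 ⊆ Y := by grind [topTri, insert_subset_iff]
  refine h.rounded_free hN (Z := ext₂ C n g Z) (.inl ⟨Z, hZ, ⟨hn, ?_, h.not_glue_of_b hbc.1⟩, rfl⟩)
    ?_
  all_goals grind [mem_delTris, topTri, insert_subset_iff, subset_ext₂, le_rfl, isZ_simple,
              h.inj, h.mem_ext₂]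

lemma rim_onBd (h : Host C n g Fr) (hN : Cap N n g Fr ε th)
    (he : IsRim n g th e) : (rounded C n g N).OnBd e := by
  have key : ∀ Z ∈ mixTris n g th, e ⊆ Z → (rounded C n g N).OnBd e := fun Z hZ =>
    h.rounded_free hN (.inr (.inr (.inr hZ)))
  rcases he with rfl | rfl | ⟨i, h1, h2, ⟨h3, rfl | rfl⟩ | ⟨h3, rfl⟩⟩
  all_goals grind [mix₄, mix₁, mix₃, mix₆, h.hubα_one_onBd]

/-- The boundary edges after a round. -/
lemma bdEdge_iff (h : Host C n g Fr) (hN : Cap N n g Fr ε th) :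
    e ∈ (rounded C n g N).face 1 ∧ (rounded C n g N).OnBd e ↔
      (e ∈ C.face 1 ∧ C.OnBd e) ∧ e ∉ delEdges n g ∧ e ∉ lostEdges n g ∨ e ∈ hubEdges n g ∨
      e ∈ outerEdges N (IsSeam n g th) (IsRim n g th) ∨ e ∈ mixEdges n g th := by
  have hn2 := h.two
  constructor
  · rintro ⟨he, Z, hZ, hn, heZ⟩; have hZ := (h.free_iff hN).1 ⟨hZ, hn⟩
    rcases (h.rounded_one hN).1 he with ⟨he, hd⟩ | he | he | he
    any_goals grind
    · left; have hcard := h.card₁ e he; have hold := h.sub₁ e he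
      have hap : ∀ x, Apart C (g .o) x → e ≠ {g .o, x} := by
        rintro x hx rfl; exact hx.e1 _ he subset_rfl
      have hapc : ∀ i, 1 ≤ i → i < n → e ≠ {g .o, g (.c i)} := fun i h1 h2 => hap _ (h.apc i h1 h2)
      have side : ∀ i, 1 ≤ i → i < n → e = {g (.c i), g (.c (i + 1))} →
          (e ∈ C.face 1 ∧ C.OnBd e) ∧ e ∉ delEdges n g ∧ e ∉ lostEdges n g := by
        rintro i h1 h2 rfl; refine ⟨⟨he, _, h.fil.tri i h1 h2, h.fil.fac i h1 h2, by simp⟩, hd, ?_⟩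
        rw [mem_lostEdges]; simp [pair_eq_iff, h.inj.eq_iff]
      have hocn : e = {g .o, g (.c n)} →
          (e ∈ C.face 1 ∧ C.OnBd e) ∧ e ∉ delEdges n g ∧ e ∉ lostEdges n g := by
        rintro rfl; refine ⟨⟨he, _, h.root.tri, h.root.fac, by grind⟩, hd, ?_⟩
        rw [mem_lostEdges]; simp [pair_eq_iff, h.inj.eq_iff]
      have fresh : ∀ x y z : Vertex, x ∈ Fr → y ∈ Fr → e ⊆ {x, y, z} → False := by
        intro x y z hx hy hs; rcases pair_sub hcard hs with rfl | rfl | rfl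
        all_goals grind
      have fresh1 : ∀ x y z : Vertex, y ∈ Fr → e ⊆ {x, y, z} → e = {x, z} := by
        intro x y z hy hs; rcases pair_sub hcard hs with rfl | rfl | rfl
        all_goals grind
      rcases hZ with ⟨W, hW, ⟨hW1, hW2, hW3⟩, rfl⟩ | hZ | hZ | hZ
      · have heW : e ⊆ W := fun x hx => (h.trace₂ (hold x hx)).1 (heZ hx)
        refine ⟨⟨he, W, hW, hW1, heW⟩, hd, ?_⟩; rw [mem_lostEdges]; rintro (rfl | ⟨i, h1, h2, rfl⟩)
        · rcases h.tooth.free W hW heW hW1 with rfl | rfl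
          · exact hW3 (.inl rfl)
          · exact hW3 (.inr (.inl rfl))
        · rcases h.fil.free' i h1 h2 W hW heW hW1 with rfl | rfl
          · refine hW3 (.inr (.inr ⟨i - 1, by omega, by omega, ?_⟩))
            rw [show i - 1 + 1 = i by omega]
          · split_ifs at hW3 with h3
            · exact hW3 (.inr (.inr ⟨i, by omega, h3, rfl⟩))
            · obtain rfl : i = n := by omega
              refine hW3 (.inr (.inl ?_)); ext x; simp; tauto
      · rw [mem_hubTris] at hZ; rcases hZ with rfl | rfl | ⟨i, h1, h2, rfl⟩
        · rcases pair_sub hcard heZ with rfl | rfl | rfl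
          · refine ⟨⟨he, _, h.root.tri, h.root.fac, by grind⟩, hd, ?_⟩
            rw [mem_lostEdges]; simp [pair_eq_iff, h.inj.eq_iff]
          · grind [h.apb]
          · refine ⟨⟨he, _, h.tooth.tri, h.tooth.fac, by grind⟩, hd, ?_⟩
            rw [mem_lostEdges]; simp [pair_eq_iff, h.inj.eq_iff]
        · rcases pair_sub hcard heZ with rfl | rfl | rfl
          · grind [h.apb]
          · grind
          · refine ⟨⟨he, _, h.fil.tri' 1 le_rfl (by omega), h.fil.fac' 1 le_rfl (by omega),
              by grind⟩, hd, ?_⟩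
            rw [mem_lostEdges]; simp [pair_eq_iff, h.inj.eq_iff]
        · rcases pair_sub hcard heZ with h3 | h3 | h3
          all_goals grind
      · exfalso; simp only [outerRidges, mem_filter] at hZ
        exact h.not_subset_seam (h.exists_ne_hub (by omega) hold) (hN.sub₂ Z hZ.1) heZ
      · rw [mem_mixTris] at hZ
        rcases hZ with ⟨i, h1, h2, rfl⟩ | ⟨i, h1, h2, rfl⟩ | ⟨i, h1, h2, rfl⟩ | rfl | rfl |
          ⟨i, h1, h2, h3, rfl⟩
        · exact (fresh _ _ (g (.c (i + 1))) (h.frα (i + 1)) (h.frβ i)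
            (heZ.trans (by intro x; simp; tauto))).elim
        · grind [pair_comm, h.frβ]
        · grind [h.frβ, h.frα]
        · have h3 := fresh1 (g .b) (g (.α (n - 1))) (g (.c n)) (h.frα _) (heZ.trans (by grind))
          subst h3; refine ⟨⟨he, _, h.fil.tri (n - 1) (by omega) (by omega),
            h.fil.fac (n - 1) (by omega) (by omega), ?_⟩, hd, ?_⟩
          · grind
          · rw [mem_lostEdges]; simp [pair_eq_iff, h.inj.eq_iff]
        all_goals grind [pair_comm, h.frα, h.frβ]
    · refine .inr (.inr (.inl ?_)); have hcard := hN.card₁ e he; have hsub := hN.sub₁ e he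
      simp only [outerEdges, mem_filter]; refine ⟨he, ?_⟩; have hnc : ∀ i, g (.c i) ∉ e := by
        grind [h.inj, h.frc]
      have hnoc : ∀ x i z, e ⊆ {x, g (.c i), z} → e = {x, z} := by grind [pair_sub]
      rcases hZ with ⟨W, hW, ⟨hW1, hW2, hW3⟩, rfl⟩ | hZ | hZ | hZ
      · right; obtain ⟨x, hx, hxb⟩ := exists_mem_ne (by omega : 1 < e.card) (g .b)
        have hxF := (hsub x hx).resolve_left hxb
        obtain ⟨i, h1, h2, h3, rfl⟩ := h.fresh_ext₂ hW (heZ hx) hxF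
        obtain ⟨y, hy, hyx⟩ := exists_mem_ne (by omega : 1 < e.card) (g (.α i))
        have hyb : y = g .b := by grind [h.fresh_ext₂_unique]
        subst hyb; have he' : e = {g .b, g (.α i)} := by
          symm; apply eq_of_subset_of_card_le
          all_goals grind
        obtain ⟨-, hb, hc, -, hne⟩ := isZ_simple.1 h3; by_cases h4 : i = 1
        · subst h4; exact .inl he'
        · exfalso; rcases h.fil.free i (by omega) h2 W hW (by grind) hW1 with rfl | rfl
          · apply hW2; rw [mem_delTris]; exact ⟨i - 1, by omega, by omega, by grind [topTri]⟩
          · exact hne rfl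
      · exfalso; have hs : ∀ x ∈ e, x = g .b := by grind [mem_hubTris, h.fro, h.fra, h.frb', h.frc]
        obtain ⟨x, hx, hxb⟩ := exists_mem_ne (by omega : 1 < e.card) (g .b); exact hxb (hs x hx)
      · grind
      · right; rw [mem_mixTris] at hZ; have hβ : ∀ i, 1 ≤ i → i + 1 < n → g (.β i) ∈ e → th i := by
          grind [hN.no₁]
        rcases hZ with ⟨i, h1, h2, rfl⟩ | ⟨i, h1, h2, rfl⟩ | ⟨i, h1, h2, rfl⟩ | rfl | rfl |
          ⟨i, h1, h2, h3, rfl⟩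
        · have h3 := hnoc _ _ _ heZ
          exact .inr (.inr ⟨i, h1, h2, .inl ⟨hβ i h1 h2 (by simp [h3]), .inl h3⟩⟩)
        · grind
        · have h3 := hnoc (g (.β i)) _ (g (.α i)) (heZ.trans (by intro x; simp; tauto))
          exact .inr (.inr ⟨i, h1, h2, .inl ⟨hβ i h1 h2 (by simp [h3]), .inr h3⟩⟩)
        · exact .inr (.inl (hnoc _ _ _ heZ))
        · grind
        · rcases pair_sub hcard heZ with h4 | h4 | h4
          any_goals grind
          · exact .inr (.inr ⟨i, h1, h2, .inr ⟨h3, h4⟩⟩)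
  · rintro (⟨⟨he, W, hW, hW1, heW⟩, hd, hl⟩ | he | he | he)
    · refine ⟨(h.rounded_one hN).2 (.inl ⟨he, hd⟩), ?_⟩; have hcard := h.card₁ e he
      have hub : ∀ Z ∈ hubTris n g, e ⊆ Z → (rounded C n g N).OnBd e := fun Z hZ =>
        h.rounded_free hN (.inr (.inl hZ))
      rw [mem_lostEdges] at hl; by_cases hg : IsGlue n g W
      · rcases hg with rfl | rfl | ⟨i, h1, h2, rfl⟩
        · rcases pair_sub hcard heW with rfl | rfl | rfl
          · exact hub _ (mem_hubTris.2 (.inl rfl)) (by grind)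
          · refine hub _ (mem_hubTris.2 (.inr (.inr ⟨n - 1, by omega, by omega, rfl⟩))) ?_; grind
          · grind
        · rcases pair_sub hcard heW with rfl | rfl | rfl
          any_goals grind
          · exact hub _ (mem_hubTris.2 (.inl rfl)) (by grind)
        · rcases pair_sub hcard heW with rfl | rfl | rfl
          · by_cases h3 : i = 1
            · subst h3; exact hub _ (mem_hubTris.2 (.inr (.inl rfl))) (by grind)
            grind
          · grind
          · exact hub _ (mem_hubTris.2 (.inr (.inr ⟨i, h1, h2, rfl⟩))) (by grind)
      · by_cases hd' : W ∈ delTris n g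
        · obtain ⟨i, h1, h2, rfl⟩ := mem_delTris.1 hd'; rw [mem_delEdges] at hd
          rcases pair_sub hcard heW with rfl | rfl | rfl
          · grind
          · rcases (show i + 1 ≤ n by omega).lt_or_eq with h3 | rfl
            · grind
            · exact h.rounded_free hN (.inr (.inr (.inr mix₄))) (by grind)
          · rcases (show i + 1 ≤ n by omega).lt_or_eq with h3 | rfl
            · exact h.rounded_free hN (.inr (.inr (.inr (mix₂ h1 h3)))) (by grind)
            · exact h.rounded_free hN (.inr (.inr (.inr mix₅))) (by grind)
        · exact h.rounded_free hN (.inl ⟨W, hW, ⟨hW1, hd', hg⟩, rfl⟩) (heW.trans (subset_ext₂ W))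
    · refine ⟨(h.rounded_one hN).2 (.inr (.inl he)), ?_⟩; rw [mem_hubEdges] at he
      rcases he with rfl | ⟨i, h1, h2, rfl⟩
      · exact h.rounded_free hN (.inr (.inl (mem_hubTris.2 (.inl rfl)))) (by grind)
      · exact h.rounded_free hN (.inr (.inl (mem_hubTris.2 (.inr (.inr ⟨i, h1, h2, rfl⟩)))))
          (by grind)
    · simp only [outerEdges, mem_filter] at he
      refine ⟨(h.rounded_one hN).2 (.inr (.inr (.inl he.1))), ?_⟩
      rcases he.2 with ⟨T, hT, heT⟩ | hr
      · exact h.rounded_free hN (.inr (.inr (.inl hT))) heT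
      · exact h.rim_onBd hN hr
    grind [h.rounded_one, h.mixEdge_onBd]

end Host


section Counting

variable {n : ℕ} {g : Sym → Vertex} {th : ℕ → Prop}

lemma card_delEdges (hg : g.Injective) : (delEdges n g).card = n - 1 := by
  rw [delEdges, card_image_of_injective, Nat.card_Ico]
  intro i j hij
  grind [pair_eq_iff]

lemma card_hubEdges (hg : g.Injective) (hn : 2 ≤ n) : (hubEdges n g).card = n := by
  rw [hubEdges, card_insert_of_notMem, card_image_of_injective, Nat.card_Ico]
  · omega
  · intro i j hij; grind [pair_eq_iff]
  · grind [pair_eq_iff]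

lemma card_lostEdges (hg : g.Injective) (hn : 2 ≤ n) : (lostEdges n g).card = n := by
  rw [lostEdges, card_insert_of_notMem, card_image_of_injective, Nat.card_Ico]
  · omega
  · intro i j hij; grind [pair_eq_iff]
  · grind [pair_eq_iff]

lemma card_delTris (hg : g.Injective) : (delTris n g).card = n - 1 := by
  rw [delTris, card_image_of_injective, Nat.card_Ico]
  intro i j hij
  grind [topTri, triple_eq_iff]

lemma card_hubTris (hg : g.Injective) (hn : 2 ≤ n) : (hubTris n g).card = n + 1 := by
  rw [hubTris, card_insert_of_notMem, card_insert_of_notMem, card_image_of_injective, Nat.card_Ico]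
  · omega
  · intro i j hij; grind [triple_eq_iff]
  · grind [triple_eq_iff]
  · simp [triple_eq_iff, hg.eq_iff]

lemma card_mixEdges (hg : g.Injective) (hn : 2 ≤ n) :
    (mixEdges n g th).card + 4 = 3 * n + 2 * (gaps n th).card := by
  rw [mixEdges]
  repeat rw [card_union_of_disjoint]
  · rw [card_image_of_injective, card_image_of_injective,
      card_image_of_injective, card_image_of_injective,
      card_image_of_injective, Nat.card_Ico, Nat.card_Ico, card_singleton]
    · omega
    all_goals
      intro i j hij; grind [pair_eq_iff]
  all_goals
    rw [disjoint_left]; intro Z hZ hZ'; simp only [mem_union, mem_image, mem_singleton] at hZ hZ'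
    obtain ⟨i, -, rfl⟩ := hZ; simp [pair_eq_iff, hg.eq_iff] at hZ'
  omega

lemma card_mixTris (hg : g.Injective) (hn : 2 ≤ n) :
    (mixTris n g th).card + 4 = 3 * n + (gaps n th).card := by
  rw [mixTris]
  repeat rw [card_union_of_disjoint]
  · rw [card_image_of_injective, card_image_of_injective,
      card_image_of_injective, card_image_of_injective,
      Nat.card_Ico, card_singleton, card_singleton]
    · omega
    all_goals
      intro i j hij; grind [triple_eq_iff]
  all_goals
    rw [disjoint_left]; intro Z hZ hZ'; simp only [mem_union, mem_image, mem_singleton] at hZ hZ'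
    obtain ⟨i, -, rfl⟩ := hZ; simp [triple_eq_iff, hg.eq_iff] at hZ'

end Counting

/-- The boundary edges. -/
noncomputable def Cx.bdEdges (C : Cx Vertex) : Finset (Finset Vertex) :=
  open Classical in (C.face 1).filter fun e => C.OnBd e

/-- The free ridges. -/
def Cx.freeRidges (C : Cx Vertex) : Finset (Finset Vertex) :=
  (C.face 2).filter fun Z => C.nfac Z = 1

lemma Cx.bdEdges_subset (C : Cx Vertex) : C.bdEdges ⊆ C.face 1 := by grind [Cx.bdEdges]

lemma Cx.freeRidges_subset (C : Cx Vertex) : C.freeRidges ⊆ C.face 2 := filter_subset _ _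

lemma outerEdges_subset (N : Cx Vertex) (D E : Finset Vertex → Prop) :
    outerEdges N D E ⊆ N.face 1 := by grind [outerEdges]

lemma outerRidges_subset (N : Cx Vertex) (D : Finset Vertex → Prop) :
    outerRidges N D ⊆ N.face 2 := by grind [outerRidges, filter_subset]

namespace Host

variable {C N : Cx Vertex} {n : ℕ} {g : Sym → Vertex} {Fr : Set Vertex} {ε : ℕ} {th : ℕ → Prop}

lemma card_rounded_zero (h : Host C n g Fr) (hN : Cap N n g Fr ε th) :
    ((rounded C n g N).face 0).card + 1 = (C.face 0).card + (N.face 0).card + (gaps n th).card := by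
  have hF : (rounded C n g N).face 0 = C.face 0 ∪ ((N.face 0).erase {g .b} ∪
      (gaps n th).image fun i => {g (.β i)}) := by
    grind [mem_gaps, h.rounded_zero, h.vb, h.inj, hN.vβ]
  rw [hF, card_union_of_disjoint, card_union_of_disjoint,
    card_erase_of_mem hN.vb, card_image_of_injective]
  · grind [card_pos, hN.vb]
  · intro i j hij; simpa [h.inj.eq_iff] using hij
  · rw [disjoint_left]; intro Z hZ hZ'; simp only [mem_image, mem_gaps, mem_erase] at hZ hZ'
    obtain ⟨i, ⟨h1, h2, h3⟩, rfl⟩ := hZ'; exact hN.no₀ i h1 h2 h3 _ hZ.2 (by simp)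
  · rw [disjoint_left]; intro Z hZ hZ'; have hold := h.sub₀ Z hZ
    simp only [mem_union, mem_image, mem_erase] at hZ'; rcases hZ' with ⟨h1, h2⟩ | ⟨i, -, rfl⟩
    · obtain ⟨x, rfl⟩ := hN.zero Z h2; rcases hN.sub₀ _ h2 x (by simp) with h3 | h3
      all_goals grind
    · exact hold _ (by simp) (h.frβ i)

lemma delEdges_subset (h : Host C n g Fr) : delEdges n g ⊆ C.face 1 := by
  grind [mem_delEdges, h.fil.edge]

lemma delTris_subset (h : Host C n g Fr) : delTris n g ⊆ C.face 2 := by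
  intro Z hZ
  obtain ⟨i, h1, h2, rfl⟩ := mem_delTris.1 hZ
  exact h.fil.tri i h1 h2

lemma mixEdges_mixed (h : Host C n g Fr) (hZ : Z ∈ mixEdges n g th) :
    (∃ x ∈ Z, x ∈ Fr) ∧ ((∃ x ∈ Z, x ≠ g .b ∧ x ∉ Fr) ∨
      ∃ i, 1 ≤ i ∧ i + 1 < n ∧ ¬ th i ∧ g (.β i) ∈ Z) := by
  have hc : ∀ i, g (.c i) ≠ g .b ∧ g (.c i) ∉ Fr := fun i => ⟨h.inj.ne (by simp), h.frc i⟩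
  rw [mem_mixEdges] at hZ
  rcases hZ with ⟨i, h1, h2, rfl⟩ | ⟨i, h1, h2, rfl⟩ | ⟨i, h1, h2, rfl⟩ | rfl |
    ⟨i, h1, h2, h3, rfl⟩ | ⟨i, h1, h2, h3, rfl⟩
  · exact ⟨⟨_, by simp, h.frα i⟩, .inl ⟨_, by simp, hc i⟩⟩
  · exact ⟨⟨_, by simp, h.frβ i⟩, .inl ⟨_, by simp, hc (i + 1)⟩⟩
  · exact ⟨⟨_, by simp, h.frβ i⟩, .inl ⟨_, by simp, hc i⟩⟩
  · exact ⟨⟨_, by simp, h.frα (n - 1)⟩, .inl ⟨_, by simp, hc n⟩⟩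
  · exact ⟨⟨_, by simp, h.frα (i + 1)⟩, .inr ⟨i, h1, h2, h3, by simp⟩⟩
  · exact ⟨⟨_, by simp, h.frα i⟩, .inr ⟨i, h1, h2, h3, by simp⟩⟩

lemma mixTris_mixed (h : Host C n g Fr) (hZ : Z ∈ mixTris n g th) :
    (∃ x ∈ Z, x ∈ Fr) ∧ ((∃ x ∈ Z, x ≠ g .b ∧ x ∉ Fr) ∨
      ∃ i, 1 ≤ i ∧ i + 1 < n ∧ ¬ th i ∧ g (.β i) ∈ Z) ∧ Z.card = 3 := by
  have hc : ∀ i, g (.c i) ≠ g .b ∧ g (.c i) ∉ Fr := fun i => ⟨h.inj.ne (by simp), h.frc i⟩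
  rw [mem_mixTris] at hZ
  rcases hZ with ⟨i, h1, h2, rfl⟩ | ⟨i, h1, h2, rfl⟩ | ⟨i, h1, h2, rfl⟩ | rfl | rfl |
    ⟨i, h1, h2, h3, rfl⟩
  · exact ⟨⟨_, by simp, h.frβ i⟩, .inl ⟨_, by simp, hc (i + 1)⟩,
      card_triple (by grind [h.inj]) (by grind [h.inj]) (by grind [h.inj])⟩
  · exact ⟨⟨_, by simp, h.frβ i⟩, .inl ⟨_, by simp, hc i⟩,
      card_triple (by grind [h.inj]) (by grind [h.inj]) (by grind [h.inj])⟩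
  · exact ⟨⟨_, by simp, h.frβ i⟩, .inl ⟨_, by simp, hc i⟩,
      card_triple (by grind [h.inj]) (by grind [h.inj]) (by grind [h.inj])⟩
  · exact ⟨⟨_, by simp, h.frα (n - 1)⟩, .inl ⟨_, by simp, hc n⟩,
      card_triple (by grind) (by grind [h.inj]) (by grind [h.inj])⟩
  · exact ⟨⟨_, by simp, h.frα (n - 1)⟩, .inl ⟨_, by simp, hc n⟩,
      card_triple (by grind [h.inj]) (by grind [h.inj, h.two]) (by grind [h.inj])⟩
  · exact ⟨⟨_, by simp, h.frβ i⟩, .inr ⟨i, h1, h2, h3, by simp⟩,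
      card_triple (by grind [h.inj]) (by grind [h.inj]) (by grind [h.inj])⟩

lemma hubEdges_old (h : Host C n g Fr) (hZ : Z ∈ hubEdges n g) :
    g .o ∈ Z ∧ (∀ x ∈ Z, x ∉ Fr) ∧ Z ∉ C.face 1 := by
  rw [mem_hubEdges] at hZ
  rcases hZ with rfl | ⟨i, h1, h2, rfl⟩
  · exact ⟨by simp, by simp [h.fro, h.frb'], fun h1 => h.apb.e1 _ h1 subset_rfl⟩
  · exact ⟨by simp, by simp [h.fro, h.frc], fun h3 => (h.apc i h1 h2).e1 _ h3 subset_rfl⟩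

lemma hubTris_old (h : Host C n g Fr) (hZ : Z ∈ hubTris n g) :
    g .o ∈ Z ∧ (∀ x ∈ Z, x ∉ Fr) ∧ (∀ W ∈ C.face 2, ¬ Z ⊆ W) ∧ Z.card = 3 := by
  have := h.two
  rw [mem_hubTris] at hZ
  rcases hZ with rfl | rfl | ⟨i, h1, h2, rfl⟩
  · exact ⟨by simp, by simp [h.fro, h.frb', h.fra], fun W hW hs => h.apb.e2 W hW
      (subset_trans (by grind) hs),
      card_triple (by grind [h.inj]) (by grind [h.inj]) (by grind [h.inj])⟩
  · exact ⟨by simp, by simp [h.fro, h.frb', h.frc], fun W hW hs => h.apb.e2 W hW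
      (subset_trans (by grind) hs),
      card_triple (by grind [h.inj]) (by grind [h.inj]) (by grind [h.inj])⟩
  · exact ⟨by simp, by simp [h.fro, h.frc], fun W hW hs => (h.apc i h1 h2).e2 W hW
      (subset_trans (by grind) hs),
      card_triple (by grind [h.inj]) (by grind [h.inj]) (by grind [h.inj])⟩

lemma not_cap (_ : Host C n g Fr) (hs : ∀ x ∈ Z, x = g .b ∨ x ∈ Fr)
    (hno : ∀ i, 1 ≤ i → i + 1 < n → ¬ th i → g (.β i) ∉ Z)
    (hm : (∃ x ∈ Z, x ≠ g .b ∧ x ∉ Fr) ∨ ∃ i, 1 ≤ i ∧ i + 1 < n ∧ ¬ th i ∧ g (.β i) ∈ Z) :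
    False := by grind

/-- Edges of the four kinds that make up the complex after a round are different. -/
lemma card_edges (h : Host C n g Fr) (hN : Cap N n g Fr ε th) {A B : Finset (Finset Vertex)}
    (hA : A ⊆ C.face 1) (hB : B ⊆ N.face 1) :
    (A ∪ (hubEdges n g ∪ (B ∪ mixEdges n g th))).card + 4 =
      A.card + B.card + 4 * n + 2 * (gaps n th).card := by
  have hm := card_mixEdges (th := th) h.inj h.two
  rw [card_union_of_disjoint, card_union_of_disjoint, card_union_of_disjoint,
    card_hubEdges h.inj h.two]
  · omega
  · rw [disjoint_left]; intro Z hZ hZ'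
    exact h.not_cap (hN.sub₁ Z (hB hZ)) (fun i h1 h2 h3 => hN.no₁ i h1 h2 h3 Z (hB hZ))
      (h.mixEdges_mixed hZ').2
  · grind [disjoint_left, h.hubEdges_old, hN.sub₁, h.inj, h.fro, h.mixEdges_mixed]
  · rw [disjoint_left]; intro Z hZ hZ'; have hold := h.sub₁ Z (hA hZ)
    have hc := h.card₁ Z (hA hZ); simp only [mem_union] at hZ'; rcases hZ' with h1 | h1 | h1
    · exact (h.hubEdges_old h1).2.2 (hA hZ)
    all_goals grind [subset_rfl, h.not_subset_seam, h.exists_ne_hub, hc.ge, hN.sub₁,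
      h.mixEdges_mixed]

lemma card_rounded_one (h : Host C n g Fr) (hN : Cap N n g Fr ε th) :
    ((rounded C n g N).face 1).card + 3 =
      (C.face 1).card + (N.face 1).card + 3 * n + 2 * (gaps n th).card := by
  have hF : (rounded C n g N).face 1 = (C.face 1 \ delEdges n g) ∪ (hubEdges n g ∪
      (N.face 1 ∪ mixEdges n g th)) := by grind [h.rounded_one]
  have h1 := h.card_edges hN (A := C.face 1 \ delEdges n g) sdiff_subset
    (subset_rfl : N.face 1 ⊆ N.face 1)
  rw [← hF, card_sdiff_of_subset h.delEdges_subset, card_delEdges h.inj] at h1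
  have h2 := card_le_card h.delEdges_subset
  grind [card_delEdges, h.inj, h.two]

lemma delEdges_onBd (h : Host C n g Fr) : delEdges n g ⊆ C.bdEdges := by
  intro Z hZ
  obtain ⟨i, h1, h2, rfl⟩ := mem_delEdges.1 hZ
  simp only [Cx.bdEdges, mem_filter]
  exact ⟨h.fil.edge i h1 h2.le, _, h.fil.tri i h1 h2, h.fil.fac i h1 h2, by grind⟩

lemma lostEdges_onBd (h : Host C n g Fr) : lostEdges n g ⊆ C.bdEdges := by
  have := h.two
  intro Z hZ
  simp only [Cx.bdEdges, mem_filter]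
  rcases mem_lostEdges.1 hZ with rfl | ⟨i, h1, h2, rfl⟩
  · exact ⟨h.root.xy, _, h.tooth.tri, h.tooth.fac, by grind⟩
  · refine ⟨h.fil.edge' i (by omega) h2, _, h.fil.tri' (i - 1) (by omega) (by omega),
      h.fil.fac' (i - 1) (by omega) (by omega), ?_⟩
    grind

lemma card_bdEdges (h : Host C n g Fr) (hN : Cap N n g Fr ε th) :
    (rounded C n g N).bdEdges.card + 3 = C.bdEdges.card +
      (outerEdges N (IsSeam n g th) (IsRim n g th)).card + 2 * n + 2 * (gaps n th).card := by
  have hF : (rounded C n g N).bdEdges = (C.bdEdges \ (delEdges n g ∪ lostEdges n g)) ∪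
      (hubEdges n g ∪ (outerEdges N (IsSeam n g th) (IsRim n g th) ∪ mixEdges n g th)) := by
    ext Z; simp only [Cx.bdEdges, mem_filter, mem_union, mem_sdiff, not_or]; exact h.bdEdge_iff hN
  have hsub := union_subset h.delEdges_onBd h.lostEdges_onBd
  have hdis : Disjoint (delEdges n g) (lostEdges n g) := by
    rw [disjoint_left]; grind [mem_delEdges, mem_lostEdges, pair_eq_iff, h.inj]
  have h1 := h.card_edges hN (A := C.bdEdges \ (delEdges n g ∪ lostEdges n g))
    (sdiff_subset.trans C.bdEdges_subset)
    (outerEdges_subset N (IsSeam n g th) (IsRim n g th))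
  rw [← hF, card_sdiff_of_subset hsub] at h1
  have h2 := card_le_card hsub
  grind [card_union_of_disjoint, card_delEdges, card_lostEdges, h.inj, h.two]

/-- Ridges of the four kinds that make up the complex after a round are different. -/
lemma card_ridges (h : Host C n g Fr) (hN : Cap N n g Fr ε th) {A B : Finset (Finset Vertex)}
    (hA : A ⊆ C.face 2) (hB : B ⊆ N.face 2) :
    (A.image (ext₂ C n g) ∪ (hubTris n g ∪ (B ∪ mixTris n g th))).card + 3 =
      A.card + B.card + 4 * n + (gaps n th).card ∧
    {g .o, g .b', g (.c n)} ∉ A.image (ext₂ C n g) ∪ (hubTris n g ∪ (B ∪ mixTris n g th)) := by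
  have hm := card_mixTris (th := th) h.inj h.two
  have hn := h.two
  constructor
  · rw [card_union_of_disjoint, card_union_of_disjoint, card_union_of_disjoint,
      card_hubTris h.inj h.two, card_image_of_injOn]
    · omega
    · intro Z hZ W hW he; grind [h.ext₂_inj, h.sub₂]
    · rw [disjoint_left]; intro Z hZ hZ'
      exact h.not_cap (hN.sub₂ Z (hB hZ)) (fun i h1 h2 h3 => hN.no₂ i h1 h2 h3 Z (hB hZ))
        (h.mixTris_mixed hZ').2.1
    · grind [disjoint_left, h.hubTris_old, hN.sub₂, h.inj, h.fro, h.mixTris_mixed]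
    · rw [disjoint_left]; intro Z hZ hZ'; obtain ⟨W, hW, rfl⟩ := mem_image.1 hZ
      have hW := hA hW; have hold := h.sub₂ W hW; have hc := h.card₂ W hW
      simp only [mem_union] at hZ'; rcases hZ' with h1 | h1 | h1
      · obtain ⟨-, h2, h3, -⟩ := h.hubTris_old h1; grind [h.trace₂]
      · exact h.not_subset_seam (h.exists_ne_hub (by omega) hold) (hN.sub₂ _ (hB h1))
          (subset_ext₂ W)
      · obtain ⟨⟨x, hx, hF⟩, -, h3⟩ := h.mixTris_mixed h1; have : W ⊂ ext₂ C n g W := by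
          grind [subset_ext₂]
        have := card_lt_card this; omega
  · simp only [mem_union, mem_image]; rintro (⟨W, hW, he⟩ | h1 | h1 | h1)
    · have h1 : g .o ∈ ext₂ C n g W := by rw [he]; simp
      have h2 : g .b' ∈ ext₂ C n g W := by rw [he]; simp
      rw [h.trace₂ h.fro] at h1; rw [h.trace₂ h.frb'] at h2; exact h.apb.e2 W (hA hW) (by grind)
    · rw [mem_hubTris] at h1; simp [triple_eq_iff, h.inj.eq_iff] at h1; omega
    · grind [hN.sub₂, h.inj, h.fro]
    · obtain ⟨⟨x, hx, hF⟩, -⟩ := h.mixTris_mixed h1; grind [h.fro, h.frb', h.frc]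

lemma card_rounded_two (h : Host C n g Fr) (hN : Cap N n g Fr ε th) :
    ((rounded C n g N).face 2).card + 1 =
      (C.face 2).card + (N.face 2).card + 3 * n + (gaps n th).card := by
  have hF : (rounded C n g N).face 2 = insert {g .o, g .b', g (.c n)}
      ((C.face 2 \ delTris n g).image (ext₂ C n g) ∪ (hubTris n g ∪
      (N.face 2 ∪ mixTris n g th))) := by
    ext Z; rw [h.rounded_two hN]; grind
  obtain ⟨h1, h0⟩ := h.card_ridges hN (A := C.face 2 \ delTris n g) sdiff_subset
    (subset_rfl : N.face 2 ⊆ N.face 2)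
  rw [hF, card_insert_of_notMem h0]
  rw [card_sdiff_of_subset h.delTris_subset, card_delTris h.inj] at h1
  have h2 := card_le_card h.delTris_subset
  grind [card_delTris, h.inj, h.two]

/-- The ridges that are free, but are not free or are not faces after the round. -/
def lostTris (n : ℕ) (g : Sym → Vertex) : Finset (Finset Vertex) :=
  delTris n g ∪ insert {g .o, g .a, g (.c n)} (insert {g .a, g .b', g (.c n)}
    ((Ico 1 n).image fun i => {g .b', g (.c i), g (.c (i + 1))}))

lemma mem_lostTris : Z ∈ lostTris n g ↔ Z ∈ delTris n g ∨ IsGlue n g Z := by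
  simp only [lostTris, IsGlue, mem_union, mem_insert, mem_image, mem_Ico, and_assoc, eq_comm]

lemma card_lostTris (h : Host C n g Fr) : (lostTris n g).card = 2 * n := by
  have := h.two
  rw [lostTris, card_union_of_disjoint, card_delTris h.inj, card_insert_of_notMem,
    card_insert_of_notMem, card_image_of_injective, Nat.card_Ico]
  · omega
  · intro i j hij; grind [triple_eq_iff, h.inj]
  · grind [triple_eq_iff, h.inj]
  · grind [triple_eq_iff, h.inj]
  · rw [disjoint_left]; intro Z hZ hZ'; obtain ⟨i, h1, h2, rfl⟩ := mem_delTris.1 hZ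
    simp [topTri, triple_eq_iff, h.inj.eq_iff] at hZ'

lemma lostTris_subset (h : Host C n g Fr) : lostTris n g ⊆ C.freeRidges := by
  intro Z hZ
  simp only [Cx.freeRidges, mem_filter]
  rcases mem_lostTris.1 hZ with hZ | rfl | rfl | ⟨i, h1, h2, rfl⟩
  · obtain ⟨i, h1, h2, rfl⟩ := mem_delTris.1 hZ; exact ⟨h.fil.tri i h1 h2, h.fil.fac i h1 h2⟩
  all_goals grind [h.root.tri, h.root.fac, h.tooth.tri, h.tooth.fac, h.fil.tri', h.fil.fac']

lemma card_freeRidges (h : Host C n g Fr) (hN : Cap N n g Fr ε th) :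
    (rounded C n g N).freeRidges.card + 3 = C.freeRidges.card +
      (outerRidges N (IsSeam n g th)).card + 2 * n + (gaps n th).card := by
  have hF : (rounded C n g N).freeRidges = (C.freeRidges \ lostTris n g).image (ext₂ C n g) ∪
      (hubTris n g ∪ (outerRidges N (IsSeam n g th) ∪ mixTris n g th)) := by
    ext Z; simp only [Cx.freeRidges, mem_filter, mem_union, mem_sdiff,
      mem_image, mem_lostTris, not_or]
    rw [h.free_iff hN]; simp only [and_assoc]
  obtain ⟨h1, -⟩ := h.card_ridges hN (A := C.freeRidges \ lostTris n g)
    (sdiff_subset.trans C.freeRidges_subset)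
    (outerRidges_subset N (IsSeam n g th))
  rw [← hF, card_sdiff_of_subset h.lostTris_subset, h.card_lostTris] at h1
  have h2 := card_le_card h.lostTris_subset
  rw [h.card_lostTris] at h2
  omega

lemma card_rounded_three (h : Host C n g Fr) (hN : Cap N n g Fr ε th) :
    ((rounded C n g N).face 3).card = (C.face 3).card + (N.face 3).card + 2 := by
  have h1 := h.nfac_rounded hN ∅
  simp [Cx.nfac] at h1
  omega

/-- No ridge contains another one after a round. -/
lemma rounded_anti (h : Host C n g Fr) (hN : Cap N n g Fr ε th) :
    ∀ Z ∈ (rounded C n g N).face 2, 3 ≤ Z.card ∧ ∀ W ∈ (rounded C n g N).face 2, Z ⊆ W → Z = W := by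
  have hn := h.two
  have hc : ∀ Z ∈ (rounded C n g N).face 2, 3 ≤ Z.card := by
    intro Z hZ; rcases (h.rounded_two hN).1 hZ with ⟨W, hW, -, rfl⟩ | rfl | hZ | hZ | hZ
    · exact (h.card₂ W hW).trans (card_le_card (subset_ext₂ W))
    · grind [card_triple, h.inj]
    · exact (h.hubTris_old hZ).2.2.2.ge
    · exact hN.card₂ Z hZ
    · grind [h.mixTris_mixed]
  intro Z hZ
  refine ⟨hc Z hZ, fun W hW hs => ?_⟩
  have hcz := hc Z hZ
  have three : W.card = 3 → Z = W := fun h3 => eq_of_subset_of_card_le hs (by omega)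
  rcases (h.rounded_two hN).1 hW with ⟨W, hW', -, rfl⟩ | rfl | hW | hW | hW
  · rcases (h.rounded_two hN).1 hZ with ⟨Z, hZ', -, rfl⟩ | rfl | hZ | hZ | hZ
    · grind [subset_ext₂, h.anti, h.trace₂, h.sub₂]
    · exfalso; simp only [insert_subset_iff, h.trace₂ h.fro, h.trace₂ h.frb'] at hs
      exact h.apb.e2 W hW' (by grind)
    · exfalso; obtain ⟨-, h2, h3, -⟩ := h.hubTris_old hZ; grind [h.trace₂]
    · exfalso; have h4 : 1 < (Z.erase (g .b)).card := by grind [pred_card_le_card_erase]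
      grind [one_lt_card, h.fresh_ext₂_unique, hN.sub₂]
    · exfalso; have hβ : ∀ i, g (.β i) ∉ Z := fun i hi => h.β_ext₂ hW' (hs hi)
      have hα : g (.α (n - 1)) ∈ Z → g (.c n) ∈ Z → False := by
        intro h1 h2; obtain ⟨h3, h4, h5⟩ := h.α_ext₂ hW' (hs h1)
        have := h.isZ_c h3 h4 (by omega) le_rfl h5 ((h.trace₂ (h.frc n)).1 (hs h2)); omega
      grind [mem_mixTris]
  · grind
  · exact three (h.hubTris_old hW).2.2.2
  · have hsub := hN.sub₂ W hW
    rcases (h.rounded_two hN).1 hZ with ⟨Z, hZ', -, rfl⟩ | rfl | hZ | hZ | hZ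
    · exact absurd ((subset_ext₂ Z).trans hs)
        (h.not_subset_seam (h.exists_ne_hub (by grind [h.card₂]) (h.sub₂ Z hZ')) hsub)
    · grind [h.not_subset_seam, h.inj, h.fro]
    · grind [h.not_subset_seam, h.hubTris_old, h.inj, h.fro]
    · grind [hN.anti]
    · exact (h.not_cap (fun x hx => hsub x (hs hx))
        (fun i h1 h2 h3 h4 => hN.no₂ i h1 h2 h3 W hW (hs h4)) (h.mixTris_mixed hZ).2.1).elim
  · grind [h.mixTris_mixed]

end Host


/-- The vertices of the faces that become interior at the hub in a round. -/
def hubSide (n : ℕ) (g : Sym → Vertex) : Set Vertex :=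
  {x | x = g .o ∨ x = g .a ∨ x = g .b' ∨ ∃ i, 1 ≤ i ∧ i ≤ n ∧ x = g (.c i)}

/-- The vertices of the host near the place where the complex is attached in a round. -/
def capSide (n : ℕ) (g : Sym → Vertex) : Set Vertex :=
  {x | x = g .b ∨ ∃ i, 1 ≤ i ∧ i ≤ n ∧ x = g (.c i)}

/-- A set of vertices that is not affected by a round. -/
def Away (n : ℕ) (g : Sym → Vertex) (S : Finset Vertex) : Prop :=
  (∃ x ∈ S, x ∉ hubSide n g) ∧ ∃ x ∈ S, x ∉ capSide n g

namespace Host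

variable {C N : Cx Vertex} {n : ℕ} {g : Sym → Vertex} {Fr : Set Vertex} {ε : ℕ} {th : ℕ → Prop}

lemma mixTris_old (_ : Host C n g Fr) (hZ : Z ∈ mixTris n g th) (hx : x ∈ Z) : x ∈ capSide n g ∨ x ∈ Fr := by
  have := ‹Host C n g Fr›
  have hn := this.two
  have hα := this.frα
  have hβ := this.frβ
  have hc : ∀ i, 1 ≤ i → i ≤ n → g (.c i) ∈ capSide n g := fun i h1 h2 => .inr ⟨i, h1, h2, rfl⟩
  have hb : g .b ∈ capSide n g := .inl rfl
  rw [mem_mixTris] at hZ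
  rcases hZ with ⟨i, h1, h2, rfl⟩ | ⟨i, h1, h2, rfl⟩ | ⟨i, h1, h2, rfl⟩ | rfl | rfl |
    ⟨i, h1, h2, h3, rfl⟩ <;>
  grind

lemma mixEdges_old (_ : Host C n g Fr) (hZ : Z ∈ mixEdges n g th) (hx : x ∈ Z) : x ∈ capSide n g ∨ x ∈ Fr := by
  have := ‹Host C n g Fr›
  have hn := this.two
  have hα := this.frα
  have hβ := this.frβ
  have hc : ∀ i, 1 ≤ i → i ≤ n → g (.c i) ∈ capSide n g := fun i h1 h2 => .inr ⟨i, h1, h2, rfl⟩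
  grind [mem_mixEdges]

lemma hubTris_hubSide (h : Host C n g Fr) (hZ : Z ∈ hubTris n g) (hx : x ∈ Z) : x ∈ hubSide n g := by grind [hubSide, mem_hubTris, h.two]

lemma hubEdges_hubSide (h : Host C n g Fr) (hZ : Z ∈ hubEdges n g) (hx : x ∈ Z) : x ∈ hubSide n g := by
  grind [hubSide, mem_hubEdges]

lemma delTris_capSide (h : Host C n g Fr) (hZ : Z ∈ delTris n g) (hx : x ∈ Z) : x ∈ capSide n g := by
  grind [capSide, mem_delTris, topTri]

/-- Faces away from the place of a round are preserved by the round. -/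
lemma sim (h : Host C n g Fr) (hN : Cap N n g Fr ε th) :
    Sim C (rounded C n g N) id Frᶜ {x | ∃ i, 1 ≤ i ∧ i < n ∧ x = g (.c i)} (Away n g)
      (ext₂ C n g) (ext₃ n g) := by
  have hcap : ∀ S : Finset Vertex, Away n g S → (∀ x ∈ S, x ∉ Fr) → ∀ Z : Finset Vertex,
      (∀ x ∈ Z, x ∈ capSide n g ∨ x ∈ Fr) → S ⊆ Z → False := by
    rintro S ⟨-, x, hx, h1⟩ hS Z hZ hs; exact (hZ x (hs hx)).elim h1 (hS x hx)
  have hhub : ∀ S : Finset Vertex, Away n g S → ∀ Z : Finset Vertex,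
      (∀ x ∈ Z, x ∈ hubSide n g) → S ⊆ Z → False := by
    rintro S ⟨⟨x, hx, h1⟩, -⟩ Z hZ hs; grind
  have hseam : ∀ Z : Finset Vertex, (∀ x ∈ Z, x = g .b ∨ x ∈ Fr) →
      ∀ x ∈ Z, x ∈ capSide n g ∨ x ∈ Fr := fun Z hZ x hx => (hZ x hx).imp_left .inl
  refine ⟨Set.injOn_id _, ?_, h.sub₂, h.sub₃, ?_, ?_, ?_, ?_, ?_, ?_, ?_, ?_, ?_, ?_, ?_⟩
  · rintro S S' hs ⟨⟨x, hx, h1⟩, y, hy, h2⟩; exact ⟨⟨x, hs hx, h1⟩, y, hs hy, h2⟩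
  · intro S hP hS Z hs hZ; rw [image_id] at hs
    rcases (h.rounded_one hN).1 hZ with ⟨hZ, -⟩ | hZ | hZ | hZ
    · grind [image_id, h.sub₁]
    · grind [h.hubEdges_hubSide]
    · exact (hcap S hP hS Z (hseam Z (hN.sub₁ Z hZ)) hs).elim
    · exact (hcap S hP hS Z (fun x => h.mixEdges_old hZ) hs).elim
  · intro S hP hS Z hs hZ; rw [image_id] at hs
    rcases (h.rounded_two hN).1 hZ with ⟨W, hW, -, rfl⟩ | rfl | hZ | hZ | hZ
    · grind
    · refine (hhub S hP _ (fun x hx => ?_) hs).elim; have := h.two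
      simp only [mem_insert, mem_singleton] at hx; rcases hx with rfl | rfl | rfl
      · exact .inl rfl
      · exact .inr (.inr (.inl rfl))
      · exact .inr (.inr (.inr ⟨n, by omega, le_rfl, rfl⟩))
    · grind [h.hubTris_hubSide]
    · exact (hcap S hP hS Z (hseam Z (hN.sub₂ Z hZ)) hs).elim
    · exact (hcap S hP hS Z (fun x => h.mixTris_old hZ) hs).elim
  · intro Z hZ hP; rw [h.rounded_two hN]; refine .inl ⟨Z, hZ, fun hd => ?_, rfl⟩
    exact hcap Z hP (h.sub₂ Z hZ) Z (fun x hx => .inl (h.delTris_capSide hd hx)) subset_rfl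
  · intro S hP hS Z hs hZ; rw [image_id] at hs
    have hc : ∀ i, 1 ≤ i → i ≤ n → g (.c i) ∈ hubSide n g :=
      fun i h1 h2 => .inr (.inr (.inr ⟨i, h1, h2, rfl⟩))
    have := h.two; rcases (h.rounded_three).1 hZ with ⟨W, hW, rfl⟩ | rfl | rfl | hZ
    · grind
    · refine (hhub S hP _ (fun x hx => ?_) hs).elim; simp only [mem_insert, mem_singleton] at hx
      rcases hx with rfl | rfl | rfl | rfl
      · exact .inl rfl
      · exact .inr (.inl rfl)
      · exact .inr (.inr (.inl rfl))
      · grind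
    · refine (hhub S hP _ (fun x hx => ?_) hs).elim
      rcases mem_fanFacet.1 hx with rfl | rfl | ⟨i, h1, h2, rfl⟩
      · exact .inl rfl
      · exact .inr (.inr (.inl rfl))
      · grind
    · exact (hcap S hP hS Z (hseam Z (hN.sub₃ Z hZ)) hs).elim
  · grind [h.rounded_three]
  · grind [h.trace₂]
  · grind [h.trace₃]
  · grind [h.incl]
  · grind [h.rounded_zero]
  · intro Z hZ _ hT; rw [image_id, h.rounded_one hN]; refine .inl ⟨hZ, fun hd => ?_⟩
    obtain ⟨i, h1, h2, rfl⟩ := mem_delEdges.1 hd; exact hT (g (.c i)) (by simp) ⟨i, h1, h2, rfl⟩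
  · intro Z hZ hT
    have he : ext₂ C n g Z = Z := h.ext₂_eq_self fun i h1 h2 _ h3 => hT _ h3 ⟨i, h1, h2, rfl⟩
    rw [image_id]; refine ⟨he, (h.rounded_two hN).2 (.inl ⟨Z, hZ, fun hd => ?_, he⟩)⟩
    obtain ⟨i, h1, h2, rfl⟩ := mem_delTris.1 hd
    exact hT (g (.c i)) (by simp [topTri]) ⟨i, h1, h2, rfl⟩

end Host


lemma FilletOK.congr {C : Cx Vertex} {a b b' : Vertex} {c d : ℕ → Vertex} {n : ℕ}
    (h : FilletOK C a b b' c n) (he : ∀ i, 1 ≤ i → i ≤ n → c i = d i) :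
    FilletOK C a b b' d n := by
  have e1 : ∀ i, 1 ≤ i → i < n → c i = d i := fun i h1 h2 => he i h1 h2.le
  have e2 : ∀ i, 1 ≤ i → i < n → c (i + 1) = d (i + 1) := fun i h1 h2 => he _ (by omega) h2
  have e3 : ∀ i, 2 ≤ i → i ≤ n → c (i - 1) = d (i - 1) := fun i h1 h2 => he _ (by omega) (by omega)
  constructor
  · grind [h.edge']
  · grind [h.edge]
  · grind [h.side]
  · grind [h.tri']
  · grind [h.fac']
  · grind [h.free']
  · grind [h.tri]
  · grind [h.fac]
  · intro i h1 h2 Y hY hs; rw [← e1 i h1 h2] at hs; rw [← e2 i h1 h2]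
    refine (h.near i h1 h2 Y hY hs).imp_left fun ⟨h3, h4⟩ => ⟨h3, ?_⟩
    rwa [← e3 i h3 h2.le]
  · grind [h.far]
  · grind [h.free]
  · grind [h.sideFree]
  · intro Z hZ hs; have : (Icc 1 n).image d = (Icc 1 n).image c :=
      image_congr fun i hi => (he i (mem_Icc.1 hi).1 (mem_Icc.1 hi).2).symm
    grind [h.only]
  · intro h1; rw [← he 1 le_rfl (by omega), ← he 2 (by omega) h1]; exact h.start h1

lemma FilletEnd.congr {C : Cx Vertex} {b : Vertex} {c d : ℕ → Vertex} {n : ℕ} (hn : 1 ≤ n)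
    (h : FilletEnd C b c n x) (he : ∀ i, 1 ≤ i → i ≤ n → c i = d i) : FilletEnd C b d n x := by
  constructor
  · intro Y hY hs; rw [← he n hn le_rfl] at hs; obtain ⟨h1, h2⟩ := h.near Y hY hs; grind
  grind [le_rfl, h.free]

namespace Host

variable {C N : Cx Vertex} {n : ℕ} {g : Sym → Vertex} {Fr : Set Vertex} {ε : ℕ} {th : ℕ → Prop}

lemma sub_pair : {x, y} ⊆ Z ↔ x ∈ Z ∧ y ∈ Z := by grind

lemma o_ext₂ (h : Host C n g Fr) (hW : W ∈ C.face 2)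
    (ho : g .o ∈ W) : ∀ x ∈ ext₂ C n g W, x ∉ Fr := by
  intro x hx hF
  obtain ⟨i, h1, h2, h3, -⟩ := h.fresh_ext₂ hW hx hF
  obtain ⟨-, -, h4, -⟩ := isZ_simple.1 h3
  exact (h.apc i h1 h2).e2 W hW (sub_pair.2 ⟨ho, h4⟩)

lemma fresh_ext₃ (h : Host C n g Fr) (hW : W ∈ C.face 3)
    (hx : x ∈ ext₃ n g W) (hF : x ∈ Fr) : ∃ i, 1 ≤ i ∧ i < n ∧ topTri g i ⊆ W ∧
      (x = g (.α i) ∨ i + 1 < n ∧ (x = g (.β i) ∨ x = g (.α (i + 1)))) := by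
  grind [h.mem_ext₃, h.sub₃]

lemma o_cap (h : Host C n g Fr) : ¬ (g .o = g .b ∨ g .o ∈ Fr) := by grind [h.inj, h.fro]

lemma c_cap (h : Host C n g Fr) (i : ℕ) : ¬ (g (.c i) = g .b ∨ g (.c i) ∈ Fr) := by
  grind [h.inj, h.frc]

lemma o_mixTris (h : Host C n g Fr) (hZ : Z ∈ mixTris n g th) : g .o ∉ Z := by
  intro ho
  rcases h.mixTris_old hZ ho with (h1 | ⟨i, -, -, h1⟩) | h1
  all_goals grind [h.inj, h.fro]

lemma apart_fresh (h : Host C n g Fr) (hN : Cap N n g Fr ε th) (hx : x ∈ Fr) :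
    Apart (rounded C n g N) (g .o) x := by
  constructor
  · intro Z hZ hs; rw [sub_pair] at hs; rcases (h.rounded_one hN).1 hZ with ⟨hZ, -⟩ | hZ | hZ | hZ
    · grind [h.sub₁]
    · grind [h.hubEdges_old]
    · grind [h.o_cap, hN.sub₁]
    · rcases h.mixEdges_old hZ hs.1 with (h1 | ⟨i, -, -, h1⟩) | h1
      all_goals grind [h.inj, h.fro]
  · intro Z hZ hs; rw [sub_pair] at hs
    rcases (h.rounded_two hN).1 hZ with ⟨W, hW, -, rfl⟩ | rfl | hZ | hZ | hZ
    all_goals grind [h.o_ext₂, h.trace₂, h.fro, h.frb', h.frc, h.hubTris_old, h.o_cap, hN.sub₂,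
                h.o_mixTris]
  · intro Z hZ hs; have hn := h.not_subset_old (S := Z) ⟨x, (sub_pair.1 hs).2, hx⟩
    rw [sub_pair] at hs; rcases h.rounded_three.1 hZ with ⟨W, hW, rfl⟩ | rfl | rfl | hZ
    any_goals grind
    · obtain ⟨i, h1, h2, h3, -⟩ := h.fresh_ext₃ hW hs.2 hx
      exact (h.apc i h1 h2).e3 W hW (sub_pair.2 ⟨(h.trace₃ h.fro).1 hs.1, h3 (by simp [topTri])⟩)
    · grind [h.o_cap, hN.sub₃]

lemma hubEdge_mem (h : Host C n g Fr) (hN : Cap N n g Fr ε th)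
    (hZ : Z ∈ hubEdges n g) : Z ∈ (rounded C n g N).face 1 :=
  (h.rounded_one hN).2 (.inr (.inl hZ))

lemma mixEdge_mem (h : Host C n g Fr) (hN : Cap N n g Fr ε th)
    (hZ : Z ∈ mixEdges n g th) : Z ∈ (rounded C n g N).face 1 :=
  (h.rounded_one hN).2 (.inr (.inr (.inr hZ)))

lemma capEdge_mem (h : Host C n g Fr) (hN : Cap N n g Fr ε th)
    (hZ : Z ∈ N.face 1) : Z ∈ (rounded C n g N).face 1 :=
  (h.rounded_one hN).2 (.inr (.inr (.inl hZ)))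

lemma hostEdge_mem (h : Host C n g Fr) (hN : Cap N n g Fr ε th)
    (hZ : Z ∈ C.face 1) (hb : g .b ∉ Z) : Z ∈ (rounded C n g N).face 1 := by
  refine (h.rounded_one hN).2 (.inl ⟨hZ, fun hd => hb ?_⟩)
  grind [mem_delEdges]

lemma hubTri_mem (h : Host C n g Fr) (hN : Cap N n g Fr ε th)
    (hZ : Z ∈ hubTris n g) : Z ∈ (rounded C n g N).face 2 :=
  (h.rounded_two hN).2 (.inr (.inr (.inl hZ)))

lemma capTri_mem (h : Host C n g Fr) (hN : Cap N n g Fr ε th)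
    (hZ : Z ∈ N.face 2) : Z ∈ (rounded C n g N).face 2 :=
  (h.rounded_two hN).2 (.inr (.inr (.inr (.inl hZ))))

lemma mixTri_mem (h : Host C n g Fr) (hN : Cap N n g Fr ε th)
    (hZ : Z ∈ mixTris n g th) : Z ∈ (rounded C n g N).face 2 :=
  (h.rounded_two hN).2 (.inr (.inr (.inr (.inr hZ))))

lemma vert_mem (h : Host C n g Fr) (hN : Cap N n g Fr ε th)
    (hZ : Z ∈ C.face 0) : Z ∈ (rounded C n g N).face 0 :=
  (h.rounded_zero hN).2 (.inl hZ)

/-- The hub edge at `cᵢ`. -/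
lemma hubEdge_c (h : Host C n g Fr) (hN : Cap N n g Fr ε th) (h1 : 1 ≤ i)
    (h2 : i ≤ n) : {g .o, g (.c i)} ∈ (rounded C n g N).face 1 := by
  grind [mem_hubEdges, h.hubEdge_mem, h.hostEdge_mem, h.root.oy, h.inj]

lemma rootOK_side (h : Host C n g Fr) (hN : Cap N n g Fr ε th) (h1 : 1 ≤ i)
    (h2 : i < n) : RootOK (rounded C n g N) 1 (g .o) (g (.c (i + 1))) (g (.c i)) := by
  have hs : ({g .o, g (.c (i + 1)), g (.c i)} : Finset Vertex) ∈ hubTris n g :=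
    mem_hubTris.2 (.inr (.inr ⟨i, h1, h2, by grind⟩))
  refine ⟨h.vert_mem hN h.root.vo, h.vert_mem hN (h.vc _ (by omega) h2),
    h.vert_mem hN (h.vc _ h1 h2.le), h.hubEdge_c hN (by omega) h2, h.hubEdge_c hN h1 h2.le, ?_,
    h.hubTri_mem hN hs, h.nfac_hubTris hN hs⟩
  grind [pair_comm, h.hostEdge_mem, h.fil.side, h.inj]

lemma rootOK_first (h : Host C n g Fr) (hN : Cap N n g Fr ε th) :
    RootOK (rounded C n g N) 1 (g .o) (g (.c 1)) (g .b') := by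
  have hn := h.two
  have hs : ({g .o, g (.c 1), g .b'} : Finset Vertex) ∈ hubTris n g :=
    mem_hubTris.2 (.inr (.inl (by grind)))
  refine ⟨h.vert_mem hN h.root.vo, h.vert_mem hN (h.vc _ le_rfl (by omega)),
    h.vert_mem hN h.vb', h.hubEdge_c hN le_rfl (by omega),
    h.hubEdge_mem hN (mem_hubEdges.2 (.inl rfl)), ?_, h.hubTri_mem hN hs, h.nfac_hubTris hN hs⟩
  grind [pair_comm, le_rfl, h.hostEdge_mem, h.fil.edge', h.inj]

lemma rootOK_last (h : Host C n g Fr) (hN : Cap N n g Fr ε th) :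
    RootOK (rounded C n g N) 1 (g .o) (g .b') (g .a) := by
  have hs : ({g .o, g .b', g .a} : Finset Vertex) ∈ hubTris n g := mem_hubTris.2 (.inl (by grind))
  refine ⟨h.vert_mem hN h.root.vo, h.vert_mem hN h.vb', h.vert_mem hN h.root.vx,
    h.hubEdge_mem hN (mem_hubEdges.2 (.inl rfl)),
    h.hostEdge_mem hN h.root.ox (by grind [h.inj]), ?_, h.hubTri_mem hN hs,
    h.nfac_hubTris hN hs⟩
  grind [pair_comm, h.hostEdge_mem, h.tooth.xb, h.inj]

lemma free_side (h : Host C n g Fr) (hN : Cap N n g Fr ε th) (h1 : 1 ≤ i)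
    (h2 : i < n) (hZ : Z ∈ (rounded C n g N).face 2)
    (hs : {g (.c (i + 1)), g (.c i)} ⊆ Z) (hf : (rounded C n g N).nfac Z = 1) :
    Z = {g .o, g (.c (i + 1)), g (.c i)} ∨ i + 1 < n ∧ Z = {g (.c (i + 1)), g (.β i), g (.c i)} ∨
      i + 1 = n ∧ Z = {g (.c (i + 1)), g (.α i), g (.c i)} := by
  have hn := h.two
  rw [sub_pair] at hs
  rcases (h.free_iff hN).1 ⟨hZ, hf⟩ with ⟨W, hW, ⟨h3, h4, h5⟩, rfl⟩ | hZ | hZ | hZ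
  · rw [h.trace₂ (h.frc _), h.trace₂ (h.frc _)] at hs
    rcases h.fil.sideFree i h1 h2 W hW (sub_pair.2 hs.symm) h3 with rfl | rfl
    · exact (h5 (.inr (.inr ⟨i, h1, h2, rfl⟩))).elim
    · exact (h4 (mem_delTris.2 ⟨i, h1, h2, rfl⟩)).elim
  · rw [mem_hubTris] at hZ; rcases hZ with rfl | rfl | ⟨j, h3, h4, rfl⟩
    · simp [h.inj.eq_iff] at hs
    · simp [h.inj.eq_iff] at hs; omega
    · simp [h.inj.eq_iff] at hs; grind
  · grind [outerRidges_subset, h.c_cap, hN.sub₂]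
  · rw [mem_mixTris] at hZ
    rcases hZ with ⟨j, h3, h4, rfl⟩ | ⟨j, h3, h4, rfl⟩ | ⟨j, h3, h4, rfl⟩ | rfl | rfl |
      ⟨j, h3, h4, h5, rfl⟩ <;> simp [h.inj.eq_iff] at hs
    all_goals grind

lemma toothOK_side (h : Host C n g Fr) (hN : Cap N n g Fr ε th) (h1 : 1 ≤ i) (h2 : i + 1 < n) :
    ToothOK (rounded C n g N) 1 (g .o) (g (.c (i + 1))) (g (.β i)) (g (.c i)) := by
  have hs := mix₂ (g := g) (th := th) h1 h2
  refine ⟨h.mixEdge_mem hN (th := th) ?_, h.mixEdge_mem hN (th := th) ?_, h.mixTri_mem hN hs,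
    h.nfac_mixTris hN hs, fun Z hZ hs hf => ?_⟩
  all_goals grind [mem_mixEdges, h.free_side]

lemma toothOK_end (h : Host C n g Fr) (hN : Cap N n g Fr ε th) :
    ToothOK (rounded C n g N) 1 (g .o) (g (.c n)) (g (.α (n - 1))) (g (.c (n - 1))) := by
  have hn := h.two
  have hs := mix₅ (n := n) (g := g) (th := th)
  refine ⟨h.mixEdge_mem hN (th := th) ?_, h.mixEdge_mem hN (th := th) ?_, h.mixTri_mem hN hs,
    h.nfac_mixTris hN hs, fun Z hZ hs hf => ?_⟩
  · grind [mem_mixEdges]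
  · grind [mem_mixEdges]
  · have := h.free_side hN (i := n - 1) (by omega) (by omega) hZ (by grind) hf; grind

lemma flipOK_side (h : Host C n g Fr) (hN : Cap N n g Fr ε th) (h1 : 1 ≤ i) (h2 : i + 1 < n) :
    FlipOK (rounded C n g N) (g (.c i)) (g (.c (i + 1))) (g (.β i)) (g (.α i)) := by
  have hn := h.two
  refine ⟨h.mixEdge_mem hN (th := th) ?_, ?_, ?_, ?_, ?_, ?_, ?_⟩
  · grind [mem_mixEdges, pair_comm]
  · grind [mem_mixEdges, h.capEdge_mem, hN.βα, h.mixEdge_mem]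
  · intro hZ; rcases (h.rounded_one hN).1 hZ with ⟨hZ, -⟩ | hZ | hZ | hZ
    · exact h.sub₁ _ hZ (g (.α i)) (by simp) (h.frα i)
    · exact (h.hubEdges_old hZ).2.1 (g (.α i)) (by simp) (h.frα i)
    all_goals grind [mem_mixEdges, pair_eq_iff, h.c_cap, hN.sub₁, h.inj]
  · have := h.mixTri_mem hN (mix₃ (g := g) (th := th) h1 h2); convert this using 1; ext; simp; tauto
  · intro Z hZ hs; rw [sub_pair] at hs
    rcases (h.rounded_two hN).1 hZ with ⟨W, hW, -, rfl⟩ | rfl | hZ | hZ | hZ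
    · obtain ⟨h3, h4, h5⟩ := h.α_ext₂ hW hs.2
      have := h.isZ_c h3 h4 (by omega) h2.le h5 ((h.trace₂ (h.frc _)).1 hs.1); omega
    · grind [h.inj]
    · exact (h.hubTris_old hZ).2.1 _ hs.2 (h.frα i)
    · grind [h.c_cap, hN.sub₂]
    · rw [mem_mixTris] at hZ
      rcases hZ with ⟨j, h3, h4, rfl⟩ | ⟨j, h3, h4, rfl⟩ | ⟨j, h3, h4, rfl⟩ | rfl | rfl |
        ⟨j, h3, h4, h5, rfl⟩ <;> simp [h.inj.eq_iff] at hs <;> omega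
  · intro Z hZ hs; rw [sub_pair] at hs
    rcases (h.rounded_two hN).1 hZ with ⟨W, hW, -, rfl⟩ | rfl | hZ | hZ | hZ
    · grind [h.β_ext₂]
    · grind [h.inj]
    · exact ((h.hubTris_old hZ).2.1 _ hs.2 (h.frβ i)).elim
    · grind [h.c_cap, hN.sub₂]
    · rw [mem_mixTris] at hZ
      rcases hZ with ⟨j, h3, h4, rfl⟩ | ⟨j, h3, h4, rfl⟩ | ⟨j, h3, h4, rfl⟩ | rfl | rfl |
        ⟨j, h3, h4, h5, rfl⟩ <;> simp [h.inj.eq_iff] at hs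
      · omega
      · grind
      grind
  · obtain ⟨Y, hY, ht, hu⟩ := h.top_facet h1 (by omega)
    refine ⟨ext₃ n g Y, h.rounded_three.2 (.inl ⟨Y, hY, rfl⟩), ?_, ?_, ?_⟩
    · grind [sub_pair, topTri, h.trace₃, h.frc, h.β_mem]
    · grind [sub_pair, topTri, h.trace₃, h.frc, h.α_mem]
    · intro Y' hY' hs; have hF : ∃ x ∈ Y', x ∈ Fr := by grind [sub_pair, h.frβ, h.frα]
      have hno := h.not_subset_old hF
      rcases h.rounded_three.1 hY' with ⟨W, hW, rfl⟩ | rfl | rfl | hZ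
      any_goals grind
      · congr 1; apply hu W hW; rcases hs with hs | hs <;> rw [sub_pair, h.trace₃ (h.frc _)] at hs
        · grind [h.β_mem]
        · rcases (h.α_mem hW).1 hs.2 with h3 | ⟨h3, h4, h5⟩
          · exact h3.2.2
          · have := h.c_mem_top (j := i + 1) (by omega) (by omega) (by omega) h2.le hW h5 hs.1
            omega
      · grind [sub_pair, h.c_cap, hN.sub₃]

end Host


/-- A fillet `d₁, …, d_τ = αᵢ` of the complex that is attached in a round, which is to be
continued by `cᵢ`. -/
structure CapFillet (N : Cx Vertex) (n : ℕ) (g : Sym → Vertex) (Fr : Set Vertex) (ε : ℕ)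
    (th : ℕ → Prop) (i : ℕ) (d : ℕ → Vertex) (τ : ℕ) : Prop where
  two : 2 ≤ i
  lt : i + 1 < n
  th₀ : th i
  th₁ : th (i - 1)
  pos : 1 ≤ τ
  fil : FilletOK N (g (.α (i + 1))) (g (.β (i - 1))) (g (.β i)) d τ
  fend : FilletEnd N (g (.β (i - 1))) d τ (g (.α (i - 1)))
  last : d τ = g (.α i)
  next : d (τ + 1) = g (.c i)
  inner : ∀ j, 1 ≤ j → j < τ → d j ∈ Fr ∧ ∀ s, d j ≠ g s
  disc : τ = 1 → ε = 0
  ball : 2 ≤ τ → ε = 1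

namespace Host

variable {C N : Cx Vertex} {n : ℕ} {g : Sym → Vertex} {Fr : Set Vertex} {ε : ℕ} {th : ℕ → Prop}

lemma mixTris_range (hZ : Z ∈ mixTris n g th) (hx : x ∈ Z) : ∃ s, x = g s := by grind [mem_mixTris]

lemma new_ridge (h : Host C n g Fr) (hN : Cap N n g Fr ε th)
    (hZ : Z ∈ (rounded C n g N).face 2) (hx : x ∈ Z) (hF : x ∈ Fr)
    (hg : ∀ s, x ≠ g s) : Z ∈ N.face 2 ∧ (rounded C n g N).nfac Z = N.nfac Z := by
  classical
  have hZ' : Z ∈ N.face 2 := by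
    rcases (h.rounded_two hN).1 hZ with ⟨W, hW, -, rfl⟩ | rfl | hZ | hZ | hZ
    any_goals grind
    · grind [h.fresh_ext₂]
    · exact ((h.hubTris_old hZ).2.1 x hx hF).elim
    · grind [mixTris_range]
  refine ⟨hZ', ?_⟩
  rw [h.nfac_cap hN hZ', if_neg, add_zero]
  rintro ⟨i, -, -, rfl | ⟨-, rfl⟩⟩ <;>
  grind

lemma new_facet (h : Host C n g Fr) (hY : Y ∈ (rounded C n g N).face 3) (hx : x ∈ Y) (hF : x ∈ Fr)
    (hg : ∀ s, x ≠ g s) : Y ∈ N.face 3 := by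
  have hno := h.not_subset_old (S := Y) ⟨x, hx, hF⟩
  grind [subset_rfl, h.rounded_three, h.fresh_ext₃]

variable {i τ : ℕ} {d : ℕ → Vertex}

/-- The free ridges at an edge `βₖ cₖ` or `βₖ cₖ₊₁`. -/
lemma free_βc (h : Host C n g Fr) (hN : Cap N n g Fr ε th)
    (hZ : Z ∈ (rounded C n g N).face 2) (hf : (rounded C n g N).nfac Z = 1)
    (hβ : g (.β k) ∈ Z) (hc : g (.c j) ∈ Z) : Z ∈ mixTris n g th := by
  rcases (h.free_iff hN).1 ⟨hZ, hf⟩ with ⟨W, hW, -, rfl⟩ | hZ | hZ | hZ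
  · grind [h.β_ext₂]
  · exact ((h.hubTris_old hZ).2.1 _ hβ (h.frβ k)).elim
  all_goals grind [outerRidges_subset, h.c_cap, hN.sub₂]

/-- The free ridges at an edge `βₖ αⱼ`. -/
lemma free_βα (h : Host C n g Fr) (hN : Cap N n g Fr ε th)
    (hZ : Z ∈ (rounded C n g N).face 2) (hf : (rounded C n g N).nfac Z = 1)
    (hβ : g (.β k) ∈ Z) (hα : g (.α j) ∈ Z) :
    Z ∈ mixTris n g th ∨ Z ∈ N.face 2 ∧ (IsSeam n g th Z ∧ N.nfac Z = 0 ∨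
      ¬ IsSeam n g th Z ∧ N.nfac Z = 1) := by
  classical
  rcases (h.free_iff hN).1 ⟨hZ, hf⟩ with ⟨W, hW, -, rfl⟩ | h1 | h1 | h1
  · grind [h.β_ext₂]
  · exact ((h.hubTris_old h1).2.1 _ hβ (h.frβ k)).elim
  all_goals grind [outerRidges_subset, h.nfac_cap]

lemma seam_nfac (h : Host C n g Fr) (hN : Cap N n g Fr ε th)
    (hZ : IsSeam n g th Z) (hβ : g (.β k) ∈ Z) :
    N.nfac Z = ε ∧ Z = {g (.α (k + 1)), g (.β k), g (.α k)} := by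
  obtain ⟨j, h1, h2, rfl | ⟨h3, rfl⟩⟩ := hZ
  all_goals grind [h.inj, hN.facTooth]

lemma nfac_tri (h : Host C n g Fr) (hN : Cap N n g Fr ε th) (hd : CapFillet N n g Fr ε th i d τ) (hZ : Z ∈ N.face 2) (h1 : 1 ≤ j) (h2 : j < τ) (hj : d j ∈ Z) :
    (rounded C n g N).nfac Z = N.nfac Z :=
  (h.new_ridge hN (h.capTri_mem hN hZ) hj (hd.inner j h1 h2).1 (hd.inner j h1 h2).2).2

lemma filletEnd_next (h : Host C n g Fr) (hN : Cap N n g Fr ε th)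
    (hd : CapFillet N n g Fr ε th i d τ) :
    FilletEnd (rounded C n g N) (g (.β (i - 1))) d (τ + 1) (g (.c (i - 1))) := by
  have hi := hd.two
  have hin := hd.lt
  have hp := hd.pos
  constructor
  · intro Y hY hs; rw [hd.next, sub_pair] at hs; refine ⟨by omega, ?_⟩
    rw [show τ + 1 - 1 = τ by omega, hd.last]
    have hno := h.not_subset_old (S := Y) ⟨_, hs.1, h.frβ _⟩
    grind [subset_rfl, h.rounded_three, h.β_mem, h.α_mem, h.c_cap, hN.sub₃]
  · intro _ Z hZ hs hf; rw [show τ + 1 - 1 = τ by omega, hd.last]; rw [hd.next, sub_pair] at hs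
    rw [hd.next]; have := h.free_βc hN hZ hf hs.1 hs.2; rw [mem_mixTris] at this
    rcases this with ⟨j, h3, h4, rfl⟩ | ⟨j, h3, h4, rfl⟩ | ⟨j, h3, h4, rfl⟩ | rfl | rfl |
      ⟨j, h3, h4, h5, rfl⟩ <;> simp [h.inj.eq_iff] at hs
    all_goals grind

lemma filletOK_next (h : Host C n g Fr) (hN : Cap N n g Fr ε th)
    (hd : CapFillet N n g Fr ε th i d τ) :
    FilletOK (rounded C n g N) (g (.c (i + 1))) (g (.β (i - 1))) (g (.β i)) d (τ + 1) := by
  have hi := hd.two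
  have hin := hd.lt
  have hp := hd.pos
  have hi' : i - 1 + 1 = i := by omega
  have hnext := hd.next
  have hlast := hd.last
  have hmix₃ := mix₃ (g := g) (th := th) (show 1 ≤ i by omega) hin
  have hmix₁ := mix₁ (n := n) (g := g) (th := th) (show 1 ≤ i - 1 by omega) (by omega)
  rw [hi'] at hmix₁
  have e3 : ({g (.β i), g (.α i), g (.c i)} : Finset Vertex) = {g (.β i), d τ, d (τ + 1)} := by
    grind
  have e1 : ({g (.α i), g (.c i), g (.β (i - 1))} : Finset Vertex) =
      {g (.β (i - 1)), d τ, d (τ + 1)} := by grind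
  rw [e3] at hmix₃
  rw [e1] at hmix₁
  have hfresh : ∀ j, 1 ≤ j → j ≤ τ → d j ∈ Fr := by grind [hd.inner, h.frα]
  constructor
  · grind [mem_mixEdges, h.capEdge_mem, hd.fil.edge', h.mixEdge_mem]
  · grind [mem_mixEdges, pair_comm, h.capEdge_mem, hd.fil.edge, h.mixEdge_mem]
  · grind [Nat.le_of_lt_succ, mem_mixEdges, h.capEdge_mem, hd.fil.side, h.mixEdge_mem]
  · grind [Nat.le_of_lt_succ, h.capTri_mem, hd.fil.tri', h.mixTri_mem]
  · grind [Nat.le_of_lt_succ, h.nfac_tri, hd.fil.tri', hd.fil.fac', h.nfac_mixTris]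
  · intro j h1 h2 Z hZ hs hf; rw [sub_pair] at hs; rcases lt_trichotomy j τ with h3 | rfl | h3
    · obtain ⟨hZ', hn'⟩ := h.new_ridge hN hZ hs.2 (hd.inner j (by omega) h3).1
        (hd.inner j (by omega) h3).2
      have := hd.fil.free' j h1 h3.le Z hZ' (sub_pair.2 hs) (hn' ▸ hf); grind
    · rw [if_pos (by omega)]; rw [hlast] at hs
      rcases h.free_βα hN hZ hf hs.1 hs.2 with h3 | ⟨h3, ⟨h4, h5⟩ | ⟨h4, h5⟩⟩
      · right; rw [← e3]; rw [mem_mixTris] at h3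
        rcases h3 with ⟨j, h3, h4, rfl⟩ | ⟨j, h3, h4, rfl⟩ | ⟨j, h3, h4, rfl⟩ | rfl | rfl |
          ⟨j, h3, h4, h5, rfl⟩ <;> simp [h.inj.eq_iff] at hs
        all_goals grind [hd.th₀]
      · have := (h.seam_nfac hN h4 hs.1).1; have := hd.ball h1; omega
      · have := hd.fil.free' j h1 le_rfl Z h3 (by grind) h5; rw [if_neg (by omega)] at this
        refine this.imp_right fun h6 => (h4 ⟨i, by omega, hin, .inr ⟨hd.th₀, ?_⟩⟩).elim
        rw [h6, hlast]; ext; simp; tauto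
    · obtain rfl : j = τ + 1 := by omega
      rw [if_neg (by omega), hnext, show τ + 1 - 1 = τ by omega, hlast]; rw [hnext] at hs
      have := h.free_βc hN hZ hf hs.1 hs.2; rw [mem_mixTris] at this
      rcases this with ⟨j, h3, h4, rfl⟩ | ⟨j, h3, h4, rfl⟩ | ⟨j, h3, h4, rfl⟩ | rfl | rfl |
        ⟨j, h3, h4, h5, rfl⟩ <;> simp [h.inj.eq_iff] at hs
      all_goals grind
  · grind [Nat.le_of_lt_succ, h.capTri_mem, hd.fil.tri, h.mixTri_mem]
  · grind [Nat.le_of_lt_succ, h.nfac_tri, hd.fil.tri, hd.fil.fac, h.nfac_mixTris]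
  · intro j h1 h2 Y hY hs; rcases (Nat.le_of_lt_succ h2).lt_or_eq with h3 | rfl
    · exact hd.fil.near j h1 h3 Y (h.new_facet hY (sub_pair.1 hs).2 (hd.inner j h1 h3).1
        (hd.inner j h1 h3).2) hs
    · rw [sub_pair] at hs; have hno := h.not_subset_old (S := Y) ⟨_, hs.1, h.frβ _⟩
      grind [topTri, subset_rfl, sub_pair, h.rounded_three, h.β_mem, h.trace₃, h.frc, hd.fend.near]
  · intro j k h1 h2 h3 Y hY hs
    have hY' := h.new_facet hY (hs (by simp)) (hd.inner j h1 (by omega)).1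
      (hd.inner j h1 (by omega)).2
    grind [hd.fil.far, h.c_cap, hN.sub₃]
  · intro j h1 h2 Z hZ hs hf; rw [sub_pair] at hs
    rcases (Nat.le_of_lt_succ h2).lt_or_eq with h3 | rfl
    · obtain ⟨hZ', hn'⟩ := h.new_ridge hN hZ hs.2 (hd.inner j (by omega) h3).1
        (hd.inner j (by omega) h3).2
      grind [sub_pair, hd.fil.free]
    · rw [hlast] at hs; rcases h.free_βα hN hZ hf hs.1 hs.2 with h3 | ⟨h3, ⟨h4, h5⟩ | ⟨h4, h5⟩⟩
      · right; rw [← e1]; rw [mem_mixTris] at h3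
        rcases h3 with ⟨j, h3, h4, rfl⟩ | ⟨j, h3, h4, rfl⟩ | ⟨j, h3, h4, rfl⟩ | rfl | rfl |
          ⟨j, h3, h4, h5, rfl⟩ <;> simp [h.inj.eq_iff] at hs
        all_goals grind [hd.th₁]
      · have := (h.seam_nfac hN h4 hs.1).1; have := hd.ball h1; omega
      · have := hd.fend.free h1 Z h3 (by grind) h5
        refine this.imp_right fun h6 => (h4 ⟨i - 1, by omega, by omega, .inr ⟨hd.th₁, ?_⟩⟩).elim
        rw [h6, hlast, hi']; ext; simp; tauto
  · intro j h1 h2 Z hZ hs hf; rw [sub_pair] at hs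
    rcases (Nat.le_of_lt_succ h2).lt_or_eq with h3 | rfl
    · obtain ⟨hZ', hn'⟩ := h.new_ridge hN hZ hs.1 (hd.inner j (by omega) h3).1
        (hd.inner j (by omega) h3).2
      grind [sub_pair, hd.fil.sideFree]
    · rw [← e3, ← e1]; rw [hlast, hnext] at hs
      rcases (h.free_iff hN).1 ⟨hZ, hf⟩ with ⟨W, hW, ⟨h3, h4, -⟩, rfl⟩ | h3 | h3 | h3
      · obtain ⟨h5, h6, h7⟩ := h.α_ext₂ hW hs.1; obtain ⟨-, h8, h9, -⟩ := isZ_simple.1 h7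
        rcases h.fil.free i hi h6 W hW (sub_pair.2 ⟨h8, h9⟩) h3 with rfl | rfl
        · exact (h4 (mem_delTris.2 ⟨i - 1, by omega, by omega, by rw [topTri, hi']⟩)).elim
        · exact (h4 (mem_delTris.2 ⟨i, by omega, by omega, rfl⟩)).elim
      · exact ((h.hubTris_old h3).2.1 _ hs.1 (h.frα i)).elim
      · grind [outerRidges_subset, h.c_cap, hN.sub₂]
      · rw [mem_mixTris] at h3
        rcases h3 with ⟨j, h3, h4, rfl⟩ | ⟨j, h3, h4, rfl⟩ | ⟨j, h3, h4, rfl⟩ | rfl | rfl |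
          ⟨j, h3, h4, h5, rfl⟩ <;> simp [h.inj.eq_iff] at hs
        all_goals grind
  · intro Z hZ hs; have hold : ∀ x ∈ Z, x ∉ Fr → x = g (.c i) := by grind [h.frβ]
    have hg : ∀ s, g s ∈ Z → s = .β i ∨ s = .α i ∨ s = .c i := by
      grind [lt_trichotomy, h.inj, hd.inner]
    rcases (h.rounded_two hN).1 hZ with ⟨W, hW, -, rfl⟩ | rfl | h3 | h3 | h3
    · exfalso; have : W ⊆ {g (.c i)} := fun x hx =>
        mem_singleton.2 (hold x (subset_ext₂ W hx) (h.sub₂ W hW x hx))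
      have := card_le_card this; have := h.card₂ W hW; simp at *; omega
    · grind
    · grind [h.hubTris_old]
    · obtain ⟨j, h4, h5, h6⟩ := hd.fil.only Z h3 (by intro x hx; grind [h.c_cap, hN.sub₂])
      exact ⟨j, h4, by omega, h6⟩
    · refine ⟨τ, hp, by omega, ?_⟩; rw [← e3]; rw [mem_mixTris] at h3; grind
  · intro _; rcases hp.lt_or_eq with h3 | rfl
    · obtain ⟨Z, hZ, hs, hne, hf⟩ := hd.fil.start h3; exact ⟨Z, h.capTri_mem hN hZ, hs, hne, by
        rw [h.nfac_tri hN hd hZ le_rfl h3 (sub_pair.1 hs).2, hf]⟩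
    · classical
      have hZ := hN.tooth (i - 1) (by omega) (by omega) hd.th₁; rw [hi'] at hZ
      rw [hlast, show (1 : ℕ) + 1 = 2 from rfl] at *
      refine ⟨_, h.capTri_mem hN hZ, by grind, ?_, ?_⟩
      · rw [hnext]; intro he
        have : g (.c i) ∈ ({g (.α i), g (.β (i - 1)), g (.α (i - 1))} : Finset Vertex) := by
          rw [he]; simp
        simp [h.inj.eq_iff] at this
      · have hse : IsSeam n g th {g (.α i), g (.β (i - 1)), g (.α (i - 1))} :=
          ⟨i - 1, by omega, by omega, .inr ⟨hd.th₁, by rw [hi']⟩⟩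
        rw [h.nfac_cap hN hZ, if_pos hse, (h.seam_nfac hN hse (k := i - 1) (by simp)).1,
          hd.disc rfl]

end Host


/-- Basic properties of the faces of a complex. -/
structure Frame (C : Cx Vertex) : Prop where
  zero : ∀ Z ∈ C.face 0, ∃ x, Z = {x}
  sub₁ : ∀ Z ∈ C.face 1, ∀ x ∈ Z, {x} ∈ C.face 0
  sub₂ : ∀ Z ∈ C.face 2, ∀ x ∈ Z, {x} ∈ C.face 0
  sub₃ : ∀ Z ∈ C.face 3, ∀ x ∈ Z, {x} ∈ C.face 0
  card₁ : ∀ Z ∈ C.face 1, Z.card = 2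
  card₂ : ∀ Z ∈ C.face 2, 3 ≤ Z.card
  card₃ : ∀ Z ∈ C.face 3, 2 ≤ Z.card
  anti : ∀ Z ∈ C.face 2, ∀ W ∈ C.face 2, Z ⊆ W → Z = W

namespace Host

variable {C N : Cx Vertex} {n : ℕ} {g : Sym → Vertex} {Fr : Set Vertex} {ε : ℕ} {th : ℕ → Prop}

lemma vert_o (h : Host C n g Fr) (hN : Cap N n g Fr ε th) :
    {g .o} ∈ (rounded C n g N).face 0 := h.vert_mem hN h.root.vo

lemma vert_a (h : Host C n g Fr) (hN : Cap N n g Fr ε th) :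
    {g .a} ∈ (rounded C n g N).face 0 := h.vert_mem hN h.root.vx

lemma vert_c (h : Host C n g Fr) (hN : Cap N n g Fr ε th) (h1 : 1 ≤ i) (h2 : i ≤ n) :
    {g (.c i)} ∈ (rounded C n g N).face 0 := h.vert_mem hN (h.vc i h1 h2)

lemma vert_α (h : Host C n g Fr) (hN : Cap N n g Fr ε th) (h1 : 1 ≤ i) (h2 : i < n) :
    {g (.α i)} ∈ (rounded C n g N).face 0 :=
  (h.rounded_zero hN).2 (.inr (.inl (hN.vα i h1 h2)))

lemma vert_β (h : Host C n g Fr) (hN : Cap N n g Fr ε th) (h1 : 1 ≤ i)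
    (h2 : i + 1 < n) : {g (.β i)} ∈ (rounded C n g N).face 0 :=
  (h.rounded_zero hN).2 (.inr (.inr ⟨i, h1, h2, rfl⟩))

lemma vert_hubSide (h : Host C n g Fr) (hN : Cap N n g Fr ε th)
    (hx : x ∈ hubSide n g) : {x} ∈ (rounded C n g N).face 0 := by
  rcases hx with rfl | rfl | rfl | ⟨i, h1, h2, rfl⟩
  all_goals grind [h.vert_o, h.vert_a, h.vert_mem, h.vb', h.vert_c]

lemma frame_rounded (h : Host C n g Fr) (hN : Cap N n g Fr ε th) (hC : Frame C) (hM : Frame N) :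
    Frame (rounded C n g N) := by
  have hn := h.two
  have hanti := h.rounded_anti hN
  have hb := h.vert_mem hN h.vb
  refine ⟨?_, ?_, ?_, ?_, ?_, fun Z hZ => (hanti Z hZ).1, ?_, fun Z hZ => (hanti Z hZ).2⟩
  · grind [h.rounded_zero, hC.zero, hM.zero]
  · intro Z hZ x hx; rcases (h.rounded_one hN).1 hZ with ⟨h1, -⟩ | h1 | h1 | h1
    all_goals grind [mem_mixEdges, h.vert_mem, hC.sub₁, h.vert_hubSide, h.hubEdges_hubSide,
                h.rounded_zero, hM.sub₁, h.vert_c, h.vert_α, h.vert_β]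
  · intro Z hZ x hx; rcases (h.rounded_two hN).1 hZ with ⟨W, hW, -, rfl⟩ | rfl | h1 | h1 | h1
    · grind [h.mem_ext₂, h.vert_mem, hC.sub₂, h.vert_α]
    · apply h.vert_hubSide hN; simp only [mem_insert, mem_singleton] at hx
      rcases hx with rfl | rfl | rfl
      · exact .inl rfl
      · exact .inr (.inr (.inl rfl))
      · exact .inr (.inr (.inr ⟨n, by omega, le_rfl, rfl⟩))
    · grind [h.vert_hubSide, h.hubTris_hubSide]
    · grind [h.rounded_zero, hM.sub₂]
    · rw [mem_mixTris] at h1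
      rcases h1 with ⟨i, h1, h2, rfl⟩ | ⟨i, h1, h2, rfl⟩ | ⟨i, h1, h2, rfl⟩ | rfl | rfl |
        ⟨i, h1, h2, h3, rfl⟩ <;>
      grind [h.vert_c, h.vert_α, h.vert_β]
  · intro Z hZ x hx; rcases h.rounded_three.1 hZ with ⟨W, hW, rfl⟩ | rfl | rfl | h1
    · grind [h.mem_ext₃, h.vert_mem, hC.sub₃, h.vert_α, h.vert_β]
    · apply h.vert_hubSide hN; simp only [mem_insert, mem_singleton] at hx
      rcases hx with rfl | rfl | rfl | rfl
      · exact .inl rfl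
      · exact .inr (.inl rfl)
      · exact .inr (.inr (.inl rfl))
      · exact .inr (.inr (.inr ⟨n, by omega, le_rfl, rfl⟩))
    · apply h.vert_hubSide hN; rcases mem_fanFacet.1 hx with rfl | rfl | ⟨i, h1, h2, rfl⟩
      · exact .inl rfl
      · exact .inr (.inr (.inl rfl))
      · exact .inr (.inr (.inr ⟨i, h1, h2, rfl⟩))
    grind [h.rounded_zero, hM.sub₃]
  · intro Z hZ; rcases (h.rounded_one hN).1 hZ with ⟨h1, -⟩ | h1 | h1 | h1
    all_goals grind [mem_hubEdges, card_pair, mem_mixEdges, hC.card₁, h.inj, hM.card₁]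
  · intro Z hZ; have hoa : g .o ≠ g .b' := h.inj.ne (by simp)
    rcases h.rounded_three.1 hZ with ⟨W, hW, rfl⟩ | rfl | rfl | h1
    · exact (hC.card₃ W hW).trans (card_le_card (subset_ext₃ W))
    · grind
    · rw [← card_pair hoa]; exact card_le_card (by simp [insert_subset_iff, mem_fanFacet])
    · exact hM.card₃ Z h1

/-- The free ridges at the hub after a round. -/
lemma hub_free (h : Host C n g Fr) (hN : Cap N n g Fr ε th)
    (hZ : Z ∈ (rounded C n g N).face 2) (ho : g .o ∈ Z) (hf : (rounded C n g N).nfac Z = 1) :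
    (Z ∈ C.face 2 ∧ C.nfac Z = 1 ∧ Z ≠ {g .o, g .a, g (.c n)}) ∨ Z ∈ hubTris n g := by
  rcases (h.free_iff hN).1 ⟨hZ, hf⟩ with ⟨W, hW, ⟨h1, h2, h3⟩, rfl⟩ | h1 | h1 | h1
  · left; have ho' := (h.trace₂ h.fro).1 ho
    have he : ext₂ C n g W = W := by grind [Finset.Subset.antisymm, subset_ext₂, h.trace₂, h.o_ext₂]
    rw [he]; exact ⟨hW, h1, fun h4 => h3 (.inl h4)⟩
  all_goals grind [outerRidges_subset, h.o_cap, hN.sub₂, h.o_mixTris]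

/-- The vertices lie on the boundary after a round. -/
lemma cover_rounded (h : Host C n g Fr) (hN : Cap N n g Fr ε th)
    (hC : ∀ x, {x} ∈ C.face 0 → C.OnBd {x})
    (hM : ∀ x, {x} ∈ N.face 0 → N.OnBd {x} ∨ x = g .b ∨ (∃ i, 1 ≤ i ∧ i < n ∧ x = g (.α i)) ∨
      ∃ i, 1 ≤ i ∧ i + 1 < n ∧ x = g (.β i)) :
    ∀ x, {x} ∈ (rounded C n g N).face 0 → (rounded C n g N).OnBd {x} := by
  classical
  have hn := h.two
  have hub : ∀ Z ∈ hubTris n g, ∀ x ∈ Z, (rounded C n g N).OnBd {x} := fun Z hZ x hx =>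
    h.rounded_free hN (.inr (.inl hZ)) (by grind)
  have mix : ∀ Z ∈ mixTris n g th, ∀ x ∈ Z, (rounded C n g N).OnBd {x} := fun Z hZ x hx =>
    h.rounded_free hN (.inr (.inr (.inr hZ))) (by grind)
  have hb : (rounded C n g N).OnBd {g .b} := mix _ mix₄ _ (by simp)
  have hc : ∀ i, 1 ≤ i → i ≤ n → (rounded C n g N).OnBd {g (.c i)} := by
    intro i h1 h2; rcases h2.lt_or_eq with h3 | rfl
    · exact hub _ (mem_hubTris.2 (.inr (.inr ⟨i, h1, h3, rfl⟩))) _ (by simp)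
    · exact mix _ mix₄ _ (by simp)
  have hα : ∀ i, 1 ≤ i → i < n → (rounded C n g N).OnBd {g (.α i)} := by
    intro i h1 h2; by_cases h3 : i + 1 < n
    · exact mix _ (mix₃ h1 h3) _ (by simp)
    · obtain rfl : i = n - 1 := by omega
      exact mix _ mix₄ _ (by simp)
  have hβ : ∀ i, 1 ≤ i → i + 1 < n → (rounded C n g N).OnBd {g (.β i)} :=
    fun i h1 h2 => mix _ (mix₃ h1 h2) _ (by simp)
  intro x hx
  rcases (h.rounded_zero hN).1 hx with h1 | h1 | ⟨i, h1, h2, h3⟩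
  · obtain ⟨T, hT, hf, hs⟩ := hC x h1; rw [singleton_subset_iff] at hs
    by_cases hd : T ∈ delTris n g
    · rcases h.delTris_capSide hd hs with rfl | ⟨i, h2, h3, rfl⟩
      · exact hb
      · grind
    · by_cases hg : IsGlue n g T
      · rcases hg with rfl | rfl | ⟨i, h2, h3, rfl⟩ <;>
        · simp only [mem_insert, mem_singleton] at hs; rcases hs with rfl | rfl | rfl <;>
          first
            | exact hc _ (by omega) (by omega)
            | exact hub _ (mem_hubTris.2 (.inl rfl)) _ (by simp)
      grind [subset_ext₂, h.rounded_free]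
  · rcases hM x h1 with ⟨T, hT, hf, hs⟩ | rfl | ⟨i, h2, h3, rfl⟩ | ⟨i, h2, h3, rfl⟩
    any_goals grind
    · rw [singleton_subset_iff] at hs; by_cases hd : IsSeam n g th T
      · obtain ⟨i, h2, h3, rfl | ⟨-, rfl⟩⟩ := hd <;>
        grind
      · refine ⟨T, h.capTri_mem hN hT, ?_, by grind⟩; rw [h.nfac_cap hN hT, if_neg hd, hf]
  grind

end Host


/-- The tip of the tooth at an arc. -/
def Arc.tip (A : Arc) (o : Vertex) : Vertex := A.inner.headD o

/-- The vertex before the end of an arc. -/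
def Arc.last (A : Arc) (o : Vertex) : Vertex := A.inner.getLastD o

/-- The vertices of an arc that come after the tip. -/
def Arc.chain (A : Arc) (o : Vertex) (i : ℕ) : Vertex := (A.inner.tail ++ [A.root]).getD (i - 1) o

/-- Renaming of the vertices of an arc. -/
def Arc.map (f : Vertex → Vertex) (A : Arc) : Arc where
  inner := A.inner.map f
  root := f A.root
  fillet := A.fillet

/-- The properties of the faces around an arc that starts at `v`, where `b` is the tip of the next
tooth. -/
structure GoodSite (C : Cx Vertex) (ε t : ℕ) (o v : Vertex) (A : Arc) (b : Vertex) : Prop where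
  root : RootOK C ε o v A.root
  inner : ∀ x ∈ A.inner, {x} ∈ C.face 0 ∧ Apart C o x
  tooth : A.inner ≠ [] → ToothOK C ε o v (A.tip o) A.root
  flip : A.fillet = false → 2 ≤ A.inner.length → FlipOK C A.root v (A.tip o) (A.last o)
  fillet : A.fillet = true →
    A.inner.length = t ∧ {b} ∈ C.face 0 ∧ FilletOK C v b (A.tip o) (A.chain o) t

/-- The conditions under which a `Sim` relation preserves the properties of a site. -/
structure Kept (t : ℕ) (o v : Vertex) (A : Arc) (b : Vertex) (U T : Set Vertex)
    (P : Finset Vertex → Prop) : Prop where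
  hub : o ∈ U ∧ o ∉ T
  start : v ∈ U ∧ v ∉ T
  endRoot : A.root ∈ U ∧ A.root ∉ T
  inner : ∀ x ∈ A.inner, x ∈ U ∧ x ∉ T
  nextTip : A.fillet = true → b ∈ U ∧ b ∉ T
  root : P {o, v, A.root}
  side : A.inner ≠ [] → P {v, A.root}
  apart : ∀ x ∈ A.inner, P {o, x}
  flip : A.fillet = false → 2 ≤ A.inner.length → P {A.root, A.tip o} ∧ P {v, A.last o}
  near : A.fillet = true → ∀ i, 1 ≤ i → i < t → P {b, A.chain o i}
  far : A.fillet = true → ∀ i, 2 ≤ i → i ≤ t → P {A.tip o, A.chain o i}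
  one : A.fillet = true → ∀ i, 1 ≤ i → i < t → P {A.chain o i}

section Kept

variable {C C' : Cx Vertex} {f : Vertex → Vertex} {U T : Set Vertex} {P : Finset Vertex → Prop}
  {e₂ e₃ : Finset Vertex → Finset Vertex} {ε t : ℕ} {o v b : Vertex} {A : Arc}

lemma getD_mem_or {l : List Vertex} : l.getD i o ∈ l ∨ l.getD i o = o := by grind

lemma Arc.chain_mem (A : Arc) (o : Vertex) (i : ℕ) :
    A.chain o i ∈ A.inner.tail ∨ A.chain o i = A.root ∨ A.chain o i = o := by
  rcases getD_mem_or (l := A.inner.tail ++ [A.root]) (i := i - 1) (o := o) with h | h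
  · rw [List.mem_append, List.mem_singleton] at h; exact h.imp_right .inl
  · exact .inr (.inr h)

lemma Arc.tip_mem (A : Arc) (o : Vertex) : A.tip o ∈ A.inner ∨ A.tip o = o := by
  unfold Arc.tip
  cases A.inner <;> simp

lemma Arc.last_mem (A : Arc) (o : Vertex) : A.last o ∈ A.inner ∨ A.last o = o := by grind [Arc.last]

lemma Arc.tip_map (A : Arc) (o : Vertex) : (A.map f).tip (f o) = f (A.tip o) := by
  unfold Arc.tip Arc.map
  cases A.inner <;> simp

lemma Arc.last_map (A : Arc) (o : Vertex) : (A.map f).last (f o) = f (A.last o) := by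
  grind [Arc.last, Arc.map]

lemma Arc.chain_map (A : Arc) (o : Vertex) (i : ℕ) :
    (A.map f).chain (f o) i = f (A.chain o i) := by grind [Arc.chain, Arc.map, List.getD_map]

lemma Kept.chain (h : Kept t o v A b U T P) (i : ℕ) : A.chain o i ∈ U ∧ A.chain o i ∉ T := by
  grind [List.mem_of_mem_tail, A.chain_mem, h.inner, h.endRoot, h.hub]

lemma Kept.tip (h : Kept t o v A b U T P) : A.tip o ∈ U ∧ A.tip o ∉ T := by
  grind [A.tip_mem, h.inner, h.hub]

lemma Kept.last (h : Kept t o v A b U T P) : A.last o ∈ U ∧ A.last o ∉ T := by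
  grind [A.last_mem, h.inner, h.hub]

lemma GoodSite.sim (hs : GoodSite C ε t o v A b) (h : Sim C C' f U T P e₂ e₃)
    (hk : Kept t o v A b U T P) (hcard : ∀ Z ∈ C'.face 2, 3 ≤ Z.card) :
    GoodSite C' ε t (f o) (f v) (A.map f) (f b) := by
  constructor
  · refine h.rootOK hs.root hk.root ?_; simp [hk.hub, hk.start, hk.endRoot]
  · intro x hx; obtain ⟨y, hy, rfl⟩ := List.mem_map.1 hx
    grind [h.keep₀, hk.inner, hs.inner, h.apart, hk.apart, hk.hub]
  · intro hne; have hne' : A.inner ≠ [] := by grind [Arc.map]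
    rw [Arc.tip_map]
    refine h.toothOK (hs.tooth hne') (h.mono _ _ ?_ (hk.side hne')) (hk.side hne') ?_
    all_goals grind [hk.hub, hk.start, hk.endRoot, hk.tip]
  · intro hf hl; have hl' : 2 ≤ A.inner.length := by grind [Arc.map]
    rw [Arc.tip_map, Arc.last_map]
    exact h.flipOK (hs.flip hf hl') (hk.flip hf hl').1 (hk.flip hf hl').2
      (by simp [hk.start, hk.endRoot, hk.tip, hk.last])
  · intro hf; obtain ⟨h1, h2, h3⟩ := hs.fillet hf
    refine ⟨by grind [Arc.map], h.keep₀ b (hk.nextTip hf).1 h2, ?_⟩; rw [Arc.tip_map]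
    have := h.filletOK h3 (hk.near hf) (hk.far hf) (hk.one hf) hcard hk.start (hk.nextTip hf)
      hk.tip fun i _ _ => hk.chain i
    exact this.congr fun i _ _ => (A.chain_map o i).symm

end Kept

/-- The properties of the faces around an arc that starts at `v`, where `nx` is the next arc. -/
structure GoodArc (C : Cx Vertex) (ε t : ℕ) (o v : Vertex) (A : Arc) (nx : Option Arc) : Prop where
  site : GoodSite C ε t o v A ((nx.bind fun A' => A'.inner.head?).getD v)
  next : A.fillet = true → ∃ A' b, nx = some A' ∧ A'.inner.head? = some b ∧
    FilletEnd C b (A.chain o) t A'.root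

/-- A property holds for every arc in a list, where the first arc starts at `v`. -/
def Along (P : Vertex → Arc → Option Arc → Prop) : Vertex → List Arc → Prop
  | _, [] => True
  | v, A :: L => P v A L.head? ∧ Along P A.root L

/-- The starts and ends of the arcs. -/
def rootPairs : Vertex → List Arc → List (Vertex × Vertex)
  | _, [] => []
  | v, A :: L => (v, A.root) :: rootPairs A.root L

/-- The end of a list of arcs. -/
def endRoot (v : Vertex) (L : List Arc) : Vertex := (L.map Arc.root).getLastD v

/-- The profile without the hub. -/
def profile (v : Vertex) (L : List Arc) : List Vertex := v :: L.flatMap fun A => A.inner ++ [A.root]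

/-- The invariants of the construction; `ε` is `0` for a disc and `1` for a ball. -/
structure Good (ε t : ℕ) (B : Ball) : Prop where
  frame : Frame B.cx
  nodup : (B.hub :: profile B.secondRoot B.arcs).Nodup
  cover : ∀ x, {x} ∈ B.cx.face 0 → B.cx.OnBd {x} ∨ ε = 0 ∧
    (x = B.hub ∨ x = B.secondRoot ∨ ∃ A ∈ B.arcs, x = A.root ∨ A.inner.head? = some x)
  hub : ∀ Z ∈ B.cx.face 2, B.hub ∈ Z → B.cx.nfac Z = 1 →
    Z = {B.hub, B.secondRoot, endRoot B.secondRoot B.arcs} ∨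
    ∃ p ∈ rootPairs B.secondRoot B.arcs, Z = {B.hub, p.1, p.2}
  along : Along (GoodArc B.cx ε t B.hub) B.secondRoot B.arcs
  pos : 1 ≤ t
  dim : ε = if t = 1 then 0 else 1

section Map

variable {f : Vertex → Vertex}

lemma Along.map {P Q : Vertex → Arc → Option Arc → Prop}
    (hPQ : ∀ v A nx, P v A nx → Q (f v) (A.map f) (nx.map (Arc.map f))) :
    ∀ {L : List Arc} {v : Vertex}, Along P v L → Along Q (f v) (L.map (Arc.map f))
  | [], _, _ => trivial
  | A :: L, v, h => by
    refine ⟨?_, Along.map hPQ h.2⟩; have := hPQ v A L.head? h.1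
    rwa [← List.head?_map] at this

lemma rootPairs_map : ∀ (v : Vertex) (L : List Arc),
    rootPairs (f v) (L.map (Arc.map f)) = (rootPairs v L).map (Prod.map f f)
  | _, [] => rfl
  | v, A :: L => by
    have := rootPairs_map A.root L; simp only [List.map_cons, rootPairs, Prod.map]; rw [← this]; rfl

lemma endRoot_cons (v : Vertex) (A : Arc) (L : List Arc) :
    endRoot v (A :: L) = endRoot A.root L := by grind [endRoot, List.getLastD_cons]

lemma endRoot_map : ∀ (v : Vertex) (L : List Arc),
    endRoot (f v) (L.map (Arc.map f)) = f (endRoot v L)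
  | _, [] => rfl
  | v, A :: L => by rw [List.map_cons, endRoot_cons, endRoot_cons, ← endRoot_map]; rfl

lemma profile_map (v : Vertex) (L : List Arc) :
    profile (f v) (L.map (Arc.map f)) = (profile v L).map f := by
  simp [profile, List.flatMap_map, List.map_flatMap, Arc.map]

lemma mem_map_face {C : Cx Vertex} : Z ∈ (C.map f).face k ↔ ∃ W ∈ C.face k, W.image f = Z := by
  simp [Cx.map]

/-- Renaming the vertices of a complex. -/
lemma sim_map (hf : f.Injective) (C : Cx Vertex) :
    Sim C (C.map f) f Set.univ ∅ (fun _ => True) (image f) (image f) := by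
  refine ⟨hf.injOn, fun _ _ _ _ => trivial, by simp, by simp, ?_, ?_, ?_, ?_, ?_, ?_, ?_, ?_, ?_, ?_, ?_⟩
  all_goals grind [S, mem_map_face, image_subset_image]

lemma nfac_map (hf : f.Injective) (C : Cx Vertex) (S : Finset Vertex) :
    (C.map f).nfac (S.image f) = C.nfac S :=
  (sim_map hf C).nfac_set trivial (by simp)

lemma Frame.map (hf : f.Injective) {C : Cx Vertex} (h : Frame C) : Frame (C.map f) := by
  have hc : ∀ W : Finset Vertex, (W.image f).card = W.card := fun W => card_image_of_injective W hf
  have hs : ∀ k, (∀ Z ∈ C.face k, ∀ x ∈ Z, {x} ∈ C.face 0) →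
      ∀ Z ∈ (C.map f).face k, ∀ x ∈ Z, {x} ∈ (C.map f).face 0 := by
    grind [mem_map_face]
  refine ⟨?_, hs 1 h.sub₁, hs 2 h.sub₂, hs 3 h.sub₃, ?_, ?_, ?_, ?_⟩
  · intro Z hZ; obtain ⟨W, hW, rfl⟩ := mem_map_face.1 hZ; obtain ⟨x, rfl⟩ := h.zero W hW
    exact ⟨f x, by simp⟩
  · grind [mem_map_face, h.card₁]
  · intro Z hZ; obtain ⟨W, hW, rfl⟩ := mem_map_face.1 hZ; rw [hc]; exact h.card₂ W hW
  · intro Z hZ; obtain ⟨W, hW, rfl⟩ := mem_map_face.1 hZ; rw [hc]; exact h.card₃ W hW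
  grind [mem_map_face, image_subset_image_iff, h.anti]

lemma onBd_map (hf : f.Injective) {C : Cx Vertex} (h : C.OnBd S) : (C.map f).OnBd (S.image f) := by
  obtain ⟨T, hT, hn, hs⟩ := h
  exact ⟨T.image f, mem_map_face.2 ⟨T, hT, rfl⟩, by rw [nfac_map hf, hn], image_subset_image hs⟩

lemma GoodArc.map (hf : f.Injective) {C : Cx Vertex} (hC : Frame C) {ε t : ℕ} {o v : Vertex}
    {A : Arc} {nx : Option Arc} (ht : 1 ≤ t) (h : GoodArc C ε t o v A nx) :
    GoodArc (C.map f) ε t (f o) (f v) (A.map f) (nx.map (Arc.map f)) := by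
  have hsim := sim_map hf C
  have he : ((nx.map (Arc.map f)).bind fun A' => A'.inner.head?).getD (f v) =
      f ((nx.bind fun A' => A'.inner.head?).getD v) := by
    cases nx with
    | none => rfl
    | some A' =>
      simp only [Option.map_some, Option.bind_some, Arc.map]
      cases A'.inner <;> simp
  constructor
  · rw [he]
    exact h.site.sim hsim ⟨by simp, by simp, by simp, by simp, by simp, by simp, by simp, by simp,
      by simp, by simp, by simp, by simp⟩ (Frame.map hf hC).card₂
  · intro h1; obtain ⟨A', b, rfl, h3, h4⟩ := h.next h1
    refine ⟨A'.map f, f b, rfl, by simp [Arc.map, h3], ?_⟩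
    have := hsim.filletEnd h4 trivial (by simp) (by simp) (by simp) ht
    exact this.congr ht fun i _ _ => (A.chain_map o i).symm

lemma Good.map (hf : f.Injective) {ε t : ℕ} {B : Ball} (h : Good ε t B) : Good ε t (B.map f) := by
  have harcs : (B.map f).arcs = B.arcs.map (Arc.map f) := rfl
  refine ⟨h.frame.map hf, ?_, ?_, ?_, ?_, h.pos, h.dim⟩
  · have := h.nodup.map hf; rw [List.map_cons, ← profile_map] at this; exact this
  · intro x hx; obtain ⟨W, hW, he⟩ := mem_map_face.1 hx; obtain ⟨y, rfl⟩ := h.frame.zero W hW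
    rw [image_singleton, singleton_inj] at he; subst he
    refine (h.cover y hW).imp (fun h1 => ?_) (And.imp_right ?_)
    · have := onBd_map hf h1; rw [image_singleton] at this; exact this
    · rintro (rfl | rfl | ⟨A, hA, h1⟩)
      · exact .inl rfl
      · exact .inr (.inl rfl)
      · refine .inr (.inr ⟨A.map f, List.mem_map_of_mem hA, ?_⟩); rcases h1 with rfl | h1
        · exact .inl rfl
        · right; simp [Arc.map, h1]
  · intro Z hZ ho hn; obtain ⟨W, hW, rfl⟩ := mem_map_face.1 hZ; change f B.hub ∈ _ at ho
    rw [hf.mem_finset_image] at ho; rw [show (B.map f).cx = B.cx.map f from rfl, nfac_map hf] at hn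
    rw [harcs]; change _ = {f B.hub, f B.secondRoot, endRoot (f B.secondRoot) _} ∨
      ∃ p ∈ rootPairs (f B.secondRoot) _, _ = {f B.hub, p.1, p.2}
    rw [endRoot_map, rootPairs_map]; rcases h.hub W hW ho hn with rfl | ⟨p, hp, rfl⟩
    · grind
    · right; exact ⟨_, List.mem_map_of_mem hp, by grind⟩
  · exact h.along.map (f := f) fun v A nx hA => hA.map hf h.frame h.pos

end Map


lemma Along.append {P : Vertex → Arc → Option Arc → Prop}
    (hP : ∀ v A nx, P v A none → P v A nx) : ∀ {L L' : List Arc} {v : Vertex}, Along P v L →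
      Along P (endRoot v L) L' → Along P v (L ++ L')
  | [], _, _, _, h' => h'
  | A :: L, L', v, h, h' => by
    rw [endRoot_cons] at h'; refine ⟨?_, Along.append hP h.2 h'⟩
    cases L with
    | nil => exact hP v A _ h.1
    | cons A' L => exact h.1

lemma GoodSite.of_not_fillet {C : Cx Vertex} {ε t : ℕ} {o v b b' : Vertex} {A : Arc}
    (h : GoodSite C ε t o v A b) (hf : A.fillet = false) : GoodSite C ε t o v A b' :=
  ⟨h.root, h.inner, h.tooth, h.flip, fun h' => by grind⟩

lemma GoodArc.of_none {C : Cx Vertex} {ε t : ℕ} {o v : Vertex} {A : Arc} (nx : Option Arc)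
    (h : GoodArc C ε t o v A none) : GoodArc C ε t o v A nx := by
  have hf : A.fillet = false := by
    by_contra hf; obtain ⟨A', b, h1, -⟩ := h.next (by grind); simp at h1
  exact ⟨h.site.of_not_fillet hf, fun h' => by grind⟩

lemma endRoot_append (v : Vertex) (L L' : List Arc) :
    endRoot v (L ++ L') = endRoot (endRoot v L) L' := by
  induction L generalizing v with
  | nil => rfl
  | cons A L ih => grind [endRoot_cons]

lemma rootPairs_append (v : Vertex) (L L' : List Arc) :
    rootPairs v (L ++ L') = rootPairs v L ++ rootPairs (endRoot v L) L' := by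
  induction L generalizing v with
  | nil => rfl
  | cons A L ih => grind [endRoot_cons, rootPairs]

/-- The `k`-th root, where the list of arcs starts at the root `v`. -/
def rootAt (v : Vertex) (L : List Arc) (k : ℕ) : Vertex := (v :: L.map Arc.root).getD k v

lemma rootAt_zero (v : Vertex) (L : List Arc) : rootAt v L 0 = v := rfl

lemma rootAt_succ {v : Vertex} {L : List Arc} {A : Arc} (h : L[k]? = some A) :
    rootAt v L (k + 1) = A.root := by
  simp [rootAt, h]

lemma rootAt_cons_succ (v : Vertex) (A : Arc) (L : List Arc) (hk : k ≤ L.length) :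
    rootAt v (A :: L) (k + 1) = rootAt A.root L k := by
  grind [rootAt, List.getD_cons_succ, List.getD_eq_getElem]

lemma rootAt_length (v : Vertex) (L : List Arc) : rootAt v L L.length = endRoot v L := by
  induction L generalizing v with
  | nil => rfl
  | cons A L ih => grind [List.length_cons, rootAt_cons_succ, le_rfl, endRoot_cons]

lemma Along.get {P : Vertex → Arc → Option Arc → Prop} : ∀ {L : List Arc} {v : Vertex},
    Along P v L → ∀ {k : ℕ} {A : Arc}, L[k]? = some A → P (rootAt v L k) A L[k + 1]?
  | [], _, _, _, _, h => by simp at h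
  | A :: L, v, h, 0, A', hA => by
    simp only [List.getElem?_cons_zero, Option.some.injEq] at hA; subst hA; have := h.1
    grind [List.head?_eq_getElem?, rootAt_zero]
  | A :: L, v, h, k + 1, A', hA => by
    rw [List.getElem?_cons_succ] at hA; have hk : k < L.length := (List.getElem?_eq_some_iff.1 hA).1
    rw [rootAt_cons_succ _ _ _ hk.le, List.getElem?_cons_succ]; exact h.2.get hA

lemma mem_rootPairs : ∀ {L : List Arc} {v : Vertex} {p : Vertex × Vertex}, p ∈ rootPairs v L ↔
    ∃ k < L.length, p = (rootAt v L k, rootAt v L (k + 1))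
  | [], v, p => by simp [rootPairs]
  | A :: L, v, p => by
    rw [rootPairs, List.mem_cons, mem_rootPairs]; constructor
    · rintro (rfl | ⟨k, hk, rfl⟩)
      · exact ⟨0, by simp, by grind [rootAt_zero, rootAt_succ]⟩
      · exact ⟨k + 1, by grind, by grind [rootAt_cons_succ]⟩
    grind [rootAt_zero, rootAt_succ, List.length_cons, Nat.succ_lt_succ_iff, rootAt_cons_succ]

section Profile

variable {v : Vertex} {L : List Arc}

lemma rootAt_mem_tail (h1 : 1 ≤ k) (h2 : k ≤ L.length) :
    ∃ A, L[k - 1]? = some A ∧ rootAt v L k = A.root := by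
  have : k - 1 < L.length := by omega
  refine ⟨L[k - 1], List.getElem?_eq_getElem this, ?_⟩
  have h3 := rootAt_succ (v := v) (List.getElem?_eq_getElem this)
  rwa [show k - 1 + 1 = k by omega] at h3

lemma rootAt_mem_profile (h : k ≤ L.length) : rootAt v L k ∈ profile v L := by
  rcases Nat.eq_zero_or_pos k with rfl | h1
  · simp [rootAt_zero, profile]
  · obtain ⟨A, hA, he⟩ := rootAt_mem_tail (v := v) h1 h
    rw [he, profile, List.mem_cons, List.mem_flatMap]; grind

lemma inner_mem_profile {A : Arc} (h : A ∈ L) (hx : x ∈ A.inner) :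
    x ∈ profile v L := by grind [profile]

lemma bodies_disjoint (h : (profile v L).Nodup) {k' : ℕ} {A A' : Arc} (hA : L[k]? = some A)
    (hA' : L[k']? = some A') (hx : x ∈ A.inner ++ [A.root])
    (hx' : x ∈ A'.inner ++ [A'.root]) : k = k' := by
  rw [profile, List.nodup_cons, List.nodup_flatMap, List.pairwise_iff_getElem] at h
  obtain ⟨hk, rfl⟩ := List.getElem?_eq_some_iff.1 hA
  obtain ⟨hk', rfl⟩ := List.getElem?_eq_some_iff.1 hA'
  rcases lt_trichotomy k k' with h1 | h1 | h1
  · exact (h.2.2 k k' hk hk' h1 hx hx').elim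
  · exact h1
  · exact (h.2.2 k' k hk' hk h1 hx' hx).elim

lemma rootAt_inj (h : (profile v L).Nodup) {k' : ℕ} (hk : k ≤ L.length) (hk' : k' ≤ L.length)
    (he : rootAt v L k = rootAt v L k') : k = k' := by
  have hv : ∀ j, 1 ≤ j → j ≤ L.length → rootAt v L j ≠ v := by
    intro j h1 h2 h3; obtain ⟨A, hA, h4⟩ := rootAt_mem_tail (v := v) h1 h2
    grind [profile, List.nodup_cons, List.mem_of_getElem?, List.mem_append_right,
      List.mem_singleton]
  rcases Nat.eq_zero_or_pos k with rfl | h1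
  · rcases Nat.eq_zero_or_pos k' with rfl | h2
    · rfl
    · exact (hv k' h2 hk' he.symm).elim
  · rcases Nat.eq_zero_or_pos k' with rfl | h2
    · exact (hv k h1 hk he).elim
    · obtain ⟨A, hA, h3⟩ := rootAt_mem_tail (v := v) h1 hk
      obtain ⟨A', hA', h4⟩ := rootAt_mem_tail (v := v) h2 hk'
      have := bodies_disjoint h hA hA' (x := A.root) (by simp) (by grind); omega

lemma rootAt_notMem_inner (h : (profile v L).Nodup) (hk : k ≤ L.length) {A : Arc}
    (hA : A ∈ L) : rootAt v L k ∉ A.inner := by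
  intro hx
  obtain ⟨k', hA'⟩ := List.mem_iff_getElem?.1 hA
  rcases Nat.eq_zero_or_pos k with rfl | h1
  · grind [profile, List.nodup_cons, rootAt_zero]
  · obtain ⟨A', hA₁, h3⟩ := rootAt_mem_tail (v := v) h1 hk; rw [h3] at hx
    have := bodies_disjoint h hA₁ hA' (x := A'.root) (by simp) (by simp [hx])
    grind [profile, List.nodup_cons, List.nodup_flatMap, List.nodup_append]

lemma inner_disjoint (h : (profile v L).Nodup) {k' : ℕ} {A A' : Arc} (hA : L[k]? = some A)
    (hA' : L[k']? = some A') (hx : x ∈ A.inner) (hx' : x ∈ A'.inner) : k = k' :=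
  bodies_disjoint h hA hA' (List.mem_append_left _ hx) (List.mem_append_left _ hx')

lemma inner_nodup (h : (profile v L).Nodup) {A : Arc} (hA : A ∈ L) : A.inner.Nodup := by
  grind [profile, List.nodup_cons, List.nodup_flatMap, List.nodup_append]

end Profile

lemma mem_sites_zipIdx {p : Site × ℕ} : ∀ {L : List Arc} {v : Vertex} {j : ℕ},
    p ∈ (sites v L).zipIdx j ↔ ∃ k, p.2 = j + k ∧ L[k]? = some p.1.arc ∧
      p.1.start = rootAt v L k ∧ p.1.nextTip =
        ((L[k + 1]?.bind fun A' => A'.inner.head?).getD (rootAt v L k))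
  | [], v, j => by simp [sites]
  | A :: L, v, j => by
    rw [sites, List.zipIdx_cons, List.mem_cons, mem_sites_zipIdx]; constructor
    · rintro (rfl | ⟨k, h1, h2, h3, h4⟩)
      · grind [rootAt_zero, List.head?_eq_getElem?]
      · have hk : k < L.length := (List.getElem?_eq_some_iff.1 h2).1
        refine ⟨k + 1, by omega, by grind, ?_, ?_⟩
        all_goals grind [rootAt_cons_succ, List.getElem?_cons_succ]
    · rintro ⟨k, h1, h2, h3, h4⟩
      cases k with
      | zero =>
        left; obtain ⟨⟨s, A', b⟩, m⟩ := p
        grind [List.getElem?_cons_zero, Option.some.injEq, zero_add, List.getElem?_cons_succ,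
          rootAt_zero, List.head?_eq_getElem?]
      | succ k => grind [List.getElem?_cons_succ, List.getElem?_eq_some_iff, rootAt_cons_succ]

section Cap

variable {M : Ball} {ε τ n : ℕ} {g : Sym → Vertex} {Fr : Set Vertex}

/-- There is a tooth of `M` on the roots `αᵢ₊₁, αᵢ`. -/
def HasTooth (M : Ball) (n i : ℕ) : Prop := ∃ A, M.arcs[n - 2 - i]? = some A ∧ A.inner ≠ []

/-- The names of the vertices of `M` in a round. -/
structure Named (M : Ball) (n : ℕ) (g : Sym → Vertex) (Fr : Set Vertex) : Prop where
  len : M.arcs.length + 2 = n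
  three : 3 ≤ n
  hub : g .b = M.hub
  α : ∀ i, 1 ≤ i → i < n → g (.α i) = rootAt M.secondRoot M.arcs (n - 1 - i)
  β : ∀ i A, 1 ≤ i → i + 1 < n → M.arcs[n - 2 - i]? = some A → A.inner ≠ [] →
    A.inner.head? = some (g (.β i))
  gap : ∀ i A, 1 ≤ i → i + 1 < n → M.arcs[n - 2 - i]? = some A → A.inner = [] →
    {g (.β i)} ∉ M.cx.face 0
  fr : ∀ x, {x} ∈ M.cx.face 0 → x = g .b ∨ x ∈ Fr

lemma Good.site (h : Good ε τ M) {A : Arc} (hA : M.arcs[k]? = some A) :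
    GoodSite M.cx ε τ M.hub (rootAt M.secondRoot M.arcs k) A
      ((M.arcs[k + 1]?.bind fun A' => A'.inner.head?).getD (rootAt M.secondRoot M.arcs k)) :=
  (h.along.get hA).site

lemma Named.arc (h : Named M n g Fr) (h1 : 1 ≤ i) (h2 : i + 1 < n) :
    ∃ A, M.arcs[n - 2 - i]? = some A ∧ rootAt M.secondRoot M.arcs (n - 2 - i) = g (.α (i + 1)) ∧
      A.root = g (.α i) := by
  have := h.len
  have hk : n - 2 - i < M.arcs.length := by omega
  refine ⟨M.arcs[n - 2 - i], List.getElem?_eq_getElem hk, ?_, ?_⟩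
  · grind [h.α]
  · rw [h.α i h1 (by omega), ← rootAt_succ (v := M.secondRoot) (List.getElem?_eq_getElem hk)]
    congr 1; omega

lemma tip_of_head {A : Arc} {o : Vertex} (h : A.inner.head? = some x) : A.tip o = x := by
  grind [Arc.tip]

lemma Good.cap (h : Good ε τ M) (hn : Named M n g Fr) : Cap M.cx n g Fr ε (HasTooth M n) := by
  have hlen := hn.len
  have h3 := hn.three
  have hsite : ∀ i, 1 ≤ i → i + 1 < n → ∃ A b, M.arcs[n - 2 - i]? = some A ∧ A.root = g (.α i) ∧
      GoodSite M.cx ε τ (g .b) (g (.α (i + 1))) A b := by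
    intro i h1 h2; obtain ⟨A, hA, h4, h5⟩ := hn.arc h1 h2; have := h.site hA; grind [hn.hub]
  have hroot : ∀ i, 1 ≤ i → i + 1 < n → RootOK M.cx ε (g .b) (g (.α (i + 1))) (g (.α i)) := by
    intro i h1 h2; obtain ⟨A, b, -, h5, h6⟩ := hsite i h1 h2; rw [← h5]; exact h6.root
  have htooth : ∀ i, 1 ≤ i → i + 1 < n → HasTooth M n i →
      ToothOK M.cx ε (g .b) (g (.α (i + 1))) (g (.β i)) (g (.α i)) ∧ {g (.β i)} ∈ M.cx.face 0 ∧
        Apart M.cx (g .b) (g (.β i)) := by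
    rintro i h1 h2 ⟨A', hA', hne⟩; obtain ⟨A, b, hA, h5, h6⟩ := hsite i h1 h2
    grind [tip_of_head, List.mem_of_head?, hn.β, h6.tooth, h6.inner]
  have hgap : ∀ i, 1 ≤ i → i + 1 < n → ¬ HasTooth M n i → {g (.β i)} ∉ M.cx.face 0 := by
    intro i h1 h2 h4; obtain ⟨A, b, hA, -⟩ := hsite i h1 h2
    exact hn.gap i A h1 h2 hA (by by_contra hne; exact h4 ⟨A, hA, hne⟩)
  refine ⟨?_, ?_, ?_, ?_, h.frame.zero, h.frame.card₁, h.frame.card₂, h.frame.anti, ?_, ?_, ?_,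
    ?_, ?_, ?_, ?_, ?_, ?_, ?_, ?_, ?_, ?_, ?_, ?_, ?_, ?_, ?_⟩
  · grind [h.frame.zero, hn.fr]
  · grind [hn.fr, h.frame.sub₁]
  · grind [hn.fr, h.frame.sub₂]
  · grind [hn.fr, h.frame.sub₃]
  · exact (hroot 1 le_rfl (by omega)).vo
  · intro i h1 h2; by_cases h4 : i + 1 < n
    · exact (hroot i h1 h4).vy
    · have := (hroot (i - 1) (by omega) (by omega)).vx; grind
  · grind
  · grind [h.frame.zero]
  · grind [h.frame.sub₁]
  · grind [h.frame.sub₂]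
  · grind [h.frame.sub₃]
  · intro i h1 h2; by_cases h4 : i + 1 < n
    · exact (hroot i h1 h4).oy
    · have := (hroot (i - 1) (by omega) (by omega)).ox; grind
  · exact fun i h1 h2 => (hroot i h1 h2).xy
  · exact fun i h1 h2 h4 => (htooth i h1 h2 h4).1.xb
  · exact fun i h1 h2 h4 => (htooth i h1 h2 h4).1.yb
  · exact fun i h1 h2 => (hroot i h1 h2).tri
  · exact fun i h1 h2 h4 => (htooth i h1 h2 h4).1.tri
  · exact fun i h1 h2 => (hroot i h1 h2).fac
  · exact fun i h1 h2 h4 => (htooth i h1 h2 h4).1.fac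
  · intro i h1 h2 Z hZ hs; have hc := h.frame.card₂ Z hZ
    have key : ∀ x y z : Vertex, Z ⊆ {x, y, z} → Z = {x, y, z} := fun x y z hs' =>
      eq_of_subset_of_card_le hs' (card_le_three.trans hc)
    by_cases hβ : g (.β i) ∈ Z
    · right; have ht : HasTooth M n i := by grind [h.frame.sub₂]
      refine ⟨ht, key _ _ _ fun x hx => ?_⟩; have := hs hx
      simp only [mem_insert, mem_singleton] at this ⊢; refine this.resolve_left ?_
      rintro rfl; exact (htooth i h1 h2 ht).2.2.e2 Z hZ (Host.sub_pair.2 ⟨hx, hβ⟩)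
    grind
  · intro i h1 h2 Z hZ hs hf; have hno := h.nodup; rw [List.nodup_cons] at hno
    rw [Host.sub_pair, hn.hub] at hs; have hα := hn.α i (by omega) (by omega)
    have hne : ∀ k, k ≤ M.arcs.length → rootAt M.secondRoot M.arcs k ≠ M.hub := by
      grind [rootAt_mem_profile]
    have hinj := fun k k' => rootAt_inj (k := k) (k' := k') hno.2
    rcases h.hub Z hZ hs.1 hf with rfl | ⟨p, hp, rfl⟩
    · exfalso; have h4 := hs.2; rw [hα, ← rootAt_length, ← rootAt_zero M.secondRoot M.arcs] at h4
      simp only [mem_insert, mem_singleton] at h4; rcases h4 with h4 | h4 | h4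
      · exact hne _ (by omega) h4
      · have := hinj _ _ (by omega) (by omega) h4; omega
      · have := hinj _ _ (by omega) (by omega) h4; omega
    · obtain ⟨k, hk, rfl⟩ := mem_rootPairs.1 hp; have h4 := hs.2; rw [hα] at h4
      simp only [mem_insert, mem_singleton] at h4; rcases h4 with h4 | h4 | h4
      · grind
      · obtain rfl := hinj _ _ (by omega) (by omega) h4; grind [hn.hub, hn.α]
      · have := hinj _ _ (by omega) (by omega) h4; left
        rw [hn.hub, hα, hn.α (i + 1) (by omega) (by omega), this, show n - 1 - (i + 1) = k by omega]
  · exact fun i h1 h2 h4 => (htooth i h1 h2 h4).1.free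

lemma Good.capFillet (h : Good ε τ M) (hn : Named M n g Fr) (h1 : 1 ≤ i) (h2 : i + 1 < n)
    {A : Arc} (hA : M.arcs[n - 2 - i]? = some A) (hf : A.fillet = true) {d : ℕ → Vertex}
    (hd : ∀ j, 1 ≤ j → j ≤ τ → d j = A.chain M.hub j) (hd' : d (τ + 1) = g (.c i))
    (hne : ∀ x ∈ A.inner.tail, ∀ s, x ≠ g s) :
    CapFillet M.cx n g Fr ε (HasTooth M n) i d τ := by
  have hlen := hn.len
  have hp := h.pos
  have hga := h.along.get hA
  obtain ⟨A', b, hA', hb, hE⟩ := hga.next hf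
  have hk : n - 2 - i + 1 < M.arcs.length := (List.getElem?_eq_some_iff.1 hA').1
  have hi : 2 ≤ i := by omega
  have he : n - 2 - i + 1 = n - 2 - (i - 1) := by omega
  rw [he] at hA'
  have hb' := hn.β (i - 1) A' (by omega) (by omega) hA' (by grind)
  obtain rfl : b = g (.β (i - 1)) := by grind
  obtain ⟨h3, h4, h5⟩ := hga.site.fillet hf
  rw [he, hA', Option.bind_some, hb, Option.getD_some] at h4 h5
  have hAne : A.inner ≠ [] := by grind
  have hβ := hn.β i A h1 h2 hA hAne
  rw [tip_of_head hβ] at h5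
  obtain ⟨A₁, hA₁, h6, h7⟩ := hn.arc h1 h2
  obtain rfl : A₁ = A := by grind
  obtain ⟨A₂, hA₂, h8, h9⟩ := hn.arc (i := i - 1) (by omega) (by omega)
  obtain rfl : A₂ = A' := by grind
  have hlast : A₁.chain M.hub τ = A₁.root := by
    grind [Arc.chain, List.getD_eq_getElem, List.getElem_append_right]
  have hin : ∀ j, 1 ≤ j → j < τ → A₁.chain M.hub j ∈ A₁.inner.tail := by
    grind [Arc.chain, List.getD_eq_getElem, List.getElem_append_left, List.getElem_mem]
  refine ⟨hi, h2, ⟨A₁, hA, hAne⟩, ⟨A₂, hA', by grind⟩, hp, ?_, ?_, ?_, hd', ?_, ?_, ?_⟩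
  · rw [← h6]; exact h5.congr fun j h10 h11 => (hd j h10 h11).symm
  · rw [← h9]; exact hE.congr hp fun j h10 h11 => (hd j h10 h11).symm
  · grind
  · grind [List.mem_of_mem_tail, hn.fr, hga.site.inner]
  · intro h10; rw [h.dim, if_pos h10]
  · intro h10; rw [h.dim, if_neg (by omega)]

end Cap


lemma Round.step4_congr {r r' : Round} (C : Cx Vertex) (hn : r.n = r'.n) (hb : r.b = r'.b)
    (hc : ∀ i, 1 ≤ i → i ≤ r.n → r.c i = r'.c i) (hα : ∀ i, 1 ≤ i → i < r.n → r.α i = r'.α i)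
    (hβ : ∀ i, 1 ≤ i → i + 1 < r.n → r.β i = r'.β i) : r.step4 C = r'.step4 C := by
  have hI : ∀ i ∈ Icc 1 (r.n - 1), 1 ≤ i ∧ i < r.n := by grind
  have hc' : ∀ i ∈ Icc 1 (r.n - 1), r.c i = r'.c i := fun i hi =>
    hc i (hI i hi).1 (hI i hi).2.le
  have hc'' : ∀ i ∈ Icc 1 (r.n - 1), r.c (i + 1) = r'.c (i + 1) := fun i hi =>
    hc _ (by omega) (hI i hi).2
  have htop : ∀ i ∈ Icc 1 (r.n - 1), r.topTriangle i = r'.topTriangle i := by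
    grind [Round.topTriangle]
  have hY : ∀ i ∈ Icc 1 (r.n - 1), ∀ Y, r.IsY C i Y ↔ r'.IsY C i Y := by grind [Round.IsY]
  have hZ : ∀ i ∈ Icc 1 (r.n - 1), ∀ Z, r.IsZ C i Z ↔ r'.IsZ C i Z := by grind [Round.IsZ]
  have hnv : ∀ i ∈ Icc 1 (r.n - 1), r.newVertices i = r'.newVertices i := by
    grind [Round.newVertices]
  have hnt : ∀ i ∈ Icc 1 (r.n - 1), r.newTriangles i = r'.newTriangles i := by
    grind [Round.newTriangles]
  have e1 : (Icc 1 (r.n - 1)).image (fun i => ({r.b, r.c i} : Finset Vertex)) =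
      (Icc 1 (r'.n - 1)).image (fun i => {r'.b, r'.c i}) := by grind
  have e2 : (Icc 1 (r.n - 1)).image r.topTriangle =
      (Icc 1 (r'.n - 1)).image r'.topTriangle := by grind
  have e3 : ∀ Z, ((Icc 1 (r.n - 1)).filter fun i => r.IsZ C i Z).image r.α =
      ((Icc 1 (r'.n - 1)).filter fun i => r'.IsZ C i Z).image r'.α := by grind
  have e4 : ∀ Y, ((Icc 1 (r.n - 1)).filter fun i => r.IsY C i Y).biUnion r.newVertices =
      ((Icc 1 (r'.n - 1)).filter fun i => r'.IsY C i Y).biUnion r'.newVertices := by grind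
  have e5 : (Icc 1 (r.n - 1)).biUnion r.newTriangles =
      (Icc 1 (r'.n - 1)).biUnion r'.newTriangles := by grind
  unfold Round.step4
  simp only [e1, e2, e3, e4, e5]

lemma Round.step3_congr {r r' : Round} (C : Cx Vertex) (hn : r.n = r'.n) (ho : r.o = r'.o)
    (hb' : r.b' = r'.b') (hc : ∀ i, 1 ≤ i → i ≤ r.n → r.c i = r'.c i) :
    r.step3 C = r'.step3 C := by
  unfold Round.step3
  rw [← hn, ho, hb']
  congr 2
  grind

/-- The function of symbolic names with prescribed values. -/
def symFun (n : ℕ) (o a b b' : Vertex) (c α β : ℕ → Vertex) : Sym → Vertex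
  | .o => o
  | .a => a
  | .b => b
  | .b' => b'
  | .c i => if 1 ≤ i ∧ i ≤ n then c i else Vertex.c i
  | .α i => if 1 ≤ i ∧ i < n then α i else Vertex.a i
  | .β i => if 1 ≤ i ∧ i + 1 < n then β i else Vertex.b i

/-- The new vertices in the `j`-th round. -/
def freshAt (j : ℕ) : Set Vertex :=
  {x | (∃ u, x = copy j u) ∨ (∃ i, x = extra j i) ∨ (∃ i, x = Vertex.a i) ∨ ∃ i, x = Vertex.b i}

section Names

variable {n : ℕ} {o a b b' : Vertex} {c α β : ℕ → Vertex}

lemma symFun_inj (ho : ∃ u, o = old u) (ha : ∃ u, a = old u) (hb : ∃ u, b = old u)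
    (hb' : ∃ u, b' = old u) (hc : ∀ i, 1 ≤ i → i ≤ n → ∃ u, c i = old u)
    (hα : ∀ i, 1 ≤ i → i < n → ∃ u, α i = copy j u)
    (hβ : ∀ i, 1 ≤ i → i + 1 < n → (∃ u, β i = copy j u) ∨ ∃ k, β i = extra j k)
    (hoa : o ≠ a) (hob : o ≠ b) (hob' : o ≠ b') (hab : a ≠ b) (hab' : a ≠ b') (hbb' : b ≠ b')
    (hco : ∀ i, 1 ≤ i → i ≤ n → c i ≠ o ∧ c i ≠ a ∧ c i ≠ b ∧ c i ≠ b')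
    (hcc : ∀ i i', 1 ≤ i → i ≤ n → 1 ≤ i' → i' ≤ n → c i = c i' → i = i')
    (hαα : ∀ i i', 1 ≤ i → i < n → 1 ≤ i' → i' < n → α i = α i' → i = i')
    (hββ : ∀ i i', 1 ≤ i → i + 1 < n → 1 ≤ i' → i' + 1 < n → β i = β i' → i = i')
    (hαβ : ∀ i i', 1 ≤ i → i < n → 1 ≤ i' → i' + 1 < n → α i ≠ β i') :
    (symFun n o a b b' c α β).Injective := by
  obtain ⟨uo, rfl⟩ := ho
  obtain ⟨ua, rfl⟩ := ha
  obtain ⟨ub, rfl⟩ := hb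
  obtain ⟨ub', rfl⟩ := hb'
  have ec : ∀ i, (symFun n (old uo) (old ua) (old ub) (old ub') c α β (.c i) = Vertex.c i ∧
      ¬ (1 ≤ i ∧ i ≤ n)) ∨ (1 ≤ i ∧ i ≤ n) ∧ (∃ u, c i = old u) ∧
      symFun n (old uo) (old ua) (old ub) (old ub') c α β (.c i) = c i := by
    intro i; by_cases h : 1 ≤ i ∧ i ≤ n
    · exact .inr ⟨h, hc i h.1 h.2, if_pos h⟩
    · exact .inl ⟨if_neg h, h⟩
  have eα : ∀ i, (symFun n (old uo) (old ua) (old ub) (old ub') c α β (.α i) = Vertex.a i ∧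
      ¬ (1 ≤ i ∧ i < n)) ∨ (1 ≤ i ∧ i < n) ∧ (∃ u, α i = copy j u) ∧
      symFun n (old uo) (old ua) (old ub) (old ub') c α β (.α i) = α i := by
    intro i; by_cases h : 1 ≤ i ∧ i < n
    · exact .inr ⟨h, hα i h.1 h.2, if_pos h⟩
    · exact .inl ⟨if_neg h, h⟩
  have eβ : ∀ i, (symFun n (old uo) (old ua) (old ub) (old ub') c α β (.β i) = Vertex.b i ∧
      ¬ (1 ≤ i ∧ i + 1 < n)) ∨ (1 ≤ i ∧ i + 1 < n) ∧
      ((∃ u, β i = copy j u) ∨ ∃ k, β i = extra j k) ∧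
      symFun n (old uo) (old ua) (old ub) (old ub') c α β (.β i) = β i := by
    intro i; by_cases h : 1 ≤ i ∧ i + 1 < n
    · exact .inr ⟨h, hβ i h.1 h.2, if_pos h⟩
    · exact .inl ⟨if_neg h, h⟩
  have mo : symFun n (old uo) (old ua) (old ub) (old ub') c α β .o = old uo := rfl
  have ma : symFun n (old uo) (old ua) (old ub) (old ub') c α β .a = old ua := rfl
  have mb : symFun n (old uo) (old ua) (old ub) (old ub') c α β .b = old ub := rfl
  have mb' : symFun n (old uo) (old ua) (old ub) (old ub') c α β .b' = old ub' := rfl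
  generalize symFun n (old uo) (old ua) (old ub) (old ub') c α β = G at *
  have sym : ∀ x y, (∀ i, x ≠ .c i) → (∀ i, x ≠ .α i) → (∀ i, x ≠ .β i) → G x = G y → x = y := by
    intro x y hx1 hx2 hx3 h; have hx : ∃ u, G x = old u := by
      cases x with
      | o => grind
      | a => grind
      | b => grind
      | b' => grind
      | c i => grind
      | α i => grind
      | β i => grind
    obtain ⟨u, hu⟩ := hx
    cases y with
    | c i =>
      rcases ec i with ⟨h1, -⟩ | ⟨h1, -, h2⟩
      · grind
      · obtain ⟨n1, n2, n3, n4⟩ := hco i h1.1 h1.2; rw [h2] at h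
        cases x with
        | o => grind
        | a => grind
        | b => grind
        | b' => grind
        | c i => grind
        | α i => grind
        | β i => grind
    | α i => grind
    | β i => grind
    | _ =>
      clear ec eα eβ hc hα hβ hco hcc hαα hββ hαβ
      cases x with
      | c i => grind
      | α i => grind
      | β i => grind
      | _ => grind
  have cα : ∀ i i', G (.c i) ≠ G (.α i') := by grind
  have cβ : ∀ i i', G (.c i) ≠ G (.β i') := by grind
  intro x y h
  clear mo ma mb mb' hco hoa hob hob' hab hab' hbb'
  cases x with
  | c i =>
    cases y with
    | c i' => grind
    | α i' => grind
    | β i' => grind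
    | _ => grind
  | α i =>
    cases y with
    | c i' => grind
    | α i' => grind
    | β i' => grind
    | _ => grind
  | β i =>
    cases y with
    | c i' => grind
    | α i' => grind
    | β i' => grind
    | _ => grind
  | _ => grind

end Names

section Attach

variable {M : Ball} {j n : ℕ}

lemma alphas_getD (M : Ball) (j : ℕ) (o : Vertex) (hn : M.arcs.length + 2 = n) (h1 : 1 ≤ i)
    (h2 : i < n) : (alphas M j).getD (i - 1) o =
      copy j (rootAt M.secondRoot M.arcs (n - 1 - i)) := by
  grind [alphas, List.getD_eq_getElem, rootAt, List.length_map, List.length_cons]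

lemma betas_getD (M : Ball) (j : ℕ) (o : Vertex) (hn : M.arcs.length + 2 = n)
    (h1 : 1 ≤ i) {A : Arc} (hA : M.arcs[n - 2 - i]? = some A) (h2 : i + 1 < n) :
    (betas M j).getD (i - 1) o = (A.inner.head?.map (copy j)).getD (extra j (n - 2 - i)) := by
  grind [List.getElem?_eq_some_iff, betas, List.getD_eq_getElem, List.length_map,
    List.length_zipIdx, zero_add]

lemma copyName_of_ne {v b : Vertex} (h : v ≠ M.hub) : copyName M j b v = copy j v := if_neg h

lemma copyName_hub {b : Vertex} : copyName M j b M.hub = b := if_pos rfl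

lemma copyName_inj {b : Vertex} (hb : ∃ u, b = old u) : (copyName M j b).Injective := by
  obtain ⟨u, rfl⟩ := hb
  intro x y h
  grind [copyName]

end Attach


lemma along_of_get {P : Vertex → Arc → Option Arc → Prop} : ∀ {L : List Arc} {v : Vertex},
    (∀ k A, L[k]? = some A → P (rootAt v L k) A L[k + 1]?) → Along P v L
  | [], _, _ => trivial
  | A :: L, v, h => by
    refine ⟨?_, along_of_get fun k A' hA => ?_⟩
    · have := h 0 A rfl
      rwa [List.getElem?_cons_succ, ← List.head?_eq_getElem?, rootAt_zero] at this
    · have := h (k + 1) A' (by grind)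
      grind [rootAt_cons_succ, List.getElem?_eq_some_iff, List.getElem?_cons_succ]

/-- The part of the profile after a round between `cₙ` and `a`. -/
def newPart (N : Ball) (n : ℕ) (g : Sym → Vertex) : List Arc :=
  { inner := [g (.α (n - 1))], root := g (.c (n - 1)), fillet := false } ::
    (N.arcs.zipIdx.map fun q =>
      { inner := g (.β (n - 2 - q.2)) :: q.1.inner.tail ++ [g (.α (n - 2 - q.2))]
        root := g (.c (n - 2 - q.2))
        fillet := q.1.fillet }) ++
    [{ inner := [], root := g .b', fillet := false }, { inner := [], root := g .a, fillet := false }]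

section NewPart

variable {N : Ball} {n : ℕ} {g : Sym → Vertex}

lemma newPart_length (hn : N.arcs.length + 2 = n) : (newPart N n g).length = n + 1 := by
  simp [newPart]; omega

lemma newPart_mid {Q : Arc} (hQ : N.arcs[k]? = some Q) : (newPart N n g)[k + 1]? = some
      { inner := g (.β (n - 2 - k)) :: Q.inner.tail ++ [g (.α (n - 2 - k))]
        root := g (.c (n - 2 - k))
        fillet := Q.fillet } := by
  grind [List.getElem?_eq_some_iff, newPart, List.getElem?_cons_succ, List.getElem?_append_left]

lemma newPart_cases (hn : N.arcs.length + 2 = n) {A : Arc} (hA : (newPart N n g)[k]? = some A) :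
    (k = 0 ∧ A = { inner := [g (.α (n - 1))], root := g (.c (n - 1)), fillet := false }) ∨
    (∃ i Q, 1 ≤ i ∧ i + 1 < n ∧ k = n - 1 - i ∧ N.arcs[n - 2 - i]? = some Q ∧
      A = { inner := g (.β i) :: Q.inner.tail ++ [g (.α i)], root := g (.c i),
            fillet := Q.fillet }) ∨
    (k = n - 1 ∧ A = { inner := [], root := g .b', fillet := false }) ∨
    (k = n ∧ A = { inner := [], root := g .a, fillet := false }) := by
  have hk := (List.getElem?_eq_some_iff.1 hA).1
  rw [newPart_length hn] at hk
  rcases Nat.eq_zero_or_pos k with rfl | h1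
  · grind [newPart, List.getElem?_cons_zero, Option.some.injEq]
  · by_cases h2 : k < n - 1
    · right; left; have h3 : k - 1 < N.arcs.length := by omega
      have h4 := newPart_mid (n := n) (g := g) (List.getElem?_eq_getElem h3); grind
    · right; right; rw [newPart, List.getElem?_append_right (by simp; omega)] at hA
      have h3 : (({ inner := [g (.α (n - 1))], root := g (.c (n - 1)), fillet := false } : Arc) ::
        (N.arcs.zipIdx.map fun q =>
        ({ inner := g (.β (n - 2 - q.2)) :: q.1.inner.tail ++ [g (.α (n - 2 - q.2))]
           root := g (.c (n - 2 - q.2)), fillet := q.1.fillet } : Arc))).length = n - 1 := by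
        simp; omega
      grind

/-- The roots after a round between `cₙ` and `a`. -/
lemma rootAt_newPart (hn : N.arcs.length + 2 = n) (hk : k ≤ n + 1) :
    rootAt (g (.c n)) (newPart N n g) k =
      if k < n then g (.c (n - k)) else if k = n then g .b' else g .a := by
  rcases Nat.eq_zero_or_pos k with rfl | h1
  · rw [rootAt_zero, if_pos (by omega), Nat.sub_zero]
  · have h2 : k - 1 < (newPart N n g).length := by grind [newPart_length]
    have hA := List.getElem?_eq_getElem h2; have h3 := rootAt_succ (v := g (.c n)) hA
    rw [show k - 1 + 1 = k by omega] at h3; rw [h3]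
    rcases newPart_cases hn hA with ⟨h4, h5⟩ | ⟨i, Q, h4, h5, h6, -, h7⟩ | ⟨h4, h5⟩ | ⟨h4, h5⟩
    all_goals grind

lemma endRoot_newPart (hn : N.arcs.length + 2 = n) : endRoot (g (.c n)) (newPart N n g) = g .a := by
  rw [← rootAt_length, newPart_length hn, rootAt_newPart hn le_rfl, if_neg (by omega),
    if_neg (by omega)]

lemma mem_rootPairs_newPart (hn : N.arcs.length + 2 = n) {p : Vertex × Vertex} :
    p ∈ rootPairs (g (.c n)) (newPart N n g) ↔
      (∃ i, 1 ≤ i ∧ i < n ∧ p = (g (.c (i + 1)), g (.c i))) ∨ p = (g (.c 1), g .b') ∨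
        p = (g .b', g .a) := by
  rw [mem_rootPairs]
  constructor
  · rintro ⟨k, hk, rfl⟩; rw [newPart_length hn] at hk
    rw [rootAt_newPart hn (by omega), rootAt_newPart hn (by omega)]; grind
  · have hl := newPart_length (g := g) hn; rintro (⟨i, h1, h2, rfl⟩ | rfl | rfl)
    · refine ⟨n - (i + 1), by omega, ?_⟩
      rw [rootAt_newPart hn (by omega), rootAt_newPart hn (by omega), if_pos (by omega),
        if_pos (by omega)]
      congr 3 <;> omega
    · refine ⟨n - 1, by omega, ?_⟩
      rw [rootAt_newPart hn (by omega), rootAt_newPart hn (by omega), if_pos (by omega),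
        if_neg (by omega), if_pos (by omega), show n - (n - 1) = 1 by omega]
    · refine ⟨n, by omega, ?_⟩
      rw [rootAt_newPart hn (by omega), rootAt_newPart hn (by omega), if_neg (by omega),
        if_pos rfl, if_neg (by omega), if_neg (by omega)]

end NewPart

namespace Host

variable {C : Cx Vertex} {N : Ball} {n ε τ : ℕ} {g : Sym → Vertex} {Fr : Set Vertex}

lemma goodArc_bare {v : Vertex} {A : Arc} {nx : Option Arc} {t : ℕ} {o : Vertex}
    (hr : RootOK C 1 o v A.root) (hi : A.inner = []) (hf : A.fillet = false) :
    GoodArc C 1 t o v A nx :=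
  ⟨⟨hr, by simp [hi], fun h => (h hi).elim, by simp [hi], by simp [hf]⟩, by simp [hf]⟩

/-- The new part of the profile after a round. -/
lemma along_newPart (h : Host C n g Fr) (hN : Good ε τ N) (hd : Named N n g Fr)
    (hα : ∀ i, ¬ (1 ≤ i ∧ i < n) → {g (.α i)} ∉ N.cx.face 0)
    (hβ : ∀ i, ¬ (1 ≤ i ∧ i + 1 < n) → {g (.β i)} ∉ N.cx.face 0) :
    Along (GoodArc (rounded C n g N.cx) 1 (τ + 1) (g .o)) (g (.c n)) (newPart N n g) := by
  have hc := hN.cap hd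
  have hn := hd.len
  have h3 := hd.three
  have hhub := hN.nodup
  rw [List.nodup_cons] at hhub
  refine along_of_get fun k A hA => ?_
  have hk := (List.getElem?_eq_some_iff.1 hA).1
  rw [newPart_length hn] at hk
  rw [rootAt_newPart hn (by omega)]
  rcases newPart_cases hn hA with ⟨rfl, rfl⟩ | ⟨i, Q, h1, h2, rfl, hQ, rfl⟩ | ⟨rfl, rfl⟩ |
    ⟨rfl, rfl⟩
  · rw [if_pos (by omega), Nat.sub_zero]
    refine ⟨⟨?_, ?_, fun _ => h.toothOK_end hc, by simp, by simp⟩, by simp⟩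
    all_goals grind [h.rootOK_side, h.vert_α, h.apart_fresh, h.frα]
  · rw [if_pos (by omega), show n - (n - 1 - i) = i + 1 by omega]
    have hfresh : ∀ x ∈ Q.inner, {x} ∈ N.cx.face 0 ∧ x ∈ Fr := by
      intro x hx; have hx' := ((hN.site hQ).inner x hx).1
      refine ⟨hx', (hd.fr x hx').resolve_left ?_⟩; rintro rfl; rw [hd.hub] at hx
      exact hhub.1 (inner_mem_profile (List.mem_of_getElem? hQ) hx)
    obtain ⟨Q', hQ', -, hroot⟩ := hd.arc h1 h2; obtain rfl : Q = Q' := by grind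
    refine ⟨⟨h.rootOK_side hc h1 (by omega), ?_, fun _ => h.toothOK_side hc h1 h2, ?_, ?_⟩, ?_⟩
    · intro x hx
      simp only [List.cons_append, List.mem_cons, List.mem_append, List.not_mem_nil, or_false] at hx
      grind [List.mem_of_mem_tail, h.vert_β, h.apart_fresh, h.frβ, h.rounded_zero, h.vert_α, h.frα]
    · intro _ _; have := h.flipOK_side hc h1 h2; convert this using 1
      · rfl
      · rw [Arc.last, List.getLastD_concat]
    all_goals
      intro hf; change Q.fillet = true at hf
      obtain ⟨Q', b, hQ', hb, hE⟩ := (hN.along.get hQ).next hf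
      have hk' := (List.getElem?_eq_some_iff.1 hQ').1; have hl := ((hN.site hQ).fillet hf).1
      have hp := hN.pos; have hnext := newPart_mid (n := n) (g := g) hQ'
      rw [show n - 2 - i + 1 + 1 = n - 1 - i + 1 by omega,
        show n - 2 - (n - 2 - i + 1) = i - 1 by omega] at hnext
      have hd' : CapFillet N.cx n g Fr ε (HasTooth N n) i (Arc.chain
          { inner := g (.β i) :: Q.inner.tail ++ [g (.α i)], root := g (.c i),
            fillet := Q.fillet } (g .o)) τ := by
        refine hN.capFillet hd h1 h2 hQ hf ?_ ?_ ?_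
        · grind [Arc.chain, List.tail_cons, List.getD_eq_getElem, List.getElem_append_left]
        · grind [Arc.chain, List.tail_cons, List.getD_eq_getElem, List.getElem_append_right]
        · intro x hx s he; have hQn := inner_nodup hhub.2 (List.mem_of_getElem? hQ)
          have hxQ := List.mem_of_mem_tail hx; obtain ⟨h4, h5⟩ := hfresh x hxQ
          cases s with
          | o => grind [h.fro]
          | a => grind [h.fra]
          | b => grind [h.frb]
          | b' => grind [h.frb']
          | c m => grind [h.frc]
          | α m => grind [rootAt_notMem_inner, List.mem_of_getElem?, hd.α]
          | β m =>
            by_cases hm : 1 ≤ m ∧ m + 1 < n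
            · obtain ⟨Q₁, hQ₁, -⟩ := hd.arc hm.1 hm.2; by_cases hne : Q₁.inner = []
              · grind [hd.gap]
              · have h6 := hd.β m Q₁ hm.1 hm.2 hQ₁ hne; rw [← he] at h6
                have := inner_disjoint hhub.2 hQ hQ₁ hxQ (List.mem_of_head? h6)
                obtain rfl : i = m := by omega
                obtain rfl : Q = Q₁ := by grind
                obtain ⟨l, hl⟩ := List.head?_eq_some_iff.1 h6; grind
            · grind
    · have hi := hd'.two; rw [hnext]
      exact ⟨by simp; omega, h.vert_β hc (by omega) (by omega), h.filletOK_next hc hd'⟩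
    grind [hd'.two, h.filletEnd_next]
  · rw [if_pos (by omega), show n - (n - 1) = 1 by omega]
    exact goodArc_bare (h.rootOK_first hc) rfl rfl
  · rw [if_neg (by omega), if_pos rfl]; exact goodArc_bare (h.rootOK_last hc) rfl rfl

end Host


/-- The tip of the tooth after the `j`-th arc. -/
def Ball.tipAfter (D : Ball) (j : ℕ) : Vertex :=
  (D.arcs[j + 1]?.bind fun A' => A'.inner.head?).getD (rootAt D.secondRoot D.arcs j)

/-- The site of the `j`-th arc `A`. -/
def Ball.siteAt (D : Ball) (j : ℕ) (A : Arc) : Site × ℕ :=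
  (⟨rootAt D.secondRoot D.arcs j, A, D.tipAfter j⟩, j)

/-- The names in the round for the fillet at the `j`-th arc `A`. -/
def namesAt (D M : Ball) (n j : ℕ) (A : Arc) : Sym → Vertex :=
  symFun n D.hub (rootAt D.secondRoot D.arcs j) (D.tipAfter j) (A.tip D.hub) (A.chain D.hub)
    (fun i => (alphas M j).getD (i - 1) D.hub) (fun i => (betas M j).getD (i - 1) D.hub)

/-- The copy attached in the round for the fillet at the `j`-th arc. -/
def copyAt (D M : Ball) (j : ℕ) : Ball := M.map (copyName M j (D.tipAfter j))

lemma rootAt_map (f : Vertex → Vertex) (v : Vertex) (L : List Arc) (k : ℕ) :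
    rootAt (f v) (L.map (Arc.map f)) k = f (rootAt v L k) := by
  unfold rootAt
  rw [← List.getD_map (l := v :: L.map Arc.root) (n := k) (d := v) f]
  simp [Function.comp_def, Arc.map]

lemma body_nodup {v : Vertex} {L : List Arc} (h : (profile v L).Nodup) {A : Arc} (hA : A ∈ L) :
    (A.inner ++ [A.root]).Nodup := by grind [profile, List.nodup_cons, List.nodup_flatMap]

/-- Two balls to which the recursion can be applied; `D` has the role of the first one after
renaming. -/
structure Setup (D M : Ball) (n ε τ : ℕ) : Prop where
  good : Good 1 n D
  old : ∀ x ∈ D.hub :: profile D.secondRoot D.arcs, ∃ u, x = old u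
  vert : ∀ x, {x} ∈ D.cx.face 0 → ∃ u, x = Vertex.old u
  base : Good ε τ M
  len : M.arcs.length + 2 = n
  three : 3 ≤ n

namespace Setup

variable {D M : Ball} {n ε τ j : ℕ} {A : Arc}

lemma nodup (h : Setup D M n ε τ) : (profile D.secondRoot D.arcs).Nodup :=
  (List.nodup_cons.1 h.good.nodup).2

lemma hub_ne_root (h : Setup D M n ε τ) (hk : k ≤ D.arcs.length) :
    D.hub ≠ rootAt D.secondRoot D.arcs k := by
  grind [List.nodup_cons, rootAt_mem_profile, h.good.nodup]

lemma hub_notMem (h : Setup D M n ε τ) (hA : D.arcs[j]? = some A) : D.hub ∉ A.inner := fun hx =>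
  (List.nodup_cons.1 h.good.nodup).1 (inner_mem_profile (List.mem_of_getElem? hA) hx)

lemma old_hub (h : Setup D M n ε τ) : ∃ u, D.hub = Vertex.old u := h.old _ (by simp)

lemma old_root (h : Setup D M n ε τ) (hk : k ≤ D.arcs.length) :
    ∃ u, rootAt D.secondRoot D.arcs k = Vertex.old u :=
  h.old _ (List.mem_cons_of_mem _ (rootAt_mem_profile hk))

lemma old_inner (h : Setup D M n ε τ) (hA : D.arcs[j]? = some A) (hx : x ∈ A.inner) :
    ∃ u, x = Vertex.old u :=
  h.old _ (List.mem_cons_of_mem _ (inner_mem_profile (List.mem_of_getElem? hA) hx))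

lemma root_eq (hA : D.arcs[j]? = some A) : A.root = rootAt D.secondRoot D.arcs (j + 1) :=
  (rootAt_succ hA).symm

lemma lt (hA : D.arcs[j]? = some A) : j < D.arcs.length := (List.getElem?_eq_some_iff.1 hA).1

lemma next (h : Setup D M n ε τ) (hA : D.arcs[j]? = some A) (hf : A.fillet = true) :
    ∃ A', D.arcs[j + 1]? = some A' ∧ A'.inner.head? = some (D.tipAfter j) := by
  obtain ⟨A', b, h1, h2, -⟩ := (h.good.along.get hA).next hf
  grind [Ball.tipAfter]

lemma length (h : Setup D M n ε τ) (hA : D.arcs[j]? = some A) (hf : A.fillet = true) :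
    A.inner.length = n :=
  ((h.good.site hA).fillet hf).1

lemma split (h : Setup D M n ε τ) (hA : D.arcs[j]? = some A) (hf : A.fillet = true) :
    A.inner = A.tip D.hub :: A.inner.tail := by
  have h1 := h.length hA hf
  have h2 := h.three
  unfold Arc.tip
  cases hi : A.inner with
  | nil => grind
  | cons x l => rfl

lemma tip_mem (h : Setup D M n ε τ) (hA : D.arcs[j]? = some A) (hf : A.fillet = true) :
    A.tip D.hub ∈ A.inner := by
  rw [h.split hA hf]; exact List.mem_cons_self

lemma chain_eq (h : Setup D M n ε τ) (hA : D.arcs[j]? = some A) (hf : A.fillet = true)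
    (h1 : 1 ≤ i) (h2 : i ≤ n) : ∃ hi : i < (A.inner ++ [A.root]).length,
      A.chain D.hub i = (A.inner ++ [A.root])[i] := by
  grind [length, List.getD_eq_getElem, Arc.chain, List.length_nil]

lemma chain_mem (h : Setup D M n ε τ) (hA : D.arcs[j]? = some A) (hf : A.fillet = true)
    (h1 : 1 ≤ i) (h2 : i < n) : A.chain D.hub i ∈ A.inner.tail := by
  grind [Arc.chain, List.getD_eq_getElem, List.getElem_append_left, List.getElem_mem, h.length]

lemma chain_last (h : Setup D M n ε τ) (hA : D.arcs[j]? = some A) (hf : A.fillet = true) :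
    A.chain D.hub n = A.root := by
  grind [Arc.chain, List.getD_eq_getElem, List.getElem_append_right, h.length, h.three]

lemma old_chain (h : Setup D M n ε τ) (hA : D.arcs[j]? = some A) (hf : A.fillet = true)
    (h1 : 1 ≤ i) (h2 : i ≤ n) : ∃ u, A.chain D.hub i = Vertex.old u := by
  rcases h2.lt_or_eq with h3 | rfl
  · exact h.old_inner hA (List.mem_of_mem_tail (h.chain_mem hA hf h1 h3))
  grind [root_eq, lt, h.chain_last, h.old_root]

lemma nextTip_mem (h : Setup D M n ε τ) (hA : D.arcs[j]? = some A) (hf : A.fillet = true) :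
    ∃ A', D.arcs[j + 1]? = some A' ∧ D.tipAfter j ∈ A'.inner := by grind [List.mem_of_head?, h.next]

lemma root_ne_inner (h : Setup D M n ε τ) (hA : D.arcs[j]? = some A)
    (hk : k ≤ D.arcs.length) (hx : x ∈ A.inner) :
    x ≠ rootAt D.secondRoot D.arcs k := by
  grind [rootAt_notMem_inner, List.mem_of_getElem?, h.nodup]

lemma names_inj (h : Setup D M n ε τ) (hA : D.arcs[j]? = some A) (hf : A.fillet = true) :
    (namesAt D M n j A).Injective := by
  have hlen := h.len
  have h3 := h.three
  have hj := lt hA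
  obtain ⟨A', hA', hb⟩ := h.nextTip_mem hA hf
  have hj' := lt hA'
  have hnd := body_nodup h.nodup (List.mem_of_getElem? hA)
  have hM := (List.nodup_cons.1 h.base.nodup).2
  have hβ : ∀ i, 1 ≤ i → i + 1 < n → ∃ Q, M.arcs[n - 2 - i]? = some Q ∧
      (betas M j).getD (i - 1) D.hub = (Q.inner.head?.map (copy j)).getD (extra j (n - 2 - i)) := by
    grind [List.getElem?_eq_getElem, betas_getD]
  have hαe := fun i h1 h2 => alphas_getD M j D.hub hlen (i := i) h1 h2
  have hne : ∀ x ∈ A.inner, x ≠ D.tipAfter j := by grind [inner_disjoint, h.nodup]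
  refine symFun_inj h.old_hub (h.old_root hj.le) (h.old_inner hA' hb)
    (h.old_inner hA (h.tip_mem hA hf)) (fun i h1 h2 => h.old_chain hA hf h1 h2) (j := j)
    (fun i h1 h2 => ⟨_, hαe i h1 h2⟩) ?_ (h.hub_ne_root hj.le) ?_ ?_ ?_ ?_ ?_ ?_ ?_ ?_ ?_ ?_
  · intro i h1 h2; obtain ⟨Q, -, hQ⟩ := hβ i h1 h2; rw [hQ]
    cases Q.inner.head? with
    | none => grind
    | some x => grind
  · grind [h.hub_notMem]
  · exact fun he => h.hub_notMem hA (he ▸ h.tip_mem hA hf)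
  · grind [h.root_ne_inner]
  · exact fun he => h.root_ne_inner hA hj.le (h.tip_mem hA hf) he.symm
  · grind [h.tip_mem]
  · intro i h1 h2; rcases h2.lt_or_eq with h2' | rfl
    · have hm := h.chain_mem hA hf h1 h2'; have hm' := List.mem_of_mem_tail hm
      refine ⟨fun he => h.hub_notMem hA (he ▸ hm'), h.root_ne_inner hA hj.le hm', hne _ hm',
        fun he => ?_⟩
      grind [List.nodup_cons, List.mem_append_left, h.split]
    · rw [h.chain_last hA hf, root_eq hA]
      refine ⟨(h.hub_ne_root hj).symm, fun he => ?_, fun he => ?_, fun he => ?_⟩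
      · have := rootAt_inj h.nodup hj hj.le he; omega
      · grind [h.root_ne_inner]
      · exact h.root_ne_inner hA hj (h.tip_mem hA hf) he.symm
  · intro i i' h1 h2 h3 h4 he; obtain ⟨h5, h6⟩ := h.chain_eq hA hf h1 h2
    obtain ⟨h7, h8⟩ := h.chain_eq hA hf h3 h4; grind [hnd.getElem_inj_iff]
  · intro i i' h1 h2 h3 h4 he; rw [hαe i h1 h2, hαe i' h3 h4] at he
    injection he with _ he
    have := rootAt_inj hM (by omega) (by omega) he; omega
  · intro i i' h1 h2 h3 h4 he; obtain ⟨Q, hQ, h5⟩ := hβ i h1 h2; obtain ⟨Q', hQ', h6⟩ := hβ i' h3 h4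
    rw [h5, h6] at he
    cases h7 : Q.inner.head? with
    | none =>
      cases h8 : Q'.inner.head? with
      | none => grind
      | some x => grind
    | some x =>
      cases h8 : Q'.inner.head? with
      | none => grind
      | some y =>
        rw [h7, h8] at he
        injection he with _ he
        have := inner_disjoint hM hQ hQ' (List.mem_of_head? h7) (he ▸ List.mem_of_head? h8); omega
  · intro i i' h1 h2 h3 h4 he; obtain ⟨Q', hQ', h6⟩ := hβ i' h3 h4; rw [hαe i h1 h2, h6] at he
    cases h8 : Q'.inner.head? with
    | none => grind
    | some y =>
      rw [h8] at he
      injection he with _ he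
      exact rootAt_notMem_inner hM (by omega) (List.mem_of_getElem? hQ') (he ▸ List.mem_of_head? h8)

lemma copy_inj (h : Setup D M n ε τ) (hA : D.arcs[j]? = some A) (hf : A.fillet = true) :
    (copyName M j (D.tipAfter j)).Injective := by grind [copyName_inj, h.nextTip_mem, h.old_inner]

lemma good_copy (h : Setup D M n ε τ) (hA : D.arcs[j]? = some A) (hf : A.fillet = true) :
    Good ε τ (copyAt D M j) := h.base.map (h.copy_inj hA hf)

lemma copyName_profile (h : Setup D M n ε τ) {b : Vertex}
    (hx : x ∈ profile M.secondRoot M.arcs) : copyName M j b x = copy j x :=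
  copyName_of_ne fun he => (List.nodup_cons.1 h.base.nodup).1 (he ▸ hx)

lemma names_α (h : Setup D M n ε τ) (h1 : 1 ≤ i) (h2 : i < n) :
    namesAt D M n j A (.α i) = copy j (rootAt M.secondRoot M.arcs (n - 1 - i)) :=
  (if_pos ⟨h1, h2⟩).trans (alphas_getD M j _ h.len h1 h2)

lemma names_β (h : Setup D M n ε τ) (h1 : 1 ≤ i) (h2 : i + 1 < n) {Q : Arc}
    (hQ : M.arcs[n - 2 - i]? = some Q) : namesAt D M n j A (.β i) =
      (Q.inner.head?.map (copy j)).getD (extra j (n - 2 - i)) :=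
  (if_pos ⟨h1, h2⟩).trans (betas_getD M j _ h.len h1 hQ h2)

lemma names_c (h1 : 1 ≤ i) (h2 : i ≤ n) :
    namesAt D M n j A (.c i) = A.chain D.hub i := if_pos ⟨h1, h2⟩

lemma copyAt_vert (h : Setup D M n ε τ) (hx : {x} ∈ (copyAt D M j).cx.face 0) :
    x = D.tipAfter j ∨ ∃ u, {u} ∈ M.cx.face 0 ∧ u ≠ M.hub ∧ x = copy j u := by
  obtain ⟨W, hW, he⟩ := mem_map_face.1 hx
  obtain ⟨y, rfl⟩ := h.base.frame.zero W hW
  rw [image_singleton, singleton_inj] at he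
  by_cases hy : y = M.hub
  all_goals grind [copyName_hub, copyName_of_ne]

lemma named (h : Setup D M n ε τ) (hA : D.arcs[j]? = some A) (hf : A.fillet = true) :
    Named (copyAt D M j) n (namesAt D M n j A) (freshAt j) := by
  have hlen := h.len
  have h3 := h.three
  obtain ⟨A', hA', hb⟩ := h.nextTip_mem hA hf
  obtain ⟨ub, hub⟩ := h.old_inner hA' hb
  have harc : ∀ (k : ℕ) (Q' : Arc), (copyAt D M j).arcs[k]? = some Q' → ∃ Q : Arc, M.arcs[k]? = some Q ∧
      Q' = Q.map (copyName M j (D.tipAfter j)) := by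
    intro k Q' hQ; change (M.arcs.map (Arc.map _))[k]? = _ at hQ; grind
  refine ⟨?_, h3, copyName_hub.symm, ?_, ?_, ?_, ?_⟩
  · grind [copyAt, Ball.map]
  · intro i h1 h2; rw [h.names_α h1 h2]
    change _ = rootAt (copyName M j _ M.secondRoot) (M.arcs.map (Arc.map _)) _
    rw [rootAt_map, h.copyName_profile (rootAt_mem_profile (by omega))]
  · intro i Q' h1 h2 hQ' hne; obtain ⟨Q, hQ, rfl⟩ := harc _ _ hQ'; rw [h.names_β h1 h2 hQ]
    cases hi : Q.inner with
    | nil => grind [Arc.map]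
    | cons x l =>
      have := h.copyName_profile (j := j) (b := D.tipAfter j)
        (inner_mem_profile (List.mem_of_getElem? hQ) (x := x) (by simp [hi]))
      simp [Arc.map, hi, this]
  · intro i Q' h1 h2 hQ' hne hx; obtain ⟨Q, hQ, rfl⟩ := harc _ _ hQ'
    have hi : Q.inner = [] := by simpa [Arc.map] using hne
    rw [h.names_β h1 h2 hQ, hi] at hx; grind [h.copyAt_vert]
  · intro x hx; rcases h.copyAt_vert hx with he | ⟨u, -, -, he⟩
    · exact .inl he
    · exact .inr (.inl ⟨u, he⟩)

lemma newArcs_eq (h : Setup D M n ε τ) (hA : D.arcs[j]? = some A) (hf : A.fillet = true) :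
    newArcs M D.hub (D.siteAt j A) = newPart (copyAt D M j) n (namesAt D M n j A) := by
  have hlen := h.len
  have h3 := h.three
  have hl := h.length hA hf
  have hn : (A.inner.tail ++ [A.root]).length = n := by simp; omega
  have hα : ∀ i, 1 ≤ i → i < n → (alphas M j).getD (i - 1) D.hub = namesAt D M n j A (.α i) :=
    fun i h1 h2 => (if_pos ⟨h1, h2⟩).symm
  have hβ : ∀ i, 1 ≤ i → i + 1 < n → (betas M j).getD (i - 1) D.hub = namesAt D M n j A (.β i) :=
    fun i h1 h2 => (if_pos ⟨h1, h2⟩).symm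
  have hc : ∀ i, 1 ≤ i → i ≤ n → (A.inner.tail ++ [A.root]).getD (i - 1) D.hub =
      namesAt D M n j A (.c i) := fun i h1 h2 => (if_pos ⟨h1, h2⟩).symm
  unfold newArcs newPart
  simp only [Ball.siteAt, hf, if_true, roundAt, hn]
  rw [hα (n - 1) (by omega) (by omega), hc (n - 1) (by omega) (by omega)]
  refine congrArg₂ _ (congrArg _ ?_) rfl
  change _ = (M.arcs.map (Arc.map _)).zipIdx.map _
  rw [List.zipIdx_map, List.map_map]
  refine List.map_congr_left fun q hq => ?_
  obtain ⟨q1, q2⟩ := q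
  have hq' := List.mem_zipIdx' hq
  have hk : q2 < M.arcs.length := hq'.1
  have hq1 : q1 ∈ M.arcs := by grind
  simp only [Function.comp, Prod.map, id]
  rw [hα _ (by omega) (by omega), hβ _ (by omega) (by omega), hc _ (by omega) (by omega)]
  have : q1.inner.tail.map (copy j) = (Arc.map (copyName M j (D.tipAfter j)) q1).inner.tail := by
    rw [Arc.map, ← List.map_tail]
    grind [List.map_congr_left, inner_mem_profile, List.mem_of_mem_tail, h.copyName_profile]
  rw [this]
  rfl

lemma attachAt_eq (h : Setup D M n ε τ) (hA : D.arcs[j]? = some A) (hf : A.fillet = true)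
    (C : Cx Vertex) : attachAt M D.hub C (D.siteAt j A) =
      rounded C n (namesAt D M n j A) (copyAt D M j).cx := by
  have h3 := h.three
  have hl := h.length hA hf
  have hn : (roundAt M D.hub (D.siteAt j A)).n = n := by
    change (A.inner.tail ++ [A.root]).length = n; simp; omega
  have hc : ∀ i, 1 ≤ i → i ≤ n → (roundAt M D.hub (D.siteAt j A)).c i =
      (roundOf n (namesAt D M n j A)).c i := fun i h1 h2 => (if_pos ⟨h1, h2⟩).symm
  have h2 : (roundAt M D.hub (D.siteAt j A)).step2 C = (roundOf n (namesAt D M n j A)).step2 C := by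
    unfold Round.step2; rw [hn, hc n (by omega) le_rfl]; rfl
  have e3 : ∀ C, (roundAt M D.hub (D.siteAt j A)).step3 C =
      (roundOf n (namesAt D M n j A)).step3 C := fun C =>
    Round.step3_congr C hn rfl rfl fun i h1 h2 => hc i h1 (hn ▸ h2)
  have e4 : ∀ C, (roundAt M D.hub (D.siteAt j A)).step4 C =
      (roundOf n (namesAt D M n j A)).step4 C := fun C =>
    Round.step4_congr C hn rfl (fun i h1 h2 => hc i h1 (hn ▸ h2))
      (fun i h1 h2 => (if_pos ⟨h1, hn ▸ h2⟩).symm) (fun i h1 h2 => (if_pos ⟨h1, hn ▸ h2⟩).symm)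
  unfold attachAt
  rw [if_pos (show (D.siteAt j A).1.arc.fillet = true from hf)]
  simp only [h2, e3, e4]
  rfl

end Setup


lemma Along.imp {P Q : Vertex → Arc → Option Arc → Prop} {L : List Arc} {v : Vertex}
    (h : Along P v L) (hPQ : ∀ k A, L[k]? = some A → P (rootAt v L k) A L[k + 1]? →
      Q (rootAt v L k) A L[k + 1]?) : Along Q v L :=
  along_of_get fun k A hA => hPQ k A hA (h.get hA)

lemma Arc.tip_mem_inner (A : Arc) (o : Vertex) (h : 1 ≤ A.inner.length) : A.tip o ∈ A.inner := by
  unfold Arc.tip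
  cases hi : A.inner with
  | nil => grind
  | cons x l => simp

lemma Arc.last_mem_tail (A : Arc) (o : Vertex) (h : 2 ≤ A.inner.length) :
    A.last o ∈ A.inner.tail := by
  unfold Arc.last
  cases hi : A.inner with
  | nil => grind
  | cons x l => grind

section Transfer

variable {C C' : Cx Vertex} {U T : Set Vertex} {P : Finset Vertex → Prop}
  {e₂ e₃ : Finset Vertex → Finset Vertex} {ε t : ℕ} {o v b : Vertex} {A : Arc} {nx : Option Arc}

lemma Arc.map_id (A : Arc) : A.map id = A := by simp [Arc.map]

lemma GoodSite.sim_id (hs : GoodSite C ε t o v A b) (h : Sim C C' id U T P e₂ e₃)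
    (hk : Kept t o v A b U T P) (hcard : ∀ Z ∈ C'.face 2, 3 ≤ Z.card) :
    GoodSite C' ε t o v A b := by
  have := hs.sim h hk hcard
  grind [Arc.map_id]

lemma GoodArc.sim_id (hs : GoodArc C ε t o v A nx) (h : Sim C C' id U T P e₂ e₃)
    (hcard : ∀ Z ∈ C'.face 2, 3 ≤ Z.card) (ht : 1 ≤ t)
    (hk : Kept t o v A ((nx.bind fun A' => A'.inner.head?).getD v) U T P)
    (hn : A.fillet = true → ∀ A' b, nx = some A' → A'.inner.head? = some b →
      P {b, A.chain o t} ∧ A'.root ∉ T) : GoodArc C' ε t o v A nx := by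
  refine ⟨hs.site.sim_id h hk hcard, fun hf => ?_⟩
  obtain ⟨A', b, rfl, h2, h3⟩ := hs.next hf
  have h4 := hn hf A' b rfl h2
  have h5 := hk.nextTip hf
  rw [Option.bind_some, h2, Option.getD_some] at h5
  exact ⟨A', b, rfl, h2, h.filletEnd h3 h4.1 h5 (fun i _ _ => hk.chain i) h4.2 ht⟩

end Transfer

/-- The new vertices that belong to the `j`-th arc. -/
def copied (j : ℕ) : Set Vertex := {x | (∃ u, x = copy j u) ∨ ∃ i, x = extra j i}

/-- An arc starting at `v` that results from the `j`-th arc `B`, in which there is a fillet. -/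
structure NewArc (D : Ball) (j : ℕ) (B : Arc) (v : Vertex) (A : Arc) : Prop where
  start : v ∈ B.inner ∨ v = B.root
  root : A.root ∈ B.inner ∨ A.root = rootAt D.secondRoot D.arcs j
  pair : v ∈ B.inner ∨ A.root ∈ B.inner
  side : A.inner ≠ [] → A.root ∈ B.inner.tail
  inner : ∀ x ∈ A.inner, x ∈ copied j

namespace Setup

variable {D M : Ball} {n ε τ j q : ℕ} {A B : Arc}

lemma newArc (h : Setup D M n ε τ) (hB : D.arcs[j]? = some B) (hf : B.fillet = true)
    (hA : (newArcs M D.hub (D.siteAt j B))[k]? = some A) :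
    NewArc D j B (rootAt B.root (newArcs M D.hub (D.siteAt j B)) k) A := by
  have hlen := h.len
  have h3 := h.three
  have hcn : B.root = namesAt D M n j B (.c n) := by grind [names_c, le_rfl, h.chain_last]
  have hlen' : (copyAt D M j).arcs.length + 2 = n := by grind [copyAt, Ball.map]
  have hc : ∀ i, 1 ≤ i → i < n → namesAt D M n j B (.c i) ∈ B.inner.tail := by
    grind [names_c, h.chain_mem]
  have hc' := fun i h1 h2 => List.mem_of_mem_tail (hc i h1 h2)
  have htip : namesAt D M n j B .b' ∈ B.inner := h.tip_mem hB hf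
  have hα : ∀ i, 1 ≤ i → i < n → namesAt D M n j B (.α i) ∈ copied j := fun i h1 h2 =>
    .inl ⟨_, h.names_α h1 h2⟩
  rw [h.newArcs_eq hB hf] at hA ⊢
  have hk := (List.getElem?_eq_some_iff.1 hA).1
  rw [newPart_length hlen'] at hk
  have hr := rootAt_newPart (g := namesAt D M n j B) hlen' hk.le
  rw [← hcn] at hr
  rw [hr]
  rcases newPart_cases hlen' hA with ⟨rfl, rfl⟩ | ⟨i, Q, h1, h2, rfl, hQ, rfl⟩ | ⟨rfl, rfl⟩ |
    ⟨rfl, rfl⟩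
  · rw [if_pos (by omega), Nat.sub_zero, ← hcn]
    refine ⟨.inr rfl, .inl (hc' _ (by omega) (by omega)), .inr (hc' _ (by omega) (by omega)),
      fun _ => hc _ (by omega) (by omega), fun x hx => ?_⟩
    grind
  · rw [if_pos (by omega), show n - (n - 1 - i) = i + 1 by omega]
    refine ⟨.inl (hc' _ (by omega) h2), .inl (hc' _ h1 (by omega)),
      .inr (hc' _ h1 (by omega)), fun _ => hc _ h1 (by omega), fun x hx => ?_⟩
    simp only [List.cons_append, List.mem_cons, List.mem_append, List.not_mem_nil, or_false] at hx
    rcases hx with rfl | hx | rfl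
    · have hk : n - 2 - i < M.arcs.length := by omega
      rw [h.names_β h1 h2 (List.getElem?_eq_getElem hk)]
      cases (M.arcs[n - 2 - i]).inner.head? with
      | none => exact .inr ⟨_, rfl⟩
      | some y => exact .inl ⟨y, rfl⟩
    · change (M.arcs.map (Arc.map _))[_]? = _ at hQ
      rw [List.getElem?_map, Option.map_eq_some_iff] at hQ; obtain ⟨Q', hQ', rfl⟩ := hQ
      obtain ⟨y, hy, rfl⟩ := List.mem_map.1 (List.mem_of_mem_tail hx)
      rw [h.copyName_profile (inner_mem_profile (List.mem_of_getElem? hQ') hy)]; exact .inl ⟨_, rfl⟩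
    · grind
  · rw [if_pos (by omega), show n - (n - 1) = 1 by omega]
    exact ⟨.inl (hc' _ le_rfl (by omega)), .inl htip, .inr htip, fun h => (h rfl).elim, by simp⟩
  · rw [if_neg (by omega), if_pos rfl]
    exact ⟨.inl htip, .inr rfl, .inl htip, fun h => (h rfl).elim, by simp⟩

lemma inner_ne (h : Setup D M n ε τ) (hA : D.arcs[j]? = some A) (hB : D.arcs[q]? = some B)
    (hq : q ≠ j) (hx : x ∈ B.inner) : x ∉ A.inner := fun hx' =>
  hq (inner_disjoint h.nodup hB hA hx hx')

lemma old_freshAt (hx : ∃ u, x = Vertex.old u) : x ∉ freshAt j := by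
  obtain ⟨u, rfl⟩ := hx
  rintro (⟨_, h1⟩ | ⟨_, h1⟩ | ⟨_, h1⟩ | ⟨_, h1⟩) <;> cases h1

lemma old_copied (hx : ∃ u, x = Vertex.old u) : x ∉ copied j := by
  obtain ⟨u, rfl⟩ := hx
  rintro (⟨_, h1⟩ | ⟨_, h1⟩) <;> cases h1

lemma copied_freshAt (hq : q ≠ j) (hx : x ∈ copied q) : x ∉ freshAt j := by
  rcases hx with ⟨u, rfl⟩ | ⟨i, rfl⟩ <;>
  · rintro (⟨_, h1⟩ | ⟨_, h1⟩ | ⟨_, h1⟩ | ⟨_, h1⟩)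
    all_goals grind

section Side

lemma mem_hubSide (h : Setup D M n ε τ) (hA : D.arcs[j]? = some A)
    (hf : A.fillet = true) (hx : x ∈ hubSide n (namesAt D M n j A)) : x = D.hub ∨
      (∃ k, (k = j ∨ k = j + 1) ∧ x = rootAt D.secondRoot D.arcs k) ∨ x ∈ A.inner := by
  rcases hx with rfl | rfl | rfl | ⟨i, h1, h2, rfl⟩
  · exact .inl rfl
  · exact .inr (.inl ⟨j, .inl rfl, rfl⟩)
  · exact .inr (.inr (h.tip_mem hA hf))
  grind [names_c, List.mem_of_mem_tail, root_eq, h.chain_mem, h.chain_last]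

lemma mem_capSide (h : Setup D M n ε τ) (hA : D.arcs[j]? = some A)
    (hf : A.fillet = true) (hx : x ∈ capSide n (namesAt D M n j A)) : x = D.tipAfter j ∨
      x = rootAt D.secondRoot D.arcs (j + 1) ∨ x ∈ A.inner := by
  rcases hx with rfl | ⟨i, h1, h2, rfl⟩
  · exact .inl rfl
  grind [names_c, List.mem_of_mem_tail, root_eq, h.chain_mem, h.chain_last]

lemma old_hubSide (h : Setup D M n ε τ) (hA : D.arcs[j]? = some A)
    (hf : A.fillet = true) (hx : x ∈ hubSide n (namesAt D M n j A)) : ∃ u, x = Vertex.old u := by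
  have hj := lt hA
  rcases h.mem_hubSide hA hf hx with rfl | ⟨k, hk, rfl⟩ | hx
  · exact h.old_hub
  · exact h.old_root (by omega)
  · exact h.old_inner hA hx

lemma old_capSide (h : Setup D M n ε τ) (hA : D.arcs[j]? = some A)
    (hf : A.fillet = true) (hx : x ∈ capSide n (namesAt D M n j A)) : ∃ u, x = Vertex.old u := by
  rcases h.mem_capSide hA hf hx with rfl | rfl | hx
  all_goals grind [lt, h.nextTip_mem, h.old_inner, h.old_root]

lemma inner_hubSide (h : Setup D M n ε τ) (hA : D.arcs[j]? = some A) (hf : A.fillet = true)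
    (hB : D.arcs[q]? = some B) (hq : q ≠ j) (hx : x ∈ B.inner) :
    x ∉ hubSide n (namesAt D M n j A) := by
  grind [lt, h.mem_hubSide, h.hub_notMem, h.root_ne_inner, h.inner_ne]

lemma inner_capSide (h : Setup D M n ε τ) (hA : D.arcs[j]? = some A) (hf : A.fillet = true)
    (hB : D.arcs[q]? = some B) (hq : q ≠ j) (hx : x ∈ B.inner)
    (h1 : x ∈ capSide n (namesAt D M n j A)) : B.inner.head? = some x := by
  rcases h.mem_capSide hA hf h1 with rfl | rfl | h2
  · obtain ⟨A', hA', hb⟩ := h.next hA hf; grind [inner_disjoint, List.mem_of_head?, h.nodup]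
  all_goals grind [lt, h.root_ne_inner, h.inner_ne]

lemma tail_capSide (h : Setup D M n ε τ) (hA : D.arcs[j]? = some A) (hf : A.fillet = true)
    (hB : D.arcs[q]? = some B) (hq : q ≠ j) (hx : x ∈ B.inner.tail) :
    x ∉ capSide n (namesAt D M n j A) := by
  intro h1
  have h2 := h.inner_capSide hA hf hB hq (List.mem_of_mem_tail hx) h1
  grind [List.head?_eq_some_iff, inner_nodup, List.mem_of_getElem?, List.nodup_cons, h.nodup]

lemma root_capSide (h : Setup D M n ε τ) (hA : D.arcs[j]? = some A) (hf : A.fillet = true) (hk : k ≤ D.arcs.length) (hk' : k ≠ j + 1) :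
    rootAt D.secondRoot D.arcs k ∉ capSide n (namesAt D M n j A) := by
  intro h1
  rcases h.mem_capSide hA hf h1 with h2 | h2 | h2
  all_goals grind [rootAt_inj, lt, h.nextTip_mem, h.root_ne_inner, h.nodup]

lemma root_hubSide (h : Setup D M n ε τ) (hA : D.arcs[j]? = some A) (hf : A.fillet = true) (hk : k ≤ D.arcs.length) (hk' : k ≠ j) (hk'' : k ≠ j + 1) :
    rootAt D.secondRoot D.arcs k ∉ hubSide n (namesAt D M n j A) := by
  have hj := lt hA
  intro h1
  rcases h.mem_hubSide hA hf h1 with h2 | ⟨m, hm, h2⟩ | h2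
  all_goals grind [rootAt_inj, h.hub_ne_root, h.nodup, h.root_ne_inner]

lemma hub_capSide (h : Setup D M n ε τ) (hA : D.arcs[j]? = some A) (hf : A.fillet = true) :
    D.hub ∉ capSide n (namesAt D M n j A) := by
  intro h1
  rcases h.mem_capSide hA hf h1 with h2 | h2 | h2
  all_goals grind [lt, h.nextTip_mem, h.hub_notMem, h.hub_ne_root]

/-- The vertices at which edges are deleted in a round. -/
lemma mem_cut (h : Setup D M n ε τ) (hA : D.arcs[j]? = some A) (hf : A.fillet = true) (hx : x ∈ {x | ∃ i, 1 ≤ i ∧ i < n ∧ x = namesAt D M n j A (.c i)}) :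
    x ∈ A.inner.tail := by grind [names_c, h.chain_mem]

end Side

/-- A round does not affect the properties of the other arcs. -/
lemma kept_site (h : Setup D M n ε τ) (hA : D.arcs[j]? = some A) (hf : A.fillet = true)
    (hB : D.arcs[q]? = some B) (hq : q ≠ j) :
    Kept n D.hub (rootAt D.secondRoot D.arcs q) B (D.tipAfter q) (freshAt j)ᶜ
      {x | ∃ i, 1 ≤ i ∧ i < n ∧ x = namesAt D M n j A (.c i)} (Away n (namesAt D M n j A)) := by
  have hqL := lt hB
  have hjL := lt hA
  have hcut : ∀ {x}, x ∉ A.inner.tail →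
      x ∉ {x | ∃ i, 1 ≤ i ∧ i < n ∧ x = namesAt D M n j A (.c i)} :=
    fun h1 h2 => h1 (h.mem_cut hA hf h2)
  have hroot : ∀ k, k ≤ D.arcs.length → rootAt D.secondRoot D.arcs k ∈ (freshAt j)ᶜ ∧
      rootAt D.secondRoot D.arcs k ∉
        {x | ∃ i, 1 ≤ i ∧ i < n ∧ x = namesAt D M n j A (.c i)} := fun k hk =>
    ⟨old_freshAt (h.old_root hk), hcut fun h1 =>
      h.root_ne_inner hA hk (List.mem_of_mem_tail h1) rfl⟩
  have hhub : ∃ x ∈ ({rootAt D.secondRoot D.arcs q, B.root} : Finset Vertex),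
      x ∉ hubSide n (namesAt D M n j A) := by
    rcases lt_or_gt_of_ne hq with h1 | h1
    · exact ⟨_, by simp, h.root_hubSide hA hf hqL.le (by omega) (by omega)⟩
    · refine ⟨B.root, by simp, ?_⟩; grind [root_eq, h.root_hubSide]
  have hrc : B.root ∉ capSide n (namesAt D M n j A) := by grind [root_eq, h.root_capSide]
  have hin : ∀ x ∈ B.inner, x ∉ hubSide n (namesAt D M n j A) := fun x =>
    h.inner_hubSide hA hf hB hq
  refine ⟨⟨old_freshAt h.old_hub, hcut fun h1 => h.hub_notMem hA (List.mem_of_mem_tail h1)⟩,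
    hroot q hqL.le, ?_, ?_, ?_, ?_, ?_, ?_, ?_, ?_, ?_, ?_⟩
  · grind [root_eq]
  · grind [old_freshAt, List.mem_of_mem_tail, h.old_inner, h.inner_ne]
  · intro hf'; obtain ⟨A', hA', hb⟩ := h.next hB hf'; have hb' := List.mem_of_head? hb
    refine ⟨old_freshAt (h.old_inner hA' hb'), hcut fun h1 => ?_⟩
    obtain rfl := inner_disjoint h.nodup hA' hA hb' (List.mem_of_mem_tail h1)
    grind [List.head?_eq_some_iff, inner_nodup, List.mem_of_getElem?, List.nodup_cons, h.nodup]
  · obtain ⟨x, hx, h1⟩ := hhub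
    exact ⟨⟨x, mem_insert_of_mem hx, h1⟩, D.hub, by simp, h.hub_capSide hA hf⟩
  · exact fun _ => ⟨hhub, B.root, by simp, hrc⟩
  · exact fun x hx => ⟨⟨x, by simp, hin x hx⟩, D.hub, by simp, h.hub_capSide hA hf⟩
  · intro _ hl; have hlast := B.last_mem_tail D.hub hl
    exact ⟨⟨⟨_, by simp, hin _ (B.tip_mem_inner D.hub (by omega))⟩, B.root, by simp, hrc⟩,
      ⟨_, by simp, hin _ (List.mem_of_mem_tail hlast)⟩, _, by simp, h.tail_capSide hA hf hB hq hlast⟩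
  · intro hf' i h1 h2; have hm := h.chain_mem hB hf' h1 h2
    exact ⟨⟨_, by simp, hin _ (List.mem_of_mem_tail hm)⟩, _, by simp, h.tail_capSide hA hf hB hq hm⟩
  · intro hf' i h1 h2; refine ⟨⟨_, by simp, hin _ (h.tip_mem hB hf')⟩, B.chain D.hub i, by simp, ?_⟩
    grind [h.tail_capSide, h.chain_mem, h.chain_last]
  · intro hf' i h1 h2; have hm := h.chain_mem hB hf' h1 h2
    exact ⟨⟨_, by simp, hin _ (List.mem_of_mem_tail hm)⟩, _, by simp, h.tail_capSide hA hf hB hq hm⟩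

end Setup


/-- The state of the construction after the arcs in `dn` have been dealt with. -/
structure Stage (D M : Ball) (n τ : ℕ) (dn : Set ℕ) (C : Cx Vertex) : Prop where
  frame : Frame C
  cover : ∀ x, {x} ∈ C.face 0 → C.OnBd {x}
  fresh : ∀ j A, D.arcs[j]? = some A → A.fillet = true → j ∉ dn →
    ∀ x, {x} ∈ C.face 0 → x ∉ freshAt j
  site : ∀ j A, D.arcs[j]? = some A → j ∉ dn →
    GoodSite C 1 n D.hub (rootAt D.secondRoot D.arcs j) A (D.tipAfter j)
  new : ∀ j A, D.arcs[j]? = some A → j ∈ dn →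
    Along (GoodArc C 1 (τ + 1) D.hub) A.root (newArcs M D.hub (D.siteAt j A))
  hub : ∀ Z ∈ C.face 2, D.hub ∈ Z → C.nfac Z = 1 →
    Z = {D.hub, D.secondRoot, endRoot D.secondRoot D.arcs} ∨
    ∃ j A, D.arcs[j]? = some A ∧ (j ∉ dn ∧ Z = {D.hub, rootAt D.secondRoot D.arcs j, A.root} ∨
      j ∈ dn ∧ ∃ p ∈ rootPairs A.root (newArcs M D.hub (D.siteAt j A)), Z = {D.hub, p.1, p.2})

variable {D M : Ball} {n ε τ j q : ℕ} {A B : Arc} {dn : Set ℕ} {C : Cx Vertex}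

lemma Setup.start (h : Setup D M n ε τ) : Stage D M n τ ∅ D.cx := by
  refine ⟨h.good.frame, fun x hx => (h.good.cover x hx).resolve_right (by simp), ?_, ?_, by simp, ?_⟩
  · grind [Setup.old_freshAt, h.vert]
  · exact fun j A hA _ => h.good.site hA
  · intro Z hZ ho hn; refine (h.good.hub Z hZ ho hn).imp_right ?_; rintro ⟨p, hp, rfl⟩
    obtain ⟨k, hk, rfl⟩ := mem_rootPairs.1 hp; have hA := List.getElem?_eq_getElem hk
    grind [Setup.root_eq]

namespace Setup

/-- A round does not affect the properties of the arcs that result from earlier rounds. -/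
lemma kept_new (h : Setup D M n ε τ) (hA : D.arcs[j]? = some A) (hf : A.fillet = true)
    (hB : D.arcs[q]? = some B) (hq : q ≠ j) {v b : Vertex} {A' : Arc} (hN : NewArc D q B v A')
    {t : ℕ} (hlen : A'.fillet = true → A'.inner.length = t)
    (hb : A'.fillet = true → b ∈ copied q) :
    Kept t D.hub v A' b (freshAt j)ᶜ
      {x | ∃ i, 1 ≤ i ∧ i < n ∧ x = namesAt D M n j A (.c i)} (Away n (namesAt D M n j A)) := by
  have hqL := lt hB
  have hcut : ∀ {x}, x ∉ A.inner → x ∉ {x | ∃ i, 1 ≤ i ∧ i < n ∧ x = namesAt D M n j A (.c i)} :=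
    fun h1 h2 => h1 (List.mem_of_mem_tail (h.mem_cut hA hf h2))
  have hroot : ∀ k, k ≤ D.arcs.length → rootAt D.secondRoot D.arcs k ∈ (freshAt j)ᶜ ∧
      rootAt D.secondRoot D.arcs k ∉
        {x | ∃ i, 1 ≤ i ∧ i < n ∧ x = namesAt D M n j A (.c i)} := fun k hk =>
    ⟨old_freshAt (h.old_root hk), hcut fun h1 => h.root_ne_inner hA hk h1 rfl⟩
  have hin : ∀ x ∈ B.inner, x ∈ (freshAt j)ᶜ ∧
      x ∉ {x | ∃ i, 1 ≤ i ∧ i < n ∧ x = namesAt D M n j A (.c i)} := fun x hx =>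
    ⟨old_freshAt (h.old_inner hB hx), hcut fun h1 => h.inner_ne hA hB hq hx h1⟩
  have hcop : ∀ x ∈ copied q, x ∈ (freshAt j)ᶜ ∧
      x ∉ {x | ∃ i, 1 ≤ i ∧ i < n ∧ x = namesAt D M n j A (.c i)} := fun x hx =>
    ⟨copied_freshAt hq hx, hcut fun h1 => old_copied (h.old_inner hA h1) hx⟩
  have haway : ∀ (S : Finset Vertex) (x : Vertex), x ∈ S → x ∈ copied q →
      Away n (namesAt D M n j A) S := fun S x h1 h2 =>
    ⟨⟨x, h1, fun h3 => old_copied (h.old_hubSide hA hf h3) h2⟩, x, h1,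
      fun h3 => old_copied (h.old_capSide hA hf h3) h2⟩
  have hpair : ∃ x ∈ ({v, A'.root} : Finset Vertex), x ∉ hubSide n (namesAt D M n j A) := by
    rcases hN.pair with h1 | h1
    · exact ⟨v, by simp, h.inner_hubSide hA hf hB hq h1⟩
    · exact ⟨A'.root, by simp, h.inner_hubSide hA hf hB hq h1⟩
  have hch : ∀ i, 1 ≤ i → i < t → A'.fillet = true → A'.chain D.hub i ∈ copied q := by
    grind [Arc.chain, List.getD_eq_getElem, List.getElem_append_left, List.mem_of_mem_tail,
      List.getElem_mem, hN.inner]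
  refine ⟨⟨old_freshAt h.old_hub, hcut (h.hub_notMem hA)⟩, ?_, ?_, fun x hx => hcop x (hN.inner x hx),
    fun hf' => hcop b (hb hf'), ?_, ?_, ?_, ?_, ?_, ?_, ?_⟩
  any_goals grind
  · grind [root_eq, hN.start]
  · grind [hN.root]
  · obtain ⟨x, hx, h1⟩ := hpair
    exact ⟨⟨x, mem_insert_of_mem hx, h1⟩, D.hub, by simp, h.hub_capSide hA hf⟩
  · exact fun hne => ⟨hpair, _, by simp, h.tail_capSide hA hf hB hq (hN.side hne)⟩
  · exact fun x hx => haway _ x (by simp) (hN.inner x hx)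
  · intro _ hl; exact ⟨haway _ _ (by simp) (hN.inner _ (A'.tip_mem_inner D.hub (by omega))),
      haway _ _ (by simp) (hN.inner _ (List.mem_of_mem_tail (A'.last_mem_tail D.hub hl)))⟩
  · intro hf' i h1 h2; have := hlen hf'
    exact haway _ _ (by simp) (hN.inner _ (A'.tip_mem_inner D.hub (by omega)))

end Setup

namespace Stage

lemma host (hs : Stage D M n τ dn C) (h : Setup D M n ε τ) (hA : D.arcs[j]? = some A)
    (hf : A.fillet = true) (hj : j ∉ dn) : Host C n (namesAt D M n j A) (freshAt j) := by
  have h3 := h.three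
  have hjL := Setup.lt hA
  have hF := hs.fresh j A hA hf hj
  have hsite := hs.site j A hA hj
  obtain ⟨hl, hvb, hfil⟩ := hsite.fillet hf
  have htip := h.tip_mem hA hf
  have hcn : namesAt D M n j A (.c n) = A.root := by grind [Setup.names_c, le_rfl, h.chain_last]
  have hc : ∀ i, 1 ≤ i → i < n → namesAt D M n j A (.c i) ∈ A.inner := by
    grind [Setup.names_c, List.mem_of_mem_tail, h.chain_mem]
  obtain ⟨A', hA', hb⟩ := h.nextTip_mem hA hf
  refine ⟨h.names_inj hA hf, by omega, ?_, ?_, Setup.old_freshAt h.old_hub,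
    Setup.old_freshAt (h.old_root hjL.le), Setup.old_freshAt (h.old_inner hA' hb),
    Setup.old_freshAt (h.old_inner hA htip), ?_, ?_, ?_, ?_, ?_, hs.frame.card₁, hs.frame.card₂,
    hs.frame.card₃, hs.frame.anti, ?_, ?_, (hsite.inner _ htip).2, ?_, ?_, hvb,
    (hsite.inner _ htip).1, ?_⟩
  · intro i; by_cases hi : 1 ≤ i ∧ i < n
    · rw [h.names_α hi.1 hi.2]; exact .inl ⟨_, rfl⟩
    · exact .inr (.inr (.inl ⟨i, if_neg hi⟩))
  · intro i; by_cases hi : 1 ≤ i ∧ i + 1 < n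
    · have hk : n - 2 - i < M.arcs.length := by grind [h.len]
      rw [h.names_β hi.1 hi.2 (List.getElem?_eq_getElem hk)]
      cases (M.arcs[n - 2 - i]).inner.head? with
      | none => exact .inr (.inl ⟨_, rfl⟩)
      | some y => exact .inl ⟨y, rfl⟩
    · exact .inr (.inr (.inr ⟨i, if_neg hi⟩))
  · intro i; by_cases hi : 1 ≤ i ∧ i ≤ n
    · grind [Setup.names_c, Setup.old_freshAt, h.old_chain]
    · rw [show namesAt D M n j A (.c i) = Vertex.c i from if_neg hi]
      rintro (⟨_, h1⟩ | ⟨_, h1⟩ | ⟨_, h1⟩ | ⟨_, h1⟩) <;> cases h1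
  · grind [hs.frame.zero]
  · grind [hs.frame.sub₁]
  · grind [hs.frame.sub₂]
  · grind [hs.frame.sub₃]
  · rw [hcn]; exact hsite.root
  · rw [hcn]; exact hsite.tooth (List.ne_nil_of_mem htip)
  · exact fun i h1 h2 => (hsite.inner _ (hc i h1 h2)).2
  · exact hfil.congr fun i h1 h2 => (Setup.names_c h1 h2).symm
  grind [hsite.inner, hsite.root.vy]

/-- One round of the construction. -/
lemma round (hs : Stage D M n τ dn C) (h : Setup D M n ε τ) (hA : D.arcs[j]? = some A)
    (hf : A.fillet = true) (hj : j ∉ dn) (hdn : ∀ q ∈ dn, ∀ B, D.arcs[q]? = some B →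
      B.fillet = true) :
    Stage D M n τ (insert j dn) (attachAt M D.hub C (D.siteAt j A)) := by
  have hH := hs.host h hA hf hj
  have hd := h.named hA hf
  have hM := h.good_copy hA hf
  have hN := hM.cap hd
  have hsim := hH.sim hN
  have hcn : namesAt D M n j A (.c n) = A.root := by
    grind [Setup.names_c, le_rfl, h.three, h.chain_last]
  have hframe := hH.frame_rounded hN hs.frame hM.frame
  obtain ⟨A₁, hA₁, hb₁⟩ := h.nextTip_mem hA hf
  have hcopy : ∀ {x}, {x} ∈ (copyAt D M j).cx.face 0 → x ∈ copied j ∨ ∃ u, x = Vertex.old u := by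
    intro x hx; rcases h.copyAt_vert hx with rfl | ⟨u, -, -, rfl⟩
    · grind [h.old_inner]
    · exact .inl (.inl ⟨u, rfl⟩)
  rw [h.attachAt_eq hA hf]
  refine ⟨hframe, ?_, ?_, ?_, ?_, ?_⟩
  · refine hH.cover_rounded hN hs.cover fun x hx => ?_; rcases hM.cover x hx with h1 | ⟨-, h1⟩
    · exact .inl h1
    · right; have hlen := hd.len; have hroot : ∀ k, k ≤ (copyAt D M j).arcs.length →
          ∃ i, 1 ≤ i ∧ i < n ∧ rootAt (copyAt D M j).secondRoot (copyAt D M j).arcs k =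
            namesAt D M n j A (.α i) := by
        intro k hk; refine ⟨n - 1 - k, by omega, by omega, ?_⟩; grind [hd.α]
      rcases h1 with rfl | rfl | ⟨Q, hQ, h1⟩
      · grind [hd.hub]
      · exact .inr (.inl (hroot 0 (by omega)))
      · obtain ⟨k, hQ⟩ := List.mem_iff_getElem?.1 hQ; have hk := (List.getElem?_eq_some_iff.1 hQ).1
        right; rcases h1 with rfl | h1
        · grind [rootAt_succ, copyAt]
        · right; have hQ' : (copyAt D M j).arcs[n - 2 - (n - 2 - k)]? = some Q := by grind
          have := hd.β (n - 2 - k) Q (by omega) (by omega) hQ' (by grind); grind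
  · intro q B hB hf' hq x hx; rw [Set.mem_insert_iff, not_or] at hq
    rcases (hH.rounded_zero hN).1 hx with h1 | h1 | ⟨i, h1, h2, h3⟩
    · exact hs.fresh q B hB hf' hq.2 x h1
    · rcases hcopy h1 with h2 | h2
      · exact Setup.copied_freshAt (Ne.symm hq.1) h2
      · exact Setup.old_freshAt h2
    · rw [singleton_inj] at h3; refine Setup.copied_freshAt (Ne.symm hq.1) (h3 ▸ ?_)
      have hk : n - 2 - i < M.arcs.length := by grind [h.len]
      rw [h.names_β h1 h2 (List.getElem?_eq_getElem hk)]
      cases (M.arcs[n - 2 - i]).inner.head? with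
      | none => exact .inr ⟨_, rfl⟩
      | some y => exact .inl ⟨y, rfl⟩
  · intro q B hB hq; rw [Set.mem_insert_iff, not_or] at hq
    exact (hs.site q B hB hq.2).sim_id hsim (h.kept_site hA hf hB hq.1) hframe.card₂
  · intro q B hB hq; by_cases hqj : q = j
    · subst hqj; obtain rfl : A = B := by grind
      rw [h.newArcs_eq hA hf, ← hcn]
      refine hH.along_newPart hM hd (fun i hi hx => ?_) fun i hi hx => ?_
      · rw [show namesAt D M n q A (.α i) = Vertex.a i from if_neg hi] at hx
        rcases hcopy hx with (⟨_, h1⟩ | ⟨_, h1⟩) | ⟨_, h1⟩ <;> cases h1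
      · rw [show namesAt D M n q A (.β i) = Vertex.b i from if_neg hi] at hx
        rcases hcopy hx with (⟨_, h1⟩ | ⟨_, h1⟩) | ⟨_, h1⟩ <;> cases h1
    · have hq' := hq.resolve_left hqj; have hfB := hdn q hq' B hB
      refine (hs.new q B hB hq').imp fun k A' hA' hg => ?_; have hNA := h.newArc hB hfB hA'
      have hnext : ∀ A'' b, (newArcs M D.hub (D.siteAt q B))[k + 1]? = some A'' →
          A''.inner.head? = some b → b ∈ copied q := fun A'' b h1 h2 =>
        (h.newArc hB hfB h1).inner b (List.mem_of_head? h2)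
      have hpos := h.base.pos; refine hg.sim_id hsim hframe.card₂ (by omega)
        (h.kept_new hA hf hB hqj hNA (fun hf' => (hg.site.fillet hf').1) fun hf' => ?_) ?_
      · obtain ⟨A'', b, h1, h2, -⟩ := hg.next hf'; grind
      · intro hf' A'' b h1 h2; have hb := hnext A'' b h1 h2
        refine ⟨⟨⟨b, by simp, fun h3 => Setup.old_copied (h.old_hubSide hA hf h3) hb⟩, b, by simp,
          fun h3 => Setup.old_copied (h.old_capSide hA hf h3) hb⟩, fun h3 => ?_⟩
        have h4 := List.mem_of_mem_tail (h.mem_cut hA hf h3)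
        rcases (h.newArc hB hfB h1).root with h5 | h5
        all_goals grind [Setup.lt, h.inner_ne, h.root_ne_inner]
  · intro Z hZ ho hn; rcases hH.hub_free hN hZ ho hn with ⟨h1, h2, h3⟩ | h1
    · refine (hs.hub Z h1 ho h2).imp_right ?_; rintro ⟨q, B, hB, h4⟩; refine ⟨q, B, hB, ?_⟩
      rcases h4 with ⟨h4, rfl⟩ | ⟨h4, h5⟩
      · by_cases hqj : q = j
        · subst hqj; obtain rfl : A = B := by grind
          exact (h3 (by rw [hcn]; rfl)).elim
        grind
      · grind
    · right; refine ⟨j, A, hA, .inr ⟨.inl rfl, ?_⟩⟩; rw [h.newArcs_eq hA hf, ← hcn]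
      simp only [mem_rootPairs_newPart hd.len]; rw [mem_hubTris] at h1
      rcases h1 with rfl | rfl | ⟨i, h1, h2, rfl⟩
      · exact ⟨_, .inr (.inr rfl), by ext; simp [namesAt, symFun]; tauto⟩
      · exact ⟨_, .inr (.inl rfl), by ext; simp [namesAt, symFun]; tauto⟩
      · exact ⟨_, .inl ⟨i, h1, h2, rfl⟩, by ext; simp [namesAt, symFun]; tauto⟩

end Stage


lemma Cx.mem_freeRidges {C : Cx Vertex} :
    Z ∈ C.freeRidges ↔ Z ∈ C.face 2 ∧ C.nfac Z = 1 := mem_filter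

lemma Cx.mem_bdEdges {C : Cx Vertex} :
    e ∈ C.bdEdges ↔ e ∈ C.face 1 ∧ C.OnBd e := by grind [Cx.bdEdges]

/-- The change of diagonal from `a b` to `a' d`. -/
def flipped (C : Cx Vertex) (a a' b d : Vertex) : Cx Vertex where
  face
    | 1 => (C.face 1 \ {{a, b}}) ∪ {{a', d}}
    | 2 => (C.face 2 \ {{a, b, a'}, {a, d, b}}) ∪ {{a, d, a'}, {d, b, a'}}
    | k => C.face k

/-- The conditions for a change of diagonal at the tooth `a b a'`. -/
structure Flippable (C : Cx Vertex) (o a a' b d : Vertex) : Prop where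
  frame : Frame C
  root : RootOK C 1 o a' a
  tooth : ToothOK C 1 o a' b a
  flip : FlipOK C a a' b d
  ab : a ≠ b
  aa' : a ≠ a'
  ad : a ≠ d
  a'b : a' ≠ b
  a'd : a' ≠ d
  bd : b ≠ d
  oa : o ≠ a
  oa' : o ≠ a'
  ob : o ≠ b
  od : o ≠ d

namespace Flippable

variable {C : Cx Vertex} {o a a' b d : Vertex}

lemma one : Z ∈ (flipped C a a' b d).face 1 ↔ (Z ∈ C.face 1 ∧ Z ≠ {a, b}) ∨ Z = {a', d} := by
  simp [flipped, or_comm]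

lemma two : Z ∈ (flipped C a a' b d).face 2 ↔
    (Z ∈ C.face 2 ∧ Z ≠ {a, b, a'} ∧ Z ≠ {a, d, b}) ∨ Z = {a, d, a'} ∨ Z = {d, b, a'} := by
  grind [flipped]

lemma nfac (S : Finset Vertex) : (flipped C a a' b d).nfac S = C.nfac S := rfl

lemma nfac_one (h : Flippable C o a a' b d) (hS : {a, b} ⊆ S ∨ {a', d} ⊆ S)
    (hS' : S ⊆ {a, b, a', d}) : C.nfac S = 1 := by
  obtain ⟨Y, hY, h1, h2, h3⟩ := h.flip.fac
  rw [Cx.nfac, card_eq_one]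
  refine ⟨Y, ?_⟩
  grind

lemma tri₁ (h : Flippable C o a a' b d) : {a, b, a'} ∈ C.face 2 ∧ C.nfac {a, b, a'} = 1 := by
  have := h.tooth.tri
  rw [show ({a', b, a} : Finset Vertex) = {a, b, a'} by grind] at this
  grind [insert_subset_iff, h.nfac_one]

lemma tri₂ (h : Flippable C o a a' b d) : {a, d, b} ∈ C.face 2 ∧ C.nfac {a, d, b} = 1 :=
  ⟨h.flip.tri, h.nfac_one (.inl (by grind)) (by grind)⟩

lemma new₁ (h : Flippable C o a a' b d) : {a, d, a'} ∈ (flipped C a a' b d).face 2 ∧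
    (flipped C a a' b d).nfac {a, d, a'} = 1 :=
  ⟨two.2 (by simp), h.nfac_one (.inr (by grind)) (by grind)⟩

lemma new₂ (h : Flippable C o a a' b d) : {d, b, a'} ∈ (flipped C a a' b d).face 2 ∧
    (flipped C a a' b d).nfac {d, b, a'} = 1 :=
  ⟨two.2 (by simp), h.nfac_one (.inr (by grind)) (by grind)⟩

lemma not_old (h : Flippable C o a a' b d)
    (hZ : Z = {a, d, a'} ∨ Z = {d, b, a'}) (hW : W ∈ C.face 2) : ¬ Z ⊆ W := by
  intro hs
  refine h.flip.diag' W hW (Finset.Subset.trans ?_ hs)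
  grind

lemma frame_flipped (h : Flippable C o a a' b d) : Frame (flipped C a a' b d) := by
  have hF := h.frame
  have hv : ∀ x ∈ ({a, b, a', d} : Finset Vertex), {x} ∈ C.face 0 := by
    grind [h.root.vy, hF.sub₁, h.flip.bd, h.root.vx]
  have hc : ∀ Z : Finset Vertex, Z = {a, d, a'} ∨ Z = {d, b, a'} → Z.card = 3 := by
    grind [card_triple, h.ad, h.aa', h.a'd, h.bd, h.a'b]
  refine ⟨hF.zero, ?_, ?_, hF.sub₃, ?_, ?_, hF.card₃, ?_⟩
  · intro Z hZ x hx; rcases one.1 hZ with ⟨hZ, -⟩ | rfl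
    · exact hF.sub₁ Z hZ x hx
    · refine hv x ?_; grind
  · intro Z hZ x hx; rcases two.1 hZ with ⟨hZ, -⟩ | rfl | rfl
    · exact hF.sub₂ Z hZ x hx
    all_goals
      refine hv x ?_; grind
  · grind [one, card_pair, hF.card₁, h.a'd]
  · intro Z hZ; rcases two.1 hZ with ⟨hZ, -⟩ | hZ
    · exact hF.card₂ Z hZ
    · grind
  grind [two, eq_of_subset_of_card_le, hF.anti, h.not_old, hF.card₂]

/-- Faces that are not contained in the quadrilateral are preserved by a change of diagonal. -/
lemma sim (C : Cx Vertex) (a a' b d : Vertex) : Sim C (flipped C a a' b d) id Set.univ {b}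
    (fun S => ∃ x ∈ S, x ∉ ({a, a', b, d} : Set Vertex)) id id := by
  have hsub : ∀ {S Z : Finset Vertex}, (∃ x ∈ S, x ∉ ({a, a', b, d} : Set Vertex)) → S ⊆ Z →
      (∀ x ∈ Z, x = a ∨ x = a' ∨ x = b ∨ x = d) → False := by grind
  refine ⟨Set.injOn_id _, ?_, by simp, by simp, ?_, ?_, ?_, ?_, ?_, by simp, by simp, ?_, ?_, ?_, ?_⟩
  any_goals grind
  · grind [S, image_id, one]
  · grind [S, image_id, two]
  · grind [two, subset_rfl]
  · exact fun S _ _ Z _ hZ => ⟨Z, hZ, rfl⟩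
  · exact fun Z hZ _ => hZ
  · exact fun x _ hx => hx
  · intro Z hZ _ hT; rw [image_id]; refine one.2 (.inl ⟨hZ, ?_⟩); rintro rfl
    exact hT b (by simp) rfl
  · intro Z hZ hT; rw [image_id]
    refine ⟨rfl, two.2 (.inl ⟨hZ, ?_, ?_⟩)⟩ <;> rintro rfl <;> exact hT b (by simp) rfl

lemma vert_flipped (h : Flippable C o a a' b d) (hx : C.OnBd {x}) :
    (flipped C a a' b d).OnBd {x} := by
  obtain ⟨T, hT, hn, hs⟩ := hx
  rw [singleton_subset_iff] at hs
  by_cases hq : T = {a, b, a'} ∨ T = {a, d, b}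
  · have : x = a ∨ x = d ∨ x = b ∨ x = a' := by grind
    rcases this with rfl | rfl | rfl | rfl
    · exact ⟨_, h.new₁.1, h.new₁.2, by simp⟩
    · exact ⟨_, h.new₁.1, h.new₁.2, by simp⟩
    · exact ⟨_, h.new₂.1, h.new₂.2, by simp⟩
    · exact ⟨_, h.new₂.1, h.new₂.2, by simp⟩
  · exact ⟨T, two.2 (.inl ⟨hT, not_or.1 hq⟩), hn, by grind⟩

lemma edge_flipped (h : Flippable C o a a' b d) (he : e ∈ C.face 1)
    (hne : e ≠ {a, b}) : (flipped C a a' b d).OnBd e ↔ C.OnBd e := by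
  have hc := h.frame.card₁ e he
  have hne' : e ≠ {a', d} := by grind [h.flip.diag]
  constructor
  · rintro ⟨T, hT, hn, hs⟩; rcases two.1 hT with ⟨hT, -⟩ | rfl | rfl
    · exact ⟨T, hT, hn, hs⟩
    · rcases Host.pair_sub hc hs with rfl | rfl | rfl
      · exact ⟨_, h.tri₂.1, h.tri₂.2, by grind⟩
      · exact ⟨_, h.tri₁.1, h.tri₁.2, by grind⟩
      grind
    · rcases Host.pair_sub hc hs with rfl | rfl | rfl
      · exact ⟨_, h.tri₂.1, h.tri₂.2, by simp⟩
      · grind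
      · exact ⟨_, h.tri₁.1, h.tri₁.2, by simp⟩
  · rintro ⟨T, hT, hn, hs⟩; by_cases h1 : T = {a, b, a'}
    · subst h1; rcases Host.pair_sub hc hs with rfl | rfl | rfl
      · grind
      · exact ⟨_, h.new₁.1, h.new₁.2, by grind⟩
      · exact ⟨_, h.new₂.1, h.new₂.2, by simp⟩
    · by_cases h2 : T = {a, d, b}
      · subst h2; rcases Host.pair_sub hc hs with rfl | rfl | rfl
        · exact ⟨_, h.new₁.1, h.new₁.2, by grind⟩
        · grind
        · exact ⟨_, h.new₂.1, h.new₂.2, by grind⟩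
      · exact ⟨T, two.2 (.inl ⟨hT, h1, h2⟩), hn, hs⟩

lemma card_swap {α : Type} [DecidableEq α] {s u v : Finset α} (hu : u ⊆ s) (hv : Disjoint s v)
    (hc : u.card = v.card) : ((s \ u) ∪ v).card = s.card := by
  grind [card_union_of_disjoint, sdiff_subset, card_sdiff_of_subset, card_le_card]

lemma not_new (h : Flippable C o a a' b d) : {a, d, a'} ∉ C.face 2 ∧ {d, b, a'} ∉ C.face 2 :=
  ⟨fun h1 => h.not_old (.inl rfl) h1 subset_rfl, fun h1 => h.not_old (.inr rfl) h1 subset_rfl⟩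

lemma ne_tri (h : Flippable C o a a' b d) : ({a, b, a'} : Finset Vertex) ≠ {a, d, b} ∧
    ({a, d, a'} : Finset Vertex) ≠ {d, b, a'} := by
  constructor
  · intro he; have : a' ∈ ({a, d, b} : Finset Vertex) := he ▸ by simp
    simp [h.aa'.symm, h.a'd, h.a'b] at this
  · intro he; have : b ∈ ({a, d, a'} : Finset Vertex) := he ▸ by simp
    grind [h.ab, h.bd, h.a'b]

lemma card_one (h : Flippable C o a a' b d) :
    ((flipped C a a' b d).face 1).card = (C.face 1).card := by
  refine card_swap ?_ ?_ rfl
  · grind [pair_comm, h.tooth.yb]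
  · simpa using h.flip.diag

lemma card_two (h : Flippable C o a a' b d) :
    ((flipped C a a' b d).face 2).card = (C.face 2).card := by
  refine card_swap ?_ ?_ ?_
  · grind [insert_subset_iff, h.tri₁, h.tri₂]
  · simp [h.not_new]
  grind [card_pair, h.ne_tri]

lemma card_freeRidges (h : Flippable C o a a' b d) :
    (flipped C a a' b d).freeRidges.card = C.freeRidges.card := by
  have : (flipped C a a' b d).freeRidges =
      (C.freeRidges \ {{a, b, a'}, {a, d, b}}) ∪ {{a, d, a'}, {d, b, a'}} := by
    ext Z; simp only [Cx.mem_freeRidges, two, mem_union, mem_sdiff,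
      mem_insert, mem_singleton, nfac, not_or]
    constructor
    · grind
    · rintro (⟨⟨h1, h3⟩, h2⟩ | h1)
      · grind
      · refine ⟨.inr h1, ?_⟩; rcases h1 with rfl | rfl
        · exact h.new₁.2
        · exact h.new₂.2
  grind [card_swap, Cx.mem_freeRidges, insert_subset_iff, card_pair, h.tri₁, h.tri₂,
    h.not_new, h.ne_tri]

lemma card_bdEdges (h : Flippable C o a a' b d) :
    (flipped C a a' b d).bdEdges.card = C.bdEdges.card := by
  have : (flipped C a a' b d).bdEdges = (C.bdEdges \ {{a, b}}) ∪ {{a', d}} := by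
    ext e; simp only [Cx.mem_bdEdges, one, mem_union, mem_sdiff, mem_singleton]; constructor
    · grind [h.edge_flipped]
    · rintro (⟨⟨h1, h3⟩, h2⟩ | rfl)
      · grind [h.edge_flipped]
      · exact ⟨.inr rfl, _, h.new₁.1, h.new₁.2, by grind⟩
  rw [this]
  refine card_swap ?_ ?_ rfl
  · have := h.tooth.yb; rw [pair_comm] at this; rw [singleton_subset_iff, Cx.mem_bdEdges]
    exact ⟨this, _, h.tri₁.1, h.tri₁.2, by grind⟩
  grind [disjoint_singleton_right, h.flip.diag, C.bdEdges_subset]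

/-- The root triangle after a change of diagonal. -/
lemma rootOK (h : Flippable C o a a' b d) : RootOK (flipped C a a' b d) 1 o a a' := by
  have hr := h.root
  have hs : ({o, a', a} : Finset Vertex) = {o, a, a'} := by grind
  refine ⟨hr.vo, hr.vy, hr.vx, one.2 (.inl ⟨hr.oy, ?_⟩), one.2 (.inl ⟨hr.ox, ?_⟩),
    one.2 (.inl ⟨pair_comm a' a ▸ hr.xy, ?_⟩), two.2 (.inl ⟨hs ▸ hr.tri, ?_, ?_⟩),
    hs ▸ hr.fac⟩
  · intro he; have : o ∈ ({a, b} : Finset Vertex) := he ▸ by simp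
    simp [h.oa, h.ob] at this
  · intro he; have : o ∈ ({a, b} : Finset Vertex) := he ▸ by simp
    simp [h.oa, h.ob] at this
  · intro he; have : a' ∈ ({a, b} : Finset Vertex) := he ▸ by simp
    simp [h.aa'.symm, h.a'b] at this
  · intro he; have : o ∈ ({a, b, a'} : Finset Vertex) := he ▸ by simp
    simp [h.oa, h.ob, h.oa'] at this
  · intro he; have : o ∈ ({a, d, b} : Finset Vertex) := he ▸ by simp
    simp [h.oa, h.ob, h.od] at this

lemma apart (h : Flippable C o a a' b d) (hx : Apart C o x) : Apart (flipped C a a' b d) o x := by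
  refine ⟨fun Z hZ hs => ?_, fun Z hZ hs => ?_, hx.e3⟩
  all_goals grind [one, Host.sub_pair, two, hx.e1, h.oa', h.od, hx.e2, h.oa, h.ob]

/-- The tooth after a change of diagonal. -/
lemma toothOK (h : Flippable C o a a' b d) : ToothOK (flipped C a a' b d) 1 o a d a' := by
  refine ⟨one.2 (.inl ⟨h.flip.ad, ?_⟩), one.2 (.inr (pair_comm _ _)), h.new₁.1, h.new₁.2, ?_⟩
  · intro he; have : d ∈ ({a, b} : Finset Vertex) := he ▸ by simp
    simp [h.ad.symm, h.bd.symm] at this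
  · intro Z hZ hs hf; rcases two.1 hZ with ⟨hZ, h1, h2⟩ | rfl | rfl
    · rcases h.tooth.free Z hZ (pair_comm a a' ▸ hs) hf with rfl | rfl
      all_goals grind
    all_goals grind [Host.sub_pair, h.ad, h.ab, h.aa']

/-- The diagonal can be changed back. -/
lemma flipOK (h : Flippable C o a a' b d) : FlipOK (flipped C a a' b d) a' a d b := by
  have h3 : ({a', b, d} : Finset Vertex) = {d, b, a'} := by grind
  refine ⟨one.2 (.inl ⟨h.tooth.xb, ?_⟩), one.2 (.inl ⟨pair_comm b d ▸ h.flip.bd, ?_⟩), ?_,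
    h3 ▸ h.new₂.1, ?_, ?_, ?_⟩
  · intro he; have : a' ∈ ({a, b} : Finset Vertex) := he ▸ by simp
    simp [h.aa'.symm, h.a'b] at this
  · intro he; have : d ∈ ({a, b} : Finset Vertex) := he ▸ by simp
    simp [h.ad.symm, h.bd.symm] at this
  · intro hZ; rcases one.1 hZ with ⟨-, h1⟩ | he
    · exact h1 rfl
    · have : a ∈ ({a', d} : Finset Vertex) := he ▸ by simp
      simp [h.aa', h.ad] at this
  · grind [two, Host.sub_pair, h.flip.both, h.ab, h.bd, h.a'b, h.ad, h.aa']
  · grind [two, h.flip.diag']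
  · obtain ⟨Y, hY, h1, h2, h4⟩ := h.flip.fac
    exact ⟨Y, hY, h2, h1, fun Y' hY' hs => h4 Y' hY' hs.symm⟩

end Flippable


variable {D M : Ball} {n ε τ j q : ℕ} {A B : Arc} {dn : Set ℕ} {C : Cx Vertex}

/-- The reversed arc. -/
def Arc.rev (A : Arc) (v : Vertex) : Arc where
  inner := A.inner.reverse
  root := v
  fillet := false

lemma Arc.rev_tip (A : Arc) (v o : Vertex) : (A.rev v).tip o = A.last o := by
  unfold Arc.rev Arc.tip Arc.last
  grind

lemma Arc.rev_last (A : Arc) (v o : Vertex) : (A.rev v).last o = A.tip o := by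
  grind [Arc.rev, Arc.tip, Arc.last]

lemma newArcs_rev (hf : A.fillet = false) : newArcs M D.hub (D.siteAt j A) =
    [A.rev (rootAt D.secondRoot D.arcs j)] := by
  simp [newArcs, Ball.siteAt, hf, Arc.rev]

lemma flipAt_eq (hf : A.fillet = false) (hl : 2 ≤ A.inner.length) : flipAt C (D.siteAt j A) =
    flipped C A.root (rootAt D.secondRoot D.arcs j) (A.tip D.hub) (A.last D.hub) := by
  obtain ⟨i, r, f⟩ := A
  simp only at hf hl
  subst hf
  match i, hl with
  | v :: w :: L, _ =>
    grind [flipAt, Ball.siteAt, flipped, Arc.tip, Arc.last, List.headD_cons, List.getLastD_cons]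

lemma flipAt_of_short (hl : ¬ 2 ≤ A.inner.length) : flipAt C (D.siteAt j A) = C := by
  obtain ⟨i, r, f⟩ := A
  simp only at hl
  match f, i, hl with
  | true, _, _ => rfl
  | false, [], _ => rfl
  | false, [x], _ => rfl
  | false, x :: y :: L, h => simp at h

lemma flipAt_of_fillet (hf : A.fillet = true) : flipAt C (D.siteAt j A) = C := by
  obtain ⟨i, r, f⟩ := A
  simp only at hf
  subst hf
  rfl

namespace Setup

/-- A change of diagonal does not affect arcs that do not belong to the same tooth. -/
lemma kept_flip {a a' b d o v : Vertex} {t : ℕ} {P : Vertex → Prop}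
    (hP : ∀ x, P x → x ∉ ({a, a', b, d} : Set Vertex)) (ho : P o) (hv : v ≠ b) (hr : B.root ≠ b)
    (hi : ∀ y ∈ B.inner, P y) (hx : B.fillet = true → P x) (hs : B.inner ≠ [] → P v ∨ P B.root)
    (ht : B.fillet = true → 1 ≤ t ∧ B.inner.length = t) : Kept t o v B x Set.univ {b}
      (fun S => ∃ y ∈ S, y ∉ ({a, a', b, d} : Set Vertex)) := by
  have hb : ∀ {y}, P y → y ∈ (Set.univ : Set Vertex) ∧ y ∉ ({b} : Set Vertex) := fun hy =>
    ⟨trivial, fun h => hP _ hy (by rw [Set.mem_singleton_iff.1 h]; simp)⟩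
  have hch : B.fillet = true → ∀ i, 1 ≤ i → i < t → P (B.chain o i) := by
    grind [Arc.chain, List.getD_eq_getElem, List.getElem_append_left, List.mem_of_mem_tail,
      List.getElem_mem]
  refine ⟨hb ho, ⟨trivial, hv⟩, ⟨trivial, hr⟩, fun y hy => hb (hi y hy), fun hf => hb (hx hf),
    ⟨o, by simp, hP o ho⟩, ?_, fun y hy => ⟨o, by simp, hP o ho⟩, ?_, ?_, ?_, ?_⟩
  any_goals grind
  · intro _ hl; exact ⟨⟨_, by simp, hP _ (hi _ (B.tip_mem_inner o (by omega)))⟩,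
      _, by simp, hP _ (hi _ (List.mem_of_mem_tail (B.last_mem_tail o hl)))⟩
  · intro hf i h1 h2; obtain ⟨h3, h4⟩ := ht hf
    exact ⟨_, by simp, hP _ (hi _ (B.tip_mem_inner o (by omega)))⟩

end Setup

namespace Stage

/-- After a reversed arc has been put on the profile. -/
lemma goodArc_rev {o v b : Vertex} {t t' : ℕ} (hs : GoodSite C 1 t o v A b)
    (hl : ¬ 2 ≤ A.inner.length) : GoodArc C 1 t' o A.root (A.rev v) none := by
  have hr := hs.root
  refine ⟨⟨⟨hr.vo, hr.vy, hr.vx, hr.oy, hr.ox, pair_comm v A.root ▸ hr.xy, ?_, ?_⟩, ?_, ?_, ?_,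
    by simp [Arc.rev]⟩, by simp [Arc.rev]⟩
  · convert hr.tri using 1; grind [Arc.rev]
  · convert hr.fac using 2; grind [Arc.rev]
  · exact fun x hx => hs.inner x (List.mem_reverse.1 hx)
  · intro hne; have hne' : A.inner ≠ [] := by grind [Arc.rev]
    have ht := hs.tooth hne'; have hlast : A.last o = A.tip o := by
      unfold Arc.last Arc.tip
      match A.inner, hl, hne' with
      | [x], _, _ => rfl
      | x :: y :: l, h, _ => simp at h
    have he : ({A.root, A.tip o, v} : Finset Vertex) = {v, A.tip o, A.root} := by grind
    rw [Arc.rev_tip, hlast]; refine ⟨pair_comm _ A.root ▸ ht.yb, pair_comm v _ ▸ ht.xb, ?_, ?_, ?_⟩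
    · exact he ▸ ht.tri
    · exact he ▸ ht.fac
    · intro Z hZ hsub hf
      refine (ht.free Z hZ (pair_comm A.root v ▸ hsub) hf).imp (fun h => ?_) fun h => ?_
      all_goals grind [Arc.rev]
  grind [Arc.rev]

lemma flippable (hs : Stage D M n τ dn C) (h : Setup D M n ε τ) (hA : D.arcs[j]? = some A)
    (hf : A.fillet = false) (hj : j ∉ dn) (hl : 2 ≤ A.inner.length) :
    Flippable C D.hub A.root (rootAt D.secondRoot D.arcs j) (A.tip D.hub) (A.last D.hub) := by
  have hsite := hs.site j A hA hj
  have hjL := Setup.lt hA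
  have htip := A.tip_mem_inner D.hub (by omega)
  have hlast := A.last_mem_tail D.hub hl
  have hlast' := List.mem_of_mem_tail hlast
  have hne : ∀ x ∈ A.inner, D.hub ≠ x := fun x hx he => h.hub_notMem hA (he ▸ hx)
  have hroot : ∀ x ∈ A.inner, A.root ≠ x := fun x hx he =>
    h.root_ne_inner hA hjL hx (by grind [Setup.root_eq])
  refine ⟨hs.frame, hsite.root, hsite.tooth (List.ne_nil_of_mem htip), hsite.flip hf hl,
    hroot _ htip, ?_, hroot _ hlast', fun he => h.root_ne_inner hA hjL.le htip he.symm,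
    fun he => h.root_ne_inner hA hjL.le hlast' he.symm, ?_, ?_, h.hub_ne_root hjL.le, hne _ htip,
    hne _ hlast'⟩
  · rw [Setup.root_eq hA]; intro he; have := rootAt_inj h.nodup hjL hjL.le he; omega
  · intro he; have hn := inner_nodup h.nodup (List.mem_of_getElem? hA); rw [he] at htip
    have h1 : A.inner = A.tip D.hub :: A.inner.tail := by
      unfold Arc.tip
      cases hi : A.inner with
      | nil => grind
      | cons x l => rfl
    grind
  · rw [Setup.root_eq hA]; exact h.hub_ne_root hjL

/-- The change of diagonal at one arc. -/
lemma flipStep (hs : Stage D M n τ dn C) (h : Setup D M n ε τ) (hA : D.arcs[j]? = some A)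
    (hf : A.fillet = false) (hj : j ∉ dn) (hdn : ∀ q B, D.arcs[q]? = some B → B.fillet = true →
      q ∈ dn) : Stage D M n τ (insert j dn) (flipAt C (D.siteAt j A)) := by
  have hjL := Setup.lt hA
  have hpos := h.base.pos
  have hsite := hs.site j A hA hj
  have hhub : ∀ Z : Finset Vertex, (Z = {D.hub, D.secondRoot, endRoot D.secondRoot D.arcs} ∨
      ∃ j A, D.arcs[j]? = some A ∧ (j ∉ dn ∧ Z = {D.hub, rootAt D.secondRoot D.arcs j, A.root} ∨
      j ∈ dn ∧ ∃ p ∈ rootPairs A.root (newArcs M D.hub (D.siteAt j A)), Z = {D.hub, p.1, p.2})) →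
      Z = {D.hub, D.secondRoot, endRoot D.secondRoot D.arcs} ∨
      ∃ q A, D.arcs[q]? = some A ∧ (q ∉ insert j dn ∧
      Z = {D.hub, rootAt D.secondRoot D.arcs q, A.root} ∨ q ∈ insert j dn ∧
      ∃ p ∈ rootPairs A.root (newArcs M D.hub (D.siteAt q A)), Z = {D.hub, p.1, p.2}) := by
    refine fun Z => Or.imp_right ?_; rintro ⟨q, B, hB, h1⟩; refine ⟨q, B, hB, ?_⟩
    by_cases hq : q = j
    · subst hq; obtain rfl : A = B := by grind
      right; refine ⟨.inl rfl, ?_⟩; rcases h1 with ⟨-, rfl⟩ | ⟨h1, -⟩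
      · rw [newArcs_rev hf]; exact ⟨_, List.mem_singleton.2 rfl, by ext; simp [Arc.rev]; tauto⟩
      · grind
    grind
  by_cases hl : 2 ≤ A.inner.length
  · have hF := hs.flippable h hA hf hj hl; rw [flipAt_eq hf hl]
    have hsim := Flippable.sim C A.root (rootAt D.secondRoot D.arcs j) (A.tip D.hub) (A.last D.hub)
    have htip := A.tip_mem_inner D.hub (by omega)
    have hlast := List.mem_of_mem_tail (A.last_mem_tail D.hub hl)
    have hquad : ∀ x, x ∈ ({A.root, rootAt D.secondRoot D.arcs j, A.tip D.hub, A.last D.hub} :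
        Set Vertex) → (∃ k, (k = j ∨ k = j + 1) ∧ x = rootAt D.secondRoot D.arcs k) ∨
        x ∈ A.inner := by grind [Setup.root_eq]
    have hroot : ∀ k, k ≤ D.arcs.length → rootAt D.secondRoot D.arcs k ≠ A.tip D.hub :=
      fun k hk he => h.root_ne_inner hA hk htip he.symm
    have hP : ∀ q B, D.arcs[q]? = some B → q ≠ j → ∀ x, (x = D.hub ∨ x ∈ copied q ∨ x ∈ B.inner ∨
        ∃ k ≤ D.arcs.length, k ≠ j ∧ k ≠ j + 1 ∧ x = rootAt D.secondRoot D.arcs k) →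
        x ∉ ({A.root, rootAt D.secondRoot D.arcs j, A.tip D.hub, A.last D.hub} : Set Vertex) := by
      intro q B hB hq x hx h1; rcases hquad x h1 with ⟨k, hk, rfl⟩ | h2
      · rcases hx with h3 | h3 | h3 | ⟨m, hm, h3, h4, h5⟩
        · exact h.hub_ne_root (by omega) h3.symm
        · grind [Setup.old_copied, h.old_root]
        · grind [h.root_ne_inner]
        grind [rootAt_inj, h.nodup]
      · rcases hx with h3 | h3 | h3 | ⟨m, hm, -, -, h5⟩
        · exact h.hub_notMem hA (h3 ▸ h2)
        · exact Setup.old_copied (h.old_inner hA h2) h3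
        · exact h.inner_ne hA hB hq h3 h2
        · exact h.root_ne_inner hA hm h2 h5
    have hends : ∀ q B, D.arcs[q]? = some B → q ≠ j → B.inner ≠ [] →
        (rootAt D.secondRoot D.arcs q = D.hub ∨ rootAt D.secondRoot D.arcs q ∈ copied q ∨
          rootAt D.secondRoot D.arcs q ∈ B.inner ∨ ∃ k ≤ D.arcs.length, k ≠ j ∧ k ≠ j + 1 ∧
          rootAt D.secondRoot D.arcs q = rootAt D.secondRoot D.arcs k) ∨
        (B.root = D.hub ∨ B.root ∈ copied q ∨ B.root ∈ B.inner ∨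
          ∃ k ≤ D.arcs.length, k ≠ j ∧ k ≠ j + 1 ∧ B.root = rootAt D.secondRoot D.arcs k) := by
      grind [Setup.lt, lt_or_gt_of_ne, Setup.root_eq]
    refine ⟨hF.frame_flipped, fun x hx => hF.vert_flipped (hs.cover x hx), ?_, ?_, ?_,
      fun Z hZ ho hn => ?_⟩
    · grind
    · intro q B hB hq; rw [Set.mem_insert_iff, not_or] at hq
      have hfB : B.fillet = false := by grind
      refine (hs.site q B hB hq.2).sim_id hsim (Setup.kept_flip (hP q B hB hq.1) (.inl rfl)
        (hroot q (Setup.lt hB).le) ?_ (fun y hy => .inr (.inr (.inl hy))) (by simp [hfB])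
        (hends q B hB hq.1) (by simp [hfB])) hF.frame_flipped.card₂
      rw [Setup.root_eq hB]; exact hroot _ (Setup.lt hB)
    · intro q B hB hq; by_cases hqj : q = j
      · subst hqj; obtain rfl : A = B := by grind
        rw [newArcs_rev hf]
        refine ⟨⟨⟨hF.rootOK, ?_, ?_, ?_, by simp [Arc.rev]⟩, by simp [Arc.rev]⟩, trivial⟩
        · intro x hx; have := hsite.inner x (List.mem_reverse.1 hx); exact ⟨this.1, hF.apart this.2⟩
        · intro _; rw [Arc.rev_tip]; exact hF.toothOK
        · intro _ _; rw [Arc.rev_tip, Arc.rev_last]; exact hF.flipOK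
      · have hq' := hq.resolve_left hqj; refine (hs.new q B hB hq').imp fun k A' hA' hg => ?_
        by_cases hfB : B.fillet = true
        · have hNA := h.newArc hB hfB hA'
          have hnext : ∀ A'' b, (newArcs M D.hub (D.siteAt q B))[k + 1]? = some A'' →
              A''.inner.head? = some b → b ∈ copied q := fun A'' b h1 h2 =>
            (h.newArc hB hfB h1).inner b (List.mem_of_head? h2)
          have hin : ∀ x ∈ B.inner, x ≠ A.tip D.hub := by grind [h.inner_ne]
          refine hg.sim_id hsim hF.frame_flipped.card₂ (by omega) (Setup.kept_flip (hP q B hB hqj)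
            (.inl rfl) ?_ ?_ (fun y hy => .inr (.inl (hNA.inner y hy))) ?_ ?_
            fun hf' => ⟨by omega, (hg.site.fillet hf').1⟩) ?_
          · rcases hNA.start with h1 | h1
            · grind
            · rw [h1, Setup.root_eq hB]; exact hroot _ (Setup.lt hB)
          · grind [Setup.lt, hNA.root]
          · intro hf'; obtain ⟨A'', b, h1, h2, -⟩ := hg.next hf'
            rw [h1, Option.bind_some, h2, Option.getD_some]; grind
          · exact fun hne => .inr (.inr (.inr (.inl (List.mem_of_mem_tail (hNA.side hne)))))
          · intro hf' A'' b h1 h2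
            refine ⟨⟨b, by simp, hP q B hB hqj b (.inr (.inl (hnext A'' b h1 h2)))⟩, ?_⟩
            rcases (h.newArc hB hfB h1).root with h3 | h3
            all_goals grind
        · rw [Bool.not_eq_true] at hfB; rw [newArcs_rev hfB] at hA' hg ⊢
          obtain rfl : k = 0 := by grind
          obtain rfl : B.rev (rootAt D.secondRoot D.arcs q) = A' := by simpa using hA'
          refine hg.sim_id hsim hF.frame_flipped.card₂ (by omega) (Setup.kept_flip (hP q B hB hqj)
            (.inl rfl) ?_ (hroot q (Setup.lt hB).le)
            (fun y hy => .inr (.inr (.inl (List.mem_reverse.1 hy)))) (by simp [Arc.rev])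
            (fun hne => (hends q B hB hqj (by simpa [Arc.rev] using hne)).symm)
            (by simp [Arc.rev])) (by simp [Arc.rev])
          rw [rootAt_zero, Setup.root_eq hB]; exact hroot _ (Setup.lt hB)
    · rcases Flippable.two.1 hZ with ⟨hZ, -⟩ | rfl | rfl
      · exact hhub Z (hs.hub Z hZ ho hn)
      all_goals grind [hF.oa, hF.oa', hF.od, hF.ob]
  · rw [flipAt_of_short hl]
    refine ⟨hs.frame, hs.cover, fun q B hB hf' hq => hs.fresh q B hB hf' fun h1 => hq (.inr h1),
      fun q B hB hq => hs.site q B hB fun h1 => hq (.inr h1), ?_,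
      fun Z hZ ho hn => hhub Z (hs.hub Z hZ ho hn)⟩
    intro q B hB hq; by_cases hqj : q = j
    · subst hqj; obtain rfl : A = B := by grind
      rw [newArcs_rev hf]; exact ⟨goodArc_rev hsite hl, trivial⟩
    grind [hs.new]

end Stage


/-- The profile without the hub and the first root. -/
def body (L : List Arc) : List Vertex := L.flatMap fun A : Arc => A.inner ++ [A.root]

lemma mem_body {L : List Arc} : x ∈ body L ↔ ∃ (k : ℕ) (A : Arc), L[k]? = some A ∧
    (x ∈ A.inner ∨ x = A.root) := by
  grind [body, List.mem_singleton, List.mem_iff_getElem?, List.mem_of_getElem?]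

namespace Host

variable {C : Cx Vertex} {N : Ball} {n ε τ : ℕ} {g : Sym → Vertex} {Fr : Set Vertex}

lemma inner_fresh (hN : Good ε τ N) (hd : Named N n g Fr) {Q : Arc}
    (hQ : N.arcs[k]? = some Q) (hx : x ∈ Q.inner) : {x} ∈ N.cx.face 0 ∧ x ∈ Fr := by
  have hx' := ((hN.site hQ).inner x hx).1
  refine ⟨hx', (hd.fr x hx').resolve_left ?_⟩
  rintro rfl
  rw [hd.hub] at hx
  exact (List.nodup_cons.1 hN.nodup).1 (inner_mem_profile (List.mem_of_getElem? hQ) hx)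

/-- The inner vertices of the arcs in the middle of the new part are inner vertices or roots of
`N`, or new tips. -/
lemma mid_inner (hN : Good ε τ N) (hd : Named N n g Fr) {Q : Arc} (h1 : 1 ≤ i)
    (h2 : i + 1 < n) (hQ : N.arcs[n - 2 - i]? = some Q)
    (hx : x ∈ g (.β i) :: Q.inner.tail ++ [g (.α i)]) :
    ({x} ∈ N.cx.face 0 ∧ x ∈ Q.inner ++ [Q.root]) ∨ (Q.inner = [] ∧ x = g (.β i)) := by
  obtain ⟨Q', hQ', -, hr⟩ := hd.arc h1 h2
  obtain rfl : Q = Q' := by grind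
  simp only [List.cons_append, List.mem_cons, List.mem_append, List.not_mem_nil, or_false] at hx
  rcases hx with rfl | hx | rfl
  · by_cases hne : Q.inner = []
    · grind
    · have := List.mem_of_head? (hd.β i Q h1 h2 hQ hne)
      exact .inl ⟨(inner_fresh hN hd hQ this).1, List.mem_append_left _ this⟩
  · have := List.mem_of_mem_tail hx
    exact .inl ⟨(inner_fresh hN hd hQ this).1, List.mem_append_left _ this⟩
  · rw [← hr]; exact .inl ⟨(hN.site hQ).root.vy, by simp⟩

lemma mid_nodup (h : Host C n g Fr) (hN : Good ε τ N) (hd : Named N n g Fr) {Q : Arc}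
    (h1 : 1 ≤ i) (h2 : i + 1 < n) (hQ : N.arcs[n - 2 - i]? = some Q) :
    (g (.β i) :: Q.inner.tail ++ [g (.α i)]).Nodup := by
  have hnd := (List.nodup_cons.1 hN.nodup).2
  have hbn := body_nodup hnd (List.mem_of_getElem? hQ)
  obtain ⟨Q', hQ', -, hr⟩ := hd.arc h1 h2
  obtain rfl : Q = Q' := by grind
  by_cases hne : Q.inner = []
  · grind [h.inj]
  · obtain ⟨l, hl⟩ := List.head?_eq_some_iff.1 (hd.β i Q h1 h2 hQ hne); grind

/-- The new part of the profile has no repetitions. -/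
lemma nodup_newPart (h : Host C n g Fr) (hN : Good ε τ N) (hd : Named N n g Fr) :
    (body (newPart N n g)).Nodup := by
  have hnd := (List.nodup_cons.1 hN.nodup).2
  have hlen := hd.len
  have h3 := hd.three
  have hin : ∀ (k : ℕ) (A : Arc), (newPart N n g)[k]? = some A → A.root ∉ Fr ∧ ∀ x ∈ A.inner, x ∈ Fr := by
    intro k A hA
    rcases newPart_cases hlen hA with ⟨-, rfl⟩ | ⟨i, Q, h1, h2, -, hQ, rfl⟩ | ⟨-, rfl⟩ | ⟨-, rfl⟩
    · grind [h.frc, h.frα]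
    · refine ⟨h.frc _, fun x hx => ?_⟩
      simp only [List.cons_append, List.mem_cons, List.mem_append, List.not_mem_nil, or_false] at hx
      rcases hx with rfl | hx | rfl
      · exact h.frβ _
      · exact (inner_fresh hN hd hQ (List.mem_of_mem_tail hx)).2
      · exact h.frα _
    all_goals grind [h.frb', h.fra]
  rw [body, List.nodup_flatMap]
  constructor
  · intro A hA; obtain ⟨k, hk⟩ := List.mem_iff_getElem?.1 hA; obtain ⟨h4, h5⟩ := hin k A hk
    rw [List.nodup_append]; refine ⟨?_, List.nodup_singleton _, fun x hx y hy he => ?_⟩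
    · rcases newPart_cases hlen hk with ⟨-, rfl⟩ | ⟨i, Q, h1, h2, -, hQ, rfl⟩ | ⟨-, rfl⟩ | ⟨-, rfl⟩
      all_goals grind [h.mid_nodup]
    grind
  · rw [List.pairwise_iff_getElem]; intro k k' hk hk' hlt x hx hx'
    have hA := List.getElem?_eq_getElem hk; have hA' := List.getElem?_eq_getElem hk'
    obtain ⟨r1, i1⟩ := hin _ _ hA; obtain ⟨r2, i2⟩ := hin _ _ hA'
    simp only [List.mem_append, List.mem_singleton] at hx hx'; rw [newPart_length hlen] at hk hk'
    rcases hx with hx | hx <;> rcases hx' with hx' | hx'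
    any_goals grind
    · rcases newPart_cases hlen hA' with ⟨h4, -⟩ | ⟨i', Q', h1', h2', hk', hQ', h4'⟩ | ⟨-, h4⟩ | ⟨-, h4⟩
      any_goals grind
      · rw [h4'] at hx'; have hc' := mid_inner hN hd h1' h2' hQ' hx'
        rcases newPart_cases hlen hA with ⟨-, h4⟩ | ⟨i, Q, h1, h2, hk, hQ, h4⟩ | ⟨h4, -⟩ | ⟨h4, -⟩
        · obtain rfl : x = g (.α (n - 1)) := by grind
          rcases hc' with ⟨-, h5⟩ | ⟨-, h5⟩
          · have h6 := hd.α (n - 1) (by omega) (by omega); rw [Nat.sub_self, rootAt_zero] at h6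
            grind [profile, List.nodup_cons, List.mem_of_getElem?]
          · grind [h.inj]
        · rw [h4] at hx; rcases mid_inner hN hd h1 h2 hQ hx with ⟨h5, h6⟩ | ⟨h5, h6⟩ <;>
          rcases hc' with ⟨h7, h8⟩ | ⟨h7, h8⟩
          all_goals grind [bodies_disjoint, hd.gap, h.inj]
        · omega
        · omega
    · rw [hx] at hx'; have e1 := rootAt_succ (v := g (.c n)) hA
      have e2 := rootAt_succ (v := g (.c n)) hA'; grind [rootAt_newPart, h.inj]

end Host

section Blocks

variable {G : Site × ℕ → List Arc} {P : Vertex → Arc → Option Arc → Prop}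

lemma endRoot_blocks : ∀ {L : List Arc} {v : Vertex} {k : ℕ},
    (∀ p ∈ (sites v L).zipIdx k, endRoot p.1.arc.root (G p) = p.1.start) →
    endRoot (endRoot v L) (((sites v L).zipIdx k).reverse.flatMap G) = v
  | [], v, k, _ => rfl
  | A :: L, v, k, h => by
    rw [sites, List.zipIdx_cons] at h ⊢
    rw [List.reverse_cons, List.flatMap_append, endRoot_append, endRoot_cons,
      endRoot_blocks fun p hp => h p (List.mem_cons_of_mem _ hp), List.flatMap_singleton]
    exact h _ List.mem_cons_self

lemma along_blocks (hP : ∀ v A nx, P v A none → P v A nx) : ∀ {L : List Arc} {v : Vertex} {k : ℕ},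
    (∀ p ∈ (sites v L).zipIdx k, endRoot p.1.arc.root (G p) = p.1.start) →
    (∀ p ∈ (sites v L).zipIdx k, Along P p.1.arc.root (G p)) →
    Along P (endRoot v L) (((sites v L).zipIdx k).reverse.flatMap G)
  | [], v, k, _, _ => trivial
  | A :: L, v, k, h, h' => by
    rw [sites, List.zipIdx_cons] at h h' ⊢; have hr := fun p hp => h p (List.mem_cons_of_mem _ hp)
    rw [List.reverse_cons, List.flatMap_append, endRoot_cons]
    refine Along.append hP (along_blocks hP hr fun p hp => h' p (List.mem_cons_of_mem _ hp)) ?_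
    grind [endRoot_blocks, List.flatMap_singleton, List.mem_cons_self]

lemma rootPairs_blocks {q : Vertex × Vertex} : ∀ {L : List Arc} {v : Vertex} {k : ℕ},
    (∀ p ∈ (sites v L).zipIdx k, endRoot p.1.arc.root (G p) = p.1.start) →
    ∀ p ∈ (sites v L).zipIdx k, q ∈ rootPairs p.1.arc.root (G p) →
    q ∈ rootPairs (endRoot v L) (((sites v L).zipIdx k).reverse.flatMap G)
  | [], v, k, _, p, hp, _ => by simp [sites] at hp
  | A :: L, v, k, h, p, hp, hq => by
    rw [sites, List.zipIdx_cons] at h hp ⊢; have hr := fun p hp => h p (List.mem_cons_of_mem _ hp)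
    rw [List.reverse_cons, List.flatMap_append, endRoot_cons, rootPairs_append, List.mem_append,
      endRoot_blocks hr, List.flatMap_singleton]
    rcases List.mem_cons.1 hp with rfl | hp
    · exact .inr hq
    · exact .inl (rootPairs_blocks hr p hp hq)

end Blocks

lemma mem_sites {D : Ball} {p : Site × ℕ} :
    p ∈ (sites D.secondRoot D.arcs).zipIdx ↔ ∃ j A, D.arcs[j]? = some A ∧ p = D.siteAt j A := by
  rw [mem_sites_zipIdx]
  constructor
  · rintro ⟨k, h1, h2, h3, h4⟩; obtain ⟨⟨s, A, b⟩, m⟩ := p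
    grind [zero_add, Ball.siteAt, Ball.tipAfter]
  · rintro ⟨j, A, hA, rfl⟩; exact ⟨j, by simp [Ball.siteAt], hA, rfl, rfl⟩


/-- The numbers of faces, where faces on the boundary are also counted in the next dimension. -/
noncomputable def total (C : Cx Vertex) : Fin 4 → ℤ :=
  ![(C.face 0).card + 1, (C.face 1).card + (C.face 0).card, (C.face 2).card + C.bdEdges.card,
    (C.face 3).card + C.freeRidges.card]

lemma foldl_stage {S : Set ℕ → Cx Vertex → Prop} {F : Cx Vertex → Site × ℕ → Cx Vertex}
    {b : Site × ℕ → Bool} {inc : Fin 4 → ℤ} {Q : Site × ℕ → Prop}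
    (h0 : ∀ C p, Q p → b p = false → F C p = C)
    (h1 : ∀ dn C p, Q p → b p = true → p.2 ∉ dn → S dn C →
      S (insert p.2 dn) (F C p) ∧ total (F C p) = total C + inc) :
    ∀ (ps : List (Site × ℕ)) {dn : Set ℕ} {C : Cx Vertex}, (∀ p ∈ ps, Q p) →
      (ps.map Prod.snd).Nodup → (∀ p ∈ ps, b p = true → p.2 ∉ dn) → S dn C →
      S (dn ∪ {q | ∃ p ∈ ps, b p = true ∧ p.2 = q}) (ps.foldl F C) ∧
        total (ps.foldl F C) = total C + ps.countP b • inc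
  | [], dn, C, _, _, _, hS => by simpa using hS
  | p :: ps, dn, C, hQ, hnd, hdn, hS => by
    have hQ' := fun q hq => hQ q (List.mem_cons_of_mem p hq)
    rw [List.map_cons, List.nodup_cons] at hnd; by_cases hb : b p = true
    · obtain ⟨h2, h3⟩ := h1 dn C p (hQ p (by simp)) hb (hdn p (by simp) hb) hS
      obtain ⟨h4, h5⟩ := foldl_stage h0 h1 ps hQ' hnd.2 (fun q hq hb' => by
        rw [Set.mem_insert_iff, not_or]; exact ⟨fun he => hnd.1 (he ▸ List.mem_map_of_mem hq),
          hdn q (List.mem_cons_of_mem p hq) hb'⟩) h2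
      rw [List.foldl_cons, List.countP_cons_of_pos hb]
      refine ⟨?_, by rw [h5, h3, add_smul, one_smul]; abel⟩; convert h4 using 1; ext q
      simp only [Set.mem_union, Set.mem_ofPred_eq, List.mem_cons, Set.mem_insert_iff, or_and_right,
        exists_or, exists_eq_left, hb, true_and, eq_comm (b := q)]
      tauto
    · obtain ⟨h4, h5⟩ := foldl_stage h0 h1 ps hQ' hnd.2
        (fun q hq => hdn q (List.mem_cons_of_mem p hq)) hS
      rw [List.foldl_cons, h0 C p (hQ p (by simp)) (by simpa using hb),
        List.countP_cons_of_neg (by simpa using hb)]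
      refine ⟨?_, h5⟩; convert h4 using 1; ext q; simp [hb]

lemma countP_blocks {P : Arc → Bool} {Q : Arc → Bool} {G : Site × ℕ → List Arc}
    {ps : List (Site × ℕ)} (h : ∀ p ∈ ps, (G p).countP P =
      if p.1.arc.fillet = true then k else if Q p.1.arc = true then 1 else 0) :
    (ps.reverse.flatMap G).countP P = ps.countP (fun p => p.1.arc.fillet) * k +
      ps.countP (fun p => !p.1.arc.fillet && Q p.1.arc) := by
  rw [List.flatMap_reverse, List.countP_reverse]
  induction ps with
  | nil => simp
  | cons p ps ih => grind

lemma countP_sites (f : Arc → Bool) : ∀ (L : List Arc) (v : Vertex) (k : ℕ),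
    ((sites v L).zipIdx k).countP (fun p => f p.1.arc) = L.countP f
  | [], _, _ => rfl
  | A :: L, v, k => by
    rw [sites, List.zipIdx_cons, List.countP_cons, List.countP_cons, countP_sites]

section Recursion

variable {B M : Ball} {n ε τ j : ℕ} {A : Arc}

lemma setup_old (hB : Good 1 n B) (hM : Good ε τ M) (hlen : M.arcs.length + 2 = n) (h3 : 3 ≤ n) :
    Setup (B.map old) M n ε τ := by
  refine ⟨hB.map fun _ _ h => by injection h, ?_, ?_, hM, hlen, h3⟩
  · intro x hx; change x ∈ old B.hub :: profile (old B.secondRoot) (B.arcs.map (Arc.map old)) at hx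
    rw [profile_map, ← List.map_cons, List.mem_map] at hx; grind
  · intro x hx; obtain ⟨W, hW, he⟩ := mem_map_face.1 hx
    grind [image_singleton, singleton_inj, hB.frame.zero]

namespace Setup

variable {D : Ball}

lemma endRoot_newArcs (h : Setup D M n ε τ) (hA : D.arcs[j]? = some A) :
    endRoot A.root (newArcs M D.hub (D.siteAt j A)) = rootAt D.secondRoot D.arcs j := by
  have := h.three
  by_cases hf : A.fillet = true
  · rw [h.newArcs_eq hA hf, ← h.chain_last hA hf, ← names_c (j := j) (M := M) (by omega) le_rfl,
      endRoot_newPart (h.named hA hf).len]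
    rfl
  · rw [newArcs_rev (by grind)]; rfl

lemma mem_body_newArcs (h : Setup D M n ε τ) (hA : D.arcs[j]? = some A)
    (hx : x ∈ body (newArcs M D.hub (D.siteAt j A))) :
    x = rootAt D.secondRoot D.arcs j ∨ x ∈ A.inner ∨ x ∈ copied j := by
  by_cases hf : A.fillet = true
  · obtain ⟨k, Q, hQ, hx⟩ := mem_body.1 hx; have hN := h.newArc hA hf hQ; rcases hx with hx | rfl
    · grind [hN.inner]
    · exact hN.root.symm.imp_right .inl
  grind [newArcs_rev, body, Arc.rev]

lemma nodup_body_newArcs (h : Setup D M n ε τ) (hA : D.arcs[j]? = some A) :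
    (body (newArcs M D.hub (D.siteAt j A))).Nodup := by
  by_cases hf : A.fillet = true
  · rw [h.newArcs_eq hA hf]
    exact (h.start.host h hA hf (by simp)).nodup_newPart (h.good_copy hA hf) (h.named hA hf)
  · rw [newArcs_rev (by grind)]
    simp only [body, List.flatMap_cons, List.flatMap_nil, List.append_nil, Arc.rev]
    grind [List.nodup_append, List.nodup_reverse, inner_nodup, List.mem_of_getElem?, lt,
      List.mem_singleton, h.nodup, h.root_ne_inner]

lemma disjoint_newArcs (h : Setup D M n ε τ) {q : ℕ} {A' : Arc} (hA : D.arcs[j]? = some A)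
    (hA' : D.arcs[q]? = some A') (hq : q ≠ j)
    (hx : x = rootAt D.secondRoot D.arcs j ∨ x ∈ A.inner ∨ x ∈ copied j)
    (hx' : x = rootAt D.secondRoot D.arcs q ∨ x ∈ A'.inner ∨ x ∈ copied q) : False := by
  have hj := (lt hA).le
  have hq' := (lt hA').le
  rcases hx with rfl | hx | hx <;> rcases hx' with hx' | hx' | hx'
  · exact hq (rootAt_inj h.nodup hj hq' hx').symm
  · grind [h.root_ne_inner]
  · grind [old_copied, h.old_root]
  · grind [h.root_ne_inner]
  · grind [h.inner_ne]
  · grind [old_copied, h.old_inner]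
  · grind [old_copied, h.old_root]
  · grind [old_copied, h.old_inner]
  · refine copied_freshAt hq hx' ?_; rcases hx with h1 | h1
    · exact .inl h1
    · exact .inr (.inl h1)

/-- The profile after one step of the recursion has no repetitions. -/
lemma nodup_blocks (h : Setup D M n ε τ) : (D.hub :: profile (endRoot D.secondRoot D.arcs)
      ((sites D.secondRoot D.arcs).zipIdx.reverse.flatMap (newArcs M D.hub))).Nodup := by
  have hmem : ∀ x ∈ body ((sites D.secondRoot D.arcs).zipIdx.reverse.flatMap (newArcs M D.hub)),
      ∃ j A, D.arcs[j]? = some A ∧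
        (x = rootAt D.secondRoot D.arcs j ∨ x ∈ A.inner ∨ x ∈ copied j) := by
    intro x hx; rw [body, List.flatMap_assoc, List.mem_flatMap] at hx; obtain ⟨p, hp, hx⟩ := hx
    obtain ⟨j, A, hA, rfl⟩ := mem_sites.1 (List.mem_reverse.1 hp)
    exact ⟨j, A, hA, h.mem_body_newArcs hA hx⟩
  change (D.hub :: endRoot _ _ :: body _).Nodup
  rw [← rootAt_length]
  refine List.nodup_cons.2 ⟨?_, List.nodup_cons.2 ⟨?_, ?_⟩⟩
  · rw [List.mem_cons, not_or]
    grind [le_rfl, lt, old_copied, h.hub_ne_root, h.hub_notMem, h.old_hub]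
  · intro hx; obtain ⟨j, A, hA, h1 | h1 | h1⟩ := hmem _ hx
    · exact (lt hA).ne (rootAt_inj h.nodup le_rfl (lt hA).le h1).symm
    · grind [le_rfl, h.root_ne_inner]
    · exact old_copied (h.old_root le_rfl) h1
  · rw [body, List.flatMap_assoc, List.nodup_flatMap]; constructor
    · intro p hp; obtain ⟨j, A, hA, rfl⟩ := mem_sites.1 (List.mem_reverse.1 hp)
      exact h.nodup_body_newArcs hA
    · refine (List.nodup_reverse.2 (List.Nodup.of_map _ (List.nodup_zipIdx_map_snd _))
        ).pairwise_of_forall_ne fun p hp q hq hne x hx hx' => ?_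
      obtain ⟨j, A, hA, rfl⟩ := mem_sites.1 (List.mem_reverse.1 hp)
      obtain ⟨k, A', hA', rfl⟩ := mem_sites.1 (List.mem_reverse.1 hq)
      refine h.disjoint_newArcs hA hA' ?_ (h.mem_body_newArcs hA hx) (h.mem_body_newArcs hA' hx')
      grind

end Setup

/-- The result of one step of the recursion. -/
lemma good_recursionStep (hB : Good 1 n B) (hM : Good ε τ M) (hlen : M.arcs.length + 2 = n)
    (h3 : 3 ≤ n) {inc : Fin 4 → ℤ}
    (hinc : ∀ j A C, (B.map old).arcs[j]? = some A → A.fillet = true →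
      Host C n (namesAt (B.map old) M n j A) (freshAt j) →
      total (rounded C n (namesAt (B.map old) M n j A) (copyAt (B.map old) M j).cx) =
        total C + inc) :
    Good 1 (τ + 1) (recursionStep B M) ∧ total (recursionStep B M).cx =
      total (B.map old).cx + (B.arcs.countP fun A => A.fillet) • inc := by
  have h := setup_old hB hM hlen h3
  have hret : (recursionStep B M) = 
    { cx := (sites (B.map old).secondRoot (B.map old).arcs).zipIdx.foldl flipAt
        ((sites (B.map old).secondRoot (B.map old).arcs).zipIdx.foldl (attachAt M (B.map old).hub)
          (B.map old).cx)
      hub := (B.map old).hub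
      secondRoot := endRoot (B.map old).secondRoot (B.map old).arcs
      arcs := (sites (B.map old).secondRoot (B.map old).arcs).zipIdx.reverse.flatMap
        (newArcs M (B.map old).hub) } := rfl
  have hcnt : (B.arcs.countP fun A => A.fillet) =
      ((sites (B.map old).secondRoot (B.map old).arcs).zipIdx.countP fun p => p.1.arc.fillet) := by
    rw [countP_sites (fun A => A.fillet)]; simp [Ball.map, List.countP_map, Function.comp_def]
  rw [hret, hcnt]
  clear hret hcnt
  generalize B.map old = D at *
  have hQ : ∀ p ∈ (sites D.secondRoot D.arcs).zipIdx, ∃ j A, D.arcs[j]? = some A ∧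
      p = D.siteAt j A := fun p hp => mem_sites.1 hp
  have hnd := List.nodup_zipIdx_map_snd (sites D.secondRoot D.arcs)
  obtain ⟨⟨hS, hdn⟩, ht⟩ := foldl_stage (F := attachAt M D.hub) (b := fun p => p.1.arc.fillet)
    (inc := inc) (Q := fun p => ∃ j A, D.arcs[j]? = some A ∧ p = D.siteAt j A)
    (S := fun dn C => Stage D M n τ dn C ∧ ∀ q ∈ dn, ∀ B, D.arcs[q]? = some B → B.fillet = true)
    (fun C p _ hb => by grind [attachAt]) (by
      rintro dn C _ ⟨j, A, hA, rfl⟩ hf hj ⟨hs, hdn⟩; refine ⟨⟨hs.round h hA hf hj hdn, ?_⟩, ?_⟩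
      · rintro q (rfl | hq) B' hB'
        · obtain rfl : A = B' := by grind
          exact hf
        · grind
      · rw [h.attachAt_eq hA hf]
        exact hinc j A C hA hf (hs.host h hA hf hj)) _ hQ hnd (by simp) ⟨h.start, by simp⟩
  obtain ⟨⟨hS', -⟩, ht'⟩ := foldl_stage (F := flipAt) (b := fun p => !p.1.arc.fillet)
    (inc := 0) (Q := fun p => ∃ j A, D.arcs[j]? = some A ∧ p = D.siteAt j A)
    (S := fun dn C => Stage D M n τ dn C ∧ ∀ q B, D.arcs[q]? = some B → B.fillet = true → q ∈ dn)
    (by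
      rintro C _ ⟨j, A, hA, rfl⟩ hb; exact flipAt_of_fillet (by simpa [Ball.siteAt] using hb)) (by
      rintro dn C _ ⟨j, A, hA, rfl⟩ hf hj ⟨hs, hdn⟩
      have hf' : A.fillet = false := by simpa [Ball.siteAt] using hf
      refine ⟨⟨hs.flipStep h hA hf' hj hdn, fun q B' h1 h2 => .inr (hdn q B' h1 h2)⟩, ?_⟩
      rw [add_zero]; by_cases hl : 2 ≤ A.inner.length
      · have hF := hs.flippable h hA hf' hj hl; rw [flipAt_eq hf' hl]
        simp only [total, hF.card_one, hF.card_two, hF.card_freeRidges, hF.card_bdEdges]; rfl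
      · rw [flipAt_of_short hl]) _ hQ hnd (by grind) ⟨hS, by
      intro q A hA hf; exact .inr ⟨_, mem_sites.2 ⟨q, A, hA, rfl⟩, hf, rfl⟩⟩
  rw [smul_zero, add_zero] at ht'
  refine ⟨?_, ht'.trans ht⟩
  have hall : ∀ j A, D.arcs[j]? = some A → j ∈ ∅ ∪ {q | ∃ p ∈ (sites D.secondRoot D.arcs).zipIdx,
      p.1.arc.fillet = true ∧ p.2 = q} ∪ {q | ∃ p ∈ (sites D.secondRoot D.arcs).zipIdx,
      (!p.1.arc.fillet) = true ∧ p.2 = q} := by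
    intro j A hA
    cases hf : A.fillet
    · exact .inr ⟨_, mem_sites.2 ⟨j, A, hA, rfl⟩, by simp [Ball.siteAt, hf], rfl⟩
    · exact .inl (.inr ⟨_, mem_sites.2 ⟨j, A, hA, rfl⟩, hf, rfl⟩)
  have hend : ∀ p ∈ (sites D.secondRoot D.arcs).zipIdx,
      endRoot p.1.arc.root (newArcs M D.hub p) = p.1.start := by
    intro p hp; obtain ⟨j, A, hA, rfl⟩ := mem_sites.1 hp; exact h.endRoot_newArcs hA
  refine ⟨hS'.frame, h.nodup_blocks, fun x hx => .inl (hS'.cover x hx), ?_, ?_, by omega, ?_⟩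
  · intro Z hZ ho hn; rcases hS'.hub Z hZ ho hn with rfl | ⟨j, A, hA, ⟨hj, -⟩ | ⟨-, p, hp, rfl⟩⟩
    · grind [endRoot_blocks]
    · exact (hj (hall j A hA)).elim
    · exact .inr ⟨p, rootPairs_blocks hend _ (mem_sites.2 ⟨j, A, hA, rfl⟩) hp, rfl⟩
  · refine along_blocks (fun _ _ nx => GoodArc.of_none nx) hend fun p hp => ?_
    obtain ⟨j, A, hA, rfl⟩ := mem_sites.1 hp; exact hS'.new j A hA (hall j A hA)
  · rw [if_neg (by grind [hM.pos])]

end Recursion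


lemma countP_zipIdx {V : Type} (f : V → Bool) (l : List V) (k : ℕ) :
    (l.zipIdx k).countP (fun q => f q.1) = l.countP f := by
  conv_rhs => rw [← List.zipIdx_map_fst k l, List.countP_map]
  rfl

section Recursion

variable {B M : Ball} {n ε τ : ℕ}

lemma countP_recursionStep (h : Setup (B.map old) M n ε τ) {P Q : Arc → Bool}
    (hP : ∀ g j, (newPart (copyAt (B.map old) M j) n g).countP P = k)
    (hQ : ∀ (A : Arc) v, A.fillet = false → P ((A.map old).rev v) = Q A) :
    (recursionStep B M).arcs.countP P = (B.arcs.countP fun A => A.fillet) * k +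
      B.arcs.countP fun A => !A.fillet && Q A := by
  have hret : (recursionStep B M).arcs =
      (sites (B.map old).secondRoot (B.map old).arcs).zipIdx.reverse.flatMap
        (newArcs M (B.map old).hub) := rfl
  rw [hret, countP_blocks (k := k) (Q := fun A => P (A.rev (B.map old).hub)),
    countP_sites (fun A => A.fillet), countP_sites fun A => !A.fillet && P (A.rev (B.map old).hub)]
  · change List.countP _ (B.arcs.map (Arc.map old)) * k + List.countP _ (B.arcs.map (Arc.map old)) = _
    rw [List.countP_map, List.countP_map]; congr 1; grind [List.countP_congr, Arc.map]
  · intro p hp; obtain ⟨j, A, hA, rfl⟩ := mem_sites.1 hp; by_cases hf : A.fillet = true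
    · grind [Ball.siteAt, h.newArcs_eq]
    · have hA' : A ∈ B.arcs.map (Arc.map old) := List.mem_of_getElem? hA; rw [List.mem_map] at hA'
      obtain ⟨A', -, rfl⟩ := hA'; rw [newArcs_rev (by grind)]
      have hf' : A'.fillet = false := by grind [Arc.map]
      simp only [Ball.siteAt, if_neg hf, List.countP_singleton, hQ A' _ hf']

lemma length_recursionStep (h : Setup (B.map old) M n ε τ) :
    (recursionStep B M).arcs.length = (B.arcs.countP fun A => A.fillet) * n + B.arcs.length := by
  have h1 := countP_recursionStep h (P := fun _ => true) (Q := fun _ => true) (k := n + 1)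
    (fun g j => by
      rw [List.countP_true, newPart_length]; simpa [copyAt, Ball.map] using h.len) fun _ _ _ => rfl
  have h2 := List.length_eq_countP_add_countP (fun A : Arc => A.fillet) (l := B.arcs)
  rw [List.countP_true] at h1
  grind

lemma fillets_recursionStep (h : Setup (B.map old) M n ε τ) :
    ((recursionStep B M).arcs.countP fun A => A.fillet) =
      (B.arcs.countP fun A => A.fillet) * M.arcs.countP fun A => A.fillet := by
  rw [countP_recursionStep h (Q := fun _ => false) (k := M.arcs.countP fun A => A.fillet)]
  · simp
  · intro g j; rw [newPart, List.cons_append, List.countP_cons, List.countP_append, List.countP_map]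
    change List.countP (fun q : Arc × ℕ => q.1.fillet) _ + _ + _ = _
    rw [countP_zipIdx fun A : Arc => A.fillet]
    simp [copyAt, Ball.map, List.countP_map, Function.comp_def]
  · exact fun _ _ _ => rfl

lemma bare_recursionStep (h : Setup (B.map old) M n ε τ) (hB : Good 1 n B) :
    ((recursionStep B M).arcs.countP fun A => A.inner.isEmpty) =
      2 * (B.arcs.countP fun A => A.fillet) + B.arcs.countP fun A => A.inner.isEmpty := by
  rw [countP_recursionStep h (Q := fun A => A.inner.isEmpty) (k := 2), mul_comm]
  · congr 1; refine List.countP_congr fun A hA => ?_; obtain ⟨k, hk⟩ := List.mem_iff_getElem?.1 hA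
    cases hf : A.fillet
    · simp
    · have h1 := ((hB.site hk).fillet hf).1; grind [hB.pos]
  · grind [newPart, List.countP_map, List.countP_eq_zero]
  · intro A v _; simp [Arc.rev, Arc.map]

end Recursion


open Classical in
lemma gaps_card {M : Ball} {n : ℕ} (hlen : M.arcs.length + 2 = n) :
    (gaps n (HasTooth M n)).card = M.arcs.countP fun A => A.inner.isEmpty := by
  subst hlen
  have h1 : ∀ L : List Arc, ((range L.length).filter fun i =>
      ¬ ∃ A, L[i]? = some A ∧ A.inner ≠ []).card = L.countP fun A => A.inner.isEmpty := by
    intro L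
    induction L using List.reverseRecOn with
    | nil => rfl
    | append_singleton L A ih =>
      rw [List.countP_append, ← ih, List.length_append, List.length_singleton,
        range_add_one, filter_insert]
      grind [filter_congr, List.getElem?_append_left]
  rw [← h1]
  refine card_bij' (fun i _ => M.arcs.length - i) (fun i _ => M.arcs.length - i) ?_ ?_ ?_ ?_
  all_goals grind [mem_gaps, HasTooth]

section Seams

variable {N : Cx Vertex} {n : ℕ} {g : Sym → Vertex} {Fr : Set Vertex} {th : ℕ → Prop}

open Classical in
lemma card_teeth (hn : 3 ≤ n) : ((Ico 1 (n - 1)).filter th).card + (gaps n th).card + 2 = n := by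
  rw [gaps, card_filter_add_card_filter_not, Nat.card_Ico]
  omega

open Classical in
/-- The number of ridges that are free after `N` has been attached. -/
lemma Cap.card_outerRidges (hN : Cap N n g Fr 1 th) (hg : g.Injective) (hn : 3 ≤ n) :
    (outerRidges N (IsSeam n g th)).card + 2 * n = N.freeRidges.card + (gaps n th).card + 4 := by
  have hset : N.freeRidges = outerRidges N (IsSeam n g th) ∪
      ((Ico 1 (n - 1)).image (fun i => {g .b, g (.α (i + 1)), g (.α i)}) ∪
      ((Ico 1 (n - 1)).filter th).image (fun i => {g (.α (i + 1)), g (.β i), g (.α i)})) := by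
    ext Z; simp only [Cx.mem_freeRidges, outerRidges, mem_union, mem_image, mem_filter, mem_Ico]
    constructor
    · rintro ⟨h1, h2⟩; by_cases hs : IsSeam n g th Z
      · obtain ⟨i, h3, h4, rfl | ⟨h5, rfl⟩⟩ := hs
        all_goals grind
      grind
    · rintro (⟨h1, h2⟩ | ⟨i, ⟨h1, h2⟩, rfl⟩ | ⟨i, ⟨⟨h1, h2⟩, h3⟩, rfl⟩)
      · split_ifs at h2 with hs
        · obtain ⟨i, h3, h4, rfl | ⟨h5, rfl⟩⟩ := hs
          all_goals grind [hN.facTri, hN.facTooth]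
        · grind
      all_goals grind [hN.tri, hN.facTri, hN.tooth, hN.facTooth]
  rw [hset, card_union_of_disjoint, card_union_of_disjoint,
    card_image_of_injective, card_image_of_injective, Nat.card_Ico]
  · have := card_teeth (th := th) hn; omega
  · intro i j hij; grind [triple_eq_iff]
  · intro i j hij; grind [triple_eq_iff]
  · grind [disjoint_left, triple_eq_iff]
  · rw [disjoint_left]; intro Z hZ hZ'; rw [outerRidges, mem_filter] at hZ
    simp only [mem_union, mem_image, mem_filter, mem_Ico] at hZ'
    rcases hZ' with ⟨i, ⟨h1, h2⟩, rfl⟩ | ⟨i, ⟨⟨h1, h2⟩, h3⟩, rfl⟩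
    · rw [if_pos ⟨i, h1, by omega, .inl rfl⟩, hN.facTri i h1 (by omega)] at hZ; omega
    · rw [if_pos ⟨i, h1, by omega, .inr ⟨h3, rfl⟩⟩, hN.facTooth i h1 (by omega) h3] at hZ; omega

open Classical in
/-- The number of edges that are on the boundary after `N` has been attached. -/
lemma Cap.card_outerEdges (hN : Cap N n g Fr 1 th) (hg : g.Injective) (hn : 3 ≤ n) :
    (outerEdges N (IsSeam n g th) (IsRim n g th)).card + 2 * n =
      N.bdEdges.card + (gaps n th).card + 5 := by
  have hout : ∀ T, T ∈ outerRidges N (IsSeam n g th) ↔ T ∈ N.face 2 ∧ N.nfac T = 1 ∧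
      ¬ IsSeam n g th T := by
    intro T; rw [outerRidges, mem_filter]; refine and_congr_right fun h1 => ?_
    split_ifs with hs
    · refine iff_of_false (fun h2 => ?_) fun h => h.2 hs; obtain ⟨i, h3, h4, rfl | ⟨h5, rfl⟩⟩ := hs
      all_goals grind [hN.facTri, hN.facTooth]
    · simp [hs]
  have hfree : ∀ T, IsSeam n g th T → T ∈ N.face 2 ∧ N.nfac T = 1 := by
    rintro T ⟨i, h3, h4, rfl | ⟨h5, rfl⟩⟩
    all_goals grind [hN.tri, hN.facTri, hN.tooth, hN.facTooth]
  have hrim : ∀ e, IsRim n g th e → ∃ T, IsSeam n g th T ∧ e ⊆ T := by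
    rintro e (rfl | rfl | ⟨i, h1, h2, ⟨h3, rfl | rfl⟩ | ⟨h3, rfl⟩⟩)
    · exact ⟨_, ⟨1, le_rfl, by omega, .inl rfl⟩, by grind⟩
    · refine ⟨_, ⟨n - 2, by omega, by omega, .inl rfl⟩, ?_⟩; grind
    · exact ⟨_, ⟨i, h1, h2, .inr ⟨h3, rfl⟩⟩, by grind⟩
    · exact ⟨_, ⟨i, h1, h2, .inr ⟨h3, rfl⟩⟩, by simp⟩
    · exact ⟨_, ⟨i, h1, h2, .inl rfl⟩, by simp⟩
  have hset : N.bdEdges = outerEdges N (IsSeam n g th) (IsRim n g th) ∪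
      ((Ico 2 (n - 1)).image (fun i => {g .b, g (.α i)}) ∪
      ((Ico 1 (n - 1)).filter th).image (fun i => {g (.α (i + 1)), g (.α i)})) := by
    ext e; simp only [Cx.mem_bdEdges, outerEdges, mem_union, mem_image, mem_filter, mem_Ico]
    constructor
    · rintro ⟨h1, T, h2, h3, h4⟩; by_cases hs : IsSeam n g th T
      · obtain ⟨i, h5, h6, rfl | ⟨h7, rfl⟩⟩ := hs <;>
        rcases Host.pair_sub (hN.card₁ e h1) h4 with rfl | rfl | rfl
        · by_cases h8 : i + 2 = n
          · refine .inl ⟨h1, .inr (.inr (.inl ?_))⟩; rw [show i + 1 = n - 1 by omega]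
          grind
        · by_cases h8 : i = 1
          · exact .inl ⟨h1, .inr (.inl (by rw [h8]))⟩
          grind
        · by_cases h8 : th i
          · grind
          · exact .inl ⟨h1, .inr (.inr (.inr ⟨i, h5, h6, .inr ⟨h8, rfl⟩⟩))⟩
        · exact .inl ⟨h1, .inr (.inr (.inr ⟨i, h5, h6, .inl ⟨h7, .inl rfl⟩⟩))⟩
        · grind
        · exact .inl ⟨h1, .inr (.inr (.inr ⟨i, h5, h6, .inl ⟨h7, .inr rfl⟩⟩))⟩
      grind
    · rintro (⟨h1, ⟨T, hT, h2⟩ | h2⟩ | ⟨i, ⟨h1, h2⟩, rfl⟩ | ⟨i, ⟨⟨h1, h2⟩, h3⟩, rfl⟩)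
      · obtain ⟨h3, h4, -⟩ := (hout T).1 hT; exact ⟨h1, T, h3, h4, h2⟩
      · obtain ⟨T, hT, h3⟩ := hrim e h2; exact ⟨h1, T, (hfree T hT).1, (hfree T hT).2, h3⟩
      · exact ⟨hN.hubα i (by omega) (by omega), _, hN.tri i (by omega) (by omega),
          hN.facTri i (by omega) (by omega), by grind⟩
      · exact ⟨hN.αα i h1 (by omega), _, hN.tri i h1 (by omega), hN.facTri i h1 (by omega), by simp⟩
  rw [hset, card_union_of_disjoint, card_union_of_disjoint,
    card_image_of_injective, card_image_of_injective, Nat.card_Ico]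
  · have := card_teeth (th := th) hn; omega
  · intro i j hij; grind [pair_eq_iff]
  · intro i j hij; grind [pair_eq_iff]
  · grind [disjoint_left, pair_eq_iff]
  · rw [disjoint_left]; intro e he he'; rw [outerEdges, mem_filter] at he
    simp only [mem_union, mem_image, mem_filter, mem_Ico] at he'
    rcases he' with ⟨i, ⟨h1, h2⟩, rfl⟩ | ⟨i, ⟨⟨h1, h2⟩, h3⟩, rfl⟩
    · rcases he.2 with ⟨T, hT, h4⟩ | h4
      · obtain ⟨h5, h6, h7⟩ := (hout T).1 hT
        rcases hN.freeHub i h1 (by omega) T h5 h4 h6 with rfl | rfl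
        · exact h7 ⟨i, by omega, by omega, .inl rfl⟩
        · exact h7 ⟨i - 1, by omega, by omega, .inl (by grind)⟩
      · simp [IsRim, pair_eq_iff, hg.eq_iff] at h4; omega
    · rcases he.2 with ⟨T, hT, h4⟩ | h4
      · obtain ⟨h5, h6, h7⟩ := (hout T).1 hT
        rcases hN.freeSide i h1 (by omega) h3 T h5 h4 h6 with rfl | rfl
        · exact h7 ⟨i, by omega, by omega, .inl rfl⟩
        · exact h7 ⟨i, by omega, by omega, .inr ⟨h3, rfl⟩⟩
      · simp only [IsRim, pair_eq_iff, hg.eq_iff] at h4; grind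

end Seams


lemma onBd_map_iff {f : Vertex → Vertex} (hf : f.Injective) {C : Cx Vertex} :
    (C.map f).OnBd (S.image f) ↔ C.OnBd S := by
  refine ⟨?_, onBd_map hf⟩
  rintro ⟨T, hT, hn, hs⟩
  obtain ⟨W, hW, rfl⟩ := mem_map_face.1 hT
  exact ⟨W, hW, by grind [nfac_map], (image_subset_image_iff hf).1 hs⟩

lemma card_map {f : Vertex → Vertex} (hf : f.Injective) (C : Cx Vertex) (k : ℕ) :
    ((C.map f).face k).card = (C.face k).card :=
  card_image_of_injective _ (image_injective hf)

lemma total_map {f : Vertex → Vertex} (hf : f.Injective) (C : Cx Vertex) :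
    total (C.map f) = total C := by
  have h1 : (C.map f).bdEdges = C.bdEdges.image (image f) := by
    grind [Cx.mem_bdEdges, mem_map_face, onBd_map_iff, onBd_map]
  have h2 : (C.map f).freeRidges = C.freeRidges.image (image f) := by
    grind [Cx.mem_freeRidges, mem_map_face, nfac_map]
  grind [total, card_map, card_image_of_injective, image_injective]

/-- The contribution of a copy of `M` to the numbers of faces is described by `E`. -/
def Ball.Counts (M : Ball) (E : Fin 4 → ℤ) : Prop :=
  ∀ f : Vertex → Vertex, f.Injective → ∀ n g Fr, Named (M.map f) n g Fr → g.Injective →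
    E = ![(((M.map f).cx.face 0).card + 1 : ℤ), ((M.map f).cx.face 1).card + ((M.map f).cx.face 0).card,
      ((M.map f).cx.face 2).card + (outerEdges (M.map f).cx (IsSeam n g (HasTooth (M.map f) n))
        (IsRim n g (HasTooth (M.map f) n))).card + 2 * n - 5 -
        M.arcs.countP (fun A => A.inner.isEmpty),
      ((M.map f).cx.face 3).card + (outerRidges (M.map f).cx
        (IsSeam n g (HasTooth (M.map f) n))).card + 2 * n - 4 -
        M.arcs.countP (fun A => A.inner.isEmpty)]

variable {B M : Ball} {n ε τ : ℕ} {E : Fin 4 → ℤ}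

lemma gaps_card_map {f : Vertex → Vertex} (hlen : (M.map f).arcs.length + 2 = n) :
    (gaps n (HasTooth (M.map f) n)).card = M.arcs.countP fun A => A.inner.isEmpty := by
  rw [gaps_card hlen, Ball.map, List.countP_map]
  simp [Function.comp_def]

lemma Good.counts (h : Good 1 τ M) : M.Counts (total M.cx) := by
  intro f hf n g Fr hn hg
  have hN := (h.map hf).cap hn
  have h1 := hN.card_outerRidges hg hn.three
  have h2 := hN.card_outerEdges hg hn.three
  rw [gaps_card_map hn.len] at h1 h2
  rw [← total_map hf]
  change total (M.map f).cx = _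
  grind [total]

open Classical in
/-- The contribution of a copy of a triangulated disc. -/
lemma Ball.counts_disc (h3 : M.cx.face 3 = ∅) (hA : ∀ A ∈ M.arcs, A.inner ≠ [])
    (hZ : ∀ Z ∈ M.cx.face 2, ∃ k A, M.arcs[k]? = some A ∧
      (Z = {M.hub, rootAt M.secondRoot M.arcs k, A.root} ∨
        Z = {rootAt M.secondRoot M.arcs k, A.tip M.hub, A.root}))
    (he : ∀ e ∈ M.cx.face 1, ∃ T ∈ M.cx.face 2, e ⊆ T) :
    M.Counts ![(M.cx.face 0).card + 1, (M.cx.face 1).card + (M.cx.face 0).card,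
      (M.cx.face 2).card + (M.cx.face 1).card + 2 * M.arcs.length - 1,
      (M.cx.face 2).card + 2 * M.arcs.length] := by
  intro f hf n g Fr hn hg
  have hlen := hn.len
  have h3' := hn.three
  have hfac : (M.map f).cx.face 3 = ∅ := by change (M.cx.face 3).image _ = _; grind
  have h1 : outerRidges (M.map f).cx (IsSeam n g (HasTooth (M.map f) n)) = (M.map f).cx.face 2 := by
    refine filter_true_of_mem fun Z' hZ' => ?_; obtain ⟨Z, hZ₀, rfl⟩ := mem_map_face.1 hZ'
    have h5 : (M.map f).cx.nfac (Z.image f) = 0 := by grind [Cx.nfac]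
    rw [h5, if_pos]; obtain ⟨k, A, hk, hZ⟩ := hZ Z hZ₀
    have hk' := (List.getElem?_eq_some_iff.1 hk).1
    have hl : (M.map f).arcs.length = M.arcs.length := by simp [Ball.map]
    have hk2 : n - 2 - (n - 2 - k) = k := by omega
    have hmap : (M.map f).arcs[n - 2 - (n - 2 - k)]? = some (A.map f) := by
      rw [hk2]; change (M.arcs.map (Arc.map f))[k]? = _; rw [List.getElem?_map, hk]; rfl
    obtain ⟨A', h6, h7, h8⟩ := hn.arc (i := n - 2 - k) (by omega) (by omega)
    obtain rfl : A.map f = A' := by grind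
    have hne : (A.map f).inner ≠ [] := by simpa [Arc.map] using hA A (List.mem_of_getElem? hk)
    have hβ := tip_of_head (o := f M.hub) (hn.β _ _ (by omega) (by omega) hmap hne); rw [hk2] at h7
    change rootAt (f M.secondRoot) (M.arcs.map (Arc.map f)) k = _ at h7; rw [rootAt_map] at h7
    rw [Arc.tip_map] at hβ
    refine ⟨n - 2 - k, by omega, by omega, hZ.imp ?_ fun h => ⟨⟨_, hmap, hne⟩, ?_⟩⟩
    · rintro rfl; rw [hn.hub, ← h7, ← h8]; simp [image_insert, Ball.map, Arc.map]
    · rw [h, ← h7, ← h8, ← hβ]; simp [image_insert, Arc.map]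
  have h2 : outerEdges (M.map f).cx (IsSeam n g (HasTooth (M.map f) n))
      (IsRim n g (HasTooth (M.map f) n)) = (M.map f).cx.face 1 := by
    refine filter_true_of_mem fun e' he' => .inl ?_; rw [h1]
    obtain ⟨e, he₀, rfl⟩ := mem_map_face.1 he'; obtain ⟨T, hT, hs⟩ := he e he₀
    exact ⟨T.image f, mem_map_face.2 ⟨T, hT, rfl⟩, image_subset_image hs⟩
  grind [List.countP_eq_zero, Ball.map, card_map, card_empty]

/-- The numbers of faces after one step of the recursion. -/
lemma total_recursionStep (hB : Good 1 n B) (hM : Good ε τ M) (hlen : M.arcs.length + 2 = n)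
    (h3 : 3 ≤ n) (hE : M.Counts E) {r : ℕ} (hr : (M.arcs.countP fun A => A.inner.isEmpty) = r) :
    Good 1 (τ + 1) (recursionStep B M) ∧ total (recursionStep B M).cx = total B.cx +
      (B.arcs.countP fun A => A.fillet) •
        ![E 0 + r - 2, E 1 + 3 * n + 3 * r - 4, E 2 + 3 * n + 4 * r + 1, E 3 + 2 * r + 3] := by
  have h := setup_old hB hM hlen h3
  rw [← total_map (f := old) (fun _ _ h => by injection h) B.cx]
  refine good_recursionStep hB hM hlen h3 fun j A C hA hf hH => ?_
  have hd := h.named hA hf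
  have hN := (h.good_copy hA hf).cap hd
  have hE := hE _ (h.copy_inj hA hf) n _ _ hd hH.inj
  have h4 := gaps_card_map (M := M) hd.len
  have h0 := hH.card_rounded_zero hN
  have h1 := hH.card_rounded_one hN
  have h2 := hH.card_rounded_two hN
  have h5 := hH.card_bdEdges hN
  have h6 := hH.card_rounded_three hN
  have h7 := hH.card_freeRidges hN
  change (gaps n (HasTooth (copyAt (B.map old) M j) n)).card = _ at h4
  rw [h4, hr] at h0 h1 h2 h5 h7
  rw [hr] at hE
  rw [hE]
  change total _ = total C + _
  unfold total copyAt at *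
  ext i
  fin_cases i <;> simp <;> omega


section Disc

variable {s i k : ℕ} {Z : Finset Vertex}

lemma X1_face : Z ∈ (X1 s).cx.face k ↔ ∃ i, 2 ≤ i ∧ i ≤ 2 ^ s + 2 ∧
    (Z ∈ powersetCard (k + 1) {a 1, a i, a (i + 1)} ∨
      Z ∈ powersetCard (k + 1) {a i, b i, a (i + 1)}) := by
  simp only [X1, Cx.simplicial, mem_biUnion, mem_union, mem_image, mem_Icc]
  constructor
  · grind
  · rintro ⟨i, h1, h2, h | h⟩
    · exact ⟨_, .inl ⟨i, ⟨h1, h2⟩, rfl⟩, h⟩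
    · exact ⟨_, .inr ⟨i, ⟨h1, h2⟩, rfl⟩, h⟩

lemma X1_zero : Z ∈ (X1 s).cx.face 0 ↔ ∃ i, 2 ≤ i ∧ i ≤ 2 ^ s + 2 ∧
    (Z = {a 1} ∨ Z = {a i} ∨ Z = {a (i + 1)} ∨ Z = {b i}) := by
  rw [X1_face]
  refine exists_congr fun i => and_congr_right fun h1 => and_congr_right fun _ => ?_
  simp only [mem_powersetCard_one, zero_add, mem_insert, mem_singleton,
    or_and_right, exists_or, exists_eq_left]
  tauto

lemma X1_one : Z ∈ (X1 s).cx.face 1 ↔ ∃ i, 2 ≤ i ∧ i ≤ 2 ^ s + 2 ∧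
    (Z = {a 1, a i} ∨ Z = {a 1, a (i + 1)} ∨ Z = {a i, a (i + 1)} ∨ Z = {a i, b i} ∨
      Z = {b i, a (i + 1)}) := by
  rw [X1_face]
  refine exists_congr fun i => and_congr_right fun h1 => and_congr_right fun _ => ?_
  grind [mem_powersetCard_two_triple]

lemma X1_two : Z ∈ (X1 s).cx.face 2 ↔ ∃ i, 2 ≤ i ∧ i ≤ 2 ^ s + 2 ∧
    (Z = {a 1, a i, a (i + 1)} ∨ Z = {a i, b i, a (i + 1)}) := by
  rw [X1_face]
  refine exists_congr fun i => and_congr_right fun h1 => and_congr_right fun _ => ?_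
  grind [mem_powersetCard_three_triple]

lemma X1_three : (X1 s).cx.face 3 = ∅ := by
  ext Z
  simp only [X1_face, mem_powersetCard, notMem_empty, iff_false]
  rintro ⟨i, -, -, ⟨h, h'⟩ | ⟨h, h'⟩⟩ <;>
  · have := card_le_card h; grind

lemma X1_nfac (S : Finset Vertex) : (X1 s).cx.nfac S = 0 := by rw [Cx.nfac, X1_three]; rfl

lemma X1_arcs {A : Arc} : (X1 s).arcs[k]? = some A ↔ k < 2 ^ s + 1 ∧
    A = { inner := [b (k + 2)], root := a (k + 3), fillet := decide (k + 3 ≤ 2 ^ s + 2) } := by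
  grind [X1, Option.map_eq_some_iff, List.getElem?_eq_some_iff, List.length_range]

lemma X1_rootAt (hk : k ≤ 2 ^ s + 1) : rootAt (X1 s).secondRoot (X1 s).arcs k = a (k + 2) := by
  cases k with
  | zero => rfl
  | succ k => rw [rootAt_succ (X1_arcs.2 ⟨by omega, rfl⟩)]

lemma good_X1 (s : ℕ) : Good 0 1 (X1 s) := by
  have hp := Nat.one_le_two_pow (n := s)
  have hcard : ∀ k, ∀ Z ∈ (X1 s).cx.face k, Z.card = k + 1 := by grind [X1_face]
  have hsub : ∀ k, ∀ Z ∈ (X1 s).cx.face k, ∀ x ∈ Z, {x} ∈ (X1 s).cx.face 0 := by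
    grind [X1_zero, X1_face]
  refine ⟨⟨?_, hsub 1, hsub 2, hsub 3, hcard 1, fun Z hZ => (hcard 2 Z hZ).ge,
    fun Z hZ => by grind, ?_⟩, ?_, ?_, ?_, ?_, le_rfl, rfl⟩
  · grind [card_eq_one]
  · grind [eq_of_subset_of_card_le]
  · simp only [X1, profile, List.nodup_cons, List.mem_cons, List.mem_flatMap, List.mem_map,
      List.mem_range, not_or]
    refine ⟨⟨by simp, ?_⟩, ?_, ?_⟩
    any_goals grind
    · rw [List.flatMap_map, List.nodup_flatMap]
      refine ⟨fun i _ => by simp, List.nodup_range.pairwise_of_forall_ne fun i _ j _ hij x h h' => ?_⟩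
      grind
  · intro x hx; refine .inr ⟨rfl, ?_⟩; obtain ⟨i, h1, h2, h⟩ := X1_zero.1 hx
    simp only [singleton_inj] at h
    have h3 : ∀ k, k < 2 ^ s + 1 → ∃ A ∈ (X1 s).arcs, A.root = a (k + 3) ∧
        A.inner.head? = some (b (k + 2)) := fun k hk =>
      ⟨_, List.mem_of_getElem? (X1_arcs.2 ⟨hk, rfl⟩), rfl, rfl⟩
    obtain ⟨j, rfl⟩ : ∃ j, i = j + 2 := ⟨i - 2, by omega⟩; rcases h with rfl | rfl | rfl | rfl
    any_goals grind
    · exact .inl rfl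
    · cases j with
      | zero => exact .inr (.inl rfl)
      | succ j =>
        obtain ⟨A, hA, h4, -⟩ := h3 j (by omega); grind
  · grind [X1_nfac]
  · refine along_of_get fun k A hA => ?_; obtain ⟨hk, rfl⟩ := X1_arcs.1 hA; rw [X1_rootAt hk.le]
    have hv : ∀ i, 2 ≤ i → i ≤ 2 ^ s + 2 → {b i} ∈ (X1 s).cx.face 0 := fun i h1 h2 =>
      X1_zero.2 ⟨i, h1, h2, by simp⟩
    have hnext : k + 3 ≤ 2 ^ s + 2 → (X1 s).arcs[k + 1]? = some
        { inner := [b (k + 3)], root := a (k + 4), fillet := decide (k + 4 ≤ 2 ^ s + 2) } :=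
      fun h => X1_arcs.2 ⟨by omega, rfl⟩
    have h2 : k + 2 ≤ 2 ^ s + 2 := by omega
    refine ⟨⟨⟨X1_zero.2 ⟨k + 2, by simp, h2, by simp [X1]⟩, X1_zero.2 ⟨k + 2, by simp, h2, by simp⟩,
      X1_zero.2 ⟨k + 2, by simp, h2, by simp⟩, X1_one.2 ⟨k + 2, by simp, h2, by simp [X1]⟩,
      X1_one.2 ⟨k + 2, by simp, h2, by simp [X1]⟩, X1_one.2 ⟨k + 2, by simp, h2, by simp⟩,
      X1_two.2 ⟨k + 2, by simp, h2, by simp [X1]⟩, X1_nfac _⟩, ?_, ?_, by simp, ?_⟩, ?_⟩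
    · intro x hx; obtain rfl := List.mem_singleton.1 hx
      refine ⟨hv _ (by simp) h2, fun Z hZ h => ?_, fun Z hZ h => ?_, by simp [X1_three]⟩
      · obtain ⟨i, h3, -, h4⟩ := X1_one.1 hZ; grind [insert_subset_iff, X1]
      · obtain ⟨i, h3, -, h4⟩ := X1_two.1 hZ
        rcases h4 with rfl | rfl <;> simp [insert_subset_iff, X1] at h <;> omega
    · intro _; exact ⟨X1_one.2 ⟨k + 2, by simp, h2, by simp [Arc.tip]⟩,
        X1_one.2 ⟨k + 2, by simp, h2, by simp [Arc.tip]⟩,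
        X1_two.2 ⟨k + 2, by simp, h2, by simp [Arc.tip]⟩, X1_nfac _, fun Z _ _ h => by
          grind [X1_nfac]⟩
    · intro hf; have hk' := of_decide_eq_true hf; rw [hnext hk']
      have hc : ∀ (A : Arc) o i, A.inner.tail = [] → 1 ≤ i → i ≤ 1 → A.chain o i = A.root := by
        grind [Arc.chain]
      refine ⟨rfl, hv _ (by simp) hk', ?_, ?_, ?_, ?_, ?_, ?_, ?_, ?_, ?_, ?_, ?_, ?_, ?_, ?_⟩
      · grind [X1_one, Arc.tip]
      · grind [X1_one, pair_comm]
      on_goal 11 =>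
        intro Z hZ h; have h3 := (card_le_card h).trans (card_insert_le _ _)
        have h4 := card_image_le (s := Icc 1 1) (f := Arc.chain
          ⟨[b (k + 2)], a (k + 3), decide (k + 3 ≤ 2 ^ s + 2)⟩ (X1 s).hub)
        rw [hcard 2 Z hZ] at h3; simp at h3 h4
      all_goals intros; omega
    · intro hf; have hk' := of_decide_eq_true hf
      exact ⟨_, _, hnext hk', rfl, by simp [X1_three], fun h => by omega⟩

lemma card_X1 (s : ℕ) : ((X1 s).cx.face 0).card = 2 * 2 ^ s + 4 ∧
    ((X1 s).cx.face 1).card = 4 * 2 ^ s + 5 ∧ ((X1 s).cx.face 2).card = 2 * 2 ^ s + 2 := by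
  have hp := Nat.one_le_two_pow (n := s)
  generalize hq : 2 ^ s = p at *
  have h0 : (X1 s).cx.face 0 = (Icc 1 (p + 3)).image (fun i => {a i}) ∪
      (Icc 2 (p + 2)).image (fun i => {b i}) := by
    ext Z; simp only [X1_zero, mem_union, mem_image, mem_Icc, hq]; constructor
    · rintro ⟨i, h1, h2, rfl | rfl | rfl | rfl⟩
      · exact .inl ⟨1, by omega, rfl⟩
      · exact .inl ⟨i, by omega, rfl⟩
      · exact .inl ⟨i + 1, by omega, rfl⟩
      · exact .inr ⟨i, by omega, rfl⟩
    · rintro (⟨i, h1, rfl⟩ | ⟨i, h1, rfl⟩)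
      · by_cases h2 : i ≤ 2
        · exact ⟨2, by omega, by omega, by grind⟩
        · exact ⟨i - 1, by omega, by omega, by grind⟩
      · exact ⟨i, h1.1, h1.2, by simp⟩
  have h1 : (X1 s).cx.face 1 = (Icc 2 (p + 3)).image (fun i => {a 1, a i}) ∪
      ((Icc 2 (p + 2)).image (fun i => {a i, a (i + 1)}) ∪
      ((Icc 2 (p + 2)).image (fun i => {a i, b i}) ∪
      (Icc 2 (p + 2)).image (fun i => {b i, a (i + 1)}))) := by
    ext Z; simp only [X1_one, mem_union, mem_image, mem_Icc, hq]; constructor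
    · rintro ⟨i, h1, h2, rfl | rfl | rfl | rfl | rfl⟩
      · exact .inl ⟨i, by omega, rfl⟩
      · exact .inl ⟨i + 1, by omega, rfl⟩
      · exact .inr (.inl ⟨i, by omega, rfl⟩)
      · exact .inr (.inr (.inl ⟨i, by omega, rfl⟩))
      · exact .inr (.inr (.inr ⟨i, by omega, rfl⟩))
    · rintro (⟨i, h1, rfl⟩ | ⟨i, h1, rfl⟩ | ⟨i, h1, rfl⟩ | ⟨i, h1, rfl⟩)
      · by_cases h2 : i = 2
        · exact ⟨2, by omega, by omega, by simp [h2]⟩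
        · exact ⟨i - 1, by omega, by omega, by grind⟩
      all_goals exact ⟨i, h1.1, h1.2, by simp⟩
  have h2 : (X1 s).cx.face 2 = (Icc 2 (p + 2)).image (fun i => {a 1, a i, a (i + 1)}) ∪
      (Icc 2 (p + 2)).image (fun i => {a i, b i, a (i + 1)}) := by
    ext Z; simp only [X1_two, mem_union, mem_image, mem_Icc, hq]; constructor
    · rintro ⟨i, h1, h2, rfl | rfl⟩
      · exact .inl ⟨i, by omega, rfl⟩
      · exact .inr ⟨i, by omega, rfl⟩
    · rintro (⟨i, h1, rfl⟩ | ⟨i, h1, rfl⟩) <;> exact ⟨i, h1.1, h1.2, by simp⟩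
  refine ⟨?_, ?_, ?_⟩
  · rw [h0, card_union_of_disjoint, card_image_of_injective,
      card_image_of_injective, Nat.card_Icc, Nat.card_Icc]
    · omega
    · intro i j h; simpa using h
    · intro i j h; simpa using h
    · rw [disjoint_left]; intro Z hZ hZ'; simp only [mem_image] at hZ hZ'
      obtain ⟨i, -, rfl⟩ := hZ; simp at hZ'
  · rw [h1]
    repeat rw [card_union_of_disjoint]
    · repeat rw [card_image_of_injOn]
      · grind [Nat.card_Icc]
      all_goals
        intro i hi j hj h; grind [pair_eq_iff]
    all_goals
      rw [disjoint_left]; intro Z hZ hZ'; simp only [mem_image, mem_union, mem_Icc] at hZ hZ'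
      obtain ⟨i, hi, rfl⟩ := hZ; simp [pair_eq_iff] at hZ'
    omega
  · rw [h2, card_union_of_disjoint, card_image_of_injOn, card_image_of_injOn, Nat.card_Icc]
    · omega
    · intro i hi j hj h; grind [triple_eq_iff]
    · intro i hi j hj h; grind [triple_eq_iff]
    · rw [disjoint_left]; intro Z hZ hZ'; simp only [mem_image] at hZ hZ'
      obtain ⟨i, -, rfl⟩ := hZ; simp [triple_eq_iff] at hZ'

lemma counts_X1 (s : ℕ) : (X1 s).Counts
    ![2 * 2 ^ s + 5, 6 * 2 ^ s + 9, 8 * 2 ^ s + 8, 4 * 2 ^ s + 4] := by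
  have h := Ball.counts_disc (M := X1 s) X1_three ?_ ?_ ?_
  · obtain ⟨h0, h1, h2⟩ := card_X1 s; grind [X1]
  · simp [X1]
  · intro Z hZ; obtain ⟨i, h1, h2, h⟩ := X1_two.1 hZ
    obtain ⟨j, rfl⟩ : ∃ j, i = j + 2 := ⟨i - 2, by omega⟩
    refine ⟨j, _, X1_arcs.2 ⟨by omega, rfl⟩, ?_⟩; rw [X1_rootAt (by omega)]; exact h
  · intro e he; obtain ⟨i, h1, h2, h⟩ := X1_one.1 he; rcases h with rfl | rfl | rfl | rfl | rfl
    on_goal 4 => exact ⟨_, X1_two.2 ⟨i, h1, h2, .inr rfl⟩, by grind⟩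
    on_goal 4 => exact ⟨_, X1_two.2 ⟨i, h1, h2, .inr rfl⟩, by grind⟩
    all_goals exact ⟨_, X1_two.2 ⟨i, h1, h2, .inl rfl⟩, by grind⟩

end Disc


section Sum

variable {V W : Type} [DecidableEq V]

lemma mem_powersetCard_image {f : W → V} (hf : f.Injective) {S : Finset W} {Z : Finset V} :
    Z ∈ powersetCard k (S.image f) ↔ ∃ U ∈ powersetCard k S, U.image f = Z := by
  grind [subset_image_iff, card_image_of_injective]

variable [DecidableEq W]

lemma connectedSum_image {f : W → V} (hf : f.Injective) (T : Finset (Finset W)) (k : ℕ) :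
    (Cx.connectedSum (T.image (image f))).face k =
      ((Cx.connectedSum T).face k).image (image f) := by
  have key : ∀ j, (T.image (image f)).biUnion (powersetCard j) =
      (T.biUnion (powersetCard j)).image (image f) := by
    intro j; ext Z; simp only [mem_biUnion, mem_image, exists_exists_and_eq_and,
      mem_powersetCard_image hf]
    grind
  match k with
  | 0 => exact key 1
  | 1 => exact key 2
  | 2 =>
    change filter _ _ = image _ (filter _ _); rw [key, filter_image]
    congr 1; refine filter_congr fun U _ => ?_
    rw [filter_image, card_image_of_injective _ (image_injective hf)]
    simp only [image_subset_image_iff hf]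
  | 3 =>
    change {_} = image _ {_}; rw [image_singleton, singleton_inj]; grind [S, mem_image_of_mem]
  | k + 4 => rfl

lemma connectedSum_sub {T : Finset (Finset V)} {Z : Finset V}
    (hZ : Z ∈ (Cx.connectedSum T).face k) :
    (∀ x ∈ Z, {x} ∈ (Cx.connectedSum T).face 0) ∧ (k < 3 → Z.card = k + 1) ∧
      ∃ Y ∈ (Cx.connectedSum T).face 3, Z ⊆ Y := by
  grind [Cx.connectedSum, S, mem_singleton_self, subset_biUnion_of_mem,
    mem_of_mem_filter, subset_rfl]

/-- The faces of a connected sum, computed with numbers in the place of vertices. -/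
lemma mem_connectedSum {m : ℕ} (f : Fin m → V) (hf : f.Injective) (T : Finset (Finset (Fin m)))
    {T' : Finset (Finset V)} (hT : T.image (image f) = T')
    {F : Finset (Finset (Fin m))} (hF : (Cx.connectedSum T).face k = F) {Z : Finset V} :
    Z ∈ (Cx.connectedSum T').face k ↔ ∃ U ∈ F, U.image f = Z := by
  grind [connectedSum_image]

end Sum

section Base

/-- The sets of simplices whose connected sums are the facets of `X(1,p+2)`. -/
def Piece (p : ℕ) (T : Finset (Finset Vertex)) : Prop :=
  T = {{a 1, a 2, a 3, a 5}, {a 1, a 3, a 4, a 5}} ∨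
  T = {{a 2, b 2, a 3, a 5}, {b 2, c (p + 1), a 3, a 5}} ∨
  T = {{c (p + 1), a 3, b 3, a 5}, {a 3, b 3, a 4, a 5}, {b 3, c' (p + 1), a 4, a 5}} ∨
  T = {{c' (p + 1), a 4, b 4, a 5}} ∨ ∃ i, 1 ≤ i ∧ i ≤ p ∧ (T = {{b 2, c i, c (i + 1), a 5}} ∨
  T = {{c i, c (i + 1), b 3, a 5}} ∨ T = {{b 3, c' i, c' (i + 1), a 5}} ∨
  T = {{c' i, c' (i + 1), b 4, a 5}})

/-- The free ridges of `X(1,p+2)`. -/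
def FreeTri (p : ℕ) (Z : Finset Vertex) : Prop :=
  (∃ i, 1 ≤ i ∧ i ≤ p ∧ (Z = {b 2, c i, c (i + 1)} ∨ Z = {c i, c (i + 1), b 3} ∨
  Z = {b 3, c' i, c' (i + 1)} ∨ Z = {c' i, c' (i + 1), b 4})) ∨
  Z = {a 1, a 2, a 3} ∨ Z = {a 1, a 3, a 4} ∨ Z = {a 2, b 2, a 3} ∨ Z = {b 2, c (p + 1), a 3} ∨
  Z = {c (p + 1), a 3, b 3} ∨ Z = {a 3, b 3, a 4} ∨ Z = {b 3, c' (p + 1), a 4} ∨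
  Z = {c' (p + 1), a 4, b 4} ∨ Z = {a 1, a 2, a 5} ∨ Z = {a 1, a 4, a 5} ∨ Z = {a 2, b 2, a 5} ∨
  Z = {b 2, c 1, a 5} ∨ Z = {c 1, b 3, a 5} ∨ Z = {b 3, c' 1, a 5} ∨ Z = {c' 1, b 4, a 5} ∨
  Z = {a 4, b 4, a 5}

/-- The other ridges of `X(1,p+2)`. -/
def InnerTri (p : ℕ) (Z : Finset Vertex) : Prop :=
  (∃ i, 1 ≤ i ∧ i ≤ p ∧ (Z = {c i, c (i + 1), a 5} ∨ Z = {c' i, c' (i + 1), a 5} ∨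
  Z = {b 2, c (i + 1), a 5} ∨ Z = {c (i + 1), b 3, a 5} ∨ Z = {b 3, c' (i + 1), a 5} ∨
  Z = {c' (i + 1), b 4, a 5})) ∨ Z = {a 2, a 3, a 5} ∨ Z = {a 3, a 4, a 5} ∨
  Z = {c (p + 1), a 3, a 5} ∨ Z = {c' (p + 1), a 4, a 5}

/-- The boundary edges of `X(1,p+2)`. -/
def BdEdge (p : ℕ) (Z : Finset Vertex) : Prop :=
  (∃ i, 1 ≤ i ∧ i ≤ p + 1 ∧ (Z = {b 2, c i} ∨ Z = {c i, b 3} ∨ Z = {b 3, c' i} ∨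
  Z = {c' i, b 4})) ∨ (∃ i, 1 ≤ i ∧ i ≤ p ∧ (Z = {c i, c (i + 1)} ∨ Z = {c' i, c' (i + 1)})) ∨
  Z = {a 1, a 2} ∨ Z = {a 1, a 3} ∨ Z = {a 1, a 4} ∨ Z = {a 1, a 5} ∨ Z = {a 2, a 3} ∨
  Z = {a 2, a 5} ∨ Z = {a 2, b 2} ∨ Z = {a 3, a 4} ∨ Z = {b 2, a 3} ∨ Z = {a 3, b 3} ∨
  Z = {a 4, a 5} ∨ Z = {b 3, a 4} ∨ Z = {a 4, b 4} ∨ Z = {b 2, a 5} ∨ Z = {b 3, a 5} ∨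
  Z = {b 4, a 5} ∨ Z = {c (p + 1), a 3} ∨ Z = {c' (p + 1), a 4} ∨ Z = {c 1, a 5} ∨
  Z = {c' 1, a 5}

/-- The other edges of `X(1,p+2)`. -/
def InnerEdge (p : ℕ) (Z : Finset Vertex) : Prop :=
  (∃ i, 1 ≤ i ∧ i ≤ p ∧ (Z = {c (i + 1), a 5} ∨ Z = {c' (i + 1), a 5})) ∨ Z = {a 3, a 5}

/-- The facets of `X(1,p+2)`. -/
def Facet (p : ℕ) (Y : Finset Vertex) : Prop :=
  Y = {a 1, a 2, a 3, a 4, a 5} ∨ Y = {a 2, b 2, a 3, c (p + 1), a 5} ∨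
  Y = {c (p + 1), a 3, b 3, a 4, c' (p + 1), a 5} ∨ Y = {c' (p + 1), a 4, b 4, a 5} ∨
  ∃ i, 1 ≤ i ∧ i ≤ p ∧ (Y = {b 2, c i, c (i + 1), a 5} ∨ Y = {c i, c (i + 1), b 3, a 5} ∨
  Y = {b 3, c' i, c' (i + 1), a 5} ∨ Y = {c' i, c' (i + 1), b 4, a 5})

variable {p k : ℕ} {Z T : Finset Vertex}

lemma mem_base : Z ∈ (X1' (p + 2)).cx.face k ↔ ∃ T, Piece p T ∧ Z ∈ (Cx.connectedSum T).face k := by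
  simp only [X1', Cx.union, Cx.iUnion, mem_union, mem_biUnion, mem_Icc, Piece,
    or_and_right, exists_or, exists_eq_left, Nat.add_sub_cancel, Nat.add_one_sub_one]
  refine or_congr_right <| or_congr_right <| or_congr_right <| or_congr_right ?_
  constructor
  · rintro ⟨i, ⟨h1, h2⟩, h | h | h | h⟩
    · exact ⟨_, ⟨i, h1, h2, .inl rfl⟩, h⟩
    · exact ⟨_, ⟨i, h1, h2, .inr (.inl rfl)⟩, h⟩
    · exact ⟨_, ⟨i, h1, h2, .inr (.inr (.inl rfl))⟩, h⟩
    · exact ⟨_, ⟨i, h1, h2, .inr (.inr (.inr rfl))⟩, h⟩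
  grind

variable {x y z w : Vertex}

lemma sum_simplex (h : Function.Injective ![x, y, z, w]) :
    (Z ∈ (Cx.connectedSum {{x, y, z, w}}).face 1 ↔ Z = {x, y} ∨ Z = {x, z} ∨ Z = {x, w} ∨
      Z = {y, z} ∨ Z = {y, w} ∨ Z = {z, w}) ∧
    (Z ∈ (Cx.connectedSum {{x, y, z, w}}).face 2 ↔
      Z = {x, y, z} ∨ Z = {x, y, w} ∨ Z = {x, z, w} ∨ Z = {y, z, w}) ∧
    (Z ∈ (Cx.connectedSum {{x, y, z, w}}).face 3 ↔ Z = {x, y, z, w}) := by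
  have hT : ({{0, 1, 2, 3}} : Finset (Finset (Fin 4))).image (image ![x, y, z, w]) =
    {{x, y, z, w}} := by simp [image_insert]
  refine ⟨?_, ?_, ?_⟩
  · rw [mem_connectedSum _ h _ hT (F := {{0, 1}, {0, 2}, {0, 3}, {1, 2}, {1, 3}, {2, 3}})
      (by decide)]
    simp [image_insert, eq_comm (b := Z)]
  · rw [mem_connectedSum _ h _ hT (F := {{0, 1, 2}, {0, 1, 3}, {0, 2, 3}, {1, 2, 3}}) (by decide)]
    simp [image_insert, eq_comm (b := Z)]
  · rw [mem_connectedSum _ h _ hT (F := {{0, 1, 2, 3}}) (by decide)]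
    simp [image_insert, eq_comm (b := Z)]

lemma sum_hub : (Z ∈ (Cx.connectedSum {{a 1, a 2, a 3, a 5}, {a 1, a 3, a 4, a 5}}).face 1 ↔
    Z = {a 1, a 2} ∨ Z = {a 1, a 3} ∨ Z = {a 1, a 4} ∨ Z = {a 1, a 5} ∨ Z = {a 2, a 3} ∨
      Z = {a 2, a 5} ∨ Z = {a 3, a 4} ∨ Z = {a 3, a 5} ∨ Z = {a 4, a 5}) ∧
    (Z ∈ (Cx.connectedSum {{a 1, a 2, a 3, a 5}, {a 1, a 3, a 4, a 5}}).face 2 ↔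
    Z = {a 1, a 2, a 3} ∨ Z = {a 1, a 2, a 5} ∨ Z = {a 2, a 3, a 5} ∨ Z = {a 1, a 3, a 4} ∨
      Z = {a 1, a 4, a 5} ∨ Z = {a 3, a 4, a 5}) ∧
    (Z ∈ (Cx.connectedSum {{a 1, a 2, a 3, a 5}, {a 1, a 3, a 4, a 5}}).face 3 ↔
      Z = {a 1, a 2, a 3, a 4, a 5}) := by
  have h : Function.Injective ![a 1, a 2, a 3, a 4, a 5] := by
    intro i j; fin_cases i <;> fin_cases j <;> simp
  have hT : ({{0, 1, 2, 4}, {0, 2, 3, 4}} : Finset (Finset (Fin 5))).image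
      (image ![a 1, a 2, a 3, a 4, a 5]) = {{a 1, a 2, a 3, a 5}, {a 1, a 3, a 4, a 5}} := by
    simp [image_insert]
  refine ⟨?_, ?_, ?_⟩
  · rw [mem_connectedSum _ h _ hT (F := {{0, 1}, {0, 2}, {0, 3}, {0, 4}, {1, 2}, {1, 4}, {2, 3},
      {2, 4}, {3, 4}}) (by decide)]
    simp [image_insert, eq_comm (b := Z)]
  · rw [mem_connectedSum _ h _ hT (F := {{0, 1, 2}, {0, 1, 4}, {1, 2, 4}, {0, 2, 3}, {0, 3, 4},
      {2, 3, 4}}) (by decide)]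
    simp [image_insert, eq_comm (b := Z)]
  · rw [mem_connectedSum _ h _ hT (F := {{0, 1, 2, 3, 4}}) (by decide)]
    simp [image_insert, eq_comm (b := Z)]

lemma sum_left : (Z ∈ (Cx.connectedSum {{a 2, b 2, a 3, a 5}, {b 2, c k, a 3, a 5}}).face 1 ↔
    Z = {a 2, b 2} ∨ Z = {a 2, a 3} ∨ Z = {a 2, a 5} ∨ Z = {b 2, a 3} ∨ Z = {b 2, c k} ∨
      Z = {b 2, a 5} ∨ Z = {c k, a 3} ∨ Z = {a 3, a 5} ∨ Z = {c k, a 5}) ∧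
    (Z ∈ (Cx.connectedSum {{a 2, b 2, a 3, a 5}, {b 2, c k, a 3, a 5}}).face 2 ↔
    Z = {a 2, b 2, a 3} ∨ Z = {a 2, b 2, a 5} ∨ Z = {a 2, a 3, a 5} ∨ Z = {b 2, c k, a 3} ∨
      Z = {b 2, c k, a 5} ∨ Z = {c k, a 3, a 5}) ∧
    (Z ∈ (Cx.connectedSum {{a 2, b 2, a 3, a 5}, {b 2, c k, a 3, a 5}}).face 3 ↔
      Z = {a 2, b 2, a 3, c k, a 5}) := by
  have h : Function.Injective ![a 2, b 2, a 3, c k, a 5] := by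
    intro i j; fin_cases i <;> fin_cases j <;> simp
  have hT : ({{0, 1, 2, 4}, {1, 3, 2, 4}} : Finset (Finset (Fin 5))).image
      (image ![a 2, b 2, a 3, c k, a 5]) = {{a 2, b 2, a 3, a 5}, {b 2, c k, a 3, a 5}} := by
    simp [image_insert]
  refine ⟨?_, ?_, ?_⟩
  · rw [mem_connectedSum _ h _ hT (F := {{0, 1}, {0, 2}, {0, 4}, {1, 2}, {1, 3}, {1, 4}, {3, 2},
      {2, 4}, {3, 4}}) (by decide)]
    simp [image_insert, eq_comm (b := Z)]
  · rw [mem_connectedSum _ h _ hT (F := {{0, 1, 2}, {0, 1, 4}, {0, 2, 4}, {1, 3, 2}, {1, 3, 4},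
      {3, 2, 4}}) (by decide)]
    simp [image_insert, eq_comm (b := Z)]
  · rw [mem_connectedSum _ h _ hT (F := {{0, 1, 2, 3, 4}}) (by decide)]
    simp [image_insert, eq_comm (b := Z)]

lemma sum_mid : (Z ∈ (Cx.connectedSum {{c k, a 3, b 3, a 5}, {a 3, b 3, a 4, a 5},
      {b 3, c' k, a 4, a 5}}).face 1 ↔
    Z = {c k, a 3} ∨ Z = {c k, b 3} ∨ Z = {c k, a 5} ∨ Z = {a 3, b 3} ∨ Z = {a 3, a 4} ∨
      Z = {a 3, a 5} ∨ Z = {b 3, a 4} ∨ Z = {b 3, c' k} ∨ Z = {b 3, a 5} ∨ Z = {c' k, a 4} ∨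
      Z = {a 4, a 5} ∨ Z = {c' k, a 5}) ∧
    (Z ∈ (Cx.connectedSum {{c k, a 3, b 3, a 5}, {a 3, b 3, a 4, a 5},
      {b 3, c' k, a 4, a 5}}).face 2 ↔
    Z = {c k, a 3, b 3} ∨ Z = {c k, a 3, a 5} ∨ Z = {c k, b 3, a 5} ∨ Z = {a 3, b 3, a 4} ∨
      Z = {a 3, a 4, a 5} ∨ Z = {b 3, c' k, a 4} ∨ Z = {b 3, c' k, a 5} ∨ Z = {c' k, a 4, a 5}) ∧
    (Z ∈ (Cx.connectedSum {{c k, a 3, b 3, a 5}, {a 3, b 3, a 4, a 5},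
      {b 3, c' k, a 4, a 5}}).face 3 ↔ Z = {c k, a 3, b 3, a 4, c' k, a 5}) := by
  have h : Function.Injective ![c k, a 3, b 3, a 4, c' k, a 5] := by
    intro i j; fin_cases i <;> fin_cases j <;> simp
  have hT : ({{0, 1, 2, 5}, {1, 2, 3, 5}, {2, 4, 3, 5}} : Finset (Finset (Fin 6))).image
      (image ![c k, a 3, b 3, a 4, c' k, a 5]) = {{c k, a 3, b 3, a 5}, {a 3, b 3, a 4, a 5},
      {b 3, c' k, a 4, a 5}} := by
    simp [image_insert]
  refine ⟨?_, ?_, ?_⟩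
  · rw [mem_connectedSum _ h _ hT (F := {{0, 1}, {0, 2}, {0, 5}, {1, 2}, {1, 3}, {1, 5}, {2, 3},
      {2, 4}, {2, 5}, {4, 3}, {3, 5}, {4, 5}}) (by decide)]
    simp [image_insert, eq_comm (b := Z)]
  · rw [mem_connectedSum _ h _ hT (F := {{0, 1, 2}, {0, 1, 5}, {0, 2, 5}, {1, 2, 3}, {1, 3, 5},
      {2, 4, 3}, {2, 4, 5}, {4, 3, 5}}) (by decide)]
    simp [image_insert, eq_comm (b := Z)]
  · rw [mem_connectedSum _ h _ hT (F := {{0, 1, 2, 3, 4, 5}}) (by decide)]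
    simp [image_insert, eq_comm (b := Z)]

end Base


section Base

variable {p k i : ℕ} {Z T : Finset Vertex}

lemma injective_of_nodup {V : Type} {x y z w : V} (h : [x, y, z, w].Nodup) :
    Function.Injective ![x, y, z, w] := by
  simp at h
  intro i j hij
  fin_cases i <;> fin_cases j <;> simp_all [eq_comm]

lemma sum_end : Function.Injective ![c' k, a 4, b 4, a 5] := injective_of_nodup (by simp)

lemma sum_fam (k : ℕ) : Function.Injective ![b 2, c k, c (k + 1), a 5] ∧
    Function.Injective ![c k, c (k + 1), b 3, a 5] ∧
    Function.Injective ![b 3, c' k, c' (k + 1), a 5] ∧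
    Function.Injective ![c' k, c' (k + 1), b 4, a 5] := by grind [injective_of_nodup]

lemma spoke (h1 : 1 ≤ i) (h2 : i ≤ p + 1) : (BdEdge p {c i, a 5} ∨ InnerEdge p {c i, a 5}) ∧
    (BdEdge p {c' i, a 5} ∨ InnerEdge p {c' i, a 5}) ∧
    (FreeTri p {b 2, c i, a 5} ∨ InnerTri p {b 2, c i, a 5}) ∧
    (FreeTri p {c i, b 3, a 5} ∨ InnerTri p {c i, b 3, a 5}) ∧
    (FreeTri p {b 3, c' i, a 5} ∨ InnerTri p {b 3, c' i, a 5}) ∧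
    (FreeTri p {c' i, b 4, a 5} ∨ InnerTri p {c' i, b 4, a 5}) := by
  rcases Nat.lt_or_ge 1 i with h | h
  · obtain ⟨j, rfl⟩ : ∃ j, i = j + 1 := ⟨i - 1, by omega⟩; refine ⟨?_, ?_, ?_, ?_, ?_, ?_⟩ <;>
      exact .inr (.inl ⟨j, by omega, by omega, by simp⟩)
  grind [BdEdge, FreeTri]

lemma base_one : Z ∈ (X1' (p + 2)).cx.face 1 ↔ BdEdge p Z ∨ InnerEdge p Z := by
  rw [mem_base]
  have hp : 1 ≤ p + 1 := by omega
  have fam : ∀ {Z i}, 1 ≤ i → i ≤ p + 1 →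
      (Z = {b 2, c i} ∨ Z = {c i, b 3} ∨ Z = {b 3, c' i} ∨ Z = {c' i, b 4}) → BdEdge p Z :=
    fun h1 h2 h => .inl ⟨_, h1, h2, h⟩
  have side : ∀ {Z i}, 1 ≤ i → i ≤ p → (Z = {c i, c (i + 1)} ∨ Z = {c' i, c' (i + 1)}) →
      BdEdge p Z := fun h1 h2 h => .inr (.inl ⟨_, h1, h2, h⟩)
  constructor
  · rintro ⟨T, rfl | rfl | rfl | rfl | ⟨i, h1, h2, rfl | rfl | rfl | rfl⟩, hZ⟩
    · grind [sum_hub, BdEdge, InnerEdge]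
    · grind [sum_left, le_rfl, spoke, BdEdge, InnerEdge]
    · rcases sum_mid.1.1 hZ with rfl | rfl | rfl | rfl | rfl | rfl | rfl | rfl | rfl | rfl | rfl | rfl
      on_goal 2 => grind
      on_goal 2 => exact (spoke hp le_rfl).1
      on_goal 6 => grind
      on_goal 9 => exact (spoke hp le_rfl).2.1
      all_goals simp [BdEdge, InnerEdge]
    · rcases (sum_simplex sum_end).1.1 hZ with rfl | rfl | rfl | rfl | rfl | rfl
      on_goal 2 => exact .inl (fam hp le_rfl (by simp))
      on_goal 2 => exact (spoke hp le_rfl).2.1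
      all_goals simp [BdEdge]
    · rcases (sum_simplex (sum_fam i).1).1.1 hZ with rfl | rfl | rfl | rfl | rfl | rfl
      all_goals grind [BdEdge, spoke]
    · rcases (sum_simplex (sum_fam i).2.1).1.1 hZ with rfl | rfl | rfl | rfl | rfl | rfl
      all_goals grind [spoke, BdEdge]
    · rcases (sum_simplex (sum_fam i).2.2.1).1.1 hZ with rfl | rfl | rfl | rfl | rfl | rfl
      · grind
      · grind
      · simp [BdEdge]
      · grind
      · exact (spoke h1 (by omega)).2.1
      · exact (spoke (by omega) (by omega)).2.1
    · rcases (sum_simplex (sum_fam i).2.2.2).1.1 hZ with rfl | rfl | rfl | rfl | rfl | rfl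
      · grind
      · grind
      · exact (spoke h1 (by omega)).2.1
      · grind
      · exact (spoke (by omega) (by omega)).2.1
      · simp [BdEdge]
  · have h1 : ∀ i, 1 ≤ i → i ≤ p → ∀ T, (T = {{b 2, c i, c (i + 1), a 5}} ∨
        T = {{c i, c (i + 1), b 3, a 5}} ∨ T = {{b 3, c' i, c' (i + 1), a 5}} ∨
        T = {{c' i, c' (i + 1), b 4, a 5}}) → Piece p T := fun i h1 h2 T h =>
      .inr (.inr (.inr (.inr ⟨i, h1, h2, h⟩)))
    rintro ((⟨i, h2, h3, h⟩ | ⟨i, h2, h3, h⟩ | h) | (⟨i, h2, h3, h⟩ | rfl))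
    · rcases h3.lt_or_eq with h4 | rfl
      · rcases h with rfl | rfl | rfl | rfl
        · exact ⟨_, h1 i h2 (by omega) _ (.inl rfl), (sum_simplex (sum_fam i).1).1.2 (by simp)⟩
        · exact ⟨_, h1 i h2 (by omega) _ (.inr (.inl rfl)),
            (sum_simplex (sum_fam i).2.1).1.2 (by simp)⟩
        · exact ⟨_, h1 i h2 (by omega) _ (.inr (.inr (.inl rfl))),
            (sum_simplex (sum_fam i).2.2.1).1.2 (by simp)⟩
        · exact ⟨_, h1 i h2 (by omega) _ (.inr (.inr (.inr rfl))),
            (sum_simplex (sum_fam i).2.2.2).1.2 (by simp)⟩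
      · rcases h with rfl | rfl | rfl | rfl
        · exact ⟨_, .inr (.inl rfl), sum_left.1.2 (by simp)⟩
        · exact ⟨_, .inr (.inr (.inl rfl)), sum_mid.1.2 (by simp)⟩
        · exact ⟨_, .inr (.inr (.inl rfl)), sum_mid.1.2 (by simp)⟩
        · exact ⟨_, .inr (.inr (.inr (.inl rfl))), (sum_simplex sum_end).1.2 (by simp)⟩
    · rcases h with rfl | rfl
      · exact ⟨_, h1 i h2 h3 _ (.inl rfl), (sum_simplex (sum_fam i).1).1.2 (by simp)⟩
      · exact ⟨_, h1 i h2 h3 _ (.inr (.inr (.inl rfl))),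
          (sum_simplex (sum_fam i).2.2.1).1.2 (by simp)⟩
    · rcases h with rfl | rfl | rfl | rfl | rfl | rfl | rfl | rfl | rfl | rfl | rfl | rfl | rfl |
        rfl | rfl | rfl | rfl | rfl | rfl | rfl
      on_goal 19 =>
        rcases Nat.eq_zero_or_pos p with rfl | hp'
        · exact ⟨_, .inr (.inl rfl), sum_left.1.2 (by simp)⟩
        · exact ⟨_, h1 1 le_rfl hp' _ (.inl rfl), (sum_simplex (sum_fam 1).1).1.2 (by simp)⟩
      on_goal 19 =>
        rcases Nat.eq_zero_or_pos p with rfl | hp'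
        · exact ⟨_, .inr (.inr (.inl rfl)), sum_mid.1.2 (by simp)⟩
        · exact ⟨_, h1 1 le_rfl hp' _ (.inr (.inr (.inl rfl))),
            (sum_simplex (sum_fam 1).2.2.1).1.2 (by simp)⟩
      all_goals first
        | exact ⟨_, .inl rfl, sum_hub.1.2 (by simp)⟩
        | exact ⟨_, .inr (.inl rfl), sum_left.1.2 (by simp)⟩
        | exact ⟨_, .inr (.inr (.inl rfl)), sum_mid.1.2 (by simp)⟩
        | exact ⟨_, .inr (.inr (.inr (.inl rfl))), (sum_simplex sum_end).1.2 (by simp)⟩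
    · rcases h with rfl | rfl
      · exact ⟨_, h1 i h2 h3 _ (.inl rfl), (sum_simplex (sum_fam i).1).1.2 (by simp)⟩
      · exact ⟨_, h1 i h2 h3 _ (.inr (.inr (.inl rfl))),
          (sum_simplex (sum_fam i).2.2.1).1.2 (by simp)⟩
    · exact ⟨_, .inl rfl, sum_hub.1.2 (by simp)⟩

lemma base_two : Z ∈ (X1' (p + 2)).cx.face 2 ↔ FreeTri p Z ∨ InnerTri p Z := by
  rw [mem_base]
  have hp : 1 ≤ p + 1 := by omega
  have fam : ∀ {Z i}, 1 ≤ i → i ≤ p → (Z = {b 2, c i, c (i + 1)} ∨ Z = {c i, c (i + 1), b 3} ∨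
      Z = {b 3, c' i, c' (i + 1)} ∨ Z = {c' i, c' (i + 1), b 4}) → FreeTri p Z :=
    fun h1 h2 h => .inl ⟨_, h1, h2, h⟩
  constructor
  · rintro ⟨T, rfl | rfl | rfl | rfl | ⟨i, h1, h2, rfl | rfl | rfl | rfl⟩, hZ⟩
    · rcases sum_hub.2.1.1 hZ with rfl | rfl | rfl | rfl | rfl | rfl <;> simp [FreeTri, InnerTri]
    · rcases sum_left.2.1.1 hZ with rfl | rfl | rfl | rfl | rfl | rfl
      on_goal 5 => exact (spoke hp le_rfl).2.2.1
      all_goals simp [FreeTri, InnerTri]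
    · rcases sum_mid.2.1.1 hZ with rfl | rfl | rfl | rfl | rfl | rfl | rfl | rfl
      on_goal 3 => exact (spoke hp le_rfl).2.2.2.1
      on_goal 6 => exact (spoke hp le_rfl).2.2.2.2.1
      all_goals simp [FreeTri, InnerTri]
    · rcases (sum_simplex sum_end).2.1.1 hZ with rfl | rfl | rfl | rfl
      on_goal 3 => exact (spoke hp le_rfl).2.2.2.2.2
      all_goals simp [FreeTri, InnerTri]
    · rcases (sum_simplex (sum_fam i).1).2.1.1 hZ with rfl | rfl | rfl | rfl
      · grind
      · exact (spoke h1 (by omega)).2.2.1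
      · exact (spoke (by omega) (by omega)).2.2.1
      · exact .inr (.inl ⟨i, h1, h2, by simp⟩)
    · rcases (sum_simplex (sum_fam i).2.1).2.1.1 hZ with rfl | rfl | rfl | rfl
      · grind
      · exact .inr (.inl ⟨i, h1, h2, by simp⟩)
      · exact (spoke h1 (by omega)).2.2.2.1
      · exact (spoke (by omega) (by omega)).2.2.2.1
    · rcases (sum_simplex (sum_fam i).2.2.1).2.1.1 hZ with rfl | rfl | rfl | rfl
      · grind
      · exact (spoke h1 (by omega)).2.2.2.2.1
      · exact (spoke (by omega) (by omega)).2.2.2.2.1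
      · exact .inr (.inl ⟨i, h1, h2, by simp⟩)
    · rcases (sum_simplex (sum_fam i).2.2.2).2.1.1 hZ with rfl | rfl | rfl | rfl
      · grind
      · exact .inr (.inl ⟨i, h1, h2, by simp⟩)
      · exact (spoke h1 (by omega)).2.2.2.2.2
      · exact (spoke (by omega) (by omega)).2.2.2.2.2
  · have h1 : ∀ i, 1 ≤ i → i ≤ p → ∀ T, (T = {{b 2, c i, c (i + 1), a 5}} ∨
        T = {{c i, c (i + 1), b 3, a 5}} ∨ T = {{b 3, c' i, c' (i + 1), a 5}} ∨
        T = {{c' i, c' (i + 1), b 4, a 5}}) → Piece p T := fun i h1 h2 T h =>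
      .inr (.inr (.inr (.inr ⟨i, h1, h2, h⟩)))
    rintro ((⟨i, h2, h3, h⟩ | h) | (⟨i, h2, h3, h⟩ | h))
    · rcases h with rfl | rfl | rfl | rfl
      · exact ⟨_, h1 i h2 h3 _ (.inl rfl), (sum_simplex (sum_fam i).1).2.1.2 (by simp)⟩
      · exact ⟨_, h1 i h2 h3 _ (.inr (.inl rfl)), (sum_simplex (sum_fam i).2.1).2.1.2 (by simp)⟩
      · exact ⟨_, h1 i h2 h3 _ (.inr (.inr (.inl rfl))),
          (sum_simplex (sum_fam i).2.2.1).2.1.2 (by simp)⟩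
      · exact ⟨_, h1 i h2 h3 _ (.inr (.inr (.inr rfl))),
          (sum_simplex (sum_fam i).2.2.2).2.1.2 (by simp)⟩
    · rcases h with rfl | rfl | rfl | rfl | rfl | rfl | rfl | rfl | rfl | rfl | rfl | rfl | rfl |
        rfl | rfl | rfl
      all_goals first
        | exact ⟨_, .inl rfl, sum_hub.2.1.2 (by simp)⟩
        | exact ⟨_, .inr (.inl rfl), sum_left.2.1.2 (by simp)⟩
        | exact ⟨_, .inr (.inr (.inl rfl)), sum_mid.2.1.2 (by simp)⟩
        | exact ⟨_, .inr (.inr (.inr (.inl rfl))), (sum_simplex sum_end).2.1.2 (by simp)⟩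
        | rcases Nat.eq_zero_or_pos p with rfl | hp'
      · exact ⟨_, .inr (.inl rfl), sum_left.2.1.2 (by simp)⟩
      · exact ⟨_, h1 1 le_rfl hp' _ (.inl rfl), (sum_simplex (sum_fam 1).1).2.1.2 (by simp)⟩
      · exact ⟨_, .inr (.inr (.inl rfl)), sum_mid.2.1.2 (by simp)⟩
      · exact ⟨_, h1 1 le_rfl hp' _ (.inr (.inl rfl)),
          (sum_simplex (sum_fam 1).2.1).2.1.2 (by simp)⟩
      · exact ⟨_, .inr (.inr (.inl rfl)), sum_mid.2.1.2 (by simp)⟩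
      · exact ⟨_, h1 1 le_rfl hp' _ (.inr (.inr (.inl rfl))),
          (sum_simplex (sum_fam 1).2.2.1).2.1.2 (by simp)⟩
      · exact ⟨_, .inr (.inr (.inr (.inl rfl))), (sum_simplex sum_end).2.1.2 (by simp)⟩
      · exact ⟨_, h1 1 le_rfl hp' _ (.inr (.inr (.inr rfl))),
          (sum_simplex (sum_fam 1).2.2.2).2.1.2 (by simp)⟩
    · rcases h with rfl | rfl | rfl | rfl | rfl | rfl
      · exact ⟨_, h1 i h2 h3 _ (.inr (.inl rfl)), (sum_simplex (sum_fam i).2.1).2.1.2 (by simp)⟩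
      · exact ⟨_, h1 i h2 h3 _ (.inr (.inr (.inr rfl))),
          (sum_simplex (sum_fam i).2.2.2).2.1.2 (by simp)⟩
      · exact ⟨_, h1 i h2 h3 _ (.inl rfl), (sum_simplex (sum_fam i).1).2.1.2 (by simp)⟩
      · exact ⟨_, h1 i h2 h3 _ (.inr (.inl rfl)), (sum_simplex (sum_fam i).2.1).2.1.2 (by simp)⟩
      · exact ⟨_, h1 i h2 h3 _ (.inr (.inr (.inl rfl))),
          (sum_simplex (sum_fam i).2.2.1).2.1.2 (by simp)⟩
      · exact ⟨_, h1 i h2 h3 _ (.inr (.inr (.inr rfl))),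
          (sum_simplex (sum_fam i).2.2.2).2.1.2 (by simp)⟩
    · rcases h with rfl | rfl | rfl | rfl
      all_goals first
        | exact ⟨_, .inl rfl, sum_hub.2.1.2 (by simp)⟩
        | exact ⟨_, .inr (.inl rfl), sum_left.2.1.2 (by simp)⟩
        | exact ⟨_, .inr (.inr (.inl rfl)), sum_mid.2.1.2 (by simp)⟩

lemma base_three : Z ∈ (X1' (p + 2)).cx.face 3 ↔ Facet p Z := by
  rw [mem_base]
  simp only [Piece, Facet, or_and_right, exists_or, exists_eq_left, sum_hub.2.2, sum_left.2.2,
    sum_mid.2.2, (sum_simplex sum_end).2.2]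
  refine or_congr_right <| or_congr_right <| or_congr_right <| or_congr_right ?_
  constructor
  · rintro ⟨T, ⟨i, h1, h2, rfl | rfl | rfl | rfl⟩, h⟩
    · exact ⟨i, h1, h2, .inl ((sum_simplex (sum_fam i).1).2.2.1 h)⟩
    · exact ⟨i, h1, h2, .inr (.inl ((sum_simplex (sum_fam i).2.1).2.2.1 h))⟩
    · exact ⟨i, h1, h2, .inr (.inr (.inl ((sum_simplex (sum_fam i).2.2.1).2.2.1 h)))⟩
    · exact ⟨i, h1, h2, .inr (.inr (.inr ((sum_simplex (sum_fam i).2.2.2).2.2.1 h)))⟩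
  · rintro ⟨i, h1, h2, h | h | h | h⟩
    · exact ⟨_, ⟨i, h1, h2, .inl rfl⟩, (sum_simplex (sum_fam i).1).2.2.2 h⟩
    · exact ⟨_, ⟨i, h1, h2, .inr (.inl rfl)⟩, (sum_simplex (sum_fam i).2.1).2.2.2 h⟩
    · exact ⟨_, ⟨i, h1, h2, .inr (.inr (.inl rfl))⟩, (sum_simplex (sum_fam i).2.2.1).2.2.2 h⟩
    · exact ⟨_, ⟨i, h1, h2, .inr (.inr (.inr rfl))⟩, (sum_simplex (sum_fam i).2.2.2).2.2.2 h⟩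

lemma base_sub (hZ : Z ∈ (X1' (p + 2)).cx.face k) :
    (∀ x ∈ Z, {x} ∈ (X1' (p + 2)).cx.face 0) ∧ (k < 3 → Z.card = k + 1) ∧
      ∃ Y ∈ (X1' (p + 2)).cx.face 3, Z ⊆ Y := by grind [mem_base, connectedSum_sub]

lemma nfac_eq_one {C : Cx Vertex} (hY : Y ∈ C.face 3) (hS : S ⊆ Y)
    (h : ∀ Y' ∈ C.face 3, S ⊆ Y' → Y' = Y) : C.nfac S = 1 := by
  rw [Cx.nfac, card_eq_one]
  refine ⟨Y, ?_⟩
  grind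

lemma nfac_ne_one {C : Cx Vertex} {Y' : Finset Vertex} (hY : Y ∈ C.face 3) (hS : S ⊆ Y)
    (hY' : Y' ∈ C.face 3) (hS' : S ⊆ Y') (h : ¬ Y' ⊆ Y) : C.nfac S ≠ 1 := by
  rw [Cx.nfac, Ne, card_eq_one]
  rintro ⟨W, hW⟩
  have h1 : Y ∈ ({W} : Finset (Finset Vertex)) := hW ▸ mem_filter.2 ⟨hY, hS⟩
  have h2 : Y' ∈ ({W} : Finset (Finset Vertex)) := hW ▸ mem_filter.2 ⟨hY', hS'⟩
  grind

lemma facet_const : Facet p {a 1, a 2, a 3, a 4, a 5} ∧ Facet p {a 2, b 2, a 3, c (p + 1), a 5} ∧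
    Facet p {c (p + 1), a 3, b 3, a 4, c' (p + 1), a 5} ∧ Facet p {c' (p + 1), a 4, b 4, a 5} := by
  simp [Facet]

lemma facet_fam (h1 : 1 ≤ i) (h2 : i ≤ p) :
    Facet p {b 2, c i, c (i + 1), a 5} ∧ Facet p {c i, c (i + 1), b 3, a 5} ∧
    Facet p {b 3, c' i, c' (i + 1), a 5} ∧ Facet p {c' i, c' (i + 1), b 4, a 5} :=
  have h := fun Z hZ => (.inr (.inr (.inr (.inr ⟨i, h1, h2, hZ⟩))) : Facet p Z)
  ⟨h _ (.inl rfl), h _ (.inr (.inl rfl)), h _ (.inr (.inr (.inl rfl))), h _ (.inr (.inr (.inr rfl)))⟩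

lemma base_free (h : FreeTri p Z) : (X1' (p + 2)).cx.nfac Z = 1 := by
  have key : ∀ Y, Facet p Y → Z ⊆ Y → (∀ Y', Facet p Y' → Z ⊆ Y' → Y' = Y) →
      (X1' (p + 2)).cx.nfac Z = 1 := fun Y h1 h2 h3 =>
    nfac_eq_one (base_three.2 h1) h2 fun Y' hY' => h3 Y' (base_three.1 hY')
  obtain ⟨A, B, C, D⟩ := facet_const (p := p)
  have key' : ∀ i, 1 ≤ i → i ≤ p → (Z = {b 2, c i, c (i + 1)} ∨ Z = {c i, c (i + 1), b 3} ∨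
      Z = {b 3, c' i, c' (i + 1)} ∨ Z = {c' i, c' (i + 1), b 4} ∨ i = 1 ∧ (
      Z = {b 2, c i, a 5} ∨ Z = {c i, b 3, a 5} ∨ Z = {b 3, c' i, a 5} ∨ Z = {c' i, b 4, a 5})) →
      (X1' (p + 2)).cx.nfac Z = 1 := by
    intro i h1 h2 h; obtain ⟨P1, P2, P3, P4⟩ := facet_fam h1 h2
    rcases h with rfl | rfl | rfl | rfl | ⟨h5, rfl | rfl | rfl | rfl⟩
    on_goal 1 => refine key _ P1 ?_ ?_
    on_goal 3 => refine key _ P2 ?_ ?_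
    on_goal 5 => refine key _ P3 ?_ ?_
    on_goal 7 => refine key _ P4 ?_ ?_
    on_goal 9 => refine key _ P1 ?_ ?_
    on_goal 11 => refine key _ P2 ?_ ?_
    on_goal 13 => refine key _ P3 ?_ ?_
    on_goal 15 => refine key _ P4 ?_ ?_
    any_goals simp [insert_subset_iff]; done
    all_goals
      rintro Y' (rfl | rfl | rfl | rfl | ⟨j, h3, h4, rfl | rfl | rfl | rfl⟩) hs <;>
        simp [insert_subset_iff] at hs <;> first
          | omega
          | (obtain rfl : i = j := by omega
             rfl)
  rcases h with ⟨i, h1, h2, h⟩ | h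
  · grind
  rcases h with rfl | rfl | rfl | rfl | rfl | rfl | rfl | rfl | rfl | rfl | rfl | rfl | rfl |
    rfl | rfl | rfl
  on_goal 12 =>
    rcases Nat.eq_zero_or_pos p with rfl | hp
    on_goal 2 => grind
  on_goal 13 =>
    rcases Nat.eq_zero_or_pos p with rfl | hp
    on_goal 2 => grind
  on_goal 14 =>
    rcases Nat.eq_zero_or_pos p with rfl | hp
    on_goal 2 => grind
  on_goal 15 =>
    rcases Nat.eq_zero_or_pos p with rfl | hp
    on_goal 2 => grind
  all_goals first
    | (refine key _ A ?_ ?_; on_goal 1 => simp [insert_subset_iff]; done)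
    | (refine key _ B ?_ ?_; on_goal 1 => simp [insert_subset_iff]; done)
    | (refine key _ C ?_ ?_; on_goal 1 => simp [insert_subset_iff]; done)
    | (refine key _ D ?_ ?_; on_goal 1 => grind)
  all_goals
    rintro Y' (rfl | rfl | rfl | rfl | ⟨j, h3, h4, rfl | rfl | rfl | rfl⟩) hs <;>
      simp [insert_subset_iff] at hs <;> first | rfl | omega

lemma base_inner (h : InnerTri p Z) : (X1' (p + 2)).cx.nfac Z ≠ 1 := by
  have key : ∀ Y Y', Facet p Y → Z ⊆ Y → Facet p Y' → Z ⊆ Y' → ¬ Y' ⊆ Y →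
      (X1' (p + 2)).cx.nfac Z ≠ 1 := fun Y Y' h1 h2 h3 h4 =>
    nfac_ne_one (base_three.2 h1) h2 (base_three.2 h3) h4
  obtain ⟨A, B, C, D⟩ := facet_const (p := p)
  rcases h with ⟨i, h1, h2, h⟩ | rfl | rfl | rfl | rfl
  · obtain ⟨P1, P2, P3, P4⟩ := facet_fam h1 h2; rcases h2.lt_or_eq with h3 | rfl
    · obtain ⟨Q1, Q2, Q3, Q4⟩ := facet_fam (i := i + 1) (by omega) h3
      rcases h with rfl | rfl | rfl | rfl | rfl | rfl
      on_goal 1 => refine key _ _ P1 ?_ P2 ?_ ?_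
      on_goal 4 => refine key _ _ P3 ?_ P4 ?_ ?_
      on_goal 7 => refine key _ _ P1 ?_ Q1 ?_ ?_
      on_goal 10 => refine key _ _ P2 ?_ Q2 ?_ ?_
      on_goal 13 => refine key _ _ P3 ?_ Q3 ?_ ?_
      on_goal 16 => refine key _ _ P4 ?_ Q4 ?_ ?_
      all_goals simp [insert_subset_iff] <;> omega
    · rcases h with rfl | rfl | rfl | rfl | rfl | rfl
      on_goal 1 => refine key _ _ P1 ?_ P2 ?_ ?_
      on_goal 4 => refine key _ _ P3 ?_ P4 ?_ ?_
      on_goal 7 => refine key _ _ P1 ?_ B ?_ ?_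
      on_goal 10 => refine key _ _ P2 ?_ C ?_ ?_
      on_goal 13 => refine key _ _ P3 ?_ C ?_ ?_
      on_goal 16 => refine key _ _ P4 ?_ D ?_ ?_
      all_goals simp [insert_subset_iff]
  on_goal 1 => refine key _ _ A ?_ B ?_ ?_
  on_goal 4 => refine key _ _ A ?_ C ?_ ?_
  on_goal 7 => refine key _ _ B ?_ C ?_ ?_
  on_goal 10 => refine key _ _ C ?_ D ?_ ?_
  all_goals simp [insert_subset_iff]

end Base


section Base

variable {p k i : ℕ} {Z T : Finset Vertex}

lemma freeTri_iff : FreeTri p Z ↔ Z ∈ (X1' (p + 2)).cx.face 2 ∧ (X1' (p + 2)).cx.nfac Z = 1 :=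
  ⟨fun h => ⟨base_two.2 (.inl h), base_free h⟩, fun h =>
    (base_two.1 h.1).resolve_right fun h' => base_inner h' h.2⟩

/-- The part of `X(1,p+2)` around the fillet `C` that lies between the tips `v'` and `v`, where
`u` and `x` are the roots before and after the end of the fillet. -/
def Fan (p : ℕ) (u v v' x : Vertex) (C : ℕ → Vertex) : Prop :=
  (∀ i, 1 ≤ i ∧ i ≤ p + 1 → C i = c i) ∧ C (p + 1 + 1) = a 3 ∧ u = a 2 ∧ v = b 3 ∧ v' = b 2 ∧ x = a 4 ∨
  (∀ i, 1 ≤ i ∧ i ≤ p + 1 → C i = c' i) ∧ C (p + 1 + 1) = a 4 ∧ u = a 3 ∧ v = b 4 ∧ v' = b 3 ∧ x = a 5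

variable {C : ℕ → Vertex} {u v v' x : Vertex}

lemma Fan.ne (h : Fan p u v v' x C) (h1 : 1 ≤ i ∧ i ≤ p + 2) :
    C i ≠ v ∧ C i ≠ v' ∧ C i ≠ u ∧ C i ≠ x ∧ C i ≠ a 5 ∧ ∀ j, 1 ≤ j ∧ j ≤ p + 2 → C i = C j → i = j := by
  have key : ∀ j, 1 ≤ j ∧ j ≤ p + 2 → 1 ≤ j ∧ j ≤ p + 1 ∨ j = p + 1 + 1 := by omega
  rcases h with ⟨hC, hW, rfl, rfl, rfl, rfl⟩ | ⟨hC, hW, rfl, rfl, rfl, rfl⟩ <;>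
    rcases key i h1 with h1 | rfl <;> first | rw [hC i h1] | rw [hW]
  all_goals grind

lemma Fan.edge (h : Fan p u v v' x C) (h1 : 1 ≤ i) (h2 : i ≤ p + 2) :
    {v', C i} ∈ (X1' (p + 2)).cx.face 1 ∧ {v, C i} ∈ (X1' (p + 2)).cx.face 1 := by
  rw [base_one, base_one]
  rcases h with ⟨hC, hW, rfl, rfl, rfl, rfl⟩ | ⟨hC, hW, rfl, rfl, rfl, rfl⟩ <;>
  · rcases (show i ≤ p + 1 ∨ i = p + 1 + 1 by omega) with h3 | rfl
    · rw [hC i ⟨h1, h3⟩]; exact ⟨.inl (.inl ⟨i, h1, h3, by grind⟩),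
        .inl (.inl ⟨i, h1, h3, by grind⟩)⟩
    · rw [hW]; simp [BdEdge, pair_eq_iff]

lemma Fan.tri (h : Fan p u v v' x C) (h1 : 1 ≤ i) (h2 : i < p + 2) :
    {C i, C (i + 1)} ∈ (X1' (p + 2)).cx.face 1 ∧ FreeTri p {v', C i, C (i + 1)} ∧
      FreeTri p {v, C i, C (i + 1)} := by
  rw [base_one]
  rcases h with ⟨hC, hW, rfl, rfl, rfl, rfl⟩ | ⟨hC, hW, rfl, rfl, rfl, rfl⟩ <;>
  · rcases (show i ≤ p ∨ i = p + 1 by omega) with h3 | rfl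
    · rw [hC i (by omega), hC (i + 1) (by omega)]
      exact ⟨.inl (.inr (.inl ⟨i, h1, h3, by simp⟩)), .inl ⟨i, h1, h3, by grind⟩,
        .inl ⟨i, h1, h3, by grind⟩⟩
    · rw [hC (p + 1) (by omega), hW]; simp [BdEdge, FreeTri, triple_eq_iff]

lemma Fan.free (h : Fan p u v v' x C) (hZ : FreeTri p Z) (h1 : 1 ≤ i) (h2 : i ≤ p + 2)
    (hi : C i ∈ Z) : (∃ j, 1 ≤ j ∧ j < p + 2 ∧ (Z = {v, C j, C (j + 1)} ∨ Z = {v', C j, C (j + 1)})) ∨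
      Z = {v, C (p + 2), x} ∨ Z = {v', C (p + 2), u} ∨ Z = {v, C 1, a 5} ∨ Z = {v', C 1, a 5} ∨
      v ∉ Z ∧ v' ∉ Z ∧ ∀ j, 1 ≤ j → j ≤ p + 2 → C j ∈ Z → j = p + 2 := by
  have key : ∀ j, 1 ≤ j ∧ j ≤ p + 2 → 1 ≤ j ∧ j ≤ p + 1 ∨ j = p + 1 + 1 := by omega
  rcases h with ⟨hC, hW, rfl, rfl, rfl, rfl⟩ | ⟨hC, hW, rfl, rfl, rfl, rfl⟩
  all_goals
    rcases hZ with ⟨j, h4, h5, rfl | rfl | rfl | rfl⟩ | rfl | rfl | rfl | rfl | rfl | rfl | rfl |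
      rfl | rfl | rfl | rfl | rfl | rfl | rfl | rfl | rfl
    any_goals
      exfalso; rcases key i ⟨h1, h2⟩ with h2 | rfl <;> simp [hC, h2, hW] at hi
      done
    all_goals first
      | exact .inl ⟨j, h4, by omega, by grind⟩
      | (refine .inl ⟨p + 1, by omega, by omega, ?_⟩
         rw [hC (p + 1) (by omega), hW]; simp [triple_eq_iff]; done)
      | (right; rw [hW, hC 1 (by omega)]; simp [triple_eq_iff]; done)
      | (iterate 5 right
         refine ⟨by simp, by simp, fun j h6 h7 h8 => ?_⟩; rcases key j ⟨h6, h7⟩ with h3 | rfl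
         · grind
         · rfl)

lemma Fan.facet (h : Fan p u v v' x C) (hZ : Facet p Z) (hv : v ∈ Z) (h1 : 1 ≤ i)
    (h2 : i ≤ p + 2) (hi : C i ∈ Z) : ∃ j, 1 ≤ j ∧ j < p + 2 ∧ C j ∈ Z ∧ C (j + 1) ∈ Z ∧
      ∀ k, 1 ≤ k → k ≤ p + 2 → C k ∈ Z → k = j ∨ k = j + 1 := by
  have key : ∀ j, 1 ≤ j ∧ j ≤ p + 2 → 1 ≤ j ∧ j ≤ p + 1 ∨ j = p + 1 + 1 := by omega
  rcases h with ⟨hC, hW, rfl, rfl, rfl, rfl⟩ | ⟨hC, hW, rfl, rfl, rfl, rfl⟩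
  all_goals
    rcases hZ with rfl | rfl | rfl | rfl | ⟨j, h4, h5, rfl | rfl | rfl | rfl⟩ <;> simp at hv
    all_goals first
      | (exfalso; rcases key i ⟨h1, h2⟩ with h2 | rfl <;> simp [hC, h2, hW] at hi; done)
      | (refine ⟨j, h4, by omega, ?_, ?_, fun k h6 h7 h8 => ?_⟩
         all_goals grind)
      | grind

lemma Fan.ok (h : Fan p u v v' x C) :
    FilletOK (X1' (p + 2)).cx u v v' C (p + 2) ∧ FilletEnd (X1' (p + 2)).cx v C (p + 2) x := by
  have hv : v' ≠ v ∧ v' ≠ u ∧ v' ≠ x ∧ v ≠ u ∧ v ≠ x ∧ v ≠ a 5 ∧ v' ≠ a 5 := by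
    rcases h with ⟨-, -, rfl, rfl, rfl, rfl⟩ | ⟨-, -, rfl, rfl, rfl, rfl⟩ <;> simp
  obtain ⟨w1, w2, w3, w4, w5, w6, w7⟩ := hv
  have hb := fun i (h1 : 1 ≤ i ∧ i ≤ p + 2) => h.ne h1
  have hinj : ∀ i j, 1 ≤ i ∧ i ≤ p + 2 → 1 ≤ j ∧ j ≤ p + 2 → (C i = C j ↔ i = j) := fun i j h1 h2 =>
    ⟨(h.ne h1).2.2.2.2.2 j h2, fun h => h ▸ rfl⟩
  refine ⟨⟨fun i h1 h2 => (h.edge h1 h2).1, fun i h1 h2 => (h.edge h1 h2).2,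
    fun i h1 h2 => (h.tri h1 h2).1, fun i h1 h2 => (freeTri_iff.1 (h.tri h1 h2).2.1).1,
    fun i h1 h2 => (freeTri_iff.1 (h.tri h1 h2).2.1).2, ?_,
    fun i h1 h2 => (freeTri_iff.1 (h.tri h1 h2).2.2).1,
    fun i h1 h2 => (freeTri_iff.1 (h.tri h1 h2).2.2).2, ?_, ?_, ?_, ?_, ?_, ?_⟩, ?_, ?_⟩
  · intro i h1 h2 Z hZ hs hn; simp only [insert_subset_iff, singleton_subset_iff] at hs
    rcases h.free (freeTri_iff.2 ⟨hZ, hn⟩) (by omega) h2 hs.2 with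
      ⟨j, h3, h4, rfl | rfl⟩ | rfl | rfl | rfl | rfl | ⟨h3, h4, h5⟩ <;> grind
  · intro i h1 h2 Y hY hs; simp only [insert_subset_iff, singleton_subset_iff] at hs
    obtain ⟨j, h3, h4, h5, h6, h7⟩ := h.facet (base_three.1 hY) hs.1 h1 h2.le hs.2; grind
  · grind [insert_subset_iff, base_three, h.facet]
  · intro i h1 h2 Z hZ hs hn; simp only [insert_subset_iff, singleton_subset_iff] at hs
    rcases h.free (freeTri_iff.2 ⟨hZ, hn⟩) (by omega) h2.le hs.2 with
      ⟨j, h3, h4, rfl | rfl⟩ | rfl | rfl | rfl | rfl | ⟨h3, h4, h5⟩ <;> grind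
  · intro i h1 h2 Z hZ hs hn; simp only [insert_subset_iff, singleton_subset_iff] at hs
    rcases h.free (freeTri_iff.2 ⟨hZ, hn⟩) h1 h2.le hs.1 with
      ⟨j, h3, h4, rfl | rfl⟩ | rfl | rfl | rfl | rfl | ⟨h3, h4, h5⟩ <;> grind
  · intro Z hZ hs; have ha : a 5 ∉ Z := fun h5 => by grind
    have hv : v ∉ Z := fun h5 => by grind
    have hF := (base_two.1 hZ).resolve_right fun h => ha <| by
      rcases h with ⟨i, -, -, rfl | rfl | rfl | rfl | rfl | rfl⟩ | rfl | rfl | rfl | rfl <;> simp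
    obtain ⟨y, hy, hy'⟩ : ∃ y ∈ Z, y ≠ v' := by
      by_contra! hno; have := card_le_card (fun y hy => mem_singleton.2 (hno y hy) : Z ⊆ {v'})
      rw [(base_sub hZ).2.1 (by omega)] at this; simp at this
    obtain ⟨i, h7, rfl⟩ := mem_image.1 ((mem_insert.1 (hs hy)).resolve_left hy')
    rw [mem_Icc] at h7; rcases h.free hF h7.1 h7.2 hy with
      ⟨j, h3, h4, rfl | rfl⟩ | rfl | rfl | rfl | rfl | ⟨h3, h4, h5⟩
    on_goal 2 => grind
    on_goal 3 =>
      have := hs (by simp : u ∈ _); grind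
    on_goal 5 =>
      have : Z ⊆ {C (p + 2)} := fun z hz => by grind
      have := card_le_card this; rw [(base_sub hZ).2.1 (by omega)] at this; simp at this
    all_goals simp at hv ha
  · have hF : FreeTri p {v, C 1, a 5} := by
      rcases h with ⟨hC, hW, rfl, rfl, rfl, rfl⟩ | ⟨hC, hW, rfl, rfl, rfl, rfl⟩ <;>
        rw [hC 1 (by omega)] <;> simp [FreeTri, triple_eq_iff]
    exact fun _ => ⟨_, (freeTri_iff.1 hF).1, by simp, fun h' => by
      have : C 2 ∈ ({v, C 1, a 5} : Finset Vertex) := by rw [h']; simp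
      grind, (freeTri_iff.1 hF).2⟩
  · intro Y hY hs; simp only [insert_subset_iff, singleton_subset_iff] at hs
    obtain ⟨j, h3, h4, h5, h6, h7⟩ := h.facet (base_three.1 hY) hs.1 (by omega) le_rfl hs.2; grind
  · intro _ Z hZ hs hn; simp only [insert_subset_iff, singleton_subset_iff] at hs
    rcases h.free (freeTri_iff.2 ⟨hZ, hn⟩) (by omega) le_rfl hs.2 with
      ⟨j, h3, h4, rfl | rfl⟩ | rfl | rfl | rfl | rfl | ⟨h3, h4, h5⟩ <;> grind

end Base


section Base

variable {p : ℕ} {x : Vertex}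

lemma base_zero : ({x} ∈ (X1' (p + 2)).cx.face 0 ↔ (X1' (p + 2)).cx.OnBd {x}) ∧
    ({x} ∈ (X1' (p + 2)).cx.face 0 ↔ x ∈ ({a 1, a 2, a 3, a 4, a 5, b 2, b 3, b 4} : Finset Vertex) ∨
      ∃ i, 1 ≤ i ∧ i ≤ p + 1 ∧ (x = c i ∨ x = c' i)) := by
  have h1 : {x} ∈ (X1' (p + 2)).cx.face 0 → x ∈ ({a 1, a 2, a 3, a 4, a 5, b 2, b 3, b 4} : Finset Vertex) ∨
      ∃ i, 1 ≤ i ∧ i ≤ p + 1 ∧ (x = c i ∨ x = c' i) := by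
    intro h; obtain ⟨Y, hY, hx⟩ := (base_sub h).2.2; have hp : 1 ≤ p + 1 := by omega
    rcases base_three.1 hY with rfl | rfl | rfl | rfl | ⟨j, h4, h5, rfl | rfl | rfl | rfl⟩ <;>
      simp at hx
    all_goals grind
  have h2 : (X1' (p + 2)).cx.OnBd {x} → {x} ∈ (X1' (p + 2)).cx.face 0 := by
    rintro ⟨Z, hZ, -, hx⟩; exact (base_sub hZ).1 x (by grind)
  have h3 : x ∈ ({a 1, a 2, a 3, a 4, a 5, b 2, b 3, b 4} : Finset Vertex) ∨
      (∃ i, 1 ≤ i ∧ i ≤ p + 1 ∧ (x = c i ∨ x = c' i)) → (X1' (p + 2)).cx.OnBd {x} := by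
    have key : ∀ Z, FreeTri p Z → x ∈ Z → (X1' (p + 2)).cx.OnBd {x} := fun Z hZ hx =>
      ⟨Z, (freeTri_iff.1 hZ).1, (freeTri_iff.1 hZ).2, by grind⟩
    rintro (h | ⟨i, h4, h5, h⟩)
    · simp only [mem_insert, mem_singleton] at h
      rcases h with rfl | rfl | rfl | rfl | rfl | rfl | rfl | rfl
      on_goal 3 => exact key {a 2, b 2, a 3} (by simp [FreeTri]) (by simp)
      on_goal 5 => exact key {a 2, b 2, a 3} (by simp [FreeTri]) (by simp)
      on_goal 5 => exact key {a 3, b 3, a 4} (by simp [FreeTri]) (by simp)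
      on_goal 5 => exact key {a 4, b 4, a 5} (by simp [FreeTri]) (by simp)
      on_goal 2 => exact key {a 1, a 2, a 5} (by simp [FreeTri]) (by simp)
      all_goals exact key {a 1, a 4, a 5} (by simp [FreeTri]) (by simp)
    · rcases (show i ≤ p ∨ i = p + 1 by omega) with h5 | rfl <;> rcases h with rfl | rfl
      · exact key {b 2, c i, c (i + 1)} (.inl ⟨i, h4, h5, by simp⟩) (by simp)
      · exact key {b 3, c' i, c' (i + 1)} (.inl ⟨i, h4, h5, by simp⟩) (by simp)
      · exact key {b 2, c (p + 1), a 3} (by simp [FreeTri]) (by simp)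
      · exact key {b 3, c' (p + 1), a 4} (by simp [FreeTri]) (by simp)
  grind

lemma base_apart (hx : x ∉ ({a 1, a 2, a 3, a 4, a 5} : Finset Vertex)) :
    Apart (X1' (p + 2)).cx (a 1) x := by
  have key : ∀ k, ∀ Z ∈ (X1' (p + 2)).cx.face k, ¬ {a 1, x} ⊆ Z := by
    intro k Z hZ hs; obtain ⟨Y, hY, h⟩ := (base_sub hZ).2.2; have := hs.trans h
    rcases base_three.1 hY with rfl | rfl | rfl | rfl | ⟨j, h4, h5, rfl | rfl | rfl | rfl⟩
    · grind
    all_goals simp [insert_subset_iff] at this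
  exact ⟨key 1, key 2, key 3⟩

lemma base_tooth {v b' w : Vertex} (h : v = a 2 ∧ b' = b 2 ∧ w = a 3 ∨ v = a 3 ∧ b' = b 3 ∧ w = a 4 ∨
    v = a 4 ∧ b' = b 4 ∧ w = a 5) : RootOK (X1' (p + 2)).cx 1 (a 1) v w ∧
      ToothOK (X1' (p + 2)).cx 1 (a 1) v b' w := by
  rcases h with ⟨rfl, rfl, rfl⟩ | ⟨rfl, rfl, rfl⟩ | ⟨rfl, rfl, rfl⟩
  all_goals
    refine ⟨⟨base_zero.2.2 (by simp), base_zero.2.2 (by simp), base_zero.2.2 (by simp),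
      base_one.2 (by simp [BdEdge]), base_one.2 (by simp [BdEdge]), base_one.2 (by simp [BdEdge]),
      base_two.2 (by simp [FreeTri]), base_free (by simp [FreeTri])⟩, base_one.2 (by simp [BdEdge]),
      base_one.2 (by simp [BdEdge]), base_two.2 (by simp [FreeTri]), base_free (by simp [FreeTri]), ?_⟩
    intro Z hZ hs hn
    rcases freeTri_iff.2 ⟨hZ, hn⟩ with ⟨j, h4, h5, rfl | rfl | rfl | rfl⟩ | rfl | rfl | rfl | rfl |
      rfl | rfl | rfl | rfl | rfl | rfl | rfl | rfl | rfl | rfl | rfl | rfl <;>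
    simp [insert_subset_iff] at hs <;> simp

lemma chain_range (f : ℕ → Vertex) (t w o : Vertex) (d : Bool) :
    (∀ i, 1 ≤ i ∧ i ≤ p + 1 → Arc.chain ⟨t :: (List.range (p + 1)).map fun i => f (i + 1), w, d⟩ o i =
      f i) ∧ Arc.chain ⟨t :: (List.range (p + 1)).map fun i => f (i + 1), w, d⟩ o (p + 1 + 1) = w := by
  grind [Arc.chain, List.getD_append, List.getD_eq_getElem, Nat.sub_add_cancel]

lemma good_base (p : ℕ) : Good 1 (p + 2) (X1' (p + 2)) := by
  have hc := Fan.ok (.inl ⟨(chain_range (p := p) c (b 2) (a 3) (a 1) true).1,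
    (chain_range c (b 2) (a 3) (a 1) true).2, rfl, rfl, rfl, rfl⟩)
  have hc' := Fan.ok (.inr ⟨(chain_range (p := p) c' (b 3) (a 4) (a 1) true).1,
    (chain_range c' (b 3) (a 4) (a 1) true).2, rfl, rfl, rfl, rfl⟩)
  refine ⟨⟨fun Z hZ => ?_, fun Z hZ => (base_sub hZ).1, fun Z hZ => (base_sub hZ).1,
    fun Z hZ => (base_sub hZ).1, fun Z hZ => (base_sub hZ).2.1 (by omega),
    fun Z hZ => ((base_sub hZ).2.1 (by omega)).ge, fun Z hZ => ?_, fun Z hZ W hW h => ?_⟩, ?_,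
    fun x hx => .inl (base_zero.1.1 hx), fun Z hZ h1 hn => ?_,
    ⟨⟨⟨(base_tooth (.inl ⟨rfl, rfl, rfl⟩)).1, ?_, fun _ => (base_tooth (.inl ⟨rfl, rfl, rfl⟩)).2,
      nofun, fun _ => ⟨by simp, base_zero.2.2 (by simp), ?_⟩⟩, ?_⟩,
    ⟨⟨(base_tooth (.inr (.inl ⟨rfl, rfl, rfl⟩))).1, ?_,
      fun _ => (base_tooth (.inr (.inl ⟨rfl, rfl, rfl⟩))).2,
      nofun, fun _ => ⟨by simp, base_zero.2.2 (by simp), ?_⟩⟩, ?_⟩,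
    ⟨⟨(base_tooth (.inr (.inr ⟨rfl, rfl, rfl⟩))).1, ?_,
      fun _ => (base_tooth (.inr (.inr ⟨rfl, rfl, rfl⟩))).2,
      by simp, nofun⟩, nofun⟩, trivial⟩,
    by omega, by simp⟩
  · exact card_eq_one.1 ((base_sub hZ).2.1 (by omega))
  · rcases base_three.1 hZ with rfl | rfl | rfl | rfl | ⟨j, h4, h5, rfl | rfl | rfl | rfl⟩ <;>
      refine one_lt_card.2 ⟨a 5, by simp, ?_⟩ <;> simp
  · exact eq_of_subset_of_card_le h
      (by rw [(base_sub hZ).2.1 (by omega), (base_sub hW).2.1 (by omega)])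
  · simp [X1', profile, List.nodup_append]; have h (f : ℕ → Vertex) (hf : f.Injective) :
        ((List.range (p + 1)).map fun i => f (i + 1)).Nodup :=
      List.nodup_range.map fun i j hij => by grind
    refine ⟨h c fun i j h => by simpa using h, h c' fun i j h => by simpa using h, ?_⟩; grind
  · change a 1 ∈ Z at h1
    rcases freeTri_iff.2 ⟨hZ, hn⟩ with ⟨j, h4, h5, rfl | rfl | rfl | rfl⟩ | rfl | rfl | rfl | rfl |
      rfl | rfl | rfl | rfl | rfl | rfl | rfl | rfl | rfl | rfl | rfl | rfl <;>
    simp at h1 <;> simp [X1', endRoot, rootPairs]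
  · intro x hx; simp at hx; rcases hx with rfl | ⟨i, hi, rfl⟩
    · exact ⟨base_zero.2.2 (by simp), base_apart (by simp)⟩
    · exact ⟨base_zero.2.2 (.inr ⟨_, by omega, by omega, .inl rfl⟩), base_apart (by simp)⟩
  · exact hc.1
  · exact fun _ => ⟨_, _, rfl, rfl, hc.2⟩
  · intro x hx; simp at hx; rcases hx with rfl | ⟨i, hi, rfl⟩
    · exact ⟨base_zero.2.2 (by simp), base_apart (by simp)⟩
    · exact ⟨base_zero.2.2 (.inr ⟨_, by omega, by omega, .inr rfl⟩), base_apart (by simp)⟩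
  · exact hc'.1
  · exact fun _ => ⟨_, _, rfl, rfl, hc'.2⟩
  · intro x hx; obtain rfl := List.mem_singleton.1 hx
    exact ⟨base_zero.2.2 (by simp), base_apart (by simp)⟩

end Base


section Count

variable {p : ℕ} {Z : Finset Vertex}

lemma card_family {V : Type} [DecidableEq V] (fam : Fin k → ℕ → V) (I : Finset ℕ)
    (T : Finset V) {S : Finset V} (hS : ∀ Z, Z ∈ S ↔ (∃ i ∈ I, ∃ x, Z = fam x i) ∨ Z ∈ T)
    (hfam : ∀ x y, ∀ i j, fam x i = fam y j → x = y ∧ i = j)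
    (hT : ∀ x, ∀ i ∈ I, fam x i ∉ T) : S.card = k * I.card + T.card := by
  have : S = (univ ×ˢ I).image (fun q => fam q.1 q.2) ∪ T := by
    ext Z; simp only [hS, mem_union, mem_image, mem_product, Prod.exists, mem_univ, true_and]; grind
  rw [this, card_union_of_disjoint, card_image_of_injective, card_product,
    card_univ, Fintype.card_fin]
  · intro q r h; grind
  grind [disjoint_left]

lemma edge_onBd (h : BdEdge p Z) : (X1' (p + 2)).cx.OnBd Z := by
  have key : ∀ T, FreeTri p T → Z ⊆ T → (X1' (p + 2)).cx.OnBd Z := fun T hT h =>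
    ⟨T, (freeTri_iff.1 hT).1, (freeTri_iff.1 hT).2, h⟩
  rcases h with ⟨i, h1, h2, h⟩ | ⟨i, h1, h2, h⟩ | h
  · rcases (show i ≤ p ∨ i = p + 1 by omega) with h2 | rfl
    · have F : ∀ T, (T = {b 2, c i, c (i + 1)} ∨ T = {c i, c (i + 1), b 3} ∨
        T = {b 3, c' i, c' (i + 1)} ∨ T = {c' i, c' (i + 1), b 4}) → FreeTri p T := fun T h =>
        .inl ⟨i, h1, h2, h⟩
      rcases h with rfl | rfl | rfl | rfl
      · exact key _ (F _ (.inl rfl)) (by grind)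
      · exact key _ (F _ (.inr (.inl rfl))) (by grind)
      · exact key _ (F _ (.inr (.inr (.inl rfl)))) (by grind)
      · exact key _ (F _ (.inr (.inr (.inr rfl)))) (by grind)
    · rcases h with rfl | rfl | rfl | rfl
      · exact key {b 2, c (p + 1), a 3} (by simp [FreeTri]) (by grind)
      · exact key {c (p + 1), a 3, b 3} (by simp [FreeTri]) (by grind)
      · exact key {b 3, c' (p + 1), a 4} (by simp [FreeTri]) (by grind)
      · exact key {c' (p + 1), a 4, b 4} (by simp [FreeTri]) (by grind)
  · rcases h with rfl | rfl
    · exact key {b 2, c i, c (i + 1)} (.inl ⟨i, h1, h2, by simp⟩) (by simp)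
    · exact key {b 3, c' i, c' (i + 1)} (.inl ⟨i, h1, h2, by simp⟩) (by simp)
  · obtain ⟨T, hT, h⟩ : ∃ T ∈ ({{a 1, a 2, a 3}, {a 1, a 3, a 4}, {a 1, a 2, a 5}, {a 1, a 4, a 5},
        {a 2, b 2, a 3}, {a 3, b 3, a 4}, {a 4, b 4, a 5}, {b 2, c 1, a 5}, {c 1, b 3, a 5},
        {b 2, c (p + 1), a 3}, {b 3, c' (p + 1), a 4}, {b 3, c' 1, a 5}} : Finset (Finset Vertex)), Z ⊆ T := by
      rcases h with rfl | rfl | rfl | rfl | rfl | rfl | rfl | rfl | rfl | rfl | rfl | rfl | rfl |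
        rfl | rfl | rfl | rfl | rfl | rfl | rfl <;> simp [insert_subset_iff]
    refine key T ?_ h; simp only [mem_insert, mem_singleton] at hT; grind [FreeTri]

lemma edge_not_onBd (h : InnerEdge p Z) : ¬ (X1' (p + 2)).cx.OnBd Z := by
  rintro ⟨T, hT, hn, hs⟩
  rcases h with ⟨i, h1, h2, rfl | rfl⟩ | rfl <;>
  rcases freeTri_iff.2 ⟨hT, hn⟩ with ⟨j, h4, h5, rfl | rfl | rfl | rfl⟩ | rfl | rfl | rfl | rfl |
      rfl | rfl | rfl | rfl | rfl | rfl | rfl | rfl | rfl | rfl | rfl | rfl <;>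
    simp [insert_subset_iff] at hs <;> omega

lemma card_freeRidges_base (p : ℕ) : (X1' (p + 2)).cx.freeRidges.card = 4 * p + 16 := by
  rw [card_family ![fun i => {b 2, c i, c (i + 1)}, fun i => {c i, c (i + 1), b 3},
    fun i => {b 3, c' i, c' (i + 1)}, fun i => {c' i, c' (i + 1), b 4}] (Icc 1 p)
    {{a 1, a 2, a 3}, {a 1, a 3, a 4}, {a 2, b 2, a 3}, {b 2, c (p + 1), a 3},
     {c (p + 1), a 3, b 3}, {a 3, b 3, a 4}, {b 3, c' (p + 1), a 4},
     {c' (p + 1), a 4, b 4}, {a 1, a 2, a 5}, {a 1, a 4, a 5}, {a 2, b 2, a 5},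
     {b 2, c 1, a 5}, {c 1, b 3, a 5}, {b 3, c' 1, a 5}, {c' 1, b 4, a 5}, {a 4, b 4, a 5}}]
  · rw [Nat.card_Icc]; simp [triple_eq_iff]
  · intro Z; rw [Cx.mem_freeRidges, ← freeTri_iff]; simp [FreeTri, Fin.exists_fin_succ, and_assoc]
  · intro x y i j h
    fin_cases x <;> fin_cases y <;> simp [triple_eq_iff] at h ⊢ <;> omega
  · intro x i _
    fin_cases x <;> simp [triple_eq_iff]

lemma card_bdEdges_base (p : ℕ) : (X1' (p + 2)).cx.bdEdges.card = 6 * p + 24 := by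
  rw [card_family ![fun i => {b 2, c i}, fun i => {c i, b 3}, fun i => {b 3, c' i},
    fun i => {c' i, b 4}, fun i => {c i, c (i + 1)}, fun i => {c' i, c' (i + 1)}] (Icc 1 p)
    ({{b 2, c (p + 1)}, {c (p + 1), b 3}, {b 3, c' (p + 1)}, {c' (p + 1), b 4}, {a 1, a 2}, {a 1, a 3},
     {a 1, a 4}, {a 1, a 5}, {a 2, a 3}, {a 2, a 5}, {a 2, b 2}, {a 3, a 4}, {b 2, a 3}, {a 3, b 3},
     {a 4, a 5}, {b 3, a 4}, {a 4, b 4}, {b 2, a 5}, {b 3, a 5}, {b 4, a 5}, {c (p + 1), a 3},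
     {c' (p + 1), a 4}, {c 1, a 5}, {c' 1, a 5}})]
  · rw [Nat.card_Icc]; simp [pair_eq_iff]
  · intro Z; have : Z ∈ (X1' (p + 2)).cx.bdEdges ↔ BdEdge p Z := by
      grind [Cx.mem_bdEdges, base_one, edge_not_onBd, edge_onBd]
    rw [this, BdEdge]
    have : ∀ P : ℕ → Prop, (∃ i, 1 ≤ i ∧ i ≤ p + 1 ∧ P i) ↔ (∃ i, 1 ≤ i ∧ i ≤ p ∧ P i) ∨ P (p + 1) := by
      grind
    rw [this]; simp only [Fin.exists_fin_succ, mem_insert, mem_singleton, mem_Icc,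
      and_assoc, and_or_left, exists_or]
    simp; rw [or_or_or_comm]; simp only [or_assoc]
  · intro x y i j h
    fin_cases x <;> fin_cases y <;> simp [pair_eq_iff] at h ⊢ <;> omega
  · intro x i hi
    fin_cases x <;> simp [pair_eq_iff] <;> simp at hi <;> omega

lemma card_facets_base (p : ℕ) : ((X1' (p + 2)).cx.face 3).card = 4 * p + 4 := by
  rw [card_family ![fun i => {b 2, c i, c (i + 1), a 5}, fun i => {c i, c (i + 1), b 3, a 5},
    fun i => {b 3, c' i, c' (i + 1), a 5}, fun i => {c' i, c' (i + 1), b 4, a 5}] (Icc 1 p)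
    {{a 1, a 2, a 3, a 4, a 5}, {a 2, b 2, a 3, c (p + 1), a 5},
      {c (p + 1), a 3, b 3, a 4, c' (p + 1), a 5}, {c' (p + 1), a 4, b 4, a 5}}]
  · rw [Nat.card_Icc]; simp [Finset.Subset.antisymm_iff, insert_subset_iff]
  · intro Z; rw [base_three]; simp [Facet, Fin.exists_fin_succ, and_assoc]; grind
  · intro x y i j h; have h' := h.superset; replace h := h.subset
    fin_cases x <;> fin_cases y <;> simp [insert_subset_iff] at h h' ⊢ <;> omega
  · intro x i hi
    fin_cases x <;> simp [Finset.Subset.antisymm_iff, insert_subset_iff]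

lemma card_base (p : ℕ) : ((X1' (p + 2)).cx.face 0).card = 2 * p + 10 ∧
    ((X1' (p + 2)).cx.face 1).card = 8 * p + 25 ∧ ((X1' (p + 2)).cx.face 2).card = 10 * p + 20 ∧
    ((X1' (p + 2)).cx.face 3).card = 4 * p + 4 := by
  classical
  refine ⟨?_, ?_, ?_, ?_⟩
  · rw [card_family ![fun i => {c i}, fun i => {c' i}] (Icc 1 (p + 1))
      {{a 1}, {a 2}, {a 3}, {a 4}, {a 5}, {b 2}, {b 3}, {b 4}}]
    · rw [Nat.card_Icc]; simp; omega
    · intro Z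
      have : Z ∈ (X1' (p + 2)).cx.face 0 ↔ ∃ x, Z = {x} ∧ {x} ∈ (X1' (p + 2)).cx.face 0 := by
        constructor
        · intro h; obtain ⟨x, rfl⟩ := (good_base p).frame.zero Z h; exact ⟨x, rfl, h⟩
        grind
      simp only [this, base_zero.2]; constructor
      · rintro ⟨x, rfl, h | ⟨i, h1, h2, rfl | rfl⟩⟩
        · exact .inr (by simpa using h)
        · exact .inl ⟨i, by simp [*], 0, rfl⟩
        · exact .inl ⟨i, by simp [*], 1, rfl⟩
      · rintro (⟨i, hi, x, rfl⟩ | h)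
        · rw [mem_Icc] at hi
          fin_cases x
          exacts [⟨_, rfl, .inr ⟨i, hi.1, hi.2, .inl rfl⟩⟩, ⟨_, rfl, .inr ⟨i, hi.1, hi.2, .inr rfl⟩⟩]
        · simp only [mem_insert, mem_singleton] at h
          rcases h with rfl | rfl | rfl | rfl | rfl | rfl | rfl | rfl <;> exact ⟨_, rfl, by simp⟩
    · intro x y i j h
      fin_cases x <;> fin_cases y <;> simp at h ⊢ <;> omega
    · intro x i hi
      fin_cases x <;> simp
  · have h := card_filter_add_card_filter_not (s := (X1' (p + 2)).cx.face 1)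
      fun e => (X1' (p + 2)).cx.OnBd e
    rw [card_family (S := filter (fun e => ¬ (X1' (p + 2)).cx.OnBd e) _)
      ![fun i => {c (i + 1), a 5}, fun i => {c' (i + 1), a 5}] (Icc 1 p) {{a 3, a 5}}] at h
    · have h1 := card_bdEdges_base p; rw [Cx.bdEdges] at h1
      rw [← h, Nat.card_Icc, card_singleton]; grind
    · intro Z; rw [mem_filter, base_one]
      have : InnerEdge p Z ↔ (BdEdge p Z ∨ InnerEdge p Z) ∧ ¬ (X1' (p + 2)).cx.OnBd Z :=
        ⟨fun h => ⟨.inr h, edge_not_onBd h⟩, fun h => h.1.resolve_left fun h' => h.2 (edge_onBd h')⟩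
      rw [← this]; simp [InnerEdge, Fin.exists_fin_succ, and_assoc]
    · intro x y i j h
      fin_cases x <;> fin_cases y <;> simp [pair_eq_iff] at h ⊢ <;> omega
    · intro x i hi
      fin_cases x <;> simp [pair_eq_iff]
  · have h := card_filter_add_card_filter_not (s := (X1' (p + 2)).cx.face 2)
      fun e => (X1' (p + 2)).cx.nfac e = 1
    rw [← Cx.freeRidges, card_freeRidges_base,
      card_family (S := filter (fun e => ¬ (X1' (p + 2)).cx.nfac e = 1) _)
      ![fun i => {c i, c (i + 1), a 5}, fun i => {c' i, c' (i + 1), a 5}, fun i => {b 2, c (i + 1), a 5},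
        fun i => {c (i + 1), b 3, a 5}, fun i => {b 3, c' (i + 1), a 5}, fun i => {c' (i + 1), b 4, a 5}]
      (Icc 1 p) {{a 2, a 3, a 5}, {a 3, a 4, a 5}, {c (p + 1), a 3, a 5}, {c' (p + 1), a 4, a 5}},
      Nat.card_Icc] at h
    · grind [triple_eq_iff]
    · intro Z; rw [mem_filter, base_two]
      have : InnerTri p Z ↔ (FreeTri p Z ∨ InnerTri p Z) ∧ ¬ (X1' (p + 2)).cx.nfac Z = 1 :=
        ⟨fun h => ⟨.inr h, base_inner h⟩, fun h => h.1.resolve_left fun h' => h.2 (base_free h')⟩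
      rw [← this]; simp [InnerTri, Fin.exists_fin_succ, and_assoc]
    · intro x y i j h
      fin_cases x <;> fin_cases y <;> simp [triple_eq_iff] at h ⊢ <;> omega
    · intro x i hi
      fin_cases x <;> simp [triple_eq_iff]
  · exact card_facets_base p

lemma total_base (p : ℕ) : total (X1' (p + 2)).cx =
    ![2 * (p : ℤ) + 11, 10 * (p : ℤ) + 35, 16 * (p : ℤ) + 44, 8 * (p : ℤ) + 20] := by
  grind [card_base, total, card_bdEdges_base, card_freeRidges_base]

end Count


/-- The numbers of arcs, of fillets and of arcs without tooth, and the numbers of faces. -/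
structure Census (s t : ℕ) : Prop where
  good : Good (if t = 1 then 0 else 1) t (X s t)
  arcs : (X s t).arcs.length + 2 = KPrime s t
  fillets : ((X s t).arcs.countP fun A => A.fillet) = K s t
  bare : ((X s t).arcs.countP fun A => A.inner.isEmpty) = R s t
  counts : (X s t).Counts (F s t)
  total : 1 < t → total (X s t).cx = F s t

lemma census_one (s : ℕ) : Census (s + 1) 1 := by
  have hX : X (s + 1) 1 = X1 (s + 1) := by rw [X]
  have hK : KPrime (s + 1) 1 = 2 ^ (s + 1) + 3 ∧ K (s + 1) 1 = 2 ^ (s + 1) ∧ R (s + 1) 1 = 0 := by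
    cases s <;> simp [KPrime, K, R]
  obtain ⟨h1, h2, h3⟩ := hK
  refine ⟨hX ▸ good_X1 _, by grind [X1], ?_, ?_, ?_, fun h => absurd h (lt_irrefl _)⟩
  all_goals grind [X1, List.countP_map, Function.comp_def, List.range_succ, List.countP_eq_length,
              F, counts_X1]

lemma census_base (t : ℕ) : Census 1 (t + 2) := by
  have hX : X 1 (t + 2) = X1' (t + 2) := by rw [X]
  have hT : FatSpheres.total (X1' (t + 2)).cx = F 1 (t + 2) := by grind [total_base, F]
  refine ⟨by grind [good_base], ?_, ?_, ?_, ?_, fun _ => by rw [hX, hT]⟩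
  · grind [X1', KPrime]
  · grind [X1', K]
  · grind [X1', R]
  · rw [hX, ← hT]; exact (good_base t).counts

lemma three_le_KPrime : ∀ s t, 3 ≤ KPrime (s + 1) (t + 1)
  | 0, t => by simp [KPrime]
  | s + 1, 0 => by simp [KPrime]
  | s + 1, t + 1 => by
    rw [KPrime]; obtain ⟨n, hn⟩ : ∃ n, KPrime (s + 2) (t + 1) = n + 1 :=
      ⟨KPrime (s + 2) (t + 1) - 1, by have : 3 ≤ KPrime (s + 2) (t + 1) := three_le_KPrime (s + 1) t; omega⟩
    have := three_le_KPrime s n; rw [hn]; omega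

lemma census_step {s t : ℕ} (hB : Census (s + 1) (KPrime (s + 2) (t + 1)))
    (hM : Census (s + 2) (t + 1)) : Census (s + 2) (t + 2) := by
  have h3 : 3 ≤ KPrime (s + 2) (t + 1) := three_le_KPrime (s + 1) t
  have hX : X (s + 2) (t + 2) =
    recursionStep (X (s + 1) (KPrime (s + 2) (t + 1))) (X (s + 2) (t + 1)) := by rw [X]
  have hg := hB.good
  rw [if_neg (by omega)] at hg
  obtain ⟨h1, h2⟩ := total_recursionStep hg hM.good hM.arcs h3 hM.counts hM.bare
  have h := setup_old hg hM.good hM.arcs h3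
  have hT : FatSpheres.total (X (s + 2) (t + 2)).cx = F (s + 2) (t + 2) := by
    rw [hX, h2, hB.total (by omega), hB.fillets, F]; ext i
    fin_cases i <;> simp <;> ring
  rw [← hX] at h1
  refine ⟨by grind, ?_, ?_, ?_, hT ▸ h1.counts, fun _ => hT⟩
  · grind [length_recursionStep, KPrime, hB.fillets, hB.arcs]
  · grind [fillets_recursionStep, K, hB.fillets, hM.fillets]
  · grind [bare_recursionStep, R, hB.fillets, hB.bare]

lemma census : ∀ s t, Census (s + 1) (t + 1)
  | s, 0 => census_one s
  | 0, t + 1 => census_base t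
  | s + 1, t + 1 => by
    obtain ⟨n, hn⟩ : ∃ n, KPrime (s + 2) (t + 1) = n + 1 :=
      ⟨KPrime (s + 2) (t + 1) - 1, by grind [KPrime, three_le_KPrime]⟩
    exact census_step (hn ▸ census s n) (census (s + 1) t)

lemma boundary_face {ε t : ℕ} {B : Ball} (h : Good ε t B) (ht : 1 < t) :
    B.cx.boundary.face 0 = B.cx.face 0 ∧ B.cx.boundary.face 1 = B.cx.bdEdges ∧
      B.cx.boundary.face 2 = B.cx.freeRidges := by
  refine ⟨?_, ?_, ?_⟩
  · ext Z; refine ⟨fun hZ => (mem_filter.1 hZ).1, fun hZ => mem_filter.2 ⟨hZ, by omega, ?_⟩⟩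
    obtain ⟨x, rfl⟩ := h.frame.zero Z hZ; have h0 := h.dim; rw [if_neg (by omega)] at h0
    obtain ⟨T, hT, hn, hs⟩ := (h.cover x hZ).resolve_right (by omega); exact ⟨T, hT, hs, hn⟩
  · ext Z; rw [Cx.mem_bdEdges]
    refine ⟨fun hZ => ?_, fun ⟨hZ, T, hT, hn, hs⟩ => mem_filter.2 ⟨hZ, by omega, T, hT, hs, hn⟩⟩
    obtain ⟨h1, -, T, hT, hs, hn⟩ := mem_filter.1 hZ; exact ⟨h1, T, hT, hn, hs⟩
  · ext Z; rw [Cx.mem_freeRidges]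
    refine ⟨fun hZ => ?_, fun ⟨hZ, hn⟩ => mem_filter.2 ⟨hZ, le_rfl, Z, hZ, subset_rfl, hn⟩⟩
    obtain ⟨h1, -, T, hT, hs, hn⟩ := mem_filter.1 hZ; obtain rfl := h.frame.anti Z h1 T hT hs
    exact ⟨h1, hn⟩

lemma card_cone {V : Type} [DecidableEq V] (C D : Cx V) :
    ((C.cone D).face 0).card = (C.face 0).card + 1 ∧ ∀ k, ((C.cone D).face (k + 1)).card =
      (C.face (k + 1)).card + (D.face k).card := by
  have h1 := image_injective (Option.some_injective V)
  have h2 : ∀ k, ∀ Z ∈ (C.face k).image (image some), none ∉ Z := by grind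
  constructor
  · change (_ ∪ _ : Finset _).card = _
    grind [card_union_of_disjoint, card_image_of_injective, card_singleton,
      disjoint_singleton_right]
  · intro k; change (_ ∪ _ : Finset _).card = _
    rw [card_union_of_disjoint, card_image_of_injective _ h1, card_image_of_injOn]
    · intro Z _ W _ h; apply h1; have := congrArg (fun S => S.erase none) h; simpa using this
    grind [disjoint_left]

end FatSpheres

lemma mainTheorem4 (s t : ℕ) (hs : 1 ≤ s) (ht : 1 < t) :
    (fun k : Fin 4 => ((FatSpheres.S s t).fVector k : ℤ)) = FatSpheres.F s t := by
  obtain ⟨s, rfl⟩ : ∃ i, s = i + 1 := ⟨s - 1, by omega⟩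
  obtain ⟨t, rfl⟩ : ∃ i, t = i + 1 := ⟨t - 1, by omega⟩
  have h := FatSpheres.census s t
  obtain ⟨h0, h1, h2⟩ := FatSpheres.boundary_face h.good ht
  obtain ⟨h3, h4⟩ := FatSpheres.card_cone (FatSpheres.X (s + 1) (t + 1)).cx
    (FatSpheres.X (s + 1) (t + 1)).cx.boundary
  rw [← h.total ht]
  ext k
  fin_cases k
  · exact congrArg Nat.cast h3
  · exact congrArg Nat.cast ((h4 0).trans (by rw [h0]))
  · exact congrArg Nat.cast ((h4 1).trans (by rw [h1]))
  · exact congrArg Nat.cast ((h4 2).trans (by rw [h2]))
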